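/- **Notation.** $\Delta(\rho)=\{|w|<\rho\}$, $\Delta=\Delta(1)$, $A_{r,R}=\{z\in\mathbb C: r<|z|<R\}$ with $0<r<R<\infty$. A holomorphic $f$ on $A_{r,R}$ has a unique *Laurent decomposition* $f=f^++f^-$, with $f^+$ holomorphic in $\{|z|<R\}$, $f^-$ holomorphic in $\{|z|>r\}$ and $f^-(\infty)=0$. A *curve* is an effective divisor; $\mathrm{Div}(F)$ is the zero divisor of $F$, so $C=\mathrm{Div}(F)$ means that $F$ generates the ideal sheaf of $C$. **Smoothness.** A *smoothness class* $S$ in $\Delta$ is a subalgebra $\Gamma_S(\Delta,\mathcal O)$ of the bounded holomorphic functions in $\Delta$ with a complete norm $\|\cdot\|_S$ such that: (i) $\|fg\|_S\le c\|f\|_S\|g\|_S$ and $\sup_\Delta|f|\le c\|f\|_S$; (ii) it is invariant under rotations; (iii) if $f\in\Gamma_S(\Delta,\mathcal O)$ and $g$ is holomorphic in $A_{r,R}$, $r<1<R$, then $(fg)^+\in\Gamma_S(\Delta,\mathcal O)$ and $\|(fg)^+\|_S\le C(S,r,R)\|f\|_S\sup|g|$; (iv) if $f$ and $1/f$ are bounded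 and holomorphic in $A_{r,1}$, $0<r<1$, and $f^+\in\Gamma_S(\Delta,\mathcal O)$, then $(1/f)^+\in\Gamma_S(\Delta,\mathcal O)$. For classes $S_1,S_2$ assigned to the inner and outer circle, a holomorphic $f$ on $A_{r,R}$ is smooth if $p(\zeta)=(f(r/\zeta))^+$ and $q(\zeta)=(f(R\zeta))^+$ lie in $\Gamma_{S_1}(\Delta,\mathcal O)$ and $\Gamma_{S_2}(\Delta,\mathcal O)$; the norm is $\|p\|_{S_1}+\|q\|_{S_2}$ (up to equivalence). If $S_1=S_2=S$, the space is written $\Gamma_S(A_{r,R},\mathcal O)$. $\Gamma_S(A\times\Delta(\rho),\mathcal O)$ is the space of bounded holomorphic maps $\Delta(\rho)\to\Gamma_S(A,\mathcal O)$ with the supremum norm. **Distorted cylinder.** Let $U\subset\mathbb C^2$ (coordinates $(z,w)$) be an open neighbourhood of $\{r\le|z|\le R,\ w=0\}$, and let $z_1,z_2$ be holomorphic in $U$, equal to $z$ on $A_{r,R}\times\{0\}$, such that $(z_1,w)$ and $(z_2,w)$ are both coordinates in $U$. Let $\rho>0$ be such that $W=W_{r,R,\rho}=\{x\in U:|z_1|>r,|z_2|<R,|w|<\rho\}$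 is relatively compact in $U$ and the sets $\{x\in U:|z_1|=r,|w|\le\rho\}$ and $\{x\in U:|z_2|=R,|w|\le\rho\}$ are disjoint. Let $r<r'<R'<R$ be such that $V^-=\{x\in U:r<|z_1|<r',|w|<\rho\}$ and $V^+=\{x\in U:R'<|z_2|<R,|w|<\rho\}$ lie in $W$ and are mapped by $(z_1,w)$, resp. $(z_2,w)$, onto $A_{r,r'}\times\Delta(\rho)$, resp. $A_{R',R}\times\Delta(\rho)$. Let $S=(S^-,S^+)$ be two smoothness classes in $\Delta$. $\Gamma_S(A_{r,R},\mathcal O)$ is formed with $S^-$ at $|z|=r$ and $S^+$ at $|z|=R$. A holomorphic $F$ in $W$ is *$S$-smooth* if $F|_{V^\pm}\in\Gamma_{S^\pm}(V^\pm,\mathcal O)$, where $V^\pm$ are regarded as products by the above coordinates. **Curves in $W$.** A curve $C$ in $W$ is *$S$-smooth* if $|C|\subset\{|w|<\rho'\}$ for some $\rho'<\rho$ and $C=\mathrm{Div}(F)$ for an $S$-smooth $F$. Its *degree* is $\frac1{2\pi i}\oint d\log F$ over a loop $\{z_1=\zeta,\ |w|=\sigma\}$ in $V^-$, $\rho'<\sigma<\rho$.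 For $C$ of degree $n$, let $\kappa^{(n)}(C)=(g^-,g^+)$ be the coefficients of the Weierstraß polynomials $w^n+\sum_{i=1}^n g_i^-(z_1)w^{n-i}$ on $V^-$ and $w^n+\sum_{i=1}^n g_i^+(z_2)w^{n-i}$ on $V^+$ whose zero divisors are $C\cap V^-$ and $C\cap V^+$. The bound $\|\kappa^{(n)}(C)\|_S\le\varepsilon$ means that $\kappa^{(n)}(C)$ lies in $\Gamma_{S^-}(A_{r,r'},\mathcal O^n)\oplus\Gamma_{S^+}(A_{R',R},\mathcal O^n)$ and has norm at most $\varepsilon$ there. For $f\in\Gamma_S(A_{r,R},\mathcal O^n)$ the *distorted Weierstraß polynomial* is $$\widetilde P_f=w^n+\sum_{i=1}^n\bigl(f_i^-(z_1)+f_i^+(z_2)\bigr)w^{n-i}\quad\text{on }W.$$ **Families.** A family $\{C_y\}_{y\in Y}$ of $S$-smooth curves of degree $n$, parametrised by a topological space $Y$, is *continuous* if $y\mapsto\kappa^{(n)}(C_y)$ is a continuous map to $\Gamma_{S^-}(A_{r,r'},\mathcal O^n)\oplus\Gamma_{S^+}(A_{R',R},\mathcal O^n)$. For a Banach analytic space $Y$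 (in the sense of Douady, possibly non-reduced) a map from $Y$ to a Banach space $E$ is *holomorphic* if it is induced by a morphism, i.e. by a section of $\mathcal O_Y(E)$. A continuous family parametrised by a Banach analytic space $Y$ is *holomorphic* if there are holomorphic maps $\psi^\pm:Y\to\Gamma_{S^\pm}(V^\pm,\mathcal O)$ such that, for all $y$, $C_y\cap V^\pm=\mathrm{Div}(\psi^\pm(y))$ and $|\psi^\pm(y)|$ is bounded away from $0$ on $V^\pm\cap\{\rho'<|w|<\rho\}$ for some $\rho'<\rho$ (depending on $y$). **Lemma.** For all such data and every $n$ there is $\varepsilon>0$ such that: 1. every $S$-smooth curve $C$ of degree $n$ in $W$ with $\|\kappa^{(n)}(C)\|_S\le\varepsilon$ is the zero divisor of $\widetilde P_f$ for exactly one $f\in\Gamma_S(A_{r,R},\mathcal O^n)$; 2. if $\{C_y\}_{y\in Y}$ is a continuous family of such curves ($\|\kappa^{(n)}(C_y)\|_S\le\varepsilon$ for all $y$), the induced map $\psi_Y:Y\to\Gamma_S(A_{r,R},\mathcal O^n)$ with $\mathrm{Div}(\widetilde P_{\psi_Y(y)})=C_y$ is continuous; 3. if $Y$ is a Banach analytic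 space and $\{C_y\}_{y\in Y}$ is a holomorphic family of such curves, then $\psi_Y$ is holomorphic. -/

import Mathlib

open scoped Topology

universe u v w

noncomputable section

/-! ### Annuli, Laurent decompositions, smoothness classes -/

/-- The annulus `A_{r,R} = {r < |z| < R}`. -/
def annulus (r R : ℝ) : Set ℂ := {z | r < ‖z‖ ∧ ‖z‖ < R}

/-- `f = fp + fm` is the Laurent decomposition of `f` on `A_{r,R}`: `fp` is holomorphic in
`{|z| < R}`, `fm` is holomorphic in `{|z| > r}` and vanishes at infinity. -/
structure IsLaurentDecomposition (r R : ℝ) (f fp fm : ℂ → ℂ) : Prop where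
  plus_holomorphic : DifferentiableOn ℂ fp (Metric.ball 0 R)
  minus_holomorphic : DifferentiableOn ℂ fm {z | r < ‖z‖}
  minus_infinity : Filter.Tendsto fm (Bornology.cobounded ℂ) (𝓝 0)
  sum_eq : ∀ z ∈ annulus r R, f z = fp z + fm z

/-- A smoothness class `S` in the unit disc `Δ`: a Banach algebra `Γ_S(Δ, 𝒪)` of bounded
holomorphic functions in `Δ` (multiplication being bounded up to a constant).  An element of
`carrier` is the function `toFun f` on `Δ`; the values of `toFun f` off `Δ` carry no meaning. -/
structure SmoothnessClass where
  carrier : Type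
  [normedGroup : NormedAddCommGroup carrier]
  [normedSpace : NormedSpace ℂ carrier]
  [complete : CompleteSpace carrier]
  toFun : carrier →ₗ[ℂ] (ℂ → ℂ)
  injective : ∀ f g : carrier, (∀ z ∈ Metric.ball (0 : ℂ) 1, toFun f z = toFun g z) → f = g
  holomorphic : ∀ f : carrier, DifferentiableOn ℂ (toFun f) (Metric.ball 0 1)
  /-- The inclusion into the bounded functions is continuous. -/
  bound : ∃ c : ℝ, ∀ f : carrier, ∀ z ∈ Metric.ball (0 : ℂ) 1, ‖toFun f z‖ ≤ c * ‖f‖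
  /-- Closed under products, and multiplication is continuous. -/
  mul : ∃ c : ℝ, ∀ f g : carrier, ∃ h : carrier,
    (∀ z ∈ Metric.ball (0 : ℂ) 1, toFun h z = toFun f z * toFun g z) ∧ ‖h‖ ≤ c * ‖f‖ * ‖g‖
  /-- Invariance under rotations of the disc. -/
  rotation : ∀ (a : ℂ), ‖a‖ = 1 → ∀ f : carrier, ∃ h : carrier,
    ∀ z ∈ Metric.ball (0 : ℂ) 1, toFun h z = toFun f (a * z)
  /-- Multiplication by functions holomorphic near the unit circle. -/
  mul_plus : ∀ r R : ℝ, 0 < r → r < 1 → 1 < R → ∃ c : ℝ,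
    ∀ (f : carrier) (g : ℂ → ℂ), DifferentiableOn ℂ g (annulus r R) →
    ∀ hp hm : ℂ → ℂ, IsLaurentDecomposition r 1 (fun z => toFun f z * g z) hp hm →
    ∃ h : carrier, (∀ z ∈ Metric.ball (0 : ℂ) 1, toFun h z = hp z) ∧
      ∀ M : ℝ, (∀ z ∈ annulus r R, ‖g z‖ ≤ M) → ‖h‖ ≤ c * ‖f‖ * M
  /-- Stability under taking bounded inverses near the unit circle. -/
  inv_plus : ∀ r : ℝ, 0 < r → r < 1 → ∀ f fp fm gp gm : ℂ → ℂ,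
    DifferentiableOn ℂ f (annulus r 1) →
    (∃ M : ℝ, ∀ z ∈ annulus r 1, ‖f z‖ ≤ M) →
    (∃ c : ℝ, 0 < c ∧ ∀ z ∈ annulus r 1, c ≤ ‖f z‖) →
    IsLaurentDecomposition r 1 f fp fm →
    (∃ p : carrier, ∀ z ∈ Metric.ball (0 : ℂ) 1, toFun p z = fp z) →
    IsLaurentDecomposition r 1 (fun z => (f z)⁻¹) gp gm →
    ∃ q : carrier, ∀ z ∈ Metric.ball (0 : ℂ) 1, toFun q z = gp z

attribute [instance] SmoothnessClass.normedGroup SmoothnessClass.normedSpace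
  SmoothnessClass.complete

/-- The Banach space `Γ_S(A_{r,R}, 𝒪)` for the smoothness given by the class `Sm` at the inner
circle `|z| = r` and the class `Sp` at the outer circle `|z| = R`.

A holomorphic `f` on `A_{r,R}` is `S`-smooth iff the two functions
`p = (ζ ↦ f (r / ζ))⁺` and `q = (ζ ↦ f (R * ζ))⁺` belong to `Γ_{Sm}(Δ, 𝒪)` and `Γ_{Sp}(Δ, 𝒪)`.
With the Laurent decomposition `f = f⁺ + f⁻` one has `q ζ = f⁺ (R * ζ)` and
`p ζ = f⁻ (r / ζ) + f⁺ 0`.  So `f` is the same thing as a pair `(p, q)` with `p 0 = q 0`.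
The norm is `max ‖p‖ ‖q‖`, which is equivalent to `‖p‖ + ‖q‖`. -/
def annulusSubmodule (Sm Sp : SmoothnessClass) : Submodule ℂ (Sm.carrier × Sp.carrier) where
  carrier := {f | Sm.toFun f.1 0 = Sp.toFun f.2 0}
  add_mem' := by
    intro a b ha hb
    simp only [Set.mem_ofPred_eq, Prod.fst_add, Prod.snd_add, map_add, Pi.add_apply] at *
    rw [ha, hb]
  zero_mem' := by simp
  smul_mem' := by
    intro c a ha
    simp only [Set.mem_ofPred_eq, Prod.smul_fst, Prod.smul_snd, map_smul, Pi.smul_apply] at *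
    rw [ha]

/-- See `annulusSubmodule`. -/
def AnnulusSpace (Sm Sp : SmoothnessClass) : Type := ↥(annulusSubmodule Sm Sp)

instance (Sm Sp : SmoothnessClass) : NormedAddCommGroup (AnnulusSpace Sm Sp) :=
  inferInstanceAs (NormedAddCommGroup ↥(annulusSubmodule Sm Sp))

instance (Sm Sp : SmoothnessClass) : NormedSpace ℂ (AnnulusSpace Sm Sp) :=
  inferInstanceAs (NormedSpace ℂ ↥(annulusSubmodule Sm Sp))

namespace AnnulusSpace

variable {Sm Sp : SmoothnessClass}

/-- The part `f⁺` of the Laurent decomposition, a function on `{|z| < R}`. -/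
def plus (R : ℝ) (f : AnnulusSpace Sm Sp) (z : ℂ) : ℂ := Sp.toFun f.1.2 (z / (R : ℂ))

/-- The part `f⁻` of the Laurent decomposition, a function on `{|z| > r}` with `f⁻(∞) = 0`. -/
def minus (r : ℝ) (f : AnnulusSpace Sm Sp) (z : ℂ) : ℂ :=
  Sm.toFun f.1.1 ((r : ℂ) / z) - Sm.toFun f.1.1 0

/-- The value `f z` for `z ∈ A_{r,R}`. -/
def eval (r R : ℝ) (f : AnnulusSpace Sm Sp) (z : ℂ) : ℂ := f.plus R z + f.minus r z

end AnnulusSpace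

/-- The Banach space `Γ_S(A × Δ(ρ), 𝒪)`, `A` an annulus with the class `S` at both boundary
circles: bounded holomorphic maps `Δ(ρ) → Γ_S(A, 𝒪)` with the supremum norm. -/
def productSubmodule (S : SmoothnessClass) (ρ : ℝ) :
    Submodule ℂ (BoundedContinuousFunction (Metric.ball (0 : ℂ) ρ) (AnnulusSpace S S)) where
  carrier := {G | ∃ H : ℂ → AnnulusSpace S S, DifferentiableOn ℂ H (Metric.ball 0 ρ) ∧
    ∀ a : Metric.ball (0 : ℂ) ρ, G a = H a}
  add_mem' := by
    rintro a b ⟨H, hH, h⟩ ⟨H', hH', h'⟩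
    exact ⟨H + H', hH.add hH', fun x => by simp [h x, h' x]⟩
  zero_mem' := ⟨0, differentiableOn_const 0, fun x => by simp⟩
  smul_mem' := by
    rintro c a ⟨H, hH, h⟩
    exact ⟨c • H, hH.const_smul c, fun x => by simp [h x]⟩

/-- See `productSubmodule`. -/
def ProductSpace (S : SmoothnessClass) (ρ : ℝ) : Type := ↥(productSubmodule S ρ)

instance (S : SmoothnessClass) (ρ : ℝ) : NormedAddCommGroup (ProductSpace S ρ) :=
  inferInstanceAs (NormedAddCommGroup ↥(productSubmodule S ρ))

instance (S : SmoothnessClass) (ρ : ℝ) : NormedSpace ℂ (ProductSpace S ρ) :=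
  inferInstanceAs (NormedSpace ℂ ↥(productSubmodule S ρ))

open Classical in
/-- The value `G(ζ, a)` for `ζ ∈ A_{r,R}` and `a ∈ Δ(ρ)` (zero if `|a| ≥ ρ`). -/
def ProductSpace.eval {S : SmoothnessClass} {ρ : ℝ} (r R : ℝ) (G : ProductSpace S ρ)
    (ζ a : ℂ) : ℂ :=
  if h : a ∈ Metric.ball (0 : ℂ) ρ then AnnulusSpace.eval r R (G.1 ⟨a, h⟩) ζ else 0

/-! ### Curves (effective divisors) in an open subset of `ℂ²` -/

/-- The ideal `f · 𝒪_x`, as the set of all functions whose germ at `x` lies in it. -/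
def principalStalk (f : ℂ × ℂ → ℂ) (x : ℂ × ℂ) : Set (ℂ × ℂ → ℂ) :=
  {g | ∃ h : ℂ × ℂ → ℂ, AnalyticAt ℂ h x ∧ g =ᶠ[𝓝 x] fun y => h y * f y}

/-- A curve, i.e. an effective divisor, in the open set `W ⊆ ℂ²`, given by its ideal sheaf `ℐ_C`:
locally `ℐ_C` is generated by one holomorphic function which vanishes identically on no
non-empty open set. -/
@[ext]
structure Curve (W : Set (ℂ × ℂ)) where
  stalk : W → Set (ℂ × ℂ → ℂ)
  locally_principal : ∀ x : W, ∃ V : Set (ℂ × ℂ), IsOpen V ∧ x.1 ∈ V ∧ V ⊆ W ∧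
    ∃ f : ℂ × ℂ → ℂ, AnalyticOnNhd ℂ f V ∧ (∀ y ∈ V, ¬ f =ᶠ[𝓝 y] 0) ∧
      ∀ y : W, y.1 ∈ V → stalk y = principalStalk f y.1

namespace Curve

variable {W : Set (ℂ × ℂ)}

/-- The support `|C|`. -/
def support (C : Curve W) : Set (ℂ × ℂ) :=
  {x | ∃ hx : x ∈ W, ∀ g ∈ C.stalk ⟨x, hx⟩, g x = 0}

/-- `C ∩ V = Div(F)` for a subset `V ⊆ W`: `F` generates the ideal sheaf of `C` over `V`. -/
def IsDivOn (C : Curve W) (V : Set (ℂ × ℂ)) (F : ℂ × ℂ → ℂ) : Prop :=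
  ∀ x : W, x.1 ∈ V → C.stalk x = principalStalk F x.1

end Curve

/-! ### The distorted cylinder -/

/-- The data of a distorted cylinder: functions `z₁`, `z₂` on a neighbourhood `U` of the closed
annulus `{r ≤ |z| ≤ R, w = 0}` in `ℂ²` and radii `r < r' < R' < R`, `ρ`.  The function `w` is the
second coordinate `x.2`. -/
structure DistortedCylinder where
  U : Set (ℂ × ℂ)
  z₁ : ℂ × ℂ → ℂ
  z₂ : ℂ × ℂ → ℂ
  r : ℝ
  r' : ℝ
  R' : ℝ
  R : ℝ
  ρ : ℝ
  isOpen_U : IsOpen U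
  r_pos : 0 < r
  r_lt_r' : r < r'
  r'_lt_R' : r' < R'
  R'_lt_R : R' < R
  ρ_pos : 0 < ρ
  annulus_subset : ∀ z : ℂ, r ≤ ‖z‖ → ‖z‖ ≤ R → (z, 0) ∈ U
  z₁_analytic : AnalyticOnNhd ℂ z₁ U
  z₂_analytic : AnalyticOnNhd ℂ z₂ U
  z₁_annulus : ∀ z ∈ annulus r R, z₁ (z, 0) = z
  z₂_annulus : ∀ z ∈ annulus r R, z₂ (z, 0) = z
  /-- `(z₁, w)` and `(z₂, w)` are coordinates in `U`. -/
  coord₁_injOn : Set.InjOn (fun x => (z₁ x, x.2)) U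
  coord₁_deriv : ∀ x ∈ U, fderiv ℂ z₁ x (1, 0) ≠ 0
  coord₂_injOn : Set.InjOn (fun x => (z₂ x, x.2)) U
  coord₂_deriv : ∀ x ∈ U, fderiv ℂ z₂ x (1, 0) ≠ 0
  /-- `W_{r,R,ρ}` is relatively compact in `U`. -/
  W_compact : IsCompact (closure {x | x ∈ U ∧ r < ‖z₁ x‖ ∧ ‖z₂ x‖ < R ∧ ‖x.2‖ < ρ})
  W_closure : closure {x | x ∈ U ∧ r < ‖z₁ x‖ ∧ ‖z₂ x‖ < R ∧ ‖x.2‖ < ρ} ⊆ U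
  /-- The lower side `|z₁| = r` and the upper side `|z₂| = R` are disjoint. -/
  sides_disjoint : Disjoint {x | x ∈ U ∧ ‖z₁ x‖ = r ∧ ‖x.2‖ ≤ ρ}
    {x | x ∈ U ∧ ‖z₂ x‖ = R ∧ ‖x.2‖ ≤ ρ}
  /-- `V⁻ = {r < |z₁| < r', |w| < ρ}` lies in `W` and is, in the coordinates `(z₁, w)`, the product
  of an annulus and a disc. -/
  Vm_subset : ∀ x ∈ U, r < ‖z₁ x‖ → ‖z₁ x‖ < r' → ‖x.2‖ < ρ → ‖z₂ x‖ < R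
  Vm_product : ∀ ζ ∈ annulus r r', ∀ a : ℂ, ‖a‖ < ρ → ∃ x ∈ U, z₁ x = ζ ∧ x.2 = a
  /-- `V⁺ = {R' < |z₂| < R, |w| < ρ}` lies in `W` and is, in the coordinates `(z₂, w)`, the product
  of an annulus and a disc. -/
  Vp_subset : ∀ x ∈ U, R' < ‖z₂ x‖ → ‖z₂ x‖ < R → ‖x.2‖ < ρ → r < ‖z₁ x‖
  Vp_product : ∀ ζ ∈ annulus R' R, ∀ a : ℂ, ‖a‖ < ρ → ∃ x ∈ U, z₂ x = ζ ∧ x.2 = a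

namespace DistortedCylinder

/-- The distorted cylinder `W_{r,R,ρ}`. -/
def W (D : DistortedCylinder) : Set (ℂ × ℂ) :=
  {x | x ∈ D.U ∧ D.r < ‖D.z₁ x‖ ∧ ‖D.z₂ x‖ < D.R ∧ ‖x.2‖ < D.ρ}

/-- `V⁻_{r,r'}`. -/
def Vm (D : DistortedCylinder) : Set (ℂ × ℂ) :=
  {x | x ∈ D.U ∧ D.r < ‖D.z₁ x‖ ∧ ‖D.z₁ x‖ < D.r' ∧ ‖x.2‖ < D.ρ}

/-- `V⁺_{R',R}`. -/
def Vp (D : DistortedCylinder) : Set (ℂ × ℂ) :=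
  {x | x ∈ D.U ∧ D.R' < ‖D.z₂ x‖ ∧ ‖D.z₂ x‖ < D.R ∧ ‖x.2‖ < D.ρ}

variable (D : DistortedCylinder) {Sm Sp : SmoothnessClass} {n : ℕ}

/-- An element of `Γ_{S⁻}(V⁻, 𝒪)` as a function on `V⁻`. -/
def funVm (G : ProductSpace Sm D.ρ) (x : ℂ × ℂ) : ℂ := G.eval D.r D.r' (D.z₁ x) x.2

/-- An element of `Γ_{S⁺}(V⁺, 𝒪)` as a function on `V⁺`. -/
def funVp (G : ProductSpace Sp D.ρ) (x : ℂ × ℂ) : ℂ := G.eval D.R' D.R (D.z₂ x) x.2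

/-- `F ∈ Γ_S(W, 𝒪)`, with restrictions `Gm` to `V⁻` and `Gp` to `V⁺`. -/
structure IsSmoothFunction (F : ℂ × ℂ → ℂ) (Gm : ProductSpace Sm D.ρ)
    (Gp : ProductSpace Sp D.ρ) : Prop where
  analytic : AnalyticOnNhd ℂ F D.W
  minus : ∀ x ∈ D.Vm, F x = D.funVm Gm x
  plus : ∀ x ∈ D.Vp, F x = D.funVp Gp x

/-- `C` is an `S`-smooth curve of degree `n` in `W`: its support lies in `W_{r,R,ρ'}` for some
`ρ' < ρ`, and `C = Div(F)` for some `S`-smooth `F`.  The degree is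
`(2πi)⁻¹ ∮ d log F` over the loops `{z₁ = ζ, |w| = σ}` in `V⁻` with `ρ' < σ < ρ`. -/
def IsSmoothCurve (Sm Sp : SmoothnessClass) (n : ℕ) (C : Curve D.W) : Prop :=
  ∃ (F : ℂ × ℂ → ℂ) (Gm : ProductSpace Sm D.ρ) (Gp : ProductSpace Sp D.ρ) (ρ' : ℝ),
    D.IsSmoothFunction F Gm Gp ∧ C.IsDivOn D.W F ∧
    0 < ρ' ∧ ρ' < D.ρ ∧ (∀ x ∈ C.support, ‖x.2‖ < ρ') ∧
    ∀ ζ ∈ annulus D.r D.r', ∀ σ : ℝ, ρ' < σ → σ < D.ρ →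
      (∮ a in C(0, σ), logDeriv (fun b => Gm.eval D.r D.r' ζ b) a) =
        2 * (Real.pi : ℂ) * Complex.I * (n : ℂ)

/-- The space `Γ_{S⁻}(A_{r,r'}, 𝒪ⁿ) ⊕ Γ_{S⁺}(A_{R',R}, 𝒪ⁿ)` with the maximum norm. -/
abbrev KappaSpace (Sm Sp : SmoothnessClass) (n : ℕ) : Type :=
  (Fin n → AnnulusSpace Sm Sm) × (Fin n → AnnulusSpace Sp Sp)

/-- The Weierstrass polynomial `wⁿ + ∑ gᵢ(z₁) wⁿ⁻ⁱ` on `V⁻` (here `i = 1, …, n` is `i + 1` for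
`i : Fin n`). -/
def polyVm (g : Fin n → AnnulusSpace Sm Sm) (x : ℂ × ℂ) : ℂ :=
  x.2 ^ n + ∑ i : Fin n, (g i).eval D.r D.r' (D.z₁ x) * x.2 ^ (n - (i.val + 1))

/-- The Weierstrass polynomial `wⁿ + ∑ gᵢ(z₂) wⁿ⁻ⁱ` on `V⁺`. -/
def polyVp (g : Fin n → AnnulusSpace Sp Sp) (x : ℂ × ℂ) : ℂ :=
  x.2 ^ n + ∑ i : Fin n, (g i).eval D.R' D.R (D.z₂ x) * x.2 ^ (n - (i.val + 1))

/-- `κ⁽ⁿ⁾(C) = k`: the two components of `k` are the coefficients of the Weierstrass polynomials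
of `C ∩ V⁻` and `C ∩ V⁺`. -/
def IsKappa (C : Curve D.W) (k : KappaSpace Sm Sp n) : Prop :=
  C.IsDivOn D.Vm (D.polyVm k.1) ∧ C.IsDivOn D.Vp (D.polyVp k.2)

/-- The distorted Weierstrass polynomial `wⁿ + ∑ (fᵢ⁻(z₁) + fᵢ⁺(z₂)) wⁿ⁻ⁱ` with coefficients
`f ∈ Γ_S(A_{r,R}, 𝒪ⁿ)`. -/
def distortedPoly (f : Fin n → AnnulusSpace Sm Sp) (x : ℂ × ℂ) : ℂ :=
  x.2 ^ n + ∑ i : Fin n,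
    ((f i).minus D.r (D.z₁ x) + (f i).plus D.R (D.z₂ x)) * x.2 ^ (n - (i.val + 1))

/-- `‖κ⁽ⁿ⁾(C)‖_S ≤ ε`. -/
def KappaNormLE (Sm Sp : SmoothnessClass) (n : ℕ) (C : Curve D.W) (ε : ℝ) : Prop :=
  ∃ k : KappaSpace Sm Sp n, D.IsKappa C k ∧ ‖k‖ ≤ ε

/-- A continuous family of `S`-smooth curves of degree `n`. -/
def IsContinuousFamily (Sm Sp : SmoothnessClass) (n : ℕ) {Y : Type u} [TopologicalSpace Y]
    (C : Y → Curve D.W) : Prop :=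
  (∀ y, D.IsSmoothCurve Sm Sp n (C y)) ∧
    ∃ K : Y → KappaSpace Sm Sp n, (∀ y, D.IsKappa (C y) (K y)) ∧ Continuous K

end DistortedCylinder

/-! ### Banach analytic spaces -/

section BanachAnalytic

/-- Two germs `g`, `h` at `x` of maps to `G` define the same element of the stalk of `𝒪(G)` of the
model space `{f = 0}`: their difference is `φ · f` with `φ` an analytic germ of maps to
`L(F, G)`. -/
def ModelRel {E F G : Type*} [NormedAddCommGroup E] [NormedSpace ℂ E] [NormedAddCommGroup F]
    [NormedSpace ℂ F] [NormedAddCommGroup G] [NormedSpace ℂ G]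
    (f : E → F) (x : E) (g h : E → G) : Prop :=
  ∃ φ : E → F →L[ℂ] G, AnalyticAt ℂ φ x ∧ ∀ᶠ u in 𝓝 x, g u - h u = φ u (f u)

/-- The structure of a Banach analytic space on a topological space `Y` (in general neither
reduced nor finite dimensional), given by an atlas.  The chart `i` identifies an open set `dom i`
with the model space `{f i = 0} ⊆ U i`, where `U i` is open in the Banach space `E i` and `f i` is
an analytic map to a Banach space `F i`; its structure sheaf is
`𝒪(G) = 𝒪_U(G) / 𝒪_U(L(F, G)) · f`.
The transition morphism from chart `i` to chart `j` is a section over `dom i ∩ dom j` of `𝒪(E j)`,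
and `trans i j y` represents its germ at `y`. -/
structure BanachAnalyticSpace (Y : Type u) [TopologicalSpace Y] where
  ι : Type v
  E : ι → Type v
  F : ι → Type v
  [groupE : ∀ i, NormedAddCommGroup (E i)]
  [spaceE : ∀ i, NormedSpace ℂ (E i)]
  [completeE : ∀ i, CompleteSpace (E i)]
  [groupF : ∀ i, NormedAddCommGroup (F i)]
  [spaceF : ∀ i, NormedSpace ℂ (F i)]
  [completeF : ∀ i, CompleteSpace (F i)]
  U : ∀ i, Set (E i)
  f : ∀ i, E i → F i
  isOpen_U : ∀ i, IsOpen (U i)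
  analytic_f : ∀ i, AnalyticOnNhd ℂ (f i) (U i)
  dom : ι → Set Y
  isOpen_dom : ∀ i, IsOpen (dom i)
  cover : ∀ y, ∃ i, y ∈ dom i
  chart : ∀ i, Y → E i
  chart_embedding : ∀ i, Topology.IsEmbedding ((dom i).domRestrict (chart i))
  chart_image : ∀ i, chart i '' dom i = {u | u ∈ U i ∧ f i u = 0}
  trans : ∀ i j, Y → E i → E j
  /-- The germs `trans i j y` form a section of `𝒪(E j)`. -/
  trans_section : ∀ i j, ∀ y ∈ dom i ∩ dom j, ∃ g : E i → E j, AnalyticAt ℂ g (chart i y) ∧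
    ∀ᶠ y' in 𝓝 y, ModelRel (f i) (chart i y') (trans i j y') g
  trans_apply : ∀ i j, ∀ y ∈ dom i ∩ dom j, trans i j y (chart i y) = chart j y
  /-- It is a morphism to the model space `{f j = 0}`. -/
  trans_model : ∀ i j, ∀ y ∈ dom i ∩ dom j,
    ModelRel (f i) (chart i y) (fun u => f j (trans i j y u)) (fun _ => 0)
  trans_self : ∀ i, ∀ y ∈ dom i, ModelRel (f i) (chart i y) (trans i i y) id
  trans_trans : ∀ i j k, ∀ y ∈ dom i ∩ dom j ∩ dom k,
    ModelRel (f i) (chart i y) (fun u => trans j k y (trans i j y u)) (trans i k y)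

attribute [instance] BanachAnalyticSpace.groupE BanachAnalyticSpace.spaceE
  BanachAnalyticSpace.completeE BanachAnalyticSpace.groupF BanachAnalyticSpace.spaceF
  BanachAnalyticSpace.completeF

namespace BanachAnalyticSpace

variable {Y : Type u} [TopologicalSpace Y] (X : BanachAnalyticSpace.{u, v} Y)
  (G : Type w) [NormedAddCommGroup G] [NormedSpace ℂ G]

/-- A morphism from the Banach analytic space to the Banach space `G`, i.e. a global section of
the sheaf `𝒪_Y(G)`; `germ i y` represents its germ at `y` in the chart `i`. -/
structure Morphism where
  germ : ∀ i, Y → X.E i → G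
  isSection : ∀ i, ∀ y ∈ X.dom i, ∃ g : X.E i → G, AnalyticAt ℂ g (X.chart i y) ∧
    ∀ᶠ y' in 𝓝 y, ModelRel (X.f i) (X.chart i y') (germ i y') g
  compatible : ∀ i j, ∀ y ∈ X.dom i ∩ X.dom j,
    ModelRel (X.f i) (X.chart i y) (fun u => germ j y (X.trans i j y u)) (germ i y)

variable {X G}

/-- The morphism `s` induces the map `ψ : Y → G`. -/
def Morphism.Induces (s : X.Morphism G) (ψ : Y → G) : Prop :=
  ∀ i, ∀ y ∈ X.dom i, s.germ i y (X.chart i y) = ψ y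

variable (X)

/-- A map `Y → G` is holomorphic if it is induced by a morphism. -/
def IsHolomorphic (ψ : Y → G) : Prop := ∃ s : X.Morphism G, s.Induces ψ

end BanachAnalyticSpace

end BanachAnalytic

namespace DistortedCylinder

variable (D : DistortedCylinder)

/-- A holomorphic family of `S`-smooth curves of degree `n`: a continuous family whose restrictions
to `V⁻` and `V⁺` are given by holomorphic maps `ψm`, `ψp` from the Banach analytic space `X` to
`Γ_{S⁻}(V⁻, 𝒪)` and `Γ_{S⁺}(V⁺, 𝒪)`.  The determining functions `ψm y`, `ψp y` are bounded away
from zero near `|w| = ρ` (so that they are determining functions up to the boundary circles). -/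
def IsHolomorphicFamily (Sm Sp : SmoothnessClass) (n : ℕ) {Y : Type u} [TopologicalSpace Y]
    (X : BanachAnalyticSpace.{u, v} Y) (C : Y → Curve D.W) : Prop :=
  D.IsContinuousFamily Sm Sp n C ∧
    ∃ (ψm : Y → ProductSpace Sm D.ρ) (ψp : Y → ProductSpace Sp D.ρ),
      X.IsHolomorphic ψm ∧ X.IsHolomorphic ψp ∧
      ∀ y, (C y).IsDivOn D.Vm (D.funVm (ψm y)) ∧ (C y).IsDivOn D.Vp (D.funVp (ψp y)) ∧
        ∃ ρ' c : ℝ, ρ' < D.ρ ∧ 0 < c ∧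
          (∀ x ∈ D.Vm, ρ' < ‖x.2‖ → c ≤ ‖D.funVm (ψm y) x‖) ∧
          (∀ x ∈ D.Vp, ρ' < ‖x.2‖ → c ≤ ‖D.funVp (ψp y) x‖)

end DistortedCylinder

end

noncomputable section

open Set Metric Filter

/-! ### A form of the closed graph theorem -/

/-! Over a thin disc |w| < σ the coordinates z₁ and z₂ are close to each other, and the problem
becomes linear algebra over the Banach algebras Γ_S(A × Δ(σ), 𝒪). For ψ close to wⁿ the operator q
wⁿ + ρ ↦ q ψ + ρ (`ProductSpace.divOp`, with ρ of degree less than n) is close to the identity. So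
division by ψ with remainder is possible, and the remainder is analytic in ψ.

Uniqueness. If P̃_f defines C and ψ^± are determining functions of C on V^±, then the remainders of
P̃_f modulo ψ⁻ and ψ⁺ vanish. This linear system for f is overdetermined. Only the minus part of the
inner remainder and the plus part of the outer remainder are kept, which gives the operator
`Frame.op` on Γ_S(A_{r,R}, 𝒪ⁿ). For ψ^± = wⁿ it is unipotent: a coefficient of P̃_f acts only on its
own power of w and on higher ones, and on w = 0, where z₁ = z₂, the two kept parts add up to the
function one started with (`isUnit_op_wpow`). Hence `op` is invertible for small κ, and the only
candidate for f is `Frame.solution`.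

Existence. The candidate makes only the kept parts of the remainders νm, νp vanish. The rest is
geometry. By a maximum principle for |w| (`exists_mem_support_end`) the curve stays near w = 0, so
its Weierstrass polynomial on V⁻ continues over a tube in the coordinates (z₁, w) that reaches far
into V⁺ (`exists_weierstrass_tube`). Division by it continues νm, which has only a plus part, as a
function of z₁. On the overlap inside V⁺ the difference of the outer remainder, a function of z₂
with only a minus part, and of the continued inner one is a multiple of the equation of C. It is
again a distorted Laurent sum, with the roles of z₁ and z₂ exchanged, so the uniqueness argument for
the exchanged situation gives νm = νp = 0 (`remainders_eq_zero`). Thus P̃_f is a multiple of the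
equation of C. The quotient has no zeros because numerator and denominator are both close to wⁿ on a
circle |w| = τ (`ne_zero_of_close`).

Dependence on parameters. `Frame.solution` is built from continuous linear maps, products and
inverses of operators, so its differences are given by analytic families of linear maps
(`HasSlopeAt`). This gives continuity, and it also makes composition respect the ideals of a
non-reduced Banach analytic space. A holomorphic family comes with arbitrary determining functions.
Over a smaller disc these are units times the Weierstrass polynomials (`exists_unit_factor`), and
units do not change the solution (`solution_mul_unit`).

Many of the linear maps are first found value by value, without norm estimates; their continuity
then follows from the closed graph theorem below, tested on evaluations at points. -/

/-- A linear map between Banach spaces is continuous if its compositions with a separating family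
of continuous linear maps are. -/
theorem LinearMap.continuous_of_separating {E F : Type*} [NormedAddCommGroup E] [NormedSpace ℂ E]
    [CompleteSpace E] [NormedAddCommGroup F] [NormedSpace ℂ F] [CompleteSpace F] (T : E →ₗ[ℂ] F)
    {ι : Type*} {G : ι → Type*} [∀ i, NormedAddCommGroup (G i)] [∀ i, NormedSpace ℂ (G i)]
    (φ : ∀ i, F →L[ℂ] G i) (sep : ∀ y, (∀ i, φ i y = 0) → y = 0)
    (h : ∀ i, Continuous fun x => φ i (T x)) : Continuous T := by
  refine T.continuous_of_seq_closed_graph fun u x y hu hTu => ?_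
  refine sub_eq_zero.1 (sep _ fun i => ?_)
  rw [map_sub, sub_eq_zero]
  exact tendsto_nhds_unique (((φ i).continuous.tendsto y).comp hTu) (((h i).tendsto x).comp hu)

/-! ### Cauchy integrals depending on a parameter -/

/-- Integration over the circle `|z - c| = s` as a functional on continuous functions. -/
def circleFunctional (c : ℂ) {s : ℝ} (hs : 0 ≤ s) : C(sphere c s, ℂ) →L[ℂ] ℂ :=
  LinearMap.mkContinuous
    { toFun := fun a => ∫ θ in (0 : ℝ)..2 * Real.pi,
        deriv (circleMap c s) θ * a ⟨circleMap c s θ, circleMap_mem_sphere c hs θ⟩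
      map_add' := by
        intro a b
        rw [← intervalIntegral.integral_add]
        · simp [mul_add]
        all_goals
          apply Continuous.intervalIntegrable
          simp only [deriv_circleMap]
          fun_prop
      map_smul' := by
        intro k a
        simp only [RingHom.id_apply, smul_eq_mul]
        rw [← intervalIntegral.integral_const_mul]
        congr 1
        ext θ
        simp
        ring }
    (s * |2 * Real.pi - 0|) (by
      intro a
      have := intervalIntegral.norm_integral_le_of_norm_le_const (a := 0) (b := 2 * Real.pi)
        (C := s * ‖a‖) (f := fun θ => deriv (circleMap c s) θ *
          a ⟨circleMap c s θ, circleMap_mem_sphere c hs θ⟩) (by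
          intro θ _
          rw [norm_mul]
          have h1 : ‖deriv (circleMap c s) θ‖ = s := by
            simp [abs_of_nonneg hs]
          rw [h1]
          gcongr
          exact a.norm_coe_le_norm _)
      simpa [mul_assoc, mul_comm, mul_left_comm] using this)

/-- The identity of a circle, as a continuous function. -/
def circleId (c : ℂ) (s : ℝ) : C(sphere c s, ℂ) := ⟨fun z => z, continuous_subtype_val⟩

/-- The Cauchy kernel `ζ ↦ (ζ - z)⁻¹` on a circle. -/
def cauchyKernel (c : ℂ) (s : ℝ) (z : ℂ) : C(sphere c s, ℂ) :=
  Ring.inverse (circleId c s - algebraMap ℂ _ z)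

theorem isUnit_cauchyKernel {c z : ℂ} {s : ℝ} (hz : z ∉ sphere c s) :
    IsUnit (circleId c s - algebraMap ℂ C(sphere c s, ℂ) z) := by
  have hne : ∀ ζ : sphere c s, (ζ : ℂ) - z ≠ 0 := fun ζ h => hz (by
    rw [sub_eq_zero] at h; rw [← h]; exact ζ.2)
  refine IsUnit.of_mul_eq_one ⟨fun ζ => ((ζ : ℂ) - z)⁻¹, ?_⟩ ?_
  · exact Continuous.inv₀ (by fun_prop) hne
  · ext ζ
    simpa [circleId] using mul_inv_cancel₀ (hne ζ)

theorem cauchyKernel_apply {c z : ℂ} {s : ℝ} (hz : z ∉ sphere c s) (ζ : sphere c s) :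
    cauchyKernel c s z ζ = ((ζ : ℂ) - z)⁻¹ := by
  have h := Ring.inverse_mul_cancel _ (isUnit_cauchyKernel hz)
  have h2 := DFunLike.congr_fun h ζ
  have hne : (ζ : ℂ) - z ≠ 0 := fun h => hz (by rw [sub_eq_zero] at h; rw [← h]; exact ζ.2)
  refine eq_inv_of_mul_eq_one_left ?_
  rw [cauchyKernel]
  simpa [circleId] using h2

/-- The kernel is the inverse of an affine function of z in the Banach algebra of continuous
functions on the circle, and inversion is analytic at units. So Cauchy integrals are analytic
without any differentiation under the integral sign. -/
theorem analyticAt_cauchyKernel {c z : ℂ} {s : ℝ} (hz : z ∉ sphere c s) :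
    AnalyticAt ℂ (cauchyKernel c s) z := by
  obtain ⟨u, hu⟩ := isUnit_cauchyKernel hz
  have h1 : AnalyticAt ℂ (fun z => circleId c s - algebraMap ℂ C(sphere c s, ℂ) z) z :=
    analyticAt_const.sub ((Algebra.linearMap ℂ C(sphere c s, ℂ)).toContinuousLinearMap.analyticAt z)
  have h2 := analyticAt_inverse (𝕜 := ℂ) u
  rw [hu] at h2
  exact AnalyticAt.comp (f := fun z => circleId c s - algebraMap ℂ C(sphere c s, ℂ) z) h2 h1

/-- Cauchy's formula in the parameter writes K(z, ·), up to 2πi, as a fixed continuous linear map Λ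
applied to the Cauchy kernel at z. The integral then becomes a continuous functional of the product
of two kernels, each analytic with values in a Banach space. -/
theorem analyticAt_circleIntegral_of_ball {K : ℂ → ℂ → ℂ} {z₀ c w : ℂ} {s τ : ℝ} (hs : 0 < s)
    (hτ : 0 < τ) (hK : ContinuousOn (Function.uncurry K) (closedBall z₀ s ×ˢ sphere c τ))
    (hd : ∀ t ∈ sphere c τ, DifferentiableOn ℂ (fun z => K z t) (ball z₀ s))
    (hw : w ∈ ball c τ) :
    AnalyticAt ℂ (fun p : ℂ × ℂ => ∮ t in C(c, τ), (t - p.2)⁻¹ * K p.1 t) (z₀, w) := by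
  have hsph : ∀ t ∈ sphere c τ, ∀ z ∈ ball z₀ s,
      K z t = (2 * Real.pi * Complex.I : ℂ)⁻¹ * ∮ ζ in C(z₀, s), (ζ - z)⁻¹ * K ζ t := by
    intro t ht z hz
    have hc : ContinuousOn (fun z => K z t) (closedBall z₀ s) := by
      have : ContinuousOn (fun z : ℂ => (z, t)) (closedBall z₀ s) := by fun_prop
      exact hK.comp this fun z hz => ⟨hz, ht⟩
    have hdc : DiffContOnCl ℂ (fun z => K z t) (ball z₀ s) :=
      ⟨hd t ht, by rwa [closure_ball _ hs.ne']⟩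
    simpa using (hdc.two_pi_i_inv_smul_circleIntegral_sub_inv_smul hz).symm
  let Khat : C(sphere c τ × sphere z₀ s, ℂ) := ⟨fun p => K p.2 p.1, by
    have : ContinuousOn (fun p : ℂ × ℂ => K p.2 p.1) (sphere c τ ×ˢ sphere z₀ s) := by
      have h2 : ContinuousOn (fun p : ℂ × ℂ => (p.2, p.1)) (sphere c τ ×ˢ sphere z₀ s) := by
        fun_prop
      exact hK.comp h2 fun p hp => ⟨sphere_subset_closedBall hp.2, hp.1⟩
    exact this.comp_continuous (f := fun p : sphere c τ × sphere z₀ s => ((p.1 : ℂ), (p.2 : ℂ)))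
      (by fun_prop) fun p => ⟨p.1.2, p.2.2⟩⟩
  -- Λ₀ integrates a function on the parameter circle against K. Continuity is tested on the point
  -- evaluations.
  let Λ₀ : C(sphere z₀ s, ℂ) →ₗ[ℂ] C(sphere c τ, ℂ) :=
    { toFun := fun a => ⟨fun t => circleFunctional z₀ hs.le (Khat.curry t * a),
        (circleFunctional z₀ hs.le).continuous.comp (by fun_prop)⟩
      map_add' := by intro a b; ext t; simp [mul_add]
      map_smul' := by intro k a; ext t; simp }
  have hΛ : Continuous Λ₀ := by
    refine Λ₀.continuous_of_separating (ι := sphere c τ) (G := fun _ => ℂ)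
      (fun t => ContinuousMap.evalCLM ℂ t) (fun y hy => by ext t; simpa using hy t) fun t => ?_
    change Continuous fun a => circleFunctional z₀ hs.le (Khat.curry t * a)
    fun_prop
  let Λ : C(sphere z₀ s, ℂ) →L[ℂ] C(sphere c τ, ℂ) := ⟨Λ₀, hΛ⟩
  have hz₀ : z₀ ∉ sphere z₀ s := by simp [hs.ne]
  have hw' : w ∉ sphere c τ := fun h => (ne_of_lt (mem_ball.1 hw)) (mem_sphere.1 h)
  have key : AnalyticAt ℂ (fun p : ℂ × ℂ => (2 * Real.pi * Complex.I : ℂ)⁻¹ *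
      circleFunctional c hτ.le (cauchyKernel c τ p.2 * Λ (cauchyKernel z₀ s p.1))) (z₀, w) := by
    have h1 : AnalyticAt ℂ (fun p : ℂ × ℂ => cauchyKernel c τ p.2) (z₀, w) :=
      AnalyticAt.comp (f := fun p : ℂ × ℂ => p.2) (x := (z₀, w))
        (analyticAt_cauchyKernel hw') analyticAt_snd
    have h2 : AnalyticAt ℂ (fun p : ℂ × ℂ => Λ (cauchyKernel z₀ s p.1)) (z₀, w) :=
      (Λ.analyticAt _).comp (AnalyticAt.comp (f := fun p : ℂ × ℂ => p.1) (x := (z₀, w))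
        (analyticAt_cauchyKernel hz₀) analyticAt_fst)
    exact analyticAt_const.mul (((circleFunctional c hτ.le).analyticAt _).comp (h1.mul h2))
  refine key.congr ?_
  have hnhds : ball z₀ s ×ˢ ball c τ ∈ 𝓝 (z₀, w) :=
    (isOpen_ball.prod isOpen_ball).mem_nhds ⟨mem_ball_self hs, hw⟩
  filter_upwards [hnhds] with p hp
  have hp1 : p.1 ∉ sphere z₀ s := fun h => (ne_of_lt (mem_ball.1 hp.1)) (mem_sphere.1 h)
  have hp2 : p.2 ∉ sphere c τ := fun h => (ne_of_lt (mem_ball.1 hp.2)) (mem_sphere.1 h)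
  have h3 : ∀ t : sphere c τ, Λ (cauchyKernel z₀ s p.1) t =
      (2 * Real.pi * Complex.I : ℂ) * K p.1 t := by
    intro t
    have hne : (2 * Real.pi * Complex.I : ℂ) ≠ 0 := Complex.two_pi_I_ne_zero
    rw [hsph t t.2 p.1 hp.1, mul_inv_cancel_left₀ hne]
    change circleFunctional z₀ hs.le (Khat.curry t * cauchyKernel z₀ s p.1) = _
    change (∫ θ in (0 : ℝ)..2 * Real.pi, _) = ∫ θ in (0 : ℝ)..2 * Real.pi, _
    congr 1
    ext θ
    rw [ContinuousMap.mul_apply, cauchyKernel_apply hp1, smul_eq_mul, mul_comm (Khat.curry t _)]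
    rfl
  change _ * (∫ θ in (0 : ℝ)..2 * Real.pi, _) = ∫ θ in (0 : ℝ)..2 * Real.pi, _
  rw [← intervalIntegral.integral_const_mul]
  congr 1
  ext θ
  rw [ContinuousMap.mul_apply, cauchyKernel_apply hp2, h3, smul_eq_mul]
  have hne : (2 * Real.pi * Complex.I : ℂ) ≠ 0 := Complex.two_pi_I_ne_zero
  field_simp

/-- The Cauchy integral of a function depending holomorphically on a parameter is analytic in the
parameter and the variable. -/
theorem analyticAt_circleIntegral {K : ℂ → ℂ → ℂ} {Z : Set ℂ} (hZ : IsOpen Z) {c z w : ℂ} {τ : ℝ}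
    (hτ : 0 < τ) (hK : ContinuousOn (Function.uncurry K) (Z ×ˢ sphere c τ))
    (hd : ∀ t ∈ sphere c τ, DifferentiableOn ℂ (fun z => K z t) Z) (hz : z ∈ Z)
    (hw : w ∈ ball c τ) :
    AnalyticAt ℂ (fun p : ℂ × ℂ => ∮ t in C(c, τ), (t - p.2)⁻¹ * K p.1 t) (z, w) := by
  obtain ⟨s, hs, hsub⟩ := Metric.nhds_basis_closedBall.mem_iff.1 (hZ.mem_nhds hz)
  exact analyticAt_circleIntegral_of_ball hs hτ (hK.mono (prod_mono hsub subset_rfl))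
    (fun t ht => (hd t ht).mono (ball_subset_closedBall.trans hsub)) hw

/-- This is the Cauchy integral of t K(z, t) at the centre w = 0: the factor t cancels the kernel
t⁻¹. -/
theorem differentiableOn_circleIntegral {K : ℂ → ℂ → ℂ} {Z : Set ℂ} (hZ : IsOpen Z) {τ : ℝ}
    (hτ : 0 < τ) (hK : ContinuousOn (Function.uncurry K) (Z ×ˢ sphere 0 τ))
    (hd : ∀ t ∈ sphere (0 : ℂ) τ, DifferentiableOn ℂ (fun z => K z t) Z) :
    DifferentiableOn ℂ (fun z => ∮ t in C(0, τ), K z t) Z := by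
  intro z hz
  have h := analyticAt_circleIntegral (K := fun z t => t * K z t) hZ (c := 0) (w := 0) hτ
    (by
      have h1 : ContinuousOn (fun p : ℂ × ℂ => p.2) (Z ×ˢ sphere (0 : ℂ) τ) := by fun_prop
      exact h1.mul hK)
    (fun t ht => (hd t ht).const_mul t) hz (mem_ball_self hτ)
  have h2 : AnalyticAt ℂ (fun z : ℂ => (z, (0 : ℂ))) z := by fun_prop
  have h3 : AnalyticAt ℂ (fun z : ℂ => ∮ t in C(0, τ), (t - 0)⁻¹ * (t * K z t)) z :=
    AnalyticAt.comp (f := fun z : ℂ => (z, (0 : ℂ))) (x := z) h h2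
  refine (h3.differentiableAt.congr_of_eventuallyEq (Eventually.of_forall fun z => ?_)).differentiableWithinAt
  refine circleIntegral.integral_congr hτ.le fun t ht => ?_
  have : t ≠ 0 := by
    rintro rfl
    simp at ht
    exact hτ.ne ht
  simp [this]

end

noncomputable section

open Set Metric Filter

/-! ### Laurent decompositions -/

theorem isOpen_annulus (r R : ℝ) : IsOpen (annulus r R) :=
  (isOpen_lt continuous_const continuous_norm).inter (isOpen_lt continuous_norm continuous_const)

theorem isOpen_norm_gt (r : ℝ) : IsOpen {z : ℂ | r < ‖z‖} :=
  isOpen_lt continuous_const continuous_norm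

theorem annulus_subset_ball (r R : ℝ) : annulus r R ⊆ ball 0 R := fun z hz => by simpa using hz.2

theorem annulus_mono {r R r' R' : ℝ} (hr : r' ≤ r) (hR : R ≤ R') : annulus r R ⊆ annulus r' R' :=
  fun _ hz => ⟨hr.trans_lt hz.1, hz.2.trans_le hR⟩

theorem isPreconnected_annulus {r R : ℝ} (hr : 0 ≤ r) : IsPreconnected (annulus r R) := by
  have h : annulus r R = (fun p : ℝ × ℝ => (p.1 : ℂ) * Complex.exp (p.2 * Complex.I)) ''
      (Ioo r R ×ˢ univ) := by
    ext z
    constructor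
    · intro hz
      refine ⟨(‖z‖, z.arg), ⟨hz, mem_univ _⟩, ?_⟩
      simp
    · rintro ⟨p, ⟨hp, -⟩, rfl⟩
      have hp0 : 0 < p.1 := hr.trans_lt hp.1
      simpa [annulus, Complex.norm_exp_ofReal_mul_I, abs_of_pos hp0] using hp
  rw [h]
  exact (isPreconnected_Ioo.prod isPreconnected_univ).image _ (by fun_prop)

theorem annulus_nonempty {r R : ℝ} (hr : 0 ≤ r) (h : r < R) : (annulus r R).Nonempty := by
  refine ⟨(((r + R) / 2 : ℝ) : ℂ), ?_⟩
  have : |(r + R) / 2| = (r + R) / 2 := abs_of_nonneg (by linarith)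
  constructor <;> rw [Complex.norm_real, Real.norm_eq_abs, this] <;> linarith

/-- The Cauchy integral of `f` over the circle `|ζ| = s`. -/
def cauchyTransform (f : ℂ → ℂ) (s : ℝ) (z : ℂ) : ℂ :=
  (2 * Real.pi * Complex.I : ℂ)⁻¹ * ∮ ζ in C(0, s), (ζ - z)⁻¹ * f ζ

theorem differentiableAt_cauchyTransform {f : ℂ → ℂ} {s : ℝ} (hs : 0 ≤ s)
    (hf : ContinuousOn f (sphere 0 s)) {z : ℂ} (hz : ‖z‖ ≠ s) :
    DifferentiableAt ℂ (cauchyTransform f s) z := by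
  let a : C(sphere (0 : ℂ) s, ℂ) := ⟨fun z => f z, continuousOn_iff_continuous_domRestrict.1 hf⟩
  have hz' : z ∉ sphere (0 : ℂ) s := by simpa using hz
  have h1 : DifferentiableAt ℂ (fun z => (2 * Real.pi * Complex.I : ℂ)⁻¹ *
      circleFunctional 0 hs (cauchyKernel 0 s z * a)) z := by
    have h2 := (analyticAt_cauchyKernel hz').mul (analyticAt_const (v := a))
    exact (((circleFunctional 0 hs).analyticAt _).comp h2).differentiableAt.const_mul _
  refine h1.congr_of_eventuallyEq ?_
  have : {w : ℂ | ‖w‖ ≠ s} ∈ 𝓝 z := (isOpen_ne_fun continuous_norm continuous_const).mem_nhds hz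
  filter_upwards [this] with w hw
  have hw' : w ∉ sphere (0 : ℂ) s := by simpa using hw
  change _ * (∫ θ in (0 : ℝ)..2 * Real.pi, _) = _ * ∫ θ in (0 : ℝ)..2 * Real.pi, _
  congr 2
  ext θ
  rw [ContinuousMap.mul_apply, cauchyKernel_apply hw']
  rfl

theorem circleIntegral_eq_of_annulus {r R s₁ s₂ : ℝ} (hr : 0 ≤ r) (h₁ : r < s₁) (h₁₂ : s₁ ≤ s₂)
    (h₂ : s₂ < R) {f : ℂ → ℂ} (hf : DifferentiableOn ℂ f (annulus r R)) :
    (∮ ζ in C(0, s₂), f ζ) = ∮ ζ in C(0, s₁), f ζ := by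
  have hsub : ∀ ζ, s₁ ≤ ‖ζ‖ → ‖ζ‖ ≤ s₂ → ζ ∈ annulus r R := fun ζ h h' =>
    ⟨h₁.trans_le h, h'.trans_lt h₂⟩
  refine Complex.circleIntegral_eq_of_differentiable_on_annulus_off_countable
    (hr.trans_lt h₁) h₁₂ countable_empty (fun ζ hζ => ?_) fun ζ hζ => ?_
  · simp only [Set.mem_sdiff, mem_closedBall, dist_zero_right, mem_ball, not_lt] at hζ
    exact (hf.continuousOn ζ (hsub ζ hζ.2 hζ.1)).mono_of_mem_nhdsWithin
      (mem_nhdsWithin_of_mem_nhds ((isOpen_annulus r R).mem_nhds (hsub ζ hζ.2 hζ.1)))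
  · simp only [Set.mem_sdiff, mem_closedBall, dist_zero_right, mem_ball, not_le,
      mem_empty_iff_false, not_false_eq_true, and_true] at hζ
    exact hf.differentiableAt ((isOpen_annulus r R).mem_nhds (hsub ζ hζ.2.le hζ.1.le))

/-- Between the two circles the integrand has no pole, since z lies inside both or outside both; the
annulus is shrunk at |z| to exclude the pole. -/
theorem cauchyTransform_eq {r R s₁ s₂ : ℝ} (hr : 0 ≤ r) (h₁ : r < s₁) (h₁₂ : s₁ ≤ s₂) (h₂ : s₂ < R)
    {f : ℂ → ℂ} (hf : DifferentiableOn ℂ f (annulus r R)) {z : ℂ} (hz : ‖z‖ < s₁ ∨ s₂ < ‖z‖) :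
    cauchyTransform f s₂ z = cauchyTransform f s₁ z := by
  unfold cauchyTransform
  congr 1
  rcases hz with hz | hz
  · refine circleIntegral_eq_of_annulus (r := max r ‖z‖) (R := R) (hr.trans (le_max_left _ _))
      (max_lt h₁ hz) h₁₂ h₂ ?_
    refine DifferentiableOn.mul (DifferentiableOn.inv (by fun_prop) fun ζ hζ h => ?_)
      (hf.mono (annulus_mono (le_max_left _ _) le_rfl))
    rw [sub_eq_zero] at h
    exact absurd hζ.1 (by rw [h]; simp)
  · refine circleIntegral_eq_of_annulus (r := r) (R := min R ‖z‖) hr h₁ h₁₂ (lt_min h₂ hz) ?_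
    refine DifferentiableOn.mul (DifferentiableOn.inv (by fun_prop) fun ζ hζ h => ?_)
      (hf.mono (annulus_mono le_rfl (min_le_left _ _)))
    rw [sub_eq_zero] at h
    exact absurd hζ.2 (by rw [h]; simp)

theorem DifferentiableOn.continuousOn_sphere {f : ℂ → ℂ} {r R s : ℝ}
    (hf : DifferentiableOn ℂ f (annulus r R)) (h₁ : r < s) (h₂ : s < R) :
    ContinuousOn f (sphere 0 s) :=
  hf.continuousOn.mono fun z hz => by
    have : ‖z‖ = s := by simpa using hz
    exact ⟨by rw [this]; exact h₁, by rw [this]; exact h₂⟩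

theorem continuousOn_sub_inv {s : ℝ} {z : ℂ} (hz : ‖z‖ ≠ s) :
    ContinuousOn (fun ζ : ℂ => (ζ - z)⁻¹) (sphere 0 s) := by
  refine ContinuousOn.inv₀ (by fun_prop) fun ζ hζ h => hz ?_
  rw [sub_eq_zero] at h
  rw [← h]
  simpa using hζ

theorem circleIntegral_sub_inv_of_lt {s : ℝ} (hs : 0 ≤ s) {z : ℂ} (hz : s < ‖z‖) :
    (∮ ζ in C(0, s), (ζ - z)⁻¹) = 0 := by
  refine Complex.circleIntegral_eq_zero_of_differentiable_on_off_countable hs countable_empty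
    ?_ ?_
  · refine ContinuousOn.inv₀ (by fun_prop) fun ζ hζ h => ?_
    rw [sub_eq_zero] at h
    rw [h] at hζ
    simp at hζ
    linarith
  · intro ζ hζ
    refine DifferentiableAt.inv (by fun_prop) fun h => ?_
    rw [sub_eq_zero] at h
    rw [h] at hζ
    simp at hζ
    linarith

/-- The difference quotient `dslope f z` is holomorphic on the whole annulus, so its integrals over
the two circles agree. Splitting it into two terms leaves ∮ (ζ - z)⁻¹, which is 2πi for the outer
and 0 for the inner circle. -/
theorem cauchyTransform_sub {r R s₁ s₂ : ℝ} (hr : 0 ≤ r) (h₁ : r < s₁) (h₂ : s₂ < R)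
    {f : ℂ → ℂ} (hf : DifferentiableOn ℂ f (annulus r R)) {z : ℂ} (hz₁ : s₁ < ‖z‖)
    (hz₂ : ‖z‖ < s₂) : cauchyTransform f s₂ z - cauchyTransform f s₁ z = f z := by
  have hza : z ∈ annulus r R := ⟨h₁.trans hz₁, hz₂.trans h₂⟩
  have hd : DifferentiableOn ℂ (dslope f z) (annulus r R) :=
    (Complex.differentiableOn_dslope ((isOpen_annulus r R).mem_nhds hza)).2 hf
  have h := circleIntegral_eq_of_annulus hr h₁ (hz₁.trans hz₂).le h₂ hd
  have key : ∀ s, r < s → s < R → ‖z‖ ≠ s → (∮ ζ in C(0, s), dslope f z ζ) =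
      (∮ ζ in C(0, s), (ζ - z)⁻¹ * f ζ) - (∮ ζ in C(0, s), (ζ - z)⁻¹) * f z := by
    intro s hs hsR hzs
    have hs0 : 0 ≤ s := hr.trans hs.le
    have hi1 : CircleIntegrable (fun ζ => (ζ - z)⁻¹ * f ζ) 0 s := ContinuousOn.circleIntegrable hs0
      ((continuousOn_sub_inv hzs).mul (hf.continuousOn_sphere hs hsR))
    have hi2 : CircleIntegrable (fun ζ => (ζ - z)⁻¹ * f z) 0 s := ContinuousOn.circleIntegrable hs0
      ((continuousOn_sub_inv hzs).mul continuousOn_const)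
    have h3 : (∮ ζ in C(0, s), (ζ - z)⁻¹ * f z) = (∮ ζ in C(0, s), (ζ - z)⁻¹) * f z := by
      have := circleIntegral.integral_smul_const (fun ζ : ℂ => (ζ - z)⁻¹) (f z) 0 s
      simpa using this
    rw [← h3, ← circleIntegral.integral_sub hi1 hi2]
    refine circleIntegral.integral_congr hs0 fun ζ hζ => ?_
    have hne : ζ ≠ z := fun h => hzs (by rw [← h]; simpa using hζ)
    rw [dslope_of_ne _ hne, slope_def_field]
    field_simp
  rw [key s₂ ((h₁.trans hz₁).trans hz₂) h₂ hz₂.ne,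
    key s₁ h₁ ((hz₁.trans hz₂).trans h₂) hz₁.ne', circleIntegral_sub_inv_of_lt (hr.trans h₁.le) hz₁,
    circleIntegral.integral_sub_inv_of_mem_ball (by simpa using hz₂)] at h
  unfold cauchyTransform
  have hne : (2 * Real.pi * Complex.I : ℂ) ≠ 0 := Complex.two_pi_I_ne_zero
  rw [← mul_sub, inv_mul_eq_iff_eq_mul₀ hne]
  linear_combination h

theorem tendsto_cauchyTransform {f : ℂ → ℂ} {s : ℝ} (hs : 0 ≤ s)
    (hf : ContinuousOn f (sphere 0 s)) :
    Tendsto (cauchyTransform f s) (Bornology.cobounded ℂ) (𝓝 0) := by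
  obtain ⟨M, hM⟩ := (isCompact_sphere (0 : ℂ) s).exists_bound_of_continuousOn hf
  have h1 : Tendsto (fun z : ℂ => s * ((‖z‖ - s)⁻¹ * M)) (Bornology.cobounded ℂ) (𝓝 0) := by
    have h2 : Tendsto (fun z : ℂ => ‖z‖ - s) (Bornology.cobounded ℂ) atTop :=
      tendsto_atTop_add_const_right _ _ tendsto_norm_cobounded_atTop
    have := (h2.inv_tendsto_atTop.mul_const M).const_mul s
    simpa using this
  refine squeeze_zero_norm' ?_ h1
  filter_upwards [tendsto_norm_cobounded_atTop.eventually (eventually_gt_atTop s)] with z hz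
  have := circleIntegral.norm_two_pi_i_inv_smul_integral_le_of_norm_le_const (c := 0) hs
    (f := fun ζ => (ζ - z)⁻¹ * f ζ) (C := (‖z‖ - s)⁻¹ * M) (fun ζ hζ => by
      rw [norm_mul, norm_inv]
      have h3 : ‖ζ‖ = s := by simpa using hζ
      have h4 : ‖z‖ - s ≤ ‖ζ - z‖ := by
        rw [← h3, norm_sub_rev]; exact norm_sub_norm_le _ _
      have h5 := hM ζ hζ
      have h6 : 0 < ‖z‖ - s := by linarith
      gcongr)
  simpa [cauchyTransform] using this

/-- Existence of the Laurent decomposition. -/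
theorem exists_isLaurentDecomposition {r R : ℝ} (hr : 0 ≤ r) (hrR : r < R) {f : ℂ → ℂ}
    (hf : DifferentiableOn ℂ f (annulus r R)) :
    ∃ fp fm : ℂ → ℂ, IsLaurentDecomposition r R f fp fm := by
  -- The radius varies with z so as to be admissible for every z; `hfp` and `hfm` show that any
  -- other admissible radius gives the same value.
  let fp : ℂ → ℂ := fun z => cauchyTransform f ((max ‖z‖ r + R) / 2) z
  let fm : ℂ → ℂ := fun z => - cauchyTransform f ((r + min ‖z‖ R) / 2) z
  have hfp : ∀ s z, r < s → s < R → ‖z‖ < s → fp z = cauchyTransform f s z := by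
    intro s z hs hsR hz
    have h1 : max ‖z‖ r < R := max_lt (hz.trans hsR) hrR
    have h2 : ‖z‖ < (max ‖z‖ r + R) / 2 := by linarith [le_max_left ‖z‖ r]
    have h3 : r < (max ‖z‖ r + R) / 2 := by linarith [le_max_right ‖z‖ r]
    rcases le_total s ((max ‖z‖ r + R) / 2) with h | h
    · exact cauchyTransform_eq hr hs h (by linarith) hf (Or.inl hz)
    · exact (cauchyTransform_eq hr h3 h hsR hf (Or.inl h2)).symm
  have hfm : ∀ s z, r < s → s < R → s < ‖z‖ → fm z = - cauchyTransform f s z := by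
    intro s z hs hsR hz
    have h1 : r < min ‖z‖ R := lt_min (hs.trans hz) hrR
    have h2 : (r + min ‖z‖ R) / 2 < ‖z‖ := by linarith [min_le_left ‖z‖ R]
    have h3 : (r + min ‖z‖ R) / 2 < R := by linarith [min_le_right ‖z‖ R]
    simp only [fm, neg_inj]
    rcases le_total s ((r + min ‖z‖ R) / 2) with h | h
    · exact cauchyTransform_eq hr hs h h3 hf (Or.inr h2)
    · exact (cauchyTransform_eq hr (by linarith) h hsR hf (Or.inr hz)).symm
  refine ⟨fp, fm, ?_, ?_, ?_, ?_⟩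
  · intro z hz
    have hz' : ‖z‖ < R := by simpa using hz
    obtain ⟨s, hs1, hs2⟩ := exists_between (max_lt hrR hz')
    have hrs : r < s := (le_max_left _ _).trans_lt hs1
    have hzs : ‖z‖ < s := (le_max_right _ _).trans_lt hs1
    refine ((differentiableAt_cauchyTransform (hr.trans hrs.le) (hf.continuousOn_sphere hrs hs2)
      hzs.ne).congr_of_eventuallyEq ?_).differentiableWithinAt
    filter_upwards [(isOpen_lt continuous_norm continuous_const).mem_nhds hzs] with w hw
    exact hfp s w hrs hs2 hw
  · intro z hz
    have hz' : r < ‖z‖ := hz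
    obtain ⟨s, hs1, hs2⟩ := exists_between (lt_min hrR hz')
    have hsR : s < R := hs2.trans_le (min_le_left _ _)
    have hzs : s < ‖z‖ := hs2.trans_le (min_le_right _ _)
    refine ((differentiableAt_cauchyTransform (hr.trans hs1.le) (hf.continuousOn_sphere hs1 hsR)
      hzs.ne').neg.congr_of_eventuallyEq ?_).differentiableWithinAt
    filter_upwards [(isOpen_lt continuous_const continuous_norm).mem_nhds hzs] with w hw
    exact hfm s w hs1 hsR hw
  · obtain ⟨s, hs1, hs2⟩ := exists_between hrR
    have h := (tendsto_cauchyTransform (hr.trans hs1.le) (hf.continuousOn_sphere hs1 hs2)).neg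
    rw [neg_zero] at h
    refine h.congr' ?_
    filter_upwards [tendsto_norm_cobounded_atTop.eventually (eventually_gt_atTop s)] with z hz
    exact (hfm s z hs1 hs2 hz).symm
  · intro z hz
    obtain ⟨s₁, h1, h2⟩ := exists_between hz.1
    obtain ⟨s₂, h3, h4⟩ := exists_between hz.2
    rw [hfp s₂ z (hz.1.trans h3) h4 h3, hfm s₁ z h1 (h2.trans hz.2) h2, ← sub_eq_add_neg]
    exact (cauchyTransform_sub hr h1 h4 hf h2 h3).symm

/-- Uniqueness of the Laurent decomposition. -/
theorem IsLaurentDecomposition.eq_zero {r R : ℝ} (hrR : r < R) {fp fm : ℂ → ℂ}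
    (h : IsLaurentDecomposition r R (fun _ => 0) fp fm) :
    (∀ z ∈ ball (0 : ℂ) R, fp z = 0) ∧ ∀ z, r < ‖z‖ → fm z = 0 := by
  classical
  -- The parts of the zero function satisfy fp = -fm on the annulus and glue to an entire function
  -- that tends to 0 at infinity, so Liouville's theorem applies.
  let g : ℂ → ℂ := fun z => if ‖z‖ < R then fp z else - fm z
  have hg1 : ∀ z, ‖z‖ < R → g z = fp z := fun z hz => if_pos hz
  have hg2 : ∀ z, r < ‖z‖ → g z = - fm z := by
    intro z hz
    by_cases hzR : ‖z‖ < R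
    · rw [hg1 z hzR]
      have := h.sum_eq z ⟨hz, hzR⟩
      linear_combination - this
    · exact if_neg hzR
  have hdiff : Differentiable ℂ g := by
    intro z
    by_cases hzR : ‖z‖ < R
    · have := h.plus_holomorphic.differentiableAt (isOpen_ball.mem_nhds (by simpa using hzR))
      refine this.congr_of_eventuallyEq ?_
      filter_upwards [(isOpen_lt continuous_norm continuous_const).mem_nhds hzR] with w hw
      exact hg1 w hw
    · have hz : r < ‖z‖ := by linarith
      have := h.minus_holomorphic.differentiableAt ((isOpen_norm_gt r).mem_nhds hz)
      refine this.neg.congr_of_eventuallyEq ?_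
      filter_upwards [(isOpen_norm_gt r).mem_nhds hz] with w hw
      exact hg2 w hw
  have hlim : Tendsto g (cocompact ℂ) (𝓝 0) := by
    rw [← Metric.cobounded_eq_cocompact]
    have := h.minus_infinity.neg
    rw [neg_zero] at this
    refine this.congr' ?_
    filter_upwards [tendsto_norm_cobounded_atTop.eventually (eventually_gt_atTop r)] with z hz
    exact (hg2 z hz).symm
  have h0 : ∀ z, g z = 0 := fun z => hdiff.apply_eq_of_tendsto_cocompact z hlim
  refine ⟨fun z hz => ?_, fun z hz => ?_⟩
  · rw [← hg1 z (by simpa using hz), h0]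
  · have := hg2 z hz
    rw [h0] at this
    exact neg_eq_zero.1 this.symm

theorem IsLaurentDecomposition.sub {r R : ℝ} {f g fp fm gp gm : ℂ → ℂ}
    (hf : IsLaurentDecomposition r R f fp fm) (hg : IsLaurentDecomposition r R g gp gm) :
    IsLaurentDecomposition r R (f - g) (fp - gp) (fm - gm) where
  plus_holomorphic := hf.plus_holomorphic.sub hg.plus_holomorphic
  minus_holomorphic := hf.minus_holomorphic.sub hg.minus_holomorphic
  minus_infinity := by
    have := hf.minus_infinity.sub hg.minus_infinity
    rwa [sub_zero] at this
  sum_eq := fun z hz => by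
    simp only [Pi.sub_apply, hf.sum_eq z hz, hg.sum_eq z hz]; ring

theorem IsLaurentDecomposition.add {r R : ℝ} {f g fp fm gp gm : ℂ → ℂ}
    (hf : IsLaurentDecomposition r R f fp fm) (hg : IsLaurentDecomposition r R g gp gm) :
    IsLaurentDecomposition r R (f + g) (fp + gp) (fm + gm) where
  plus_holomorphic := hf.plus_holomorphic.add hg.plus_holomorphic
  minus_holomorphic := hf.minus_holomorphic.add hg.minus_holomorphic
  minus_infinity := by
    have := hf.minus_infinity.add hg.minus_infinity
    rwa [add_zero] at this
  sum_eq := fun z hz => by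
    simp only [Pi.add_apply, hf.sum_eq z hz, hg.sum_eq z hz]; ring

theorem IsLaurentDecomposition.congr {r R : ℝ} {f g fp fm : ℂ → ℂ}
    (hf : IsLaurentDecomposition r R f fp fm) (h : ∀ z ∈ annulus r R, g z = f z) :
    IsLaurentDecomposition r R g fp fm :=
  { hf with sum_eq := fun z hz => by rw [h z hz, hf.sum_eq z hz] }

theorem IsLaurentDecomposition.unique {r R : ℝ} (hrR : r < R) {f fp fm gp gm : ℂ → ℂ}
    (hf : IsLaurentDecomposition r R f fp fm) (hg : IsLaurentDecomposition r R f gp gm) :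
    (∀ z ∈ ball (0 : ℂ) R, fp z = gp z) ∧ ∀ z, r < ‖z‖ → fm z = gm z := by
  have h := ((hf.sub hg).congr (g := fun _ => 0) (by simp)).eq_zero hrR
  exact ⟨fun z hz => sub_eq_zero.1 (h.1 z hz), fun z hz => sub_eq_zero.1 (h.2 z hz)⟩

end

noncomputable section

open Set Metric Filter

/-! ### Smoothness at the boundary of the disc -/

theorem IsLaurentDecomposition.of_plus {r R : ℝ} {f : ℂ → ℂ} (hf : DifferentiableOn ℂ f (ball 0 R)) :
    IsLaurentDecomposition r R f f 0 where
  plus_holomorphic := hf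
  minus_holomorphic := differentiableOn_const 0
  minus_infinity := tendsto_const_nhds
  sum_eq := fun z _ => by simp

theorem IsLaurentDecomposition.of_minus {r R : ℝ} {f : ℂ → ℂ}
    (hf : DifferentiableOn ℂ f {z | r < ‖z‖}) (h0 : Tendsto f (Bornology.cobounded ℂ) (𝓝 0)) :
    IsLaurentDecomposition r R f 0 f where
  plus_holomorphic := differentiableOn_const 0
  minus_holomorphic := hf
  minus_infinity := h0
  sum_eq := fun z _ => by simp

/-- The map ζ ↦ s/ζ exchanges the two boundary circles and hence the two parts. The constant hp 0
has to stay with the new plus part, since the new minus part must vanish at infinity. -/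
theorem IsLaurentDecomposition.inversion {s : ℝ} (hs : 0 < s) {G hp hm : ℂ → ℂ}
    (h : IsLaurentDecomposition s 1 G hp hm) :
    IsLaurentDecomposition s 1 (fun ζ => G (s / ζ))
      (fun ζ => if ζ = 0 then hp 0 else hm (s / ζ) + hp 0) (fun ζ => hp (s / ζ) - hp 0) := by
  have hnorm : ∀ ζ : ℂ, ‖(s : ℂ) / ζ‖ = s / ‖ζ‖ := fun ζ => by
    rw [norm_div, Complex.norm_real, Real.norm_of_nonneg hs.le]
  have hmem : ∀ ζ : ℂ, s < ‖ζ‖ → (s : ℂ) / ζ ∈ ball (0 : ℂ) 1 := fun ζ hζ => by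
    rw [mem_ball_zero_iff, hnorm, div_lt_one (hs.trans hζ)]; exact hζ
  have hlt : ∀ ζ : ℂ, ζ ≠ 0 → ‖ζ‖ < 1 → s < ‖(s : ℂ) / ζ‖ := fun ζ h0 h1 => by
    rw [hnorm, lt_div_iff₀ (norm_pos_iff.2 h0)]; nlinarith
  refine ⟨?_, ?_, ?_, ?_⟩
  -- Removable singularity at 0: the prescribed value hp 0 is the limit because hm vanishes at
  -- infinity.
  · refine (Complex.differentiableOn_compl_singleton_and_continuousAt_iff (c := 0)
      (ball_mem_nhds 0 one_pos)).1 ⟨?_, ?_⟩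
    · intro ζ hζ
      have h0 : ζ ≠ 0 := hζ.2
      have h1 : ‖ζ‖ < 1 := by simpa using hζ.1
      have hd : DifferentiableAt ℂ (fun ζ => hm (s / ζ) + hp 0) ζ := by
        have h2 := h.minus_holomorphic.differentiableAt
          ((isOpen_norm_gt s).mem_nhds (hlt ζ h0 h1))
        exact (h2.comp ζ ((differentiableAt_const _).div differentiableAt_id h0)).add_const _
      refine (hd.congr_of_eventuallyEq ?_).differentiableWithinAt
      filter_upwards [isOpen_ne.mem_nhds h0] with w hw
      exact if_neg hw
    · rw [continuousAt_iff_punctured_nhds]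
      simp only [if_true]
      have h2 : Tendsto (fun ζ : ℂ => (s : ℂ) / ζ) (𝓝[≠] 0) (Bornology.cobounded ℂ) := by
        simp only [div_eq_mul_inv]
        have : (s : ℂ) ≠ 0 := by exact_mod_cast hs.ne'
        exact (tendsto_mul_left_cobounded this).comp tendsto_inv₀_nhdsNE_zero
      have h3 := (h.minus_infinity.comp h2).add_const (hp 0)
      rw [zero_add] at h3
      refine h3.congr' ?_
      filter_upwards [self_mem_nhdsWithin] with ζ hζ
      exact (if_neg hζ).symm
  · intro ζ hζ
    have hζ0 : ζ ≠ 0 := norm_pos_iff.1 (hs.trans hζ)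
    have h2 := h.plus_holomorphic.differentiableAt (isOpen_ball.mem_nhds (hmem ζ hζ))
    exact ((h2.comp ζ ((differentiableAt_const _).div differentiableAt_id hζ0)).sub_const
      _).differentiableWithinAt
  · have h2 : Tendsto (fun ζ : ℂ => (s : ℂ) / ζ) (Bornology.cobounded ℂ) (𝓝 0) := by
      simp only [div_eq_mul_inv]
      simpa using (tendsto_inv₀_cobounded (α := ℂ)).const_mul (s : ℂ)
    have h3 : ContinuousAt hp 0 :=
      (h.plus_holomorphic.differentiableAt (ball_mem_nhds 0 one_pos)).continuousAt
    have h4 := (h3.tendsto.comp h2).sub_const (hp 0)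
    rwa [sub_self] at h4
  · intro ζ hζ
    have h0 : ζ ≠ 0 := norm_pos_iff.1 (hs.trans hζ.1)
    have h1 := h.sum_eq (s / ζ) ⟨hlt ζ h0 hζ.2, by simpa using hmem ζ hζ.1⟩
    simp only [h1, if_neg h0]
    ring

namespace SmoothnessClass

variable (S : SmoothnessClass)

theorem continuousAt_toFun (f : S.carrier) {z : ℂ} (hz : ‖z‖ < 1) : ContinuousAt (S.toFun f) z :=
  ((S.holomorphic f).differentiableAt (isOpen_ball.mem_nhds (by simpa using hz))).continuousAt

/-- Constants belong to every smoothness class. -/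
theorem exists_one : ∃ e : S.carrier, ∀ z ∈ ball (0 : ℂ) 1, S.toFun e z = 1 := by
  have hne : ∀ z ∈ annulus (1 / 2) 1, z ≠ 0 := fun z hz => norm_pos_iff.1 (by
    have := hz.1; linarith)
  -- The plus part of z⁻¹ is 0 and thus in the class, so the plus part of its inverse, the
  -- coordinate z, is in the class too.
  obtain ⟨q, hq⟩ := S.inv_plus (1 / 2) (by norm_num) (by norm_num) (fun z => z⁻¹) 0 (fun z => z⁻¹)
    (fun z => z) 0
    (fun z hz => (differentiableAt_inv (hne z hz)).differentiableWithinAt)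
    ⟨2, fun z hz => by
      rw [norm_inv, inv_le_comm₀ (norm_pos_iff.2 (hne z hz)) two_pos]; linarith [hz.1]⟩
    ⟨1, one_pos, fun z hz => by
      rw [norm_inv, one_le_inv₀ (norm_pos_iff.2 (hne z hz))]; exact hz.2.le⟩
    (IsLaurentDecomposition.of_minus (fun z hz => (differentiableAt_inv (norm_pos_iff.1 (by
      have : (1 / 2 : ℝ) < ‖z‖ := hz
      linarith))).differentiableWithinAt) tendsto_inv₀_cobounded)
    ⟨0, fun z _ => by simp⟩
    ((IsLaurentDecomposition.of_plus differentiableOn_id).congr fun z _ => inv_inv z)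
  obtain ⟨c, hc⟩ := S.mul_plus (1 / 2) 2 (by norm_num) (by norm_num) (by norm_num)
  -- Multiplying the coordinate z by z⁻¹, which is holomorphic across the unit circle, gives 1.
  obtain ⟨e, he, -⟩ := hc q (fun z => z⁻¹) (fun z hz => (differentiableAt_inv (norm_pos_iff.1 (by
      have := hz.1
      linarith))).differentiableWithinAt) (fun _ => 1) 0
    ((IsLaurentDecomposition.of_plus (differentiableOn_const 1)).congr fun z hz => by
      rw [hq z (annulus_subset_ball _ _ hz), mul_inv_cancel₀ (hne z hz)])
  exact ⟨e, he⟩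

/-- `F` is a function on `{s < |z| < 1}` with `F⁺ ∈ Γ_S(Δ, 𝒪)`. -/
def PlusMem (s : ℝ) (F : ℂ → ℂ) : Prop :=
  ∃ hp hm : ℂ → ℂ, IsLaurentDecomposition s 1 F hp hm ∧
    ∃ h : S.carrier, ∀ z ∈ ball (0 : ℂ) 1, S.toFun h z = hp z

variable {S} {s : ℝ} {F G : ℂ → ℂ}

theorem PlusMem.congr (hF : S.PlusMem s F) (h : ∀ z ∈ annulus s 1, G z = F z) : S.PlusMem s G := by
  obtain ⟨hp, hm, hd, hh⟩ := hF
  exact ⟨hp, hm, hd.congr h, hh⟩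

theorem PlusMem.add (hF : S.PlusMem s F) (hG : S.PlusMem s G) : S.PlusMem s (F + G) := by
  obtain ⟨hp, hm, hd, h, hh⟩ := hF
  obtain ⟨kp, km, kd, k, hk⟩ := hG
  exact ⟨_, _, hd.add kd, h + k, fun z hz => by simp [hh z hz, hk z hz]⟩

theorem PlusMem.toFun_mul (hs : 0 < s) (hs1 : s < 1) (f : S.carrier) {R : ℝ} (hR : 1 < R)
    (hG : DifferentiableOn ℂ G (annulus s R)) : S.PlusMem s (fun z => S.toFun f z * G z) := by
  obtain ⟨c, hc⟩ := S.mul_plus s R hs hs1 hR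
  obtain ⟨hp, hm, hd⟩ := exists_isLaurentDecomposition hs.le hs1 (f := fun z => S.toFun f z * G z)
    (((S.holomorphic f).mono (annulus_subset_ball _ _)).mul (hG.mono (annulus_mono le_rfl hR.le)))
  obtain ⟨h, hh, -⟩ := hc f G hG hp hm hd
  exact ⟨hp, hm, hd, h, hh⟩

/-- Expand the product of the two Laurent decompositions. The product of the plus parts lies in the
algebra. In the mixed products the minus factor is holomorphic across the unit circle, so `mul_plus`
applies. The product of the minus parts has no plus part. -/
theorem PlusMem.mul (hs : 0 < s) (hs1 : s < 1) (hF : S.PlusMem s F) (hG : S.PlusMem s G) :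
    S.PlusMem s (fun z => F z * G z) := by
  obtain ⟨hp, hm, hd, h, hh⟩ := hF
  obtain ⟨kp, km, kd, k, hk⟩ := hG
  obtain ⟨c, hc⟩ := S.mul
  obtain ⟨e, he, -⟩ := hc h k
  have h1 : S.PlusMem s (S.toFun e) :=
    ⟨S.toFun e, 0, IsLaurentDecomposition.of_plus (S.holomorphic e), e, fun _ _ => rfl⟩
  have hsub : annulus s 2 ⊆ {z | s < ‖z‖} := fun z hz => hz.1
  have h2 := PlusMem.toFun_mul hs hs1 h one_lt_two (kd.minus_holomorphic.mono hsub)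
  have h3 := PlusMem.toFun_mul hs hs1 k one_lt_two (hd.minus_holomorphic.mono hsub)
  have h4 : S.PlusMem s (fun z => hm z * km z) := by
    refine ⟨0, _, IsLaurentDecomposition.of_minus
      (hd.minus_holomorphic.mul kd.minus_holomorphic) ?_, 0, fun z _ => by simp⟩
    simpa using hd.minus_infinity.mul kd.minus_infinity
  refine ((h1.add h2).add (h3.add h4)).congr fun z hz => ?_
  have hz1 := annulus_subset_ball _ _ hz
  simp only [Pi.add_apply, hd.sum_eq z hz, kd.sum_eq z hz, he z hz1, hh z hz1, hk z hz1]
  ring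

theorem PlusMem.inv (hs : 0 < s) (hs1 : s < 1) (hF : S.PlusMem s F)
    (hM : ∃ M : ℝ, ∀ z ∈ annulus s 1, ‖F z‖ ≤ M)
    (hc : ∃ c : ℝ, 0 < c ∧ ∀ z ∈ annulus s 1, c ≤ ‖F z‖) : S.PlusMem s (fun z => (F z)⁻¹) := by
  obtain ⟨hp, hm, hd, h⟩ := hF
  have hdiff : DifferentiableOn ℂ F (annulus s 1) :=
    ((hd.plus_holomorphic.mono (annulus_subset_ball _ _)).add
      (hd.minus_holomorphic.mono fun z hz => hz.1)).congr hd.sum_eq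
  have hne : ∀ z ∈ annulus s 1, F z ≠ 0 := by
    obtain ⟨c, hc0, hc⟩ := hc
    exact fun z hz => norm_pos_iff.1 (hc0.trans_le (hc z hz))
  obtain ⟨gp, gm, gd⟩ := exists_isLaurentDecomposition hs.le hs1 (hdiff.inv hne)
  exact ⟨gp, gm, gd, S.inv_plus s hs hs1 F hp hm gp gm hdiff hM hc hd h gd⟩

variable (S) in
-- Apply `mul_plus` to the product of the constant 1 and G; its estimate bounds the norm of the plus
-- part by the supremum of G.
theorem exists_plusMem_bound (hs : 0 < s) (hs1 : s < 1) {R : ℝ} (hR : 1 < R) : ∃ C : ℝ, 0 ≤ C ∧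
    ∀ (G : ℂ → ℂ) (M : ℝ), DifferentiableOn ℂ G (annulus s R) → (∀ z ∈ annulus s R, ‖G z‖ ≤ M) →
      ∃ hp hm : ℂ → ℂ, IsLaurentDecomposition s 1 G hp hm ∧
        ∃ h : S.carrier, (∀ z ∈ ball (0 : ℂ) 1, S.toFun h z = hp z) ∧ ‖h‖ ≤ C * M := by
  obtain ⟨c, hc⟩ := S.mul_plus s R hs hs1 hR
  obtain ⟨e, he⟩ := S.exists_one
  refine ⟨|c| * ‖e‖, by positivity, fun G M hG hM => ?_⟩
  obtain ⟨hp, hm, hd⟩ := exists_isLaurentDecomposition hs.le hs1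
    (hG.mono (annulus_mono le_rfl hR.le))
  obtain ⟨h, hh, hb⟩ := hc e G hG hp hm (hd.congr fun z hz => by
    rw [he z (annulus_subset_ball _ _ hz), one_mul])
  refine ⟨hp, hm, hd, h, hh, (hb M hM).trans ?_⟩
  have hM0 : 0 ≤ M := by
    obtain ⟨z, hz⟩ := annulus_nonempty hs.le (hs1.trans hR)
    exact (norm_nonneg _).trans (hM z hz)
  gcongr
  exact le_abs_self c

end SmoothnessClass

/-! ### The Banach algebra of smooth functions on an annulus -/

namespace AnnulusSpace

variable {Sm Sp : SmoothnessClass}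

instance : CompleteSpace (AnnulusSpace Sm Sp) := by
  have hc : ∀ S : SmoothnessClass, Continuous fun f : S.carrier => S.toFun f 0 := by
    intro S
    obtain ⟨c, hc⟩ := S.bound
    exact ((LinearMap.proj (0 : ℂ)).comp S.toFun).mkContinuous c
      (fun f => hc f 0 (mem_ball_self one_pos)) |>.continuous
  have hcl : IsClosed (annulusSubmodule Sm Sp : Set (Sm.carrier × Sp.carrier)) :=
    isClosed_eq ((hc Sm).comp continuous_fst) ((hc Sp).comp continuous_snd)
  exact hcl.completeSpace_coe

variable {r R : ℝ}

theorem zero_eq (f : AnnulusSpace Sm Sp) : Sm.toFun f.1.1 0 = Sp.toFun f.1.2 0 := f.2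

theorem norm_fst_le (f : AnnulusSpace Sm Sp) : ‖f.1.1‖ ≤ ‖f‖ := _root_.norm_fst_le f.1

theorem norm_snd_le (f : AnnulusSpace Sm Sp) : ‖f.1.2‖ ≤ ‖f‖ := _root_.norm_snd_le f.1

theorem norm_le_iff (f : AnnulusSpace Sm Sp) {C : ℝ} : ‖f‖ ≤ C ↔ ‖f.1.1‖ ≤ C ∧ ‖f.1.2‖ ≤ C :=
  norm_prod_le_iff (x := f.1)

theorem plus_add (f g : AnnulusSpace Sm Sp) (z : ℂ) : (f + g).plus R z = f.plus R z + g.plus R z := by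
  change Sp.toFun (f.1.2 + g.1.2) _ = _
  simp [plus]

theorem plus_smul (c : ℂ) (f : AnnulusSpace Sm Sp) (z : ℂ) : (c • f).plus R z = c * f.plus R z := by
  change Sp.toFun (c • f.1.2) _ = _
  simp [plus]

theorem minus_add (f g : AnnulusSpace Sm Sp) (z : ℂ) :
    (f + g).minus r z = f.minus r z + g.minus r z := by
  change Sm.toFun (f.1.1 + g.1.1) _ - Sm.toFun (f.1.1 + g.1.1) _ = _
  simp [minus]
  ring

theorem minus_smul (c : ℂ) (f : AnnulusSpace Sm Sp) (z : ℂ) :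
    (c • f).minus r z = c * f.minus r z := by
  change Sm.toFun (c • f.1.1) _ - Sm.toFun (c • f.1.1) _ = _
  simp [minus]
  ring

theorem norm_div_lt_one_of_gt (hr : 0 < r) {z : ℂ} (hz : r < ‖z‖) : (r : ℂ) / z ∈ ball (0 : ℂ) 1 := by
  rw [mem_ball_zero_iff, norm_div, Complex.norm_real, Real.norm_of_nonneg hr.le,
    div_lt_one (hr.trans hz)]
  exact hz

theorem norm_div_lt_one_of_lt {z : ℂ} (hz : ‖z‖ < R) : z / (R : ℂ) ∈ ball (0 : ℂ) 1 := by
  have hR : 0 < R := (norm_nonneg z).trans_lt hz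
  rw [mem_ball_zero_iff, norm_div, Complex.norm_real, Real.norm_of_nonneg hR.le, div_lt_one hR]
  exact hz

variable (Sm Sp) in
-- Both parts are values of functions on the unit disc, so the constant is independent of the radii.
-- The factor 2 comes from subtracting the value at 0 in `minus`.
theorem exists_bound : ∃ c : ℝ, 0 ≤ c ∧ ∀ (r R : ℝ), 0 < r → ∀ f : AnnulusSpace Sm Sp,
    (∀ z : ℂ, ‖z‖ < R → ‖f.plus R z‖ ≤ c * ‖f‖) ∧ (∀ z : ℂ, r < ‖z‖ → ‖f.minus r z‖ ≤ c * ‖f‖) := by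
  obtain ⟨c₁, h₁⟩ := Sm.bound
  obtain ⟨c₂, h₂⟩ := Sp.bound
  refine ⟨2 * |c₁| + |c₂|, by positivity, fun r R hr f => ⟨fun z hz => ?_, fun z hz => ?_⟩⟩
  · calc ‖f.plus R z‖ ≤ c₂ * ‖f.1.2‖ := h₂ _ _ (norm_div_lt_one_of_lt hz)
      _ ≤ |c₂| * ‖f‖ := by
        gcongr
        · exact le_abs_self _
        · exact f.norm_snd_le
      _ ≤ (2 * |c₁| + |c₂|) * ‖f‖ := by gcongr; linarith [abs_nonneg c₁]
  · have h3 : ∀ w ∈ ball (0 : ℂ) 1, ‖Sm.toFun f.1.1 w‖ ≤ |c₁| * ‖f‖ := fun w hw =>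
      (h₁ _ _ hw).trans (by
        gcongr
        · exact le_abs_self _
        · exact f.norm_fst_le)
    calc ‖f.minus r z‖ ≤ |c₁| * ‖f‖ + |c₁| * ‖f‖ := (norm_sub_le _ _).trans
          (add_le_add (h3 _ (norm_div_lt_one_of_gt hr hz)) (h3 _ (mem_ball_self one_pos)))
      _ ≤ (2 * |c₁| + |c₂|) * ‖f‖ := by nlinarith [abs_nonneg c₂, norm_nonneg f]

theorem differentiableOn_plus (f : AnnulusSpace Sm Sp) :
    DifferentiableOn ℂ (f.plus R) (ball 0 R) := by
  refine (Sp.holomorphic f.1.2).comp (by fun_prop) fun z hz => ?_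
  exact norm_div_lt_one_of_lt (by simpa using hz)

theorem differentiableOn_minus (hr : 0 < r) (f : AnnulusSpace Sm Sp) :
    DifferentiableOn ℂ (f.minus r) {z | r < ‖z‖} := by
  refine DifferentiableOn.sub_const ((Sm.holomorphic f.1.1).comp ?_ fun z hz =>
    norm_div_lt_one_of_gt hr hz) _
  exact fun z hz => ((differentiableAt_const _).div differentiableAt_id
    (norm_pos_iff.1 (hr.trans hz))).differentiableWithinAt

theorem tendsto_minus (f : AnnulusSpace Sm Sp) :
    Tendsto (f.minus r) (Bornology.cobounded ℂ) (𝓝 0) := by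
  have h2 : Tendsto (fun ζ : ℂ => (r : ℂ) / ζ) (Bornology.cobounded ℂ) (𝓝 0) := by
    simp only [div_eq_mul_inv]
    simpa using (tendsto_inv₀_cobounded (α := ℂ)).const_mul (r : ℂ)
  have h4 := ((Sm.continuousAt_toFun f.1.1 (z := 0) (by simp)).tendsto.comp h2).sub_const
    (Sm.toFun f.1.1 0)
  rwa [sub_self] at h4

/-- `f⁺` and `f⁻` form the Laurent decomposition of `f`. -/
theorem isLaurentDecomposition (hr : 0 < r) (f : AnnulusSpace Sm Sp) :
    IsLaurentDecomposition r R (f.eval r R) (f.plus R) (f.minus r) :=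
  ⟨f.differentiableOn_plus, f.differentiableOn_minus hr, f.tendsto_minus, fun _ _ => rfl⟩

theorem differentiableOn_eval (hr : 0 < r) (f : AnnulusSpace Sm Sp) :
    DifferentiableOn ℂ (f.eval r R) (annulus r R) :=
  (f.differentiableOn_plus.mono (annulus_subset_ball _ _)).add
    ((f.differentiableOn_minus hr).mono fun _ hz => hz.1)

theorem eval_zero_smul_scale (hr : 0 < r) (hrR : r < R) (f : AnnulusSpace Sm Sp) :
    IsLaurentDecomposition (r / R) 1 (fun ζ => f.eval r R (R * ζ)) (Sp.toFun f.1.2)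
      (fun ζ => f.minus r (R * ζ)) := by
  have hR : 0 < R := hr.trans hrR
  have hR' : (R : ℂ) ≠ 0 := by exact_mod_cast hR.ne'
  refine ⟨Sp.holomorphic _, ?_, ?_, fun z _ => ?_⟩
  · refine (f.differentiableOn_minus hr).comp (by fun_prop) fun z hz => ?_
    have : r / R < ‖z‖ := hz
    rw [div_lt_iff₀ hR] at this
    simpa [abs_of_pos hR, mul_comm] using this
  · exact f.tendsto_minus.comp (tendsto_mul_left_cobounded hR')
  · simp [eval, plus, mul_div_cancel_left₀ _ hR']

theorem plusMem_outer (hr : 0 < r) (hrR : r < R) (f : AnnulusSpace Sm Sp) :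
    Sp.PlusMem (r / R) (fun ζ => f.eval r R (R * ζ)) :=
  ⟨_, _, f.eval_zero_smul_scale hr hrR, f.1.2, fun _ _ => rfl⟩

theorem mul_ratio_div (hR : 0 < R) (ζ : ℂ) : (R : ℂ) * (((r / R : ℝ) : ℂ) / ζ) = r / ζ := by
  have hR' : (R : ℂ) ≠ 0 := by exact_mod_cast hR.ne'
  rw [Complex.ofReal_div]
  field_simp

theorem ratio_div_div (hr : 0 < r) (hrR : r < R) (ζ : ℂ) :
    (r : ℂ) / (R * (((r / R : ℝ) : ℂ) / ζ)) = ζ := by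
  rw [mul_ratio_div (hr.trans hrR)]
  have hr' : (r : ℂ) ≠ 0 := by exact_mod_cast hr.ne'
  rw [div_div_eq_mul_div, mul_div_cancel_left₀ _ hr']

/-- Inversion of the decomposition at the outer circle. The condition p 0 = q 0 in the definition of
the space makes the plus part at the inner circle exactly p. -/
theorem plusMem_inner (hr : 0 < r) (hrR : r < R) (f : AnnulusSpace Sm Sp) :
    Sm.PlusMem (r / R) (fun ζ => f.eval r R (r / ζ)) := by
  have hR : 0 < R := hr.trans hrR
  have h := (f.eval_zero_smul_scale hr hrR).inversion (div_pos hr hR)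
  refine ⟨_, _, h.congr fun z _ => by rw [mul_ratio_div hR], f.1.1, fun z hz => ?_⟩
  by_cases hz0 : z = 0
  · rw [if_pos hz0, hz0, f.zero_eq]
  · rw [if_neg hz0, minus, ratio_div_div hr hrR, f.zero_eq, sub_add_cancel]

/-- The decompositions at the two circles belong to one function F, so by uniqueness the inner one
is the inversion of the outer one. This yields both p 0 = q 0 and the formula for the minus part. -/
theorem exists_of_laurent (hr : 0 < r) (hrR : r < R) {F hp hm kp km : ℂ → ℂ}
    (h : IsLaurentDecomposition (r / R) 1 (fun ζ => F (R * ζ)) hp hm)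
    (k : IsLaurentDecomposition (r / R) 1 (fun ζ => F (r / ζ)) kp km)
    (q : Sp.carrier) (hq : ∀ z ∈ ball (0 : ℂ) 1, Sp.toFun q z = hp z)
    (p : Sm.carrier) (hkp : ∀ z ∈ ball (0 : ℂ) 1, Sm.toFun p z = kp z) :
    ∃ f : AnnulusSpace Sm Sp, f.1 = (p, q) ∧ ∀ z ∈ annulus r R, f.eval r R z = F z := by
  have hR : 0 < R := hr.trans hrR
  have hs : r / R < 1 := (div_lt_one hR).2 hrR
  have h' := (h.inversion (div_pos hr hR)).congr (g := fun ζ => F (r / ζ))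
    fun z _ => by rw [mul_ratio_div hR]
  have hu := (k.unique hs h').1
  have h0 : Sm.toFun p 0 = hp 0 := by
    rw [hkp 0 (mem_ball_self one_pos), hu 0 (mem_ball_self one_pos), if_pos rfl]
  have hmem : (p, q) ∈ annulusSubmodule Sm Sp := by
    change Sm.toFun p 0 = Sp.toFun q 0
    rw [h0, hq 0 (mem_ball_self one_pos)]
  refine ⟨⟨(p, q), hmem⟩, rfl, fun z hz => ?_⟩
  change Sp.toFun q (z / R) + (Sm.toFun p (r / z) - Sm.toFun p 0) = F z
  have hz1 := norm_div_lt_one_of_lt hz.2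
  have hz2 := norm_div_lt_one_of_gt hr hz.1
  have hz0 : z ≠ 0 := norm_pos_iff.1 (hr.trans hz.1)
  have hr' : (r : ℂ) ≠ 0 := by exact_mod_cast hr.ne'
  have hR' : (R : ℂ) ≠ 0 := by exact_mod_cast hR.ne'
  have e : (((r / R : ℝ) : ℂ) / (r / z)) = z / R := by
    rw [Complex.ofReal_div]
    field_simp
  rw [hq _ hz1, h0, hkp _ hz2, hu _ hz2, if_neg (div_ne_zero hr' hz0), e]
  have := h.sum_eq (z / R) ⟨by
    rw [norm_div, Complex.norm_real, Real.norm_of_nonneg hR.le]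
    exact (div_lt_div_iff_of_pos_right hR).2 hz.1, by simpa using hz1⟩
  simp only [mul_div_cancel₀ _ hR'] at this
  rw [this]
  ring

/-- A function is smooth iff it is smooth at both boundary circles. -/
theorem exists_of_plusMem (hr : 0 < r) (hrR : r < R) {F : ℂ → ℂ}
    (h : Sp.PlusMem (r / R) (fun ζ => F (R * ζ))) (k : Sm.PlusMem (r / R) (fun ζ => F (r / ζ))) :
    ∃ f : AnnulusSpace Sm Sp, ∀ z ∈ annulus r R, f.eval r R z = F z := by
  obtain ⟨hp, hm, h, q, hq⟩ := h
  obtain ⟨kp, km, k, p, hkp⟩ := k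
  obtain ⟨f, -, hf⟩ := exists_of_laurent hr hrR h k q hq p hkp
  exact ⟨f, hf⟩

/-- Functions holomorphic in a neighbourhood of the closed annulus are smooth. -/
theorem exists_of_holomorphic (Sm Sp : SmoothnessClass) (hr : 0 < r) (hrR : r < R) {r₁ R₁ : ℝ}
    (hr₁ : 0 < r₁) (h₁ : r₁ < r) (h₂ : R < R₁) : ∃ C : ℝ, 0 ≤ C ∧ ∀ (F : ℂ → ℂ) (M : ℝ),
      DifferentiableOn ℂ F (annulus r₁ R₁) → (∀ z ∈ annulus r₁ R₁, ‖F z‖ ≤ M) →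
      ∃ f : AnnulusSpace Sm Sp, (∀ z ∈ annulus r R, f.eval r R z = F z) ∧ ‖f‖ ≤ C * M := by
  have hR : 0 < R := hr.trans hrR
  have hs0 : 0 < r / R := div_pos hr hR
  have hs : r / R < 1 := (div_lt_one hR).2 hrR
  obtain ⟨C₁, hC₁, H₁⟩ := Sp.exists_plusMem_bound hs0 hs ((one_lt_div hR).2 h₂)
  obtain ⟨C₂, hC₂, H₂⟩ := Sm.exists_plusMem_bound hs0 hs ((one_lt_div hr₁).2 h₁)
  refine ⟨C₁ + C₂, by positivity, fun F M hF hM => ?_⟩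
  have hM0 : 0 ≤ M := by
    obtain ⟨z, hz⟩ := annulus_nonempty hr₁.le (h₁.trans (hrR.trans h₂))
    exact (norm_nonneg _).trans (hM z hz)
  have m₁ : ∀ z ∈ annulus (r / R) (R₁ / R), (R : ℂ) * z ∈ annulus r₁ R₁ := by
    intro z hz
    have a := (div_lt_iff₀ hR).1 hz.1
    have b := (lt_div_iff₀ hR).1 hz.2
    constructor <;> rw [norm_mul, Complex.norm_real, Real.norm_of_nonneg hR.le] <;> nlinarith
  have m₂ : ∀ z ∈ annulus (r / R) (r / r₁), (r : ℂ) / z ∈ annulus r₁ R₁ := by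
    intro z hz
    have hz0 : 0 < ‖z‖ := hs0.trans hz.1
    have a := (div_lt_iff₀ hR).1 hz.1
    have b := (lt_div_iff₀ hr₁).1 hz.2
    constructor <;> rw [norm_div, Complex.norm_real, Real.norm_of_nonneg hr.le]
    · rw [lt_div_iff₀ hz0]; nlinarith
    · rw [div_lt_iff₀ hz0]; nlinarith
  obtain ⟨hp, hm, h, q, hq, hqn⟩ := H₁ (fun ζ => F (R * ζ)) M
    (hF.comp (by fun_prop) m₁) (fun z hz => hM _ (m₁ z hz))
  obtain ⟨kp, km, k, p, hkp, hpn⟩ := H₂ (fun ζ => F (r / ζ)) M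
    (hF.comp (fun z hz => ((differentiableAt_const _).div differentiableAt_id
      (norm_pos_iff.1 (hs0.trans hz.1))).differentiableWithinAt) m₂) (fun z hz => hM _ (m₂ z hz))
  obtain ⟨f, hf, hfe⟩ := exists_of_laurent hr hrR h k q hq p hkp
  refine ⟨f, hfe, (f.norm_le_iff).2 ?_⟩
  rw [hf]
  constructor <;> nlinarith

theorem eq_zero_of_eval (hr : 0 < r) (hrR : r < R) (f : AnnulusSpace Sm Sp)
    (h : ∀ z ∈ annulus r R, f.eval r R z = 0) : f = 0 := by
  have hR : 0 < R := hr.trans hrR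
  have hR' : (R : ℂ) ≠ 0 := by exact_mod_cast hR.ne'
  have hr' : (r : ℂ) ≠ 0 := by exact_mod_cast hr.ne'
  have hu := ((f.isLaurentDecomposition (R := R) hr).congr (g := fun _ => 0)
    fun z hz => (h z hz).symm).eq_zero hrR
  have hq : ∀ z ∈ ball (0 : ℂ) 1, Sp.toFun f.1.2 z = 0 := by
    intro z hz
    have := hu.1 (R * z) (by
      have : ‖z‖ < 1 := by simpa using hz
      rw [mem_ball_zero_iff, norm_mul, Complex.norm_real, Real.norm_of_nonneg hR.le]
      nlinarith)
    simpa [plus, mul_div_cancel_left₀ _ hR'] using this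
  have hq0 : f.1.2 = 0 := Sp.injective _ _ fun z hz => by rw [hq z hz]; simp
  have hp : ∀ z ∈ ball (0 : ℂ) 1, Sm.toFun f.1.1 z = 0 := by
    intro z hz
    have h0 : Sm.toFun f.1.1 0 = 0 := by rw [f.zero_eq, hq0]; simp
    by_cases hz0 : z = 0
    · rw [hz0, h0]
    · have := hu.2 (r / z) (by
        have hz1 : ‖z‖ < 1 := by simpa using hz
        rw [norm_div, Complex.norm_real, Real.norm_of_nonneg hr.le,
          lt_div_iff₀ (norm_pos_iff.2 hz0)]
        nlinarith)
      rwa [minus, h0, sub_zero, div_div_eq_mul_div, mul_div_cancel_left₀ _ hr'] at this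
  have hp0 : f.1.1 = 0 := Sm.injective _ _ fun z hz => by rw [hp z hz]; simp
  exact Subtype.ext (Prod.ext hp0 hq0)

theorem eval_add (f g : AnnulusSpace Sm Sp) (z : ℂ) :
    (f + g).eval r R z = f.eval r R z + g.eval r R z := by
  simp only [eval, plus_add, minus_add]; ring

theorem eval_smul (c : ℂ) (f : AnnulusSpace Sm Sp) (z : ℂ) :
    (c • f).eval r R z = c * f.eval r R z := by
  simp only [eval, plus_smul, minus_smul]; ring

/-- Evaluation at a point of the annulus. -/
def evalCLM (Sm Sp : SmoothnessClass) (hr : 0 < r) (z : annulus r R) : AnnulusSpace Sm Sp →L[ℂ] ℂ :=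
  LinearMap.mkContinuousOfExistsBound
    { toFun := fun f => f.eval r R z
      map_add' := fun f g => eval_add f g z
      map_smul' := fun c f => eval_smul c f z }
    (by
      obtain ⟨c, -, hc⟩ := exists_bound Sm Sp
      refine ⟨c + c, fun f => (norm_add_le _ _).trans ?_⟩
      rw [add_mul]
      exact add_le_add ((hc r R hr f).1 z z.2.2) ((hc r R hr f).2 z z.2.1))

theorem eval_sub (f g : AnnulusSpace Sm Sp) (z : ℂ) :
    (f - g).eval r R z = f.eval r R z - g.eval r R z := by
  have := eval_add (r := r) (R := R) (f - g) g z
  rw [sub_add_cancel] at this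
  rw [this, add_sub_cancel_right]

theorem ext_eval (hr : 0 < r) (hrR : r < R) {f g : AnnulusSpace Sm Sp}
    (h : ∀ z ∈ annulus r R, f.eval r R z = g.eval r R z) : f = g :=
  sub_eq_zero.1 (eq_zero_of_eval hr hrR _ fun z hz => by rw [eval_sub, h z hz, sub_self])

/-- Evaluations at points separate the elements, so the closed graph theorem replaces norm
estimates. -/
theorem continuous_of_eval {E : Type*} [NormedAddCommGroup E] [NormedSpace ℂ E] [CompleteSpace E]
    (hr : 0 < r) (hrR : r < R) (T : E →ₗ[ℂ] AnnulusSpace Sm Sp)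
    (h : ∀ z ∈ annulus r R, Continuous fun x => (T x).eval r R z) : Continuous T :=
  T.continuous_of_separating (G := fun _ : annulus r R => ℂ) (evalCLM Sm Sp hr)
    (fun y hy => eq_zero_of_eval hr hrR y fun z hz => hy ⟨z, hz⟩) fun z => h z z.2

theorem exists_mul (hr : 0 < r) (hrR : r < R) (f g : AnnulusSpace Sm Sp) :
    ∃ k : AnnulusSpace Sm Sp, ∀ z ∈ annulus r R, k.eval r R z = f.eval r R z * g.eval r R z := by
  have hR : 0 < R := hr.trans hrR
  have hs0 : 0 < r / R := div_pos hr hR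
  have hs : r / R < 1 := (div_lt_one hR).2 hrR
  exact exists_of_plusMem hr hrR (F := fun z => f.eval r R z * g.eval r R z)
    ((f.plusMem_outer hr hrR).mul hs0 hs (g.plusMem_outer hr hrR))
    ((f.plusMem_inner hr hrR).mul hs0 hs (g.plusMem_inner hr hrR))

theorem scale_mem (hr : 0 < r) (hrR : r < R) {z : ℂ} (hz : z ∈ annulus (r / R) 1) :
    (R : ℂ) * z ∈ annulus r R ∧ (r : ℂ) / z ∈ annulus r R := by
  have hR : 0 < R := hr.trans hrR
  have h1 := (div_lt_iff₀ hR).1 hz.1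
  have h2 : 0 < ‖z‖ := (div_pos hr hR).trans hz.1
  have h3 := hz.2
  refine ⟨⟨?_, ?_⟩, ⟨?_, ?_⟩⟩
  · rw [norm_mul, Complex.norm_real, Real.norm_of_nonneg hR.le]; nlinarith
  · rw [norm_mul, Complex.norm_real, Real.norm_of_nonneg hR.le]; nlinarith
  · rw [norm_div, Complex.norm_real, Real.norm_of_nonneg hr.le, lt_div_iff₀ h2]; nlinarith
  · rw [norm_div, Complex.norm_real, Real.norm_of_nonneg hr.le, div_lt_iff₀ h2]; nlinarith

theorem exists_norm_eval_le (hr : 0 < r) (f : AnnulusSpace Sm Sp) :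
    ∃ M : ℝ, ∀ z ∈ annulus r R, ‖f.eval r R z‖ ≤ M := by
  obtain ⟨c, -, hc⟩ := exists_bound Sm Sp
  exact ⟨c * ‖f‖ + c * ‖f‖, fun z hz => (norm_add_le _ _).trans
    (add_le_add ((hc r R hr f).1 z hz.2) ((hc r R hr f).2 z hz.1))⟩

theorem exists_inv (hr : 0 < r) (hrR : r < R) (f : AnnulusSpace Sm Sp)
    (hf : ∃ c : ℝ, 0 < c ∧ ∀ z ∈ annulus r R, c ≤ ‖f.eval r R z‖) :
    ∃ k : AnnulusSpace Sm Sp, ∀ z ∈ annulus r R, k.eval r R z = (f.eval r R z)⁻¹ := by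
  have hR : 0 < R := hr.trans hrR
  have hs0 : 0 < r / R := div_pos hr hR
  have hs : r / R < 1 := (div_lt_one hR).2 hrR
  obtain ⟨c, hc, hcf⟩ := hf
  obtain ⟨M, hM⟩ := f.exists_norm_eval_le (R := R) hr
  exact exists_of_plusMem hr hrR (F := fun z => (f.eval r R z)⁻¹)
    ((f.plusMem_outer hr hrR).inv hs0 hs ⟨M, fun z hz => hM _ (scale_mem hr hrR hz).1⟩
      ⟨c, hc, fun z hz => hcf _ (scale_mem hr hrR hz).1⟩)
    ((f.plusMem_inner hr hrR).inv hs0 hs ⟨M, fun z hz => hM _ (scale_mem hr hrR hz).2⟩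
      ⟨c, hc, fun z hz => hcf _ (scale_mem hr hrR hz).2⟩)

/-- `exists_mul` gives products without a norm bound. The closed graph theorem is used twice: for
multiplication by a fixed f, and then for the map sending f to this operator. -/
theorem exists_mulCLM (Sm Sp : SmoothnessClass) (hr : 0 < r) (hrR : r < R) :
    ∃ μ : AnnulusSpace Sm Sp →L[ℂ] AnnulusSpace Sm Sp →L[ℂ] AnnulusSpace Sm Sp,
      ∀ f g, ∀ z ∈ annulus r R, (μ f g).eval r R z = f.eval r R z * g.eval r R z := by
  choose m hm using exists_mul (Sm := Sm) (Sp := Sp) hr hrR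
  have hc : ∀ (z) (_ : z ∈ annulus r R), Continuous fun f : AnnulusSpace Sm Sp => f.eval r R z :=
    fun z hz => (evalCLM Sm Sp hr ⟨z, hz⟩).continuous
  let m₁ : AnnulusSpace Sm Sp → AnnulusSpace Sm Sp →L[ℂ] AnnulusSpace Sm Sp := fun f =>
    let T : AnnulusSpace Sm Sp →ₗ[ℂ] AnnulusSpace Sm Sp :=
      { toFun := m f
        map_add' := fun g k => ext_eval hr hrR fun z hz => by
          rw [eval_add, hm _ _ z hz, hm _ _ z hz, hm _ _ z hz, eval_add, mul_add]
        map_smul' := fun c g => ext_eval hr hrR fun z hz => by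
          rw [RingHom.id_apply, eval_smul, hm _ _ z hz, hm _ _ z hz, eval_smul, mul_left_comm] }
    ⟨T, continuous_of_eval hr hrR T fun z hz => by
      change Continuous fun g => (m f g).eval r R z
      simp only [hm f _ z hz]
      exact continuous_const.mul (hc z hz)⟩
  have hm₁ : ∀ f g, ∀ z ∈ annulus r R, (m₁ f g).eval r R z = f.eval r R z * g.eval r R z := hm
  let m₂ : AnnulusSpace Sm Sp →ₗ[ℂ] AnnulusSpace Sm Sp →L[ℂ] AnnulusSpace Sm Sp :=
    { toFun := m₁
      map_add' := fun f k => by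
        ext1 g
        refine ext_eval hr hrR fun z hz => ?_
        rw [add_apply, eval_add, hm₁ _ _ z hz, hm₁ _ _ z hz, hm₁ _ _ z hz,
          eval_add, add_mul]
      map_smul' := fun c f => by
        ext1 g
        refine ext_eval hr hrR fun z hz => ?_
        rw [RingHom.id_apply, smul_apply, eval_smul, hm₁ _ _ z hz,
          hm₁ _ _ z hz, eval_smul, mul_assoc] }
  refine ⟨⟨m₂, ?_⟩, hm⟩
  -- Operators are separated by applying them to g and evaluating at a point.
  refine m₂.continuous_of_separating (ι := AnnulusSpace Sm Sp × annulus r R) (G := fun _ => ℂ)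
    (fun i => (evalCLM Sm Sp hr i.2).comp (ContinuousLinearMap.apply ℂ _ i.1)) ?_ ?_
  · intro y hy
    ext1 g
    exact eq_zero_of_eval hr hrR _ fun z hz => hy (g, ⟨z, hz⟩)
  · rintro ⟨g, z⟩
    change Continuous fun f => (m₁ f g).eval r R z
    simp only [hm₁ _ g z z.2]
    exact (hc z z.2).mul continuous_const

theorem exists_one (Sm Sp : SmoothnessClass) : ∃ e : AnnulusSpace Sm Sp, ∀ r R : ℝ, 0 < r →
    ∀ z ∈ annulus r R, e.eval r R z = 1 := by
  obtain ⟨p, hp⟩ := Sm.exists_one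
  obtain ⟨q, hq⟩ := Sp.exists_one
  refine ⟨⟨(p, q), ?_⟩, fun r R hr z hz => ?_⟩
  · change Sm.toFun p 0 = Sp.toFun q 0
    rw [hp 0 (mem_ball_self one_pos), hq 0 (mem_ball_self one_pos)]
  · change Sp.toFun q (z / R) + (Sm.toFun p (r / z) - Sm.toFun p 0) = 1
    rw [hq _ (norm_div_lt_one_of_lt hz.2), hp _ (norm_div_lt_one_of_gt hr hz.1),
      hp 0 (mem_ball_self one_pos)]
    ring

end AnnulusSpace

end

noncomputable section

open Set Metric Filter

namespace AnnulusSpace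

variable {r R : ℝ}

/-- Multiplication of smooth functions on an annulus. -/
def mulCLM (Sm Sp : SmoothnessClass) (hr : 0 < r) (hrR : r < R) :
    AnnulusSpace Sm Sp →L[ℂ] AnnulusSpace Sm Sp →L[ℂ] AnnulusSpace Sm Sp :=
  (exists_mulCLM Sm Sp hr hrR).choose

variable {Sm Sp : SmoothnessClass}

theorem eval_mulCLM (hr : 0 < r) (hrR : r < R) (f g : AnnulusSpace Sm Sp) {z : ℂ}
    (hz : z ∈ annulus r R) :
    (mulCLM Sm Sp hr hrR f g).eval r R z = f.eval r R z * g.eval r R z :=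
  (exists_mulCLM Sm Sp hr hrR).choose_spec f g z hz

/-- The constant function one. -/
def one (Sm Sp : SmoothnessClass) : AnnulusSpace Sm Sp := (exists_one Sm Sp).choose

theorem eval_one (hr : 0 < r) {z : ℂ} (hz : z ∈ annulus r R) : (one Sm Sp).eval r R z = 1 :=
  (exists_one Sm Sp).choose_spec r R hr z hz

theorem eval_zero (z : ℂ) : (0 : AnnulusSpace Sm Sp).eval r R z = 0 := by
  have := eval_smul (r := r) (R := R) 0 (0 : AnnulusSpace Sm Sp) z
  simpa using this

theorem eval_sum {ι : Type*} (s : Finset ι) (f : ι → AnnulusSpace Sm Sp) (z : ℂ) :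
    (∑ i ∈ s, f i).eval r R z = ∑ i ∈ s, (f i).eval r R z := by
  classical
  induction s using Finset.induction_on with
  | empty => simp [eval_zero]
  | insert i s hi ih => rw [Finset.sum_insert hi, Finset.sum_insert hi, eval_add, ih]

end AnnulusSpace

open AnnulusSpace

theorem ContinuousLinearMap.mul_app {E : Type*} [NormedAddCommGroup E] [NormedSpace ℂ E]
    (f g : E →L[ℂ] E) (x : E) : (f * g) x = f (g x) := rfl

/-! ### The Banach algebra of smooth functions on A × Δ(σ) and its expansion in powers of w -/

namespace ProductSpace

variable {S : SmoothnessClass} {σ : ℝ}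

open Classical in
/-- The value of `G` at a point of the disc, zero outside of it. -/
def app (G : ProductSpace S σ) (a : ℂ) : AnnulusSpace S S :=
  if h : a ∈ ball (0 : ℂ) σ then G.1 ⟨a, h⟩ else 0

theorem app_of_mem (G : ProductSpace S σ) {a : ℂ} (h : a ∈ ball (0 : ℂ) σ) :
    G.app a = G.1 ⟨a, h⟩ := dif_pos h

theorem eval_eq (r R : ℝ) (G : ProductSpace S σ) (ζ a : ℂ) :
    G.eval r R ζ a = (G.app a).eval r R ζ := by
  unfold eval app
  split_ifs <;> simp [AnnulusSpace.eval_zero]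

theorem differentiableOn_app (G : ProductSpace S σ) : DifferentiableOn ℂ G.app (ball 0 σ) := by
  obtain ⟨H, hH, h⟩ := G.2
  exact hH.congr fun a ha => (G.app_of_mem ha).trans (h ⟨a, ha⟩)

theorem norm_app_le (G : ProductSpace S σ) (a : ℂ) : ‖G.app a‖ ≤ ‖G‖ := by
  by_cases h : a ∈ ball (0 : ℂ) σ
  · rw [G.app_of_mem h]
    exact G.1.norm_coe_le_norm _
  · rw [app, dif_neg h, norm_zero]
    exact norm_nonneg _

theorem ext_app {G G' : ProductSpace S σ} (h : ∀ a ∈ ball (0 : ℂ) σ, G.app a = G'.app a) :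
    G = G' := by
  refine Subtype.ext (BoundedContinuousFunction.ext fun a => ?_)
  rw [← G.app_of_mem a.2, ← G'.app_of_mem a.2, h a a.2]

theorem exists_of_differentiableOn {H : ℂ → AnnulusSpace S S} (hH : DifferentiableOn ℂ H (ball 0 σ))
    {M : ℝ} (hM : ∀ a ∈ ball (0 : ℂ) σ, ‖H a‖ ≤ M) :
    ∃ G : ProductSpace S σ, ∀ a ∈ ball (0 : ℂ) σ, G.app a = H a := by
  let G : BoundedContinuousFunction (ball (0 : ℂ) σ) (AnnulusSpace S S) :=
    BoundedContinuousFunction.ofNormedAddCommGroup (fun a => H a)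
      (continuousOn_iff_continuous_domRestrict.1 hH.continuousOn) M fun a => hM a a.2
  have hG : G ∈ productSubmodule S σ := ⟨H, hH, fun _ => rfl⟩
  exact ⟨⟨G, hG⟩, fun a ha => app_of_mem (S := S) ⟨G, hG⟩ ha⟩

instance : CompleteSpace (ProductSpace S σ) := by
  have hcl : IsClosed (productSubmodule S σ : Set (BoundedContinuousFunction
      (ball (0 : ℂ) σ) (AnnulusSpace S S))) := by
    refine IsSeqClosed.isClosed fun u G hu hG => ?_
    classical
    let e : BoundedContinuousFunction (ball (0 : ℂ) σ) (AnnulusSpace S S) → ℂ → AnnulusSpace S S :=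
      fun G a => if h : a ∈ ball (0 : ℂ) σ then G ⟨a, h⟩ else 0
    have he : ∀ G, ∀ a : ball (0 : ℂ) σ, e G a = G a := fun G a => dif_pos a.2
    refine ⟨e G, ?_, fun a => (he G a).symm⟩
    have h1 : TendstoUniformlyOn (fun n => e (u n)) (e G) atTop (ball 0 σ) := by
      rw [Metric.tendstoUniformlyOn_iff]
      intro ε hε
      filter_upwards [Metric.tendsto_nhds.1 hG ε hε] with n hn a ha
      rw [he G ⟨a, ha⟩, he (u n) ⟨a, ha⟩, dist_comm]
      exact (BoundedContinuousFunction.dist_coe_le_dist _).trans_lt hn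
    refine h1.tendstoLocallyUniformlyOn.differentiableOn (Eventually.of_forall fun n => ?_)
      isOpen_ball
    obtain ⟨H, hH, h⟩ := hu n
    exact hH.congr fun a ha => (he (u n) ⟨a, ha⟩).trans (h ⟨a, ha⟩)
  exact hcl.completeSpace_coe

theorem app_add (G G' : ProductSpace S σ) (a : ℂ) : (G + G').app a = G.app a + G'.app a := by
  by_cases h : a ∈ ball (0 : ℂ) σ
  · rw [app_of_mem _ h, app_of_mem _ h, app_of_mem _ h]
    rfl
  · simp only [app, dif_neg h, add_zero]

theorem app_smul (c : ℂ) (G : ProductSpace S σ) (a : ℂ) : (c • G).app a = c • G.app a := by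
  by_cases h : a ∈ ball (0 : ℂ) σ
  · rw [app_of_mem _ h, app_of_mem _ h]
    rfl
  · simp only [app, dif_neg h, smul_zero]

/-- Evaluation at a point of the disc. -/
def appCLM (S : SmoothnessClass) (σ : ℝ) (a : ℂ) : ProductSpace S σ →L[ℂ] AnnulusSpace S S :=
  LinearMap.mkContinuous
    { toFun := fun G => G.app a
      map_add' := fun G G' => app_add G G' a
      map_smul' := fun c G => app_smul c G a } 1 fun G => by
      rw [one_mul]
      exact G.norm_app_le a

@[simp]
theorem appCLM_apply (G : ProductSpace S σ) (a : ℂ) : appCLM S σ a G = G.app a := rfl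

theorem continuous_of_app {E : Type*} [NormedAddCommGroup E] [NormedSpace ℂ E] [CompleteSpace E]
    (T : E →ₗ[ℂ] ProductSpace S σ)
    (h : ∀ a ∈ ball (0 : ℂ) σ, Continuous fun x => (T x).app a) : Continuous T :=
  T.continuous_of_separating (G := fun _ : ball (0 : ℂ) σ => AnnulusSpace S S)
    (fun a => appCLM S σ a) (fun y hy => ext_app fun a ha => by
      rw [← appCLM_apply, ← appCLM_apply, hy ⟨a, ha⟩, map_zero]) fun a => h a a.2

/-- A family of elements depending linearly and pointwise continuously on a parameter defines a
continuous linear map. -/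
theorem exists_clm_of_app {E : Type*} [NormedAddCommGroup E] [NormedSpace ℂ E] [CompleteSpace E]
    (H : E → ℂ → AnnulusSpace S S)
    (h : ∀ x, ∃ G : ProductSpace S σ, ∀ a ∈ ball (0 : ℂ) σ, G.app a = H x a)
    (hadd : ∀ x y, ∀ a ∈ ball (0 : ℂ) σ, H (x + y) a = H x a + H y a)
    (hsmul : ∀ (c : ℂ) (x), ∀ a ∈ ball (0 : ℂ) σ, H (c • x) a = c • H x a)
    (hc : ∀ a ∈ ball (0 : ℂ) σ, Continuous fun x => H x a) :
    ∃ T : E →L[ℂ] ProductSpace S σ, ∀ x, ∀ a ∈ ball (0 : ℂ) σ, (T x).app a = H x a := by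
  choose T hT using h
  let T' : E →ₗ[ℂ] ProductSpace S σ :=
    { toFun := T
      map_add' := fun x y => ext_app fun a ha => by
        rw [app_add, hT _ a ha, hT _ a ha, hT _ a ha, hadd _ _ a ha]
      map_smul' := fun c x => ext_app fun a ha => by
        rw [RingHom.id_apply, app_smul, hT _ a ha, hT _ a ha, hsmul _ _ a ha] }
  refine ⟨⟨T', continuous_of_app T' fun a ha => ?_⟩, hT⟩
  change Continuous fun x => (T x).app a
  simp only [hT _ a ha]
  exact hc a ha

/-- The quotient (G(w) - G(0))/w is holomorphic by the removable singularity theorem. It is bounded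
near 0 by compactness and away from 0 by the size of the denominator. -/
theorem exists_shift (S : SmoothnessClass) (hσ : 0 < σ) :
    ∃ T : ProductSpace S σ →L[ℂ] ProductSpace S σ, ∀ G, ∀ a ∈ ball (0 : ℂ) σ,
      (T G).app a = dslope G.app 0 a := by
  refine exists_clm_of_app (fun (G : ProductSpace S σ) a => dslope G.app 0 a) (fun G => ?_) ?_ ?_ ?_
  · have hd : DifferentiableOn ℂ (dslope G.app 0) (ball 0 σ) :=
      (Complex.differentiableOn_dslope (ball_mem_nhds 0 hσ)).2 G.differentiableOn_app
    obtain ⟨M, hM⟩ := (isCompact_closedBall (0 : ℂ) (σ / 2)).exists_bound_of_continuousOn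
      (hd.continuousOn.mono (closedBall_subset_ball (by linarith)))
    refine exists_of_differentiableOn hd (M := max M ((σ / 2)⁻¹ * (‖G‖ + ‖G‖))) fun a ha => ?_
    by_cases h : ‖a‖ ≤ σ / 2
    · exact (hM a (by simpa using h)).trans (le_max_left _ _)
    · refine le_trans ?_ (le_max_right _ _)
      have ha0 : a ≠ 0 := by
        rintro rfl
        simp at h
        linarith
      rw [dslope_of_ne _ ha0, slope_def_module, sub_zero, norm_smul, norm_inv]
      gcongr
      · linarith
      · exact (norm_sub_le _ _).trans (add_le_add (G.norm_app_le _) (G.norm_app_le _))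
  · intro G G' a _
    have : (G + G').app = G.app + G'.app := funext fun a => app_add G G' a
    by_cases h : a = 0
    · subst h
      rw [dslope_same, dslope_same, dslope_same, this]
      exact deriv_add (G.differentiableOn_app.differentiableAt (ball_mem_nhds 0 hσ))
        (G'.differentiableOn_app.differentiableAt (ball_mem_nhds 0 hσ))
    · simp only [dslope_of_ne _ h, slope_def_module, app_add]
      rw [← smul_add]
      congr 1
      abel
  · intro c G a _
    have : (c • G).app = c • G.app := funext fun a => app_smul c G a
    by_cases h : a = 0
    · subst h
      rw [dslope_same, dslope_same, this]
      exact deriv_const_smul c (G.differentiableOn_app.differentiableAt (ball_mem_nhds 0 hσ))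
    · simp only [dslope_of_ne _ h, slope_def_module, app_smul]
      rw [← smul_sub, smul_comm]
  · intro a _
    have hcont : ∀ a, Continuous fun G : ProductSpace S σ => G.app a :=
      fun a => (appCLM S σ a).continuous
    by_cases h : a = 0
    · subst h
      have hs : (0 : ℝ) < σ / 2 := by linarith
      let D : ProductSpace S σ →ₗ[ℂ] AnnulusSpace S S :=
        { toFun := fun G => dslope G.app 0 0
          map_add' := fun G G' => by
            have : (G + G').app = G.app + G'.app := funext fun a => app_add G G' a
            simp only [dslope_same]
            rw [this]
            exact deriv_add (G.differentiableOn_app.differentiableAt (ball_mem_nhds 0 hσ))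
              (G'.differentiableOn_app.differentiableAt (ball_mem_nhds 0 hσ))
          map_smul' := fun c G => by
            have : (c • G).app = c • G.app := funext fun a => app_smul c G a
            simp only [dslope_same]
            rw [this]
            exact deriv_const_smul c
              (G.differentiableOn_app.differentiableAt (ball_mem_nhds 0 hσ)) }
      -- At w = 0 the value is the derivative; Cauchy's estimate on the circle of radius σ/2 bounds
      -- it.
      refine (D.mkContinuous (σ / 2)⁻¹ fun G => ?_).continuous
      change ‖dslope G.app 0 0‖ ≤ _
      rw [dslope_same]
      have hdc : DiffContOnCl ℂ G.app (ball 0 (σ / 2)) :=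
        (G.differentiableOn_app.mono (closedBall_subset_ball (by linarith))).diffContOnCl_ball
          subset_rfl
      have := Complex.norm_deriv_le_of_forall_mem_sphere_norm_le hs hdc
        (C := ‖G‖) fun z _ => G.norm_app_le z
      rwa [div_eq_inv_mul] at this
    · simp only [dslope_of_ne _ h, slope_def_module]
      exact Continuous.const_smul ((hcont a).sub (hcont 0)) (a - 0)⁻¹

/-- The shift `G ↦ (G - G(0)) / w`. -/
def shift (S : SmoothnessClass) (hσ : 0 < σ) : ProductSpace S σ →L[ℂ] ProductSpace S σ :=
  (exists_shift S hσ).choose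

theorem app_shift (hσ : 0 < σ) (G : ProductSpace S σ) {a : ℂ} (ha : a ∈ ball (0 : ℂ) σ) :
    (shift S hσ G).app a = dslope G.app 0 a := (exists_shift S hσ).choose_spec G a ha

theorem exists_const (S : SmoothnessClass) (σ : ℝ) :
    ∃ T : AnnulusSpace S S →L[ℂ] ProductSpace S σ, ∀ f, ∀ a ∈ ball (0 : ℂ) σ, (T f).app a = f :=
  exists_clm_of_app (fun f _ => f)
    (fun f => exists_of_differentiableOn (differentiableOn_const f) (M := ‖f‖) fun _ _ => le_rfl)
    (fun _ _ _ _ => rfl) (fun _ _ _ _ => rfl) fun _ _ => continuous_id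

/-- Functions which do not depend on `w`. -/
def const (S : SmoothnessClass) (σ : ℝ) : AnnulusSpace S S →L[ℂ] ProductSpace S σ :=
  (exists_const S σ).choose

theorem app_const (f : AnnulusSpace S S) {a : ℂ} (ha : a ∈ ball (0 : ℂ) σ) :
    (const S σ f).app a = f := (exists_const S σ).choose_spec f a ha

theorem exists_mulW (S : SmoothnessClass) (σ : ℝ) :
    ∃ T : ProductSpace S σ →L[ℂ] ProductSpace S σ, ∀ G, ∀ a ∈ ball (0 : ℂ) σ,
      (T G).app a = a • G.app a := by
  refine exists_clm_of_app (fun (G : ProductSpace S σ) a => a • G.app a) (fun G => ?_) ?_ ?_ ?_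
  · refine exists_of_differentiableOn (differentiableOn_id.smul G.differentiableOn_app)
      (M := σ * ‖G‖) fun a ha => ?_
    have : ‖a‖ < σ := by simpa using ha
    rw [norm_smul]
    exact mul_le_mul this.le (G.norm_app_le a) (norm_nonneg _) ((norm_nonneg a).trans this.le)
  · intro G G' a _
    rw [app_add, smul_add]
  · intro c G a _
    rw [app_smul, smul_comm]
  · intro a _
    exact (appCLM S σ a).continuous.const_smul a

/-- Multiplication by `w`. -/
def mulW (S : SmoothnessClass) (σ : ℝ) : ProductSpace S σ →L[ℂ] ProductSpace S σ :=
  (exists_mulW S σ).choose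

theorem app_mulW (G : ProductSpace S σ) {a : ℂ} (ha : a ∈ ball (0 : ℂ) σ) :
    (mulW S σ G).app a = a • G.app a := (exists_mulW S σ).choose_spec G a ha

theorem app_mulW_pow (k : ℕ) (G : ProductSpace S σ) {a : ℂ} (ha : a ∈ ball (0 : ℂ) σ) :
    ((mulW S σ ^ k) G).app a = a ^ k • G.app a := by
  induction k with
  | zero => simp
  | succ k ih => rw [pow_succ', ContinuousLinearMap.mul_app, app_mulW _ ha, ih, pow_succ', mul_smul]

variable {r R : ℝ}

theorem exists_mul (S : SmoothnessClass) (σ : ℝ) (hr : 0 < r) (hrR : r < R) :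
    ∃ T : ProductSpace S σ →L[ℂ] ProductSpace S σ →L[ℂ] ProductSpace S σ,
      ∀ G G', ∀ a ∈ ball (0 : ℂ) σ, (T G G').app a = mulCLM S S hr hrR (G.app a) (G'.app a) := by
  have h1 : ∀ G : ProductSpace S σ, ∃ T : ProductSpace S σ →L[ℂ] ProductSpace S σ,
      ∀ G', ∀ a ∈ ball (0 : ℂ) σ, (T G').app a = mulCLM S S hr hrR (G.app a) (G'.app a) := by
    intro G
    refine exists_clm_of_app (fun (G' : ProductSpace S σ) a => mulCLM S S hr hrR (G.app a) (G'.app a)) (fun G' => ?_)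
      ?_ ?_ ?_
    · refine exists_of_differentiableOn (M := ‖mulCLM S S hr hrR‖ * ‖G‖ * ‖G'‖) ?_ fun a _ => ?_
      · exact DifferentiableOn.clm_apply
          ((mulCLM S S hr hrR).differentiable.comp_differentiableOn G.differentiableOn_app)
          G'.differentiableOn_app
      · refine ((mulCLM S S hr hrR).le_opNorm₂ _ _).trans ?_
        gcongr
        · exact G.norm_app_le a
        · exact G'.norm_app_le a
    · intro x y a _
      rw [app_add, map_add]
    · intro c x a _
      rw [app_smul, map_smul]
    · intro a _
      exact (mulCLM S S hr hrR (G.app a)).continuous.comp (appCLM S σ a).continuous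
  choose T hT using h1
  let T' : ProductSpace S σ →ₗ[ℂ] ProductSpace S σ →L[ℂ] ProductSpace S σ :=
    { toFun := T
      map_add' := fun x y => by
        ext1 z
        refine ext_app fun a ha => ?_
        rw [add_apply, app_add, hT _ _ a ha, hT _ _ a ha, hT _ _ a ha,
          app_add, map_add, add_apply]
      map_smul' := fun c x => by
        ext1 z
        refine ext_app fun a ha => ?_
        rw [RingHom.id_apply, smul_apply, app_smul, hT _ _ a ha, hT _ _ a ha,
          app_smul, map_smul, smul_apply] }
  refine ⟨⟨T', ?_⟩, hT⟩
  refine T'.continuous_of_separating (ι := ProductSpace S σ × ball (0 : ℂ) σ)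
    (G := fun _ => AnnulusSpace S S)
    (fun i => (appCLM S σ i.2).comp (ContinuousLinearMap.apply ℂ _ i.1)) ?_ ?_
  · intro y hy
    ext1 g
    refine ext_app fun a ha => ?_
    have := hy (g, ⟨a, ha⟩)
    rw [← appCLM_apply, ← appCLM_apply, zero_apply, map_zero]
    exact this
  · rintro ⟨g, a⟩
    change Continuous fun G => (T G g).app a
    simp only [hT _ g a a.2]
    exact ((mulCLM S S hr hrR).continuous.comp (appCLM S σ a).continuous).clm_apply
      continuous_const

/-- Multiplication in `Γ_S(A × Δ(σ), 𝒪)`. -/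
def mul (S : SmoothnessClass) (σ : ℝ) (hr : 0 < r) (hrR : r < R) :
    ProductSpace S σ →L[ℂ] ProductSpace S σ →L[ℂ] ProductSpace S σ :=
  (exists_mul S σ hr hrR).choose

theorem app_mul (hr : 0 < r) (hrR : r < R) (G G' : ProductSpace S σ) {a : ℂ}
    (ha : a ∈ ball (0 : ℂ) σ) :
    (mul S σ hr hrR G G').app a = mulCLM S S hr hrR (G.app a) (G'.app a) :=
  (exists_mul S σ hr hrR).choose_spec G G' a ha

theorem eval_mul (hr : 0 < r) (hrR : r < R) (G G' : ProductSpace S σ) {ζ a : ℂ}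
    (hζ : ζ ∈ annulus r R) (ha : a ∈ ball (0 : ℂ) σ) :
    (mul S σ hr hrR G G').eval r R ζ a = G.eval r R ζ a * G'.eval r R ζ a := by
  rw [eval_eq, eval_eq, eval_eq, app_mul hr hrR _ _ ha, eval_mulCLM hr hrR _ _ hζ]

theorem eval_add (G G' : ProductSpace S σ) (ζ a : ℂ) :
    (G + G').eval r R ζ a = G.eval r R ζ a + G'.eval r R ζ a := by
  rw [eval_eq, eval_eq, eval_eq, app_add, AnnulusSpace.eval_add]

theorem ext_eval (hr : 0 < r) (hrR : r < R) {G G' : ProductSpace S σ}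
    (h : ∀ ζ ∈ annulus r R, ∀ a ∈ ball (0 : ℂ) σ, G.eval r R ζ a = G'.eval r R ζ a) : G = G' :=
  ext_app fun a ha => AnnulusSpace.ext_eval hr hrR fun ζ hζ => by
    rw [← eval_eq, ← eval_eq, h ζ hζ a ha]

/-! #### Division with remainder by `wⁿ` -/

theorem const_add_mulW_shift (hσ : 0 < σ) (G : ProductSpace S σ) :
    const S σ (G.app 0) + mulW S σ (shift S hσ G) = G := by
  refine ext_app fun a ha => ?_
  rw [app_add, app_const _ ha, app_mulW _ ha, app_shift hσ _ ha]
  have := sub_smul_dslope G.app 0 a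
  rw [sub_zero] at this
  rw [this, add_sub_cancel]

theorem shift_mulW (hσ : 0 < σ) (G : ProductSpace S σ) : shift S hσ (mulW S σ G) = G := by
  have h0 : (0 : ℂ) ∈ ball (0 : ℂ) σ := mem_ball_self hσ
  have key : ∀ a ∈ ball (0 : ℂ) σ, a ≠ 0 → (shift S hσ (mulW S σ G)).app a = G.app a := by
    intro a ha hne
    rw [app_shift hσ _ ha, dslope_of_ne _ hne, slope_def_module, app_mulW _ ha, app_mulW _ h0,
      zero_smul, sub_zero, sub_zero, smul_smul, inv_mul_cancel₀ hne, one_smul]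
  refine ext_app fun a ha => ?_
  -- At w = 0 the identity follows by continuity from the punctured disc.
  by_cases h : a = 0
  · subst h
    have h1 : ∀ G : ProductSpace S σ, Tendsto G.app (𝓝[≠] 0) (𝓝 (G.app 0)) := fun G =>
      ((G.differentiableOn_app.continuousOn.continuousAt
        (ball_mem_nhds 0 hσ)).tendsto.mono_left nhdsWithin_le_nhds)
    refine tendsto_nhds_unique ((h1 _).congr' ?_) (h1 G)
    filter_upwards [self_mem_nhdsWithin, mem_nhdsWithin_of_mem_nhds (ball_mem_nhds 0 hσ)] with a h h'
    exact key a h' h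
  · exact key a ha h

theorem shift_const (hσ : 0 < σ) (f : AnnulusSpace S S) : shift S hσ (const S σ f) = 0 := by
  have h0 : (0 : ℂ) ∈ ball (0 : ℂ) σ := mem_ball_self hσ
  have h1 := const_add_mulW_shift hσ (const S σ f)
  rw [app_const _ h0] at h1
  have h2 : mulW S σ (shift S hσ (const S σ f)) = 0 := by simpa using h1
  rw [← shift_mulW hσ (shift S hσ (const S σ f)), h2, map_zero]

theorem shift_pow_mulW_pow (hσ : 0 < σ) (k : ℕ) (G : ProductSpace S σ) :
    (shift S hσ ^ k) ((mulW S σ ^ k) G) = G := by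
  induction k with
  | zero => simp
  | succ k ih =>
    rw [pow_succ, pow_succ', ContinuousLinearMap.mul_app, ContinuousLinearMap.mul_app,
      shift_mulW, ih]

/-- The coefficients of `w^{n-1}, …, w⁰`. -/
def low (S : SmoothnessClass) (hσ : 0 < σ) (n : ℕ) :
    ProductSpace S σ →L[ℂ] (Fin n → AnnulusSpace S S) :=
  ContinuousLinearMap.pi fun i => (appCLM S σ 0).comp (shift S hσ ^ (n - (i.val + 1)))

theorem low_apply (hσ : 0 < σ) {n : ℕ} (G : ProductSpace S σ) (i : Fin n) :
    low S hσ n G i = ((shift S hσ ^ (n - (i.val + 1))) G).app 0 := rfl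

/-- The polynomial of degree less than `n` with given coefficients. -/
def poly (S : SmoothnessClass) (σ : ℝ) (n : ℕ) :
    (Fin n → AnnulusSpace S S) →L[ℂ] ProductSpace S σ :=
  ∑ i : Fin n, ((mulW S σ ^ (n - (i.val + 1))).comp (const S σ)).comp (ContinuousLinearMap.proj i)

theorem poly_apply {n : ℕ} (g : Fin n → AnnulusSpace S S) :
    poly S σ n g = ∑ i : Fin n, (mulW S σ ^ (n - (i.val + 1))) (const S σ (g i)) := by
  simp [poly]

theorem app_sum {ι : Type*} (s : Finset ι) (f : ι → ProductSpace S σ) (a : ℂ) :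
    (∑ i ∈ s, f i).app a = ∑ i ∈ s, (f i).app a := by
  rw [← appCLM_apply, map_sum]
  rfl

theorem eval_poly {n : ℕ} (g : Fin n → AnnulusSpace S S) {ζ a : ℂ} (ha : a ∈ ball (0 : ℂ) σ) :
    (poly S σ n g).eval r R ζ a = ∑ i : Fin n, (g i).eval r R ζ * a ^ (n - (i.val + 1)) := by
  rw [eval_eq, poly_apply, app_sum, AnnulusSpace.eval_sum]
  refine Finset.sum_congr rfl fun i _ => ?_
  rw [app_mulW_pow _ _ ha, app_const _ ha, AnnulusSpace.eval_smul, mul_comm]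

theorem shift_pow_mulW_pow_of_le (hσ : 0 < σ) {k l : ℕ} (h : k ≤ l) (G : ProductSpace S σ) :
    (shift S hσ ^ k) ((mulW S σ ^ l) G) = (mulW S σ ^ (l - k)) G := by
  conv_lhs => rw [← Nat.add_sub_cancel' h, pow_add, ContinuousLinearMap.mul_app,
    shift_pow_mulW_pow]

theorem shift_pow_mulW_pow_of_ge (hσ : 0 < σ) {k l : ℕ} (h : l ≤ k) (G : ProductSpace S σ) :
    (shift S hσ ^ k) ((mulW S σ ^ l) G) = (shift S hσ ^ (k - l)) G := by
  conv_lhs => rw [← Nat.sub_add_cancel h, pow_add, ContinuousLinearMap.mul_app,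
    shift_pow_mulW_pow]

theorem low_mulW_pow (hσ : 0 < σ) (n : ℕ) (G : ProductSpace S σ) :
    low S hσ n ((mulW S σ ^ n) G) = 0 := by
  ext1 i
  have hi := i.2
  rw [low_apply, shift_pow_mulW_pow_of_le hσ (by omega), app_mulW_pow _ _ (mem_ball_self hσ),
    zero_pow (by omega), zero_smul]
  rfl

theorem shift_pow_const (hσ : 0 < σ) {k : ℕ} (hk : 0 < k) (f : AnnulusSpace S S) :
    (shift S hσ ^ k) (const S σ f) = 0 := by
  obtain ⟨k, rfl⟩ := Nat.exists_eq_succ_of_ne_zero hk.ne'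
  rw [pow_succ, ContinuousLinearMap.mul_app, shift_const, map_zero]

theorem shift_pow_poly (hσ : 0 < σ) {n : ℕ} (g : Fin n → AnnulusSpace S S) :
    (shift S hσ ^ n) (poly S σ n g) = 0 := by
  rw [poly_apply, map_sum]
  refine Finset.sum_eq_zero fun i _ => ?_
  rw [shift_pow_mulW_pow_of_ge hσ (by omega), shift_pow_const hσ (by omega)]

theorem low_poly (hσ : 0 < σ) {n : ℕ} (g : Fin n → AnnulusSpace S S) :
    low S hσ n (poly S σ n g) = g := by
  have h0 : (0 : ℂ) ∈ ball (0 : ℂ) σ := mem_ball_self hσ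
  ext1 i
  have hi := i.2
  rw [low_apply, poly_apply, map_sum, app_sum, Finset.sum_eq_single i]
  · rw [shift_pow_mulW_pow, app_const _ h0]
  · intro j _ hj
    have hj' := j.2
    rcases lt_or_gt_of_ne (fun h => hj (Fin.ext h) : j.val ≠ i.val) with h | h
    · rw [shift_pow_mulW_pow_of_le hσ (by omega), app_mulW_pow _ _ h0, zero_pow (by omega),
        zero_smul]
    · rw [shift_pow_mulW_pow_of_ge hσ (by omega), shift_pow_const hσ (by omega)]
      exact map_zero (appCLM S σ 0)
  · intro h
    exact absurd (Finset.mem_univ i) h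

/-- Taylor expansion to order n, by iterating G = G(0) + w · shift G. It splits the space into
multiples of wⁿ and polynomials of degree less than n; the division operators are defined along this
splitting. -/
theorem mulW_pow_shift_add_poly_low (hσ : 0 < σ) (n : ℕ) (G : ProductSpace S σ) :
    (mulW S σ ^ n) ((shift S hσ ^ n) G) + poly S σ n (low S hσ n G) = G := by
  induction n with
  | zero => simp [poly]
  | succ n ih =>
    conv_rhs => rw [← ih, ← const_add_mulW_shift hσ ((shift S hσ ^ n) G)]
    -- Index i stands for the power n - (i + 1). When n grows by one, the old coefficients move to
    -- the successor indices and the new coefficient of wⁿ takes index 0.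
    have h1 : ∀ i : Fin n, low S hσ (n + 1) G i.succ = low S hσ n G i := fun i => by
      rw [low_apply, low_apply]
      simp
    have h2 : (mulW S σ ^ (n + 1 - ((0 : Fin (n + 1)).val + 1))) (const S σ (low S hσ (n + 1) G 0)) =
        (mulW S σ ^ n) (const S σ (((shift S hσ ^ n) G).app 0)) := by
      rw [low_apply]
      simp
    rw [map_add, poly_apply, poly_apply, Fin.sum_univ_succ, h2, pow_succ (mulW S σ),
      ContinuousLinearMap.mul_app, pow_succ' (shift S hσ), ContinuousLinearMap.mul_app]
    simp only [h1, Fin.val_succ, Nat.add_sub_add_right]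
    abel

end ProductSpace

end

noncomputable section

open Set Metric Filter AnnulusSpace

/-! ### Weierstrass division by functions close to wⁿ -/

namespace ProductSpace

variable {S : SmoothnessClass} {σ r R : ℝ}

theorem mul_comm' (hr : 0 < r) (hrR : r < R) (G G' : ProductSpace S σ) :
    mul S σ hr hrR G G' = mul S σ hr hrR G' G :=
  ext_eval hr hrR fun ζ hζ a ha => by
    rw [eval_mul hr hrR _ _ hζ ha, eval_mul hr hrR _ _ hζ ha, _root_.mul_comm]

theorem mul_assoc' (hr : 0 < r) (hrR : r < R) (G G' G'' : ProductSpace S σ) :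
    mul S σ hr hrR (mul S σ hr hrR G G') G'' = mul S σ hr hrR G (mul S σ hr hrR G' G'') :=
  ext_eval hr hrR fun ζ hζ a ha => by
    simp only [eval_mul hr hrR _ _ hζ ha, _root_.mul_assoc]

/-- The function one. -/
def one (S : SmoothnessClass) (σ : ℝ) : ProductSpace S σ := const S σ (AnnulusSpace.one S S)

theorem eval_one (hr : 0 < r) {ζ a : ℂ} (hζ : ζ ∈ annulus r R) (ha : a ∈ ball (0 : ℂ) σ) :
    (one S σ).eval r R ζ a = 1 := by
  rw [eval_eq, one, app_const _ ha, AnnulusSpace.eval_one hr hζ]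

theorem one_mul' (hr : 0 < r) (hrR : r < R) (G : ProductSpace S σ) :
    mul S σ hr hrR (one S σ) G = G :=
  ext_eval hr hrR fun ζ hζ a ha => by
    rw [eval_mul hr hrR _ _ hζ ha, eval_one hr hζ ha, one_mul]

/-- The function `wⁿ`. -/
def wpow (S : SmoothnessClass) (σ : ℝ) (n : ℕ) : ProductSpace S σ := (mulW S σ ^ n) (one S σ)

theorem eval_mulW_pow (G : ProductSpace S σ) (n : ℕ) {ζ a : ℂ} (ha : a ∈ ball (0 : ℂ) σ) :
    ((mulW S σ ^ n) G).eval r R ζ a = a ^ n * G.eval r R ζ a := by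
  rw [eval_eq, app_mulW_pow _ _ ha, AnnulusSpace.eval_smul, eval_eq]

theorem eval_wpow (hr : 0 < r) (n : ℕ) {ζ a : ℂ} (hζ : ζ ∈ annulus r R)
    (ha : a ∈ ball (0 : ℂ) σ) : (wpow S σ n).eval r R ζ a = a ^ n := by
  rw [wpow, eval_mulW_pow _ _ ha, eval_one hr hζ ha, mul_one]

theorem wpow_mul (hr : 0 < r) (hrR : r < R) (n : ℕ) (G : ProductSpace S σ) :
    mul S σ hr hrR (wpow S σ n) G = (mulW S σ ^ n) G :=
  ext_eval hr hrR fun ζ hζ a ha => by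
    rw [eval_mul hr hrR _ _ hζ ha, eval_wpow hr n hζ ha, eval_mulW_pow _ _ ha]

/-- The operator `q wⁿ + ρ ↦ q ψ + ρ`, where `ρ` has degree less than `n`. -/
def divOp (hr : 0 < r) (hrR : r < R) (hσ : 0 < σ) (n : ℕ) (ψ : ProductSpace S σ) :
    ProductSpace S σ →L[ℂ] ProductSpace S σ :=
  1 + (mul S σ hr hrR (ψ - wpow S σ n)).comp (shift S hσ ^ n)

/-- The remainder of the division by `ψ`. -/
def rem (hr : 0 < r) (hrR : r < R) (hσ : 0 < σ) (n : ℕ) (ψ h : ProductSpace S σ) :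
    Fin n → AnnulusSpace S S :=
  low S hσ n (Ring.inverse (divOp hr hrR hσ n ψ) h)

variable (hr : 0 < r) (hrR : r < R) (hσ : 0 < σ) {n : ℕ}

theorem divOp_apply (ψ q : ProductSpace S σ) (g : Fin n → AnnulusSpace S S) :
    divOp hr hrR hσ n ψ ((mulW S σ ^ n) q + poly S σ n g) =
      mul S σ hr hrR ψ q + poly S σ n g := by
  rw [divOp, add_apply, ContinuousLinearMap.comp_apply, map_add (shift S hσ ^ n), shift_pow_mulW_pow,
    shift_pow_poly, add_zero, map_sub, sub_apply, wpow_mul]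
  change ((mulW S σ ^ n) q + poly S σ n g) + _ = _
  abel

theorem inverse_apply_of_isUnit {E : Type*} [NormedAddCommGroup E] [NormedSpace ℂ E]
    {T : E →L[ℂ] E} (hT : IsUnit T) (x : E) :
    Ring.inverse T (T x) = x ∧ T (Ring.inverse T x) = x := by
  constructor
  · rw [← ContinuousLinearMap.mul_app, Ring.inverse_mul_cancel _ hT]; rfl
  · rw [← ContinuousLinearMap.mul_app, Ring.mul_inverse_cancel _ hT]; rfl

theorem rem_eq {ψ : ProductSpace S σ} (hψ : IsUnit (divOp hr hrR hσ n ψ))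
    (q : ProductSpace S σ) (g : Fin n → AnnulusSpace S S) :
    rem hr hrR hσ n ψ (mul S σ hr hrR ψ q + poly S σ n g) = g := by
  rw [rem, ← divOp_apply hr hrR hσ, (inverse_apply_of_isUnit hψ _).1, map_add, low_mulW_pow,
    zero_add, low_poly]

theorem exists_div {ψ : ProductSpace S σ} (hψ : IsUnit (divOp hr hrR hσ n ψ))
    (h : ProductSpace S σ) :
    ∃ q, h = mul S σ hr hrR ψ q + poly S σ n (rem hr hrR hσ n ψ h) := by
  refine ⟨(shift S hσ ^ n) (Ring.inverse (divOp hr hrR hσ n ψ) h), ?_⟩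
  rw [rem, ← divOp_apply hr hrR hσ, mulW_pow_shift_add_poly_low, (inverse_apply_of_isUnit hψ _).2]

theorem divOp_wpow : divOp hr hrR hσ n (wpow S σ n) = 1 := by
  simp [divOp]

theorem continuous_divOp : Continuous (divOp (S := S) hr hrR hσ n) := by
  unfold divOp
  fun_prop

/-- The operator depends continuously on ψ and is the identity for ψ = wⁿ; units are open. -/
theorem eventually_isUnit_divOp :
    ∀ᶠ g in 𝓝 (0 : Fin n → AnnulusSpace S S),
      IsUnit (divOp hr hrR hσ n (wpow S σ n + poly S σ n g)) := by
  have hc : Continuous fun g : Fin n → AnnulusSpace S S =>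
      divOp hr hrR hσ n (wpow S σ n + poly S σ n g) :=
    (continuous_divOp hr hrR hσ).comp (continuous_const.add (poly S σ n).continuous)
  refine hc.continuousAt.eventually (Units.isOpen.mem_nhds ?_)
  simp only [map_zero, add_zero, divOp_wpow]
  exact isUnit_one

/-- Passing from P to P e only changes the quotient q into e q: one has `divOp` (P e) = `divOp` P ∘
U e, where U e multiplies the part divisible by wⁿ by e and fixes the polynomial part. U e is
invertible with inverse U e', and the remainders are unchanged. -/
theorem mul_unit {P e e' : ProductSpace S σ} (hP : IsUnit (divOp hr hrR hσ n P))
    (he : mul S σ hr hrR e e' = one S σ) :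
    IsUnit (divOp hr hrR hσ n (mul S σ hr hrR P e)) ∧
      ∀ h, rem hr hrR hσ n (mul S σ hr hrR P e) h = rem hr hrR hσ n P h := by
  let μ := mul S σ hr hrR
  have hsplit := mulW_pow_shift_add_poly_low (S := S) hσ n
  let U : ProductSpace S σ → ProductSpace S σ →L[ℂ] ProductSpace S σ := fun e =>
    (mulW S σ ^ n).comp ((μ e).comp (shift S hσ ^ n)) + (poly S σ n).comp (low S hσ n)
  have hUapp : ∀ e q g, U e ((mulW S σ ^ n) q + poly S σ n g) =
      (mulW S σ ^ n) (μ e q) + poly S σ n g := by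
    intro e q g
    simp only [U, add_apply, ContinuousLinearMap.comp_apply, map_add, shift_pow_mulW_pow,
      shift_pow_poly, add_zero, low_mulW_pow, low_poly, map_zero, zero_add]
  have hUU : ∀ e e', μ e e' = one S σ → U e * U e' = 1 := by
    intro e e' h
    ext1 x
    rw [ContinuousLinearMap.mul_app, ← hsplit x, hUapp, hUapp]
    change (mulW S σ ^ n) (mul S σ hr hrR e (mul S σ hr hrR e' _)) + _ = _
    rw [← mul_assoc', show mul S σ hr hrR e e' = one S σ from h, one_mul']
    rfl
  have he' : μ e' e = one S σ := (mul_comm' hr hrR e' e).trans he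
  have hU : IsUnit (U e) := ⟨⟨U e, U e', hUU e e' he, hUU e' e he'⟩, rfl⟩
  have hN : divOp hr hrR hσ n (mul S σ hr hrR P e) = divOp hr hrR hσ n P * U e := by
    ext1 x
    rw [ContinuousLinearMap.mul_app, ← hsplit x, hUapp, divOp_apply, divOp_apply, mul_assoc']
  have hunit : IsUnit (divOp hr hrR hσ n (mul S σ hr hrR P e)) := by
    rw [hN]
    exact hP.mul hU
  refine ⟨hunit, fun h => ?_⟩
  obtain ⟨q, hq⟩ := exists_div hr hrR hσ hP h
  have : h = mul S σ hr hrR (mul S σ hr hrR P e) (mul S σ hr hrR e' q) +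
      poly S σ n (rem hr hrR hσ n P h) := by
    rw [mul_assoc', ← mul_assoc' hr hrR e e' q, he, one_mul', ← hq]
  conv_lhs => rw [this, rem_eq hr hrR hσ hunit]

/-! #### Functions holomorphic in a neighbourhood -/

/-- A function holomorphic in a neighbourhood of the closure of `A × Δ(σ)` is smooth. -/
theorem exists_of_holomorphic (S : SmoothnessClass) {r₁ R₁ σ₁ : ℝ} (hr₁ : 0 < r₁) (h₁ : r₁ < r)
    (hrR : r < R) (h₂ : R < R₁) (hσ : 0 < σ) (hσ₁ : σ < σ₁) {h : ℂ → ℂ → ℂ} {M : ℝ}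
    (hc : ContinuousOn (Function.uncurry h) (annulus r₁ R₁ ×ˢ ball 0 σ₁))
    (hd₁ : ∀ a ∈ ball (0 : ℂ) σ₁, DifferentiableOn ℂ (fun ζ => h ζ a) (annulus r₁ R₁))
    (hd₂ : ∀ ζ ∈ annulus r₁ R₁, DifferentiableOn ℂ (h ζ) (ball 0 σ₁))
    (hM : ∀ ζ ∈ annulus r₁ R₁, ∀ a ∈ ball (0 : ℂ) σ₁, ‖h ζ a‖ ≤ M) :
    ∃ G : ProductSpace S σ, ∀ ζ ∈ annulus r R, ∀ a ∈ ball (0 : ℂ) σ, G.eval r R ζ a = h ζ a := by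
  obtain ⟨s, hs, hs₁⟩ := exists_between hσ₁
  have hr : 0 < r := hr₁.trans h₁
  have hs0 : 0 < s := hσ.trans hs
  have hsph : sphere (0 : ℂ) s ⊆ ball 0 σ₁ := fun t ht => by
    have : ‖t‖ = s := by simpa using ht
    simpa [this] using hs₁
  have hM0 : 0 ≤ M := by
    obtain ⟨z, hz⟩ := annulus_nonempty hr₁.le (h₁.trans (hrR.trans h₂))
    exact (norm_nonneg _).trans (hM z hz 0 (mem_ball_self (hσ.trans hσ₁)))
  obtain ⟨C, hC, HC⟩ := AnnulusSpace.exists_of_holomorphic S S hr hrR hr₁ h₁ h₂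
  -- The Taylor coefficients of h in w, as integrals over |t| = s with σ < s < σ₁. They are
  -- holomorphic in ζ on the larger annulus and bounded by s⁻ʲ M.
  let c : ℕ → ℂ → ℂ := fun j ζ =>
    (2 * Real.pi * Complex.I : ℂ)⁻¹ * ∮ t in C(0, s), (t⁻¹ ^ j * t⁻¹) * h ζ t
  have hne : ∀ t ∈ sphere (0 : ℂ) s, t ≠ 0 := fun t ht h0 => by
    rw [h0] at ht
    simp at ht
    exact hs0.ne ht
  have hcd : ∀ j, DifferentiableOn ℂ (c j) (annulus r₁ R₁) := by
    intro j
    refine DifferentiableOn.const_mul (differentiableOn_circleIntegral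
      (K := fun ζ t => (t⁻¹ ^ j * t⁻¹) * h ζ t) (isOpen_annulus _ _) hs0 ?_ ?_) _
    · refine ContinuousOn.mul ?_ (hc.mono (prod_mono subset_rfl hsph))
      have : ContinuousOn (fun p : ℂ × ℂ => p.2⁻¹) (annulus r₁ R₁ ×ˢ sphere (0 : ℂ) s) :=
        ContinuousOn.inv₀ (by fun_prop) fun p hp => hne _ hp.2
      exact (this.pow j).mul this
    · exact fun t ht => (hd₁ t (hsph ht)).const_mul _
  have hcb : ∀ j, ∀ ζ ∈ annulus r₁ R₁, ‖c j ζ‖ ≤ s⁻¹ ^ j * M := by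
    intro j ζ hζ
    have := circleIntegral.norm_two_pi_i_inv_smul_integral_le_of_norm_le_const (c := 0) hs0.le
      (f := fun t => (t⁻¹ ^ j * t⁻¹) * h ζ t) (C := (s⁻¹ ^ j * s⁻¹) * M) (fun t ht => by
        have h3 : ‖t‖ = s := by simpa using ht
        rw [norm_mul, norm_mul, norm_pow, norm_inv, h3]
        gcongr
        exact hM ζ hζ t (hsph ht))
    refine this.trans (le_of_eq ?_)
    field_simp
  have hsum : ∀ ζ ∈ annulus r₁ R₁, ∀ a ∈ ball (0 : ℂ) σ, HasSum (fun j => a ^ j * c j ζ) (h ζ a) := by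
    intro ζ hζ a ha
    have haσ : ‖a‖ < σ := by simpa using ha
    have hd : DifferentiableOn ℂ (h ζ) (closedBall 0 s) :=
      (hd₂ ζ hζ).mono (closedBall_subset_ball hs₁)
    have hci : CircleIntegrable (h ζ) 0 s := ContinuousOn.circleIntegrable hs0.le
      (hd.continuousOn.mono sphere_subset_closedBall)
    have hsm := hasSum_cauchyPowerSeries_integral hci (w := a) (haσ.trans hs)
    have hdc := hd.diffContOnCl_ball subset_rfl
    have h1 := hdc.two_pi_i_inv_smul_circleIntegral_sub_inv_smul (w := a)
      (by simpa using haσ.trans hs)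
    rw [zero_add, h1] at hsm
    refine hsm.congr_fun fun j => ?_
    rw [cauchyPowerSeries_apply]
    simp only [c, sub_zero, smul_eq_mul]
    rw [mul_left_comm]
    congr 1
    rw [← smul_eq_mul, ← circleIntegral.integral_smul]
    congr 1
    ext t
    simp only [smul_eq_mul, div_eq_mul_inv, mul_pow]
    ring
  -- Each coefficient is smooth on the closed smaller annulus, with norm at most C s⁻ʲ M. As σ < s,
  -- the series ∑ aʲ fⱼ converges normally for |a| < σ with values in the Banach space.
  choose f hf hfn using fun j => HC (c j) _ (hcd j) (hcb j)
  have hq : σ / s < 1 := (div_lt_one hs0).2 hs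
  have hu : Summable fun j : ℕ => C * M * (σ / s) ^ j :=
    (summable_geometric_of_lt_one (by positivity) hq).mul_left _
  have hbd : ∀ (j : ℕ), ∀ a ∈ ball (0 : ℂ) σ, ‖a ^ j • f j‖ ≤ C * M * (σ / s) ^ j := by
    intro j a ha
    have haσ : ‖a‖ < σ := by simpa using ha
    rw [norm_smul, norm_pow, div_pow]
    calc ‖a‖ ^ j * ‖f j‖ ≤ σ ^ j * (C * (s⁻¹ ^ j * M)) := by
          gcongr
          exact hfn j
      _ = C * M * (σ ^ j / s ^ j) := by rw [inv_pow, div_eq_mul_inv]; ring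
  have hHd := Complex.differentiableOn_tsum_of_summable_norm hu
    (F := fun j a => a ^ j • f j) (fun j => (by fun_prop : Differentiable ℂ fun a : ℂ =>
      a ^ j • f j).differentiableOn) (isOpen_ball (x := (0 : ℂ)) (ε := σ)) hbd
  obtain ⟨G, hG⟩ := exists_of_differentiableOn (σ := σ) hHd (M := ∑' j : ℕ, C * M * (σ / s) ^ j)
    fun a ha => tsum_of_norm_bounded hu.hasSum fun j => hbd j a ha
  refine ⟨G, fun ζ hζ a ha => ?_⟩
  rw [eval_eq, hG a ha]
  have hζ₁ : ζ ∈ annulus r₁ R₁ := annulus_mono h₁.le h₂.le hζ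
  have hsm : Summable fun j => a ^ j • f j := Summable.of_norm_bounded hu fun j => hbd j a ha
  have h3 := (evalCLM S S hr ⟨ζ, hζ⟩).hasSum hsm.hasSum
  refine h3.unique ((hsum ζ hζ₁ a ha).congr_fun fun j => ?_)
  change (a ^ j • f j).eval r R ζ = _
  rw [AnnulusSpace.eval_smul, hf j ζ hζ]

end ProductSpace

end

noncomputable section

open Set Metric Filter

/-! ### Coordinates -/

section Coordinates

variable {U : Set (ℂ × ℂ)} {φ : ℂ × ℂ → ℂ}

/-- The inverse function theorem applies: a vector killed by the derivative of (φ, w) has second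
component 0, hence is a multiple of (1, 0), on which the derivative of φ does not vanish. -/
theorem map_nhds_coordinates (hφ : AnalyticOnNhd ℂ φ U) {x : ℂ × ℂ} (hx : x ∈ U)
    (hd : fderiv ℂ φ x (1, 0) ≠ 0) :
    ∃ e : OpenPartialHomeomorph (ℂ × ℂ) (ℂ × ℂ), (∀ y, e y = (φ y, y.2)) ∧ x ∈ e.source ∧
      AnalyticAt ℂ e.symm (e x) := by
  have ha : AnalyticAt ℂ (fun x : ℂ × ℂ => (φ x, x.2)) x := (hφ x hx).prod analyticAt_snd
  have hs := ha.hasStrictFDerivAt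
  have hfd : ∀ v, fderiv ℂ (fun x : ℂ × ℂ => (φ x, x.2)) x v = (fderiv ℂ φ x v, v.2) := by
    intro v
    rw [((hφ x hx).differentiableAt.hasFDerivAt.prodMk hasFDerivAt_snd).fderiv]
    rfl
  have hinj : Function.Injective (fderiv ℂ (fun x : ℂ × ℂ => (φ x, x.2)) x) := by
    rw [injective_iff_map_eq_zero]
    intro v hv
    rw [hfd, Prod.mk_eq_zero] at hv
    have hv1 : v = v.1 • ((1 : ℂ), (0 : ℂ)) := by
      ext
      · simp
      · simp [hv.2]
    have h1 := hv.1
    rw [hv1, map_smul, smul_eq_mul, mul_eq_zero] at h1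
    rw [hv1, h1.resolve_right hd, zero_smul]
  let i : (ℂ × ℂ) ≃L[ℂ] (ℂ × ℂ) := (LinearEquiv.ofInjectiveEndo
    (fderiv ℂ (fun x : ℂ × ℂ => (φ x, x.2)) x : (ℂ × ℂ) →ₗ[ℂ] (ℂ × ℂ)) hinj).toContinuousLinearEquiv
  have hi : fderiv ℂ (fun x : ℂ × ℂ => (φ x, x.2)) x = (i : (ℂ × ℂ) →L[ℂ] (ℂ × ℂ)) := by
    rfl
  have hs' : HasStrictFDerivAt (fun x : ℂ × ℂ => (φ x, x.2)) (i : (ℂ × ℂ) →L[ℂ] (ℂ × ℂ)) x :=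
    hi ▸ hs
  exact ⟨hs'.toOpenPartialHomeomorph _, fun y => rfl, hs'.mem_toOpenPartialHomeomorph_source,
    (hs'.toOpenPartialHomeomorph _).analyticAt_symm' hs'.mem_toOpenPartialHomeomorph_source ha hi⟩

theorem isOpen_image_coordinates (hU : IsOpen U) (hφ : AnalyticOnNhd ℂ φ U)
    (hd : ∀ x ∈ U, fderiv ℂ φ x (1, 0) ≠ 0) : IsOpen ((fun x : ℂ × ℂ => (φ x, x.2)) '' U) := by
  rw [isOpen_iff_mem_nhds]
  rintro _ ⟨x, hx, rfl⟩
  obtain ⟨e, he, hxe, -⟩ := map_nhds_coordinates hφ hx (hd x hx)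
  have := e.map_nhds_eq hxe
  have h2 : (fun x : ℂ × ℂ => (φ x, x.2)) = e := funext fun y => (he y).symm
  rw [h2, ← this]
  exact image_mem_map (hU.mem_nhds hx)

/-- By injectivity on U the global inverse agrees near each image point with the analytic local
inverse. -/
theorem analyticAt_invFunOn_coordinates (hU : IsOpen U) (hφ : AnalyticOnNhd ℂ φ U)
    (hd : ∀ x ∈ U, fderiv ℂ φ x (1, 0) ≠ 0) (hinj : InjOn (fun x : ℂ × ℂ => (φ x, x.2)) U)
    {y : ℂ × ℂ} (hy : y ∈ (fun x : ℂ × ℂ => (φ x, x.2)) '' U) :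
    AnalyticAt ℂ (Function.invFunOn (fun x : ℂ × ℂ => (φ x, x.2)) U) y := by
  obtain ⟨x, hx, rfl⟩ := hy
  obtain ⟨e, he, hxe, hsymm⟩ := map_nhds_coordinates hφ hx (hd x hx)
  have h2 : (fun x : ℂ × ℂ => (φ x, x.2)) = e := funext fun y => (he y).symm
  rw [h2] at hinj ⊢
  refine hsymm.congr ?_
  have h3 : ∀ᶠ y in 𝓝 (e x), e.symm y ∈ U := by
    have : ContinuousAt e.symm (e x) := e.continuousAt_symm (e.map_source hxe)
    refine this.eventually (hU.mem_nhds ?_)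
    rwa [e.left_inv hxe]
  filter_upwards [h3, e.open_target.mem_nhds (e.map_source hxe)] with y hy ht
  have h4 : y ∈ e '' U := ⟨e.symm y, hy, e.right_inv ht⟩
  refine hinj hy (Function.invFunOn_mem h4) ?_
  rw [e.right_inv ht, Function.invFunOn_eq h4]

end Coordinates

/-- The closed annulus. -/
def closedAnnulus (r R : ℝ) : Set ℂ := {z | r ≤ ‖z‖ ∧ ‖z‖ ≤ R}

theorem isCompact_closedAnnulus (r R : ℝ) : IsCompact (closedAnnulus r R) := by
  refine (isCompact_closedBall (0 : ℂ) R).of_isClosed_subset ?_ fun z hz => by simpa using hz.2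
  exact (isClosed_le continuous_const continuous_norm).inter
    (isClosed_le continuous_norm continuous_const)

theorem closedAnnulus_subset_closure {r R : ℝ} (hr : 0 < r) (hrR : r < R) :
    closedAnnulus r R ⊆ closure (annulus r R) := by
  intro z hz
  have hz0 : 0 < ‖z‖ := hr.trans_le hz.1
  have h1 : ‖z‖ ∈ closure (Ioo r R) := by rw [closure_Ioo hrR.ne]; exact hz
  have hf : Continuous fun s : ℝ => (s : ℂ) * (z / ‖z‖) := by fun_prop
  have h2 := map_mem_closure hf h1 (t := annulus r R) fun s hs => by
    have hs0 : 0 < s := hr.trans hs.1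
    have : ‖(s : ℂ) * (z / ‖z‖)‖ = s := by
      rw [norm_mul, norm_div, Complex.norm_real, Complex.norm_real, Real.norm_of_nonneg hs0.le,
        norm_norm, div_self hz0.ne', mul_one]
    exact ⟨by rw [this]; exact hs.1, by rw [this]; exact hs.2⟩
  have hz0' : (‖z‖ : ℂ) ≠ 0 := by exact_mod_cast hz0.ne'
  rwa [mul_div_cancel₀ _ hz0'] at h2

/-- The tube lemma, applied to the compact closed annulus, gives a product neighbourhood, and a
thickening of the annulus contains a slightly larger annulus. -/
theorem exists_tube {r R : ℝ} (hr : 0 < r) (hrR : r < R) {O : Set (ℂ × ℂ)} (hO : IsOpen O)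
    (h : ∀ z ∈ closedAnnulus r R, (z, (0 : ℂ)) ∈ O) :
    ∃ η σ : ℝ, 0 < η ∧ η < r ∧ 0 < σ ∧
      ∀ z ∈ annulus (r - η) (R + η), ∀ a : ℂ, ‖a‖ < σ → (z, a) ∈ O := by
  obtain ⟨u, v, hu, hv, hKu, h0v, huv⟩ := generalized_tube_lemma (isCompact_closedAnnulus r R)
    (isCompact_singleton (x := (0 : ℂ))) hO (by
      rintro ⟨z, w⟩ ⟨hz, hw⟩
      rw [mem_singleton_iff] at hw
      simp only at hw hz
      rw [hw]
      exact h z hz)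
  obtain ⟨δ, hδ, hδu⟩ := (isCompact_closedAnnulus r R).exists_thickening_subset_open hu hKu
  obtain ⟨σ, hσ, hσv⟩ := Metric.isOpen_iff.1 hv 0 (h0v rfl)
  refine ⟨min δ (r / 2), σ, lt_min hδ (by linarith), (min_le_right _ _).trans_lt (by linarith), hσ,
    fun z hz a ha => huv ⟨hδu ?_, hσv (by simpa using ha)⟩⟩
  have hη : min δ (r / 2) ≤ δ := min_le_left _ _
  have hη2 : min δ (r / 2) ≤ r / 2 := min_le_right _ _
  have hz0 : 0 < ‖z‖ := by linarith [hz.1]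
  have hz0' : (‖z‖ : ℂ) ≠ 0 := by exact_mod_cast hz0.ne'
  rw [Metric.mem_thickening_iff]
  have hs0 : 0 ≤ max r (min ‖z‖ R) := hr.le.trans (le_max_left _ _)
  -- The radial projection of z to the closed annulus.
  refine ⟨((max r (min ‖z‖ R) : ℝ) : ℂ) * (z / ‖z‖), ?_, ?_⟩
  · have : ‖((max r (min ‖z‖ R) : ℝ) : ℂ) * (z / ‖z‖)‖ = max r (min ‖z‖ R) := by
      rw [norm_mul, norm_div, Complex.norm_real, Complex.norm_real, Real.norm_of_nonneg hs0,
        norm_norm, div_self hz0.ne', mul_one]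
    exact ⟨by rw [this]; exact le_max_left _ _,
      by rw [this]; exact max_le hrR.le (min_le_right _ _)⟩
  · rw [dist_eq_norm]
    have : z - ((max r (min ‖z‖ R) : ℝ) : ℂ) * (z / ‖z‖) =
        ((‖z‖ - max r (min ‖z‖ R) : ℝ) : ℂ) * (z / ‖z‖) := by
      rw [Complex.ofReal_sub, sub_mul, mul_div_cancel₀ _ hz0']
    rw [this, norm_mul, norm_div, Complex.norm_real, Complex.norm_real, norm_norm,
      div_self hz0.ne', mul_one, Real.norm_eq_abs, abs_lt]
    have a1 := hz.1
    have a2 := hz.2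
    rcases le_total ‖z‖ R with h1 | h1
    · rw [min_eq_left h1]
      rcases le_total r ‖z‖ with h2 | h2
      · rw [max_eq_right h2]; constructor <;> linarith
      · rw [max_eq_left h2]; constructor <;> linarith
    · rw [min_eq_right h1, max_eq_right hrR.le]; constructor <;> linarith

/-! ### Geometry of the distorted cylinder near the central annulus -/

namespace DistortedCylinder

variable (D : DistortedCylinder)

/-- The coordinates `(z₁, w)`. -/
def phi₁ (x : ℂ × ℂ) : ℂ × ℂ := (D.z₁ x, x.2)

/-- The coordinates `(z₂, w)`. -/
def phi₂ (x : ℂ × ℂ) : ℂ × ℂ := (D.z₂ x, x.2)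

/-- The inverse of `phi₁`. -/
def psi₁ : ℂ × ℂ → ℂ × ℂ := Function.invFunOn D.phi₁ D.U

/-- The inverse of `phi₂`. -/
def psi₂ : ℂ × ℂ → ℂ × ℂ := Function.invFunOn D.phi₂ D.U

/-- The points having coordinates of both kinds. -/
def coordDomain : Set (ℂ × ℂ) := D.phi₁ '' D.U ∩ D.phi₂ '' D.U

theorem r_lt_R : D.r < D.R := D.r_lt_r'.trans (D.r'_lt_R'.trans D.R'_lt_R)

theorem isOpen_image₁ : IsOpen (D.phi₁ '' D.U) :=
  isOpen_image_coordinates D.isOpen_U D.z₁_analytic D.coord₁_deriv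

theorem isOpen_image₂ : IsOpen (D.phi₂ '' D.U) :=
  isOpen_image_coordinates D.isOpen_U D.z₂_analytic D.coord₂_deriv

theorem psi₁_mem {y : ℂ × ℂ} (hy : y ∈ D.phi₁ '' D.U) : D.psi₁ y ∈ D.U := Function.invFunOn_mem hy

theorem psi₂_mem {y : ℂ × ℂ} (hy : y ∈ D.phi₂ '' D.U) : D.psi₂ y ∈ D.U := Function.invFunOn_mem hy

theorem phi₁_psi₁ {y : ℂ × ℂ} (hy : y ∈ D.phi₁ '' D.U) : D.phi₁ (D.psi₁ y) = y :=
  Function.invFunOn_eq hy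

theorem phi₂_psi₂ {y : ℂ × ℂ} (hy : y ∈ D.phi₂ '' D.U) : D.phi₂ (D.psi₂ y) = y :=
  Function.invFunOn_eq hy

theorem z₁_psi₁ {y : ℂ × ℂ} (hy : y ∈ D.phi₁ '' D.U) : D.z₁ (D.psi₁ y) = y.1 :=
  congrArg Prod.fst (D.phi₁_psi₁ hy)

theorem psi₁_snd {y : ℂ × ℂ} (hy : y ∈ D.phi₁ '' D.U) : (D.psi₁ y).2 = y.2 := by
  have := congrArg Prod.snd (D.phi₁_psi₁ hy)
  exact this

theorem z₂_psi₂ {y : ℂ × ℂ} (hy : y ∈ D.phi₂ '' D.U) : D.z₂ (D.psi₂ y) = y.1 :=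
  congrArg Prod.fst (D.phi₂_psi₂ hy)

theorem psi₂_snd {y : ℂ × ℂ} (hy : y ∈ D.phi₂ '' D.U) : (D.psi₂ y).2 = y.2 := by
  have := congrArg Prod.snd (D.phi₂_psi₂ hy)
  exact this

theorem psi₁_phi₁ {x : ℂ × ℂ} (hx : x ∈ D.U) : D.psi₁ (D.phi₁ x) = x :=
  D.coord₁_injOn (D.psi₁_mem ⟨x, hx, rfl⟩) hx (D.phi₁_psi₁ ⟨x, hx, rfl⟩)

theorem psi₂_phi₂ {x : ℂ × ℂ} (hx : x ∈ D.U) : D.psi₂ (D.phi₂ x) = x :=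
  D.coord₂_injOn (D.psi₂_mem ⟨x, hx, rfl⟩) hx (D.phi₂_psi₂ ⟨x, hx, rfl⟩)

theorem analyticAt_psi₁ {y : ℂ × ℂ} (hy : y ∈ D.phi₁ '' D.U) : AnalyticAt ℂ D.psi₁ y :=
  analyticAt_invFunOn_coordinates D.isOpen_U D.z₁_analytic D.coord₁_deriv D.coord₁_injOn hy

theorem analyticAt_psi₂ {y : ℂ × ℂ} (hy : y ∈ D.phi₂ '' D.U) : AnalyticAt ℂ D.psi₂ y :=
  analyticAt_invFunOn_coordinates D.isOpen_U D.z₂_analytic D.coord₂_deriv D.coord₂_injOn hy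

theorem analyticAt_phi₁ {x : ℂ × ℂ} (hx : x ∈ D.U) : AnalyticAt ℂ D.phi₁ x :=
  (D.z₁_analytic x hx).prod analyticAt_snd

theorem analyticAt_phi₂ {x : ℂ × ℂ} (hx : x ∈ D.U) : AnalyticAt ℂ D.phi₂ x :=
  (D.z₂_analytic x hx).prod analyticAt_snd

/-- The coordinate is prescribed on the open annulus only; continuity extends the identity to the
boundary circles, which lie in U. -/
theorem eq_of_mem_closedAnnulus {φ : ℂ × ℂ → ℂ} (hφ : AnalyticOnNhd ℂ φ D.U)
    (h : ∀ z ∈ annulus D.r D.R, φ (z, 0) = z) {z : ℂ} (hz : z ∈ closedAnnulus D.r D.R) :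
    φ (z, 0) = z := by
  have hcl := closedAnnulus_subset_closure D.r_pos D.r_lt_R hz
  have hne : (𝓝[annulus D.r D.R] z).NeBot := mem_closure_iff_nhdsWithin_neBot.1 hcl
  have hc : ContinuousAt (fun z : ℂ => φ (z, 0)) z :=
    ContinuousAt.comp (f := fun z : ℂ => (z, (0 : ℂ))) (g := φ)
      (hφ _ (D.annulus_subset z hz.1 hz.2)).continuousAt (by fun_prop)
  refine tendsto_nhds_unique (l := 𝓝[annulus D.r D.R] z)
    ((hc.tendsto.mono_left nhdsWithin_le_nhds).congr' ?_)
    (tendsto_id.mono_left nhdsWithin_le_nhds)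
  filter_upwards [self_mem_nhdsWithin] with w hw
  exact h w hw

theorem z₁_zero {z : ℂ} (hz : z ∈ closedAnnulus D.r D.R) : D.z₁ (z, 0) = z :=
  D.eq_of_mem_closedAnnulus D.z₁_analytic D.z₁_annulus hz

theorem z₂_zero {z : ℂ} (hz : z ∈ closedAnnulus D.r D.R) : D.z₂ (z, 0) = z :=
  D.eq_of_mem_closedAnnulus D.z₂_analytic D.z₂_annulus hz

theorem eq_of_z₁_mem {x : ℂ × ℂ} (hx : x ∈ D.U) (h0 : x.2 = 0)
    (h : D.z₁ x ∈ closedAnnulus D.r D.R) : x = (D.z₁ x, 0) :=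
  D.coord₁_injOn hx (D.annulus_subset _ h.1 h.2) (by simp only [D.z₁_zero h, h0])

theorem eq_of_z₂_mem {x : ℂ × ℂ} (hx : x ∈ D.U) (h0 : x.2 = 0)
    (h : D.z₂ x ∈ closedAnnulus D.r D.R) : x = (D.z₂ x, 0) :=
  D.coord₂_injOn hx (D.annulus_subset _ h.1 h.2) (by simp only [D.z₂_zero h, h0])

theorem continuousOn_z₁ : ContinuousOn D.z₁ D.U := D.z₁_analytic.continuousOn

theorem continuousOn_z₂ : ContinuousOn D.z₂ D.U := D.z₂_analytic.continuousOn

theorem isOpen_W : IsOpen D.W := by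
  have h1 : IsOpen (D.U ∩ {x | D.r < ‖D.z₁ x‖}) :=
    D.continuousOn_z₁.norm.isOpen_inter_preimage D.isOpen_U isOpen_Ioi
  have h2 : IsOpen (D.U ∩ {x | ‖D.z₂ x‖ < D.R}) :=
    D.continuousOn_z₂.norm.isOpen_inter_preimage D.isOpen_U isOpen_Iio
  have h3 : IsOpen {x : ℂ × ℂ | ‖x.2‖ < D.ρ} := isOpen_lt (by fun_prop) continuous_const
  have : D.W = (D.U ∩ {x | D.r < ‖D.z₁ x‖}) ∩ ((D.U ∩ {x | ‖D.z₂ x‖ < D.R}) ∩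
      {x : ℂ × ℂ | ‖x.2‖ < D.ρ}) := by
    ext x
    simp only [W, mem_ofPred_eq, mem_inter_iff]
    tauto
  rw [this]
  exact h1.inter (h2.inter h3)

theorem closure_W_subset : closure D.W ⊆ D.U := D.W_closure

theorem isCompact_closure_W : IsCompact (closure D.W) := D.W_compact

theorem norm_of_mem_closure_W {x : ℂ × ℂ} (hx : x ∈ closure D.W) :
    D.r ≤ ‖D.z₁ x‖ ∧ ‖D.z₂ x‖ ≤ D.R ∧ ‖x.2‖ ≤ D.ρ := by
  have hU := D.closure_W_subset hx
  have hne : (𝓝[D.W] x).NeBot := mem_closure_iff_nhdsWithin_neBot.1 hx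
  have h1 := (D.continuousOn_z₁.continuousAt (D.isOpen_U.mem_nhds hU)).norm.tendsto.mono_left
    (nhdsWithin_le_nhds (s := D.W))
  have h2 := (D.continuousOn_z₂.continuousAt (D.isOpen_U.mem_nhds hU)).norm.tendsto.mono_left
    (nhdsWithin_le_nhds (s := D.W))
  have h3 : Tendsto (fun x : ℂ × ℂ => ‖x.2‖) (𝓝[D.W] x) (𝓝 ‖x.2‖) :=
    (by fun_prop : Continuous fun x : ℂ × ℂ => ‖x.2‖).continuousAt.tendsto.mono_left
      nhdsWithin_le_nhds
  refine ⟨ge_of_tendsto h1 ?_, le_of_tendsto h2 ?_, le_of_tendsto h3 ?_⟩ <;>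
    filter_upwards [self_mem_nhdsWithin] with y hy
  · exact hy.2.1.le
  · exact hy.2.2.1.le
  · exact hy.2.2.2.le

/-- The plane is connected and not compact. This drives both the description of W on w = 0 and the
maximum principle on curves. -/
theorem not_isCompact_of_isOpen {E : Set ℂ} (ho : IsOpen E) (hc : IsCompact E) : E = ∅ := by
  rcases isClopen_iff.1 ⟨hc.isClosed, ho⟩ with h | h
  · exact h
  · exact absurd (h ▸ hc) (noncompact_univ ℂ)

/-- A compact part of `W`: the points of `closure W` away from the two sides. -/
theorem mem_W_of_closure {x : ℂ × ℂ} (hx : x ∈ closure D.W) (h1 : D.r < ‖D.z₁ x‖)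
    (h2 : ‖D.z₂ x‖ < D.R) (h3 : ‖x.2‖ < D.ρ) : x ∈ D.W := ⟨D.closure_W_subset hx, h1, h2, h3⟩

/-- What is left of the cylinder when the two ends and, for ρ' < ρ, a collar of |w| = ρ are removed.
It is compact and still contained in W. -/
theorem isCompact_core (ρ' : ℝ) :
    IsCompact {x | x ∈ closure D.W ∧ D.r' ≤ ‖D.z₁ x‖ ∧ ‖D.z₂ x‖ ≤ D.R' ∧ ‖x.2‖ ≤ ρ'} := by
  have h1 : IsClosed (closure D.W ∩ {x | D.r' ≤ ‖D.z₁ x‖}) :=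
    (D.continuousOn_z₁.mono D.closure_W_subset).norm.preimage_isClosed_of_isClosed isClosed_closure
      isClosed_Ici
  have h2 : IsClosed (closure D.W ∩ {x | ‖D.z₂ x‖ ≤ D.R'}) :=
    (D.continuousOn_z₂.mono D.closure_W_subset).norm.preimage_isClosed_of_isClosed isClosed_closure
      isClosed_Iic
  have h3 : IsClosed {x : ℂ × ℂ | ‖x.2‖ ≤ ρ'} := isClosed_le (by fun_prop) continuous_const
  have : {x | x ∈ closure D.W ∧ D.r' ≤ ‖D.z₁ x‖ ∧ ‖D.z₂ x‖ ≤ D.R' ∧ ‖x.2‖ ≤ ρ'} =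
      (closure D.W ∩ {x | D.r' ≤ ‖D.z₁ x‖}) ∩ ((closure D.W ∩ {x | ‖D.z₂ x‖ ≤ D.R'}) ∩
        {x : ℂ × ℂ | ‖x.2‖ ≤ ρ'}) := by
    ext x
    simp only [mem_ofPred_eq, mem_inter_iff]
    tauto
  rw [this]
  exact D.isCompact_closure_W.of_isClosed_subset (h1.inter (h2.inter h3)) fun x hx => hx.1.1

theorem core_subset_W {ρ' : ℝ} (hρ' : ρ' < D.ρ) {x : ℂ × ℂ}
    (hx : x ∈ closure D.W ∧ D.r' ≤ ‖D.z₁ x‖ ∧ ‖D.z₂ x‖ ≤ D.R' ∧ ‖x.2‖ ≤ ρ') : x ∈ D.W :=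
  D.mem_W_of_closure hx.1 (D.r_lt_r'.trans_le hx.2.1) (hx.2.2.1.trans_lt D.R'_lt_R)
    (hx.2.2.2.trans_lt hρ')

/-- U may contain points with w = 0 away from the annulus. The set E of such points of W is open. It
avoids both ends, because there injectivity of the coordinates identifies a point with w = 0 with a
point of the annulus. Hence E lies in the compact core, is itself compact, and so is empty. -/
theorem mem_annulus_of_mem_W {z : ℂ} (hz : (z, (0 : ℂ)) ∈ D.W) : z ∈ annulus D.r D.R := by
  let E : Set ℂ := {z | (z, (0 : ℂ)) ∈ D.W ∧ z ∉ closedAnnulus D.r D.R}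
  have hK : ∀ z, (z, (0 : ℂ)) ∈ D.W → z ∈ closedAnnulus D.r D.R → z ∈ annulus D.r D.R := by
    intro z hz hK
    have h1 := hz.2.1
    have h2 := hz.2.2.1
    rw [D.z₁_zero hK] at h1
    rw [D.z₂_zero hK] at h2
    exact ⟨h1, h2⟩
  have hEo : IsOpen E := by
    refine IsOpen.inter ?_ (isCompact_closedAnnulus D.r D.R).isClosed.isOpen_compl
    exact D.isOpen_W.preimage (by fun_prop : Continuous fun z : ℂ => (z, (0 : ℂ)))
  have hEsub : ∀ z ∈ E, D.r' ≤ ‖D.z₁ (z, 0)‖ ∧ ‖D.z₂ (z, 0)‖ ≤ D.R' := by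
    rintro z ⟨hzW, hzK⟩
    constructor
    · by_contra hlt
      rw [not_le] at hlt
      have hm : D.z₁ (z, 0) ∈ closedAnnulus D.r D.R :=
        ⟨hzW.2.1.le, hlt.le.trans (D.r'_lt_R'.trans D.R'_lt_R).le⟩
      have := congrArg Prod.fst (D.eq_of_z₁_mem hzW.1 rfl hm)
      simp only at this
      rw [← this] at hm
      exact hzK hm
    · by_contra hlt
      rw [not_le] at hlt
      have hm : D.z₂ (z, 0) ∈ closedAnnulus D.r D.R :=
        ⟨((D.r_lt_r'.trans D.r'_lt_R').trans hlt).le, hzW.2.2.1.le⟩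
      have := congrArg Prod.fst (D.eq_of_z₂_mem hzW.1 rfl hm)
      simp only at this
      rw [← this] at hm
      exact hzK hm
  have hEc : IsCompact E := by
    have hc := (D.isCompact_core 0).image continuous_fst
    refine hc.of_isClosed_subset ?_ fun z hz => ⟨(z, 0), ⟨subset_closure hz.1,
      (hEsub z hz).1, (hEsub z hz).2, by simp⟩, rfl⟩
    have hEeq : E = {z : ℂ | (z, (0 : ℂ)) ∈ {x | x ∈ closure D.W ∧ D.r' ≤ ‖D.z₁ x‖ ∧
        ‖D.z₂ x‖ ≤ D.R' ∧ ‖x.2‖ ≤ 0}} ∩ (annulus D.r D.R)ᶜ := by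
      ext z
      constructor
      · intro hz
        exact ⟨⟨subset_closure hz.1, (hEsub z hz).1, (hEsub z hz).2, by simp⟩,
          fun h => hz.2 ⟨h.1.le, h.2.le⟩⟩
      · rintro ⟨hz, hza⟩
        have hzW := D.core_subset_W D.ρ_pos hz
        exact ⟨hzW, fun h => hza (hK z hzW h)⟩
    rw [hEeq]
    exact ((D.isCompact_core 0).isClosed.preimage
      (by fun_prop : Continuous fun z : ℂ => (z, (0 : ℂ)))).inter
      (isOpen_annulus _ _).isClosed_compl
  have hE := not_isCompact_of_isOpen hEo hEc
  refine hK z hz (by_contra fun h => ?_)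
  have : z ∈ E := ⟨hz, h⟩
  rw [hE] at this
  exact this

/-- On a side |z₁| = r or |z₂| = R the coordinate itself determines the point; the remaining points
of the closure with w = 0 lie in W. -/
theorem mem_closedAnnulus_of_mem_closure_W {x : ℂ × ℂ} (hx : x ∈ closure D.W) (h0 : x.2 = 0) :
    x.1 ∈ closedAnnulus D.r D.R := by
  have hU := D.closure_W_subset hx
  obtain ⟨h1, h2, -⟩ := D.norm_of_mem_closure_W hx
  rcases h1.eq_or_lt with h1 | h1
  · have hm : D.z₁ x ∈ closedAnnulus D.r D.R := ⟨h1.le, h1 ▸ D.r_lt_R.le⟩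
    rw [D.eq_of_z₁_mem hU h0 hm]
    exact hm
  rcases h2.eq_or_lt with h2 | h2
  · have hm : D.z₂ x ∈ closedAnnulus D.r D.R := ⟨h2 ▸ D.r_lt_R.le, h2.le⟩
    rw [D.eq_of_z₂_mem hU h0 hm]
    exact hm
  have hW : x ∈ D.W := D.mem_W_of_closure hx h1 h2 (by rw [h0]; simpa using D.ρ_pos)
  have hxe : x = (x.1, 0) := Prod.ext rfl h0
  rw [hxe] at hW
  have := D.mem_annulus_of_mem_W hW
  exact ⟨this.1.le, this.2.le⟩

/-- A neighbourhood of the central annulus contains all points of `W` with small `w`. -/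
theorem exists_thin {O : Set (ℂ × ℂ)} (hO : IsOpen O)
    (h : ∀ z ∈ closedAnnulus D.r D.R, (z, (0 : ℂ)) ∈ O) :
    ∃ σ : ℝ, 0 < σ ∧ ∀ x ∈ D.W, ‖x.2‖ < σ → x ∈ O := by
  -- This compact set does not meet w = 0, so |w| has a positive minimum on it.
  have hc : IsCompact (closure D.W \ O) := D.isCompact_closure_W.diff hO
  have hpos : ∀ x ∈ closure D.W \ O, 0 < ‖x.2‖ := by
    intro x hx
    refine norm_pos_iff.2 fun h0 => hx.2 ?_
    have := h _ (D.mem_closedAnnulus_of_mem_closure_W hx.1 h0)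
    rwa [← h0] at this
  obtain ⟨σ, hσ, hle⟩ : ∃ σ : ℝ, 0 < σ ∧ ∀ x ∈ closure D.W \ O, σ ≤ ‖x.2‖ := by
    rcases (closure D.W \ O).eq_empty_or_nonempty with he | hne
    · exact ⟨1, one_pos, fun x hx => by rw [he] at hx; exact hx.elim⟩
    · obtain ⟨x, hx, hmin⟩ := hc.exists_isMinOn hne
        (by fun_prop : ContinuousOn (fun x : ℂ × ℂ => ‖x.2‖) _)
      exact ⟨‖x.2‖, hpos x hx, fun y hy => hmin hy⟩
  refine ⟨σ, hσ, fun x hx hxσ => by_contra fun hxO => ?_⟩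
  exact absurd (hle x ⟨subset_closure hx, hxO⟩) (not_le.2 hxσ)

theorem isOpen_coordDomain : IsOpen D.coordDomain := D.isOpen_image₁.inter D.isOpen_image₂

theorem zero_mem_coordDomain {z : ℂ} (hz : z ∈ closedAnnulus D.r D.R) :
    (z, (0 : ℂ)) ∈ D.coordDomain :=
  ⟨⟨(z, 0), D.annulus_subset z hz.1 hz.2, by rw [phi₁, D.z₁_zero hz]⟩,
    ⟨(z, 0), D.annulus_subset z hz.1 hz.2, by rw [phi₂, D.z₂_zero hz]⟩⟩

/-- The coordinate change from `(z₁, w)` to `z₂`. -/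
def trans₁₂ (y : ℂ × ℂ) : ℂ := D.z₂ (D.psi₁ y)

/-- The coordinate change from `(z₂, w)` to `z₁`. -/
def trans₂₁ (y : ℂ × ℂ) : ℂ := D.z₁ (D.psi₂ y)

theorem analyticAt_trans₁₂ {y : ℂ × ℂ} (hy : y ∈ D.phi₁ '' D.U) : AnalyticAt ℂ D.trans₁₂ y :=
  (D.z₂_analytic _ (D.psi₁_mem hy)).comp (D.analyticAt_psi₁ hy)

theorem analyticAt_trans₂₁ {y : ℂ × ℂ} (hy : y ∈ D.phi₂ '' D.U) : AnalyticAt ℂ D.trans₂₁ y :=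
  (D.z₁_analytic _ (D.psi₂_mem hy)).comp (D.analyticAt_psi₂ hy)

theorem psi₁_zero {z : ℂ} (hz : z ∈ closedAnnulus D.r D.R) : D.psi₁ (z, 0) = (z, 0) := by
  have := D.psi₁_phi₁ (D.annulus_subset z hz.1 hz.2)
  rwa [phi₁, D.z₁_zero hz] at this

theorem psi₂_zero {z : ℂ} (hz : z ∈ closedAnnulus D.r D.R) : D.psi₂ (z, 0) = (z, 0) := by
  have := D.psi₂_phi₂ (D.annulus_subset z hz.1 hz.2)
  rwa [phi₂, D.z₂_zero hz] at this

/-- Near the central annulus both systems of coordinates exist and are close to each other. -/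
theorem exists_coord_tube {κ : ℝ} (hκ : 0 < κ) : ∃ η σ : ℝ, 0 < η ∧ η < D.r ∧ 0 < σ ∧
    ∀ z ∈ annulus (D.r - η) (D.R + η), ∀ a : ℂ, ‖a‖ < σ → (z, a) ∈ D.coordDomain ∧
      ‖D.trans₁₂ (z, a) - z‖ < κ ∧ ‖D.trans₂₁ (z, a) - z‖ < κ := by
  have hc₁ : ContinuousOn (fun y => ‖D.trans₁₂ y - y.1‖) D.coordDomain := fun y hy =>
    (((D.analyticAt_trans₁₂ hy.1).continuousAt.sub continuousAt_fst).norm).continuousWithinAt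
  have hc₂ : ContinuousOn (fun y => ‖D.trans₂₁ y - y.1‖) D.coordDomain := fun y hy =>
    (((D.analyticAt_trans₂₁ hy.2).continuousAt.sub continuousAt_fst).norm).continuousWithinAt
  have hO := (hc₁.isOpen_inter_preimage D.isOpen_coordDomain (isOpen_Iio (a := κ))).inter
    (hc₂.isOpen_inter_preimage D.isOpen_coordDomain (isOpen_Iio (a := κ)))
  obtain ⟨η, σ, h1, h2, h3, h⟩ := exists_tube D.r_pos D.r_lt_R hO fun z hz => by
    have h0 := D.zero_mem_coordDomain hz
    refine ⟨⟨h0, ?_⟩, ⟨h0, ?_⟩⟩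
    · simpa [trans₁₂, D.psi₁_zero hz, D.z₂_zero hz] using hκ
    · simpa [trans₂₁, D.psi₂_zero hz, D.z₁_zero hz] using hκ
  refine ⟨η, σ, h1, h2, h3, fun z hz a ha => ?_⟩
  obtain ⟨⟨h4, h5⟩, h6, h7⟩ := h z hz a ha
  exact ⟨h4, h5, h7⟩

end DistortedCylinder

end

noncomputable section

open Set Metric Filter

/-! ### Prescribing the two Laurent parts -/

namespace AnnulusSpace

variable {Sm Sp : SmoothnessClass} {r R : ℝ}

/-- A constant is added to p to satisfy the compatibility at 0; it does not affect the minus part.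
-/
theorem exists_glue (p : Sm.carrier) (q : Sp.carrier) : ∃ f : AnnulusSpace Sm Sp,
    f.1.2 = q ∧ ∀ r : ℝ, 0 < r → ∀ z : ℂ, r < ‖z‖ →
      f.minus r z = Sm.toFun p (r / z) - Sm.toFun p 0 := by
  obtain ⟨e, he⟩ := Sm.exists_one
  have h0 := he 0 (mem_ball_self one_pos)
  have hmem : (p + (Sp.toFun q 0 - Sm.toFun p 0) • e, q) ∈ annulusSubmodule Sm Sp := by
    change Sm.toFun (p + (Sp.toFun q 0 - Sm.toFun p 0) • e) 0 = Sp.toFun q 0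
    simp [h0]
  refine ⟨⟨_, hmem⟩, rfl, fun r hr z hz => ?_⟩
  change Sm.toFun (p + (Sp.toFun q 0 - Sm.toFun p 0) • e) (r / z) -
    Sm.toFun (p + (Sp.toFun q 0 - Sm.toFun p 0) • e) 0 = _
  simp [h0, he _ (norm_div_lt_one_of_gt hr hz)]
  ring

/-- The function with the given part in `{|z| < R}` and the given part in `{|z| > r}`. -/
def glue (p : Sm.carrier) (q : Sp.carrier) : AnnulusSpace Sm Sp := (exists_glue p q).choose

theorem plus_glue (p : Sm.carrier) (q : Sp.carrier) (z : ℂ) :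
    (glue p q).plus R z = Sp.toFun q (z / R) := by
  rw [plus, glue, (exists_glue p q).choose_spec.1]

theorem minus_glue (p : Sm.carrier) (q : Sp.carrier) (hr : 0 < r) {z : ℂ} (hz : r < ‖z‖) :
    (glue p q).minus r z = Sm.toFun p (r / z) - Sm.toFun p 0 :=
  (exists_glue p q).choose_spec.2 r hr z hz

theorem continuous_plus {z : ℂ} (hz : ‖z‖ < R) :
    Continuous fun f : AnnulusSpace Sm Sp => f.plus R z := by
  obtain ⟨c, -, hc⟩ := exists_bound Sm Sp
  let T : AnnulusSpace Sm Sp →ₗ[ℂ] ℂ :=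
    { toFun := fun f => f.plus R z
      map_add' := fun f g => plus_add f g z
      map_smul' := fun c f => plus_smul c f z }
  exact (T.mkContinuous c fun f => (hc 1 R one_pos f).1 z hz).continuous

theorem continuous_minus (hr : 0 < r) {z : ℂ} (hz : r < ‖z‖) :
    Continuous fun f : AnnulusSpace Sm Sp => f.minus r z := by
  obtain ⟨c, -, hc⟩ := exists_bound Sm Sp
  let T : AnnulusSpace Sm Sp →ₗ[ℂ] ℂ :=
    { toFun := fun f => f.minus r z
      map_add' := fun f g => minus_add f g z
      map_smul' := fun c f => minus_smul c f z }
  exact (T.mkContinuous c fun f => (hc r 1 hr f).2 z hz).continuous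

/-- A family of elements depending linearly and pointwise continuously on a parameter defines a
continuous linear map. -/
theorem exists_clm_of_eval {E : Type*} [NormedAddCommGroup E] [NormedSpace ℂ E] [CompleteSpace E]
    (hr : 0 < r) (hrR : r < R) (H : E → ℂ → ℂ)
    (h : ∀ x, ∃ f : AnnulusSpace Sm Sp, ∀ z ∈ annulus r R, f.eval r R z = H x z)
    (hadd : ∀ x y, ∀ z ∈ annulus r R, H (x + y) z = H x z + H y z)
    (hsmul : ∀ (c : ℂ) (x), ∀ z ∈ annulus r R, H (c • x) z = c * H x z)
    (hc : ∀ z ∈ annulus r R, Continuous fun x => H x z) :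
    ∃ T : E →L[ℂ] AnnulusSpace Sm Sp, ∀ x, ∀ z ∈ annulus r R, (T x).eval r R z = H x z := by
  choose T hT using h
  let T' : E →ₗ[ℂ] AnnulusSpace Sm Sp :=
    { toFun := T
      map_add' := fun x y => ext_eval hr hrR fun a ha => by
        rw [eval_add, hT _ a ha, hT _ a ha, hT _ a ha, hadd _ _ a ha]
      map_smul' := fun c x => ext_eval hr hrR fun a ha => by
        rw [RingHom.id_apply, eval_smul, hT _ a ha, hT _ a ha, hsmul _ _ a ha] }
  refine ⟨⟨T', continuous_of_eval hr hrR T' fun a ha => ?_⟩, hT⟩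
  change Continuous fun x => (T x).eval r R a
  simp only [hT _ a ha]
  exact hc a ha

end AnnulusSpace

open AnnulusSpace

theorem ProductSpace.eval_smul {S : SmoothnessClass} {σ r R : ℝ} (c : ℂ) (G : ProductSpace S σ)
    (ζ a : ℂ) : (c • G).eval r R ζ a = c * G.eval r R ζ a := by
  rw [ProductSpace.eval_eq, ProductSpace.eval_eq, ProductSpace.app_smul, AnnulusSpace.eval_smul]

theorem ProductSpace.exists_clm_of_eval {S : SmoothnessClass} {σ r R : ℝ} {E : Type*}
    [NormedAddCommGroup E] [NormedSpace ℂ E] [CompleteSpace E]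
    (hr : 0 < r) (hrR : r < R) (H : E → ℂ → ℂ → ℂ)
    (h : ∀ x, ∃ G : ProductSpace S σ, ∀ ζ ∈ annulus r R, ∀ a ∈ ball (0 : ℂ) σ,
      G.eval r R ζ a = H x ζ a)
    (hadd : ∀ x y, ∀ ζ ∈ annulus r R, ∀ a ∈ ball (0 : ℂ) σ, H (x + y) ζ a = H x ζ a + H y ζ a)
    (hsmul : ∀ (c : ℂ) (x), ∀ ζ ∈ annulus r R, ∀ a ∈ ball (0 : ℂ) σ,
      H (c • x) ζ a = c * H x ζ a)
    (hc : ∀ ζ ∈ annulus r R, ∀ a ∈ ball (0 : ℂ) σ, Continuous fun x => H x ζ a) :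
    ∃ T : E →L[ℂ] ProductSpace S σ, ∀ x, ∀ ζ ∈ annulus r R, ∀ a ∈ ball (0 : ℂ) σ,
      (T x).eval r R ζ a = H x ζ a := by
  choose T hT using h
  let T' : E →ₗ[ℂ] ProductSpace S σ :=
    { toFun := T
      map_add' := fun x y => ProductSpace.ext_eval hr hrR fun ζ hζ a ha => by
        rw [ProductSpace.eval_add, hT _ ζ hζ a ha, hT _ ζ hζ a ha, hT _ ζ hζ a ha,
          hadd _ _ ζ hζ a ha]
      map_smul' := fun c x => ProductSpace.ext_eval hr hrR fun ζ hζ a ha => by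
        rw [RingHom.id_apply, ProductSpace.eval_smul, hT _ ζ hζ a ha, hT _ ζ hζ a ha,
          hsmul _ _ ζ hζ a ha] }
  refine ⟨⟨T', ?_⟩, hT⟩
  refine T'.continuous_of_separating (ι := ball (0 : ℂ) σ × annulus r R) (G := fun _ => ℂ)
    (fun i => (evalCLM S S hr i.2).comp (ProductSpace.appCLM S σ i.1)) (fun y hy => ?_)
    fun i => ?_
  · refine ProductSpace.ext_eval hr hrR fun ζ hζ a ha => ?_
    have := hy (⟨a, ha⟩, ⟨ζ, hζ⟩)
    rw [ProductSpace.eval_eq, ProductSpace.eval_eq]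
    refine Eq.trans this ?_
    rw [← ProductSpace.appCLM_apply, map_zero, AnnulusSpace.eval_zero]
  · change Continuous fun x => ((T x).app i.1).eval r R i.2
    simp only [← ProductSpace.eval_eq, hT _ _ i.2.2 _ i.1.2]
    exact hc _ i.2.2 _ i.1.2

/-! ### Restriction of distorted Laurent sums to the two ends -/

/-- Two annuli `A_{r,r'}` and `A_{R',R}` with coordinate changes `trans₁₂ : (z₁, w) ↦ z₂` near
`A_{r,r'} × 0` and `trans₂₁ : (z₂, w) ↦ z₁` near `A_{R',R} × 0`. -/
structure Overlap where
  r : ℝ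
  r' : ℝ
  R' : ℝ
  R : ℝ
  r_pos : 0 < r
  r_lt_r' : r < r'
  r'_lt_R' : r' < R'
  R'_lt_R : R' < R
  trans₁₂ : ℂ × ℂ → ℂ
  trans₂₁ : ℂ × ℂ → ℂ
  trans₁₂_zero : ∀ z ∈ annulus r r', trans₁₂ (z, 0) = z
  trans₂₁_zero : ∀ z ∈ annulus R' R, trans₂₁ (z, 0) = z
  exists_nhds : ∃ η σ₀ : ℝ, 0 < η ∧ η < r ∧ 0 < σ₀ ∧
    (∀ ζ ∈ annulus (r - η) (r' + η), ∀ a ∈ ball (0 : ℂ) σ₀,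
      DifferentiableAt ℂ trans₁₂ (ζ, a) ∧ ‖trans₁₂ (ζ, a)‖ < R) ∧
    ∀ ζ ∈ annulus (R' - η) (R + η), ∀ a ∈ ball (0 : ℂ) σ₀,
      DifferentiableAt ℂ trans₂₁ (ζ, a) ∧ r < ‖trans₂₁ (ζ, a)‖

namespace Overlap

variable (D : Overlap)

theorem r_lt_R : D.r < D.R := D.r_lt_r'.trans (D.r'_lt_R'.trans D.R'_lt_R)

theorem R'_pos : 0 < D.R' := D.r_pos.trans (D.r_lt_r'.trans D.r'_lt_R')

end Overlap

theorem DistortedCylinder.R'_pos (D : DistortedCylinder) : 0 < D.R' :=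
  D.r_pos.trans (D.r_lt_r'.trans D.r'_lt_R')

/-- For `f ∈ Γ_S(A_{r,R}, 𝒪)`, the functions `f⁻(z₁) + f⁺(z₂)` near `w = 0` in `V⁻` and in `V⁺`. -/
structure Frame (D : Overlap) (Sm Sp : SmoothnessClass) (σ : ℝ) where
  τm : AnnulusSpace Sm Sp →L[ℂ] ProductSpace Sm σ
  τp : AnnulusSpace Sm Sp →L[ℂ] ProductSpace Sp σ
  eval_τm : ∀ f, ∀ ζ ∈ annulus D.r D.r', ∀ a ∈ ball (0 : ℂ) σ,
    (τm f).eval D.r D.r' ζ a = f.minus D.r ζ + f.plus D.R (D.trans₁₂ (ζ, a))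
  eval_τp : ∀ f, ∀ ζ ∈ annulus D.R' D.R, ∀ a ∈ ball (0 : ℂ) σ,
    (τp f).eval D.R' D.R ζ a = f.minus D.r (D.trans₂₁ (ζ, a)) + f.plus D.R ζ

/-- At the inner end f⁻(z₁) does not depend on w and is smooth at |z₁| = r by definition. The term
f⁺(z₂) is holomorphic on a larger tube, since |z₂| < R there. At the outer end the two parts
exchange their roles. -/
theorem exists_frame (D : Overlap) (Sm Sp : SmoothnessClass) :
    ∃ σ₀ : ℝ, 0 < σ₀ ∧ ∀ σ, 0 < σ → σ < σ₀ → Nonempty (Frame D Sm Sp σ) := by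
  have hr := D.r_pos
  have hR'0 := D.R'_pos
  have hrR' : D.r < D.R' := D.r_lt_r'.trans D.r'_lt_R'
  obtain ⟨η, σ₀, hη, hηr, hσ₀, hm1, hp1⟩ := D.exists_nhds
  refine ⟨σ₀, hσ₀, fun σ hσ hσσ₀ => ?_⟩
  obtain ⟨c, hc0, hc⟩ := AnnulusSpace.exists_bound Sm Sp
  have hs1 : ∀ ζ ∈ annulus D.r D.r', ζ ∈ annulus (D.r - η) (D.r' + η) := fun ζ hζ =>
    annulus_mono (by linarith) (by linarith) hζ
  have hs2 : ∀ ζ ∈ annulus D.R' D.R, ζ ∈ annulus (D.R' - η) (D.R + η) := fun ζ hζ =>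
    annulus_mono (by linarith) (by linarith) hζ
  have hbs : ball (0 : ℂ) σ ⊆ ball 0 σ₀ := ball_subset_ball hσσ₀.le
  have hdp : ∀ f : AnnulusSpace Sm Sp, ∀ p ∈ annulus (D.r - η) (D.r' + η) ×ˢ ball (0 : ℂ) σ₀,
      DifferentiableAt ℂ (fun p => f.plus D.R (D.trans₁₂ p)) p := by
    intro f p hp
    obtain ⟨h1, h2⟩ := hm1 p.1 hp.1 p.2 hp.2
    have h3 : DifferentiableAt ℂ (f.plus D.R) (D.trans₁₂ p) :=
      f.differentiableOn_plus.differentiableAt (isOpen_ball.mem_nhds (by simpa using h2))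
    exact h3.comp p h1
  have hdm : ∀ f : AnnulusSpace Sm Sp, ∀ p ∈ annulus (D.R' - η) (D.R + η) ×ˢ ball (0 : ℂ) σ₀,
      DifferentiableAt ℂ (fun p => f.minus D.r (D.trans₂₁ p)) p := by
    intro f p hp
    obtain ⟨h1, h2⟩ := hp1 p.1 hp.1 p.2 hp.2
    have h3 : DifferentiableAt ℂ (f.minus D.r) (D.trans₂₁ p) :=
      (f.differentiableOn_minus hr).differentiableAt ((isOpen_norm_gt _).mem_nhds h2)
    exact h3.comp p h1
  obtain ⟨τm, hτm⟩ := ProductSpace.exists_clm_of_eval (S := Sm) (σ := σ) (E := AnnulusSpace Sm Sp)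
    hr D.r_lt_r'
    (fun f ζ a => f.minus D.r ζ + f.plus D.R (D.trans₁₂ (ζ, a))) (fun f => by
      obtain ⟨G, hG⟩ := ProductSpace.exists_of_holomorphic (σ := σ) (σ₁ := σ₀) Sm
        (r₁ := D.r - η) (R₁ := D.r' + η) (M := c * ‖f‖) (h := fun ζ a => f.plus D.R (D.trans₁₂ (ζ, a)))
        (by linarith) (by linarith : D.r - η < D.r) D.r_lt_r' (by linarith) hσ hσσ₀
        (fun p hp => (hdp f p hp).continuousAt.continuousWithinAt)
        (fun a ha ζ hζ => ((hdp f (ζ, a) ⟨hζ, ha⟩).comp ζ (f := fun ζ => (ζ, a))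
          (by fun_prop)).differentiableWithinAt)
        (fun ζ hζ a ha => ((hdp f (ζ, a) ⟨hζ, ha⟩).comp a (f := fun a => (ζ, a))
          (by fun_prop)).differentiableWithinAt)
        fun ζ hζ a ha => (hc D.r D.R hr f).1 _ (hm1 ζ hζ a ha).2
      -- `glue f.1.1 0` is f⁻ regarded as an element on the smaller annulus, with class Sm at both
      -- circles.
      refine ⟨ProductSpace.const Sm σ (glue f.1.1 0) + G, fun ζ hζ a ha => ?_⟩
      rw [ProductSpace.eval_add, hG ζ hζ a ha, ProductSpace.eval_eq, ProductSpace.app_const _ ha,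
        AnnulusSpace.eval, plus_glue, minus_glue _ _ hr hζ.1]
      simp [AnnulusSpace.minus])
    (fun x y ζ hζ a ha => by rw [minus_add, plus_add]; ring)
    (fun k x ζ hζ a ha => by rw [minus_smul, plus_smul]; ring)
    (fun ζ hζ a ha => (continuous_minus hr hζ.1).add
      (continuous_plus (hm1 ζ (hs1 ζ hζ) a (hbs ha)).2))
  obtain ⟨τp, hτp⟩ := ProductSpace.exists_clm_of_eval (S := Sp) (σ := σ) (E := AnnulusSpace Sm Sp)
    hR'0 D.R'_lt_R
    (fun f ζ a => f.minus D.r (D.trans₂₁ (ζ, a)) + f.plus D.R ζ) (fun f => by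
      obtain ⟨G, hG⟩ := ProductSpace.exists_of_holomorphic (σ := σ) (σ₁ := σ₀) Sp
        (r₁ := D.R' - η) (R₁ := D.R + η) (M := c * ‖f‖)
        (h := fun ζ a => f.minus D.r (D.trans₂₁ (ζ, a)))
        (by linarith) (by linarith : D.R' - η < D.R') D.R'_lt_R (by linarith) hσ hσσ₀
        (fun p hp => (hdm f p hp).continuousAt.continuousWithinAt)
        (fun a ha ζ hζ => ((hdm f (ζ, a) ⟨hζ, ha⟩).comp ζ (f := fun ζ => (ζ, a))
          (by fun_prop)).differentiableWithinAt)
        (fun ζ hζ a ha => ((hdm f (ζ, a) ⟨hζ, ha⟩).comp a (f := fun a => (ζ, a))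
          (by fun_prop)).differentiableWithinAt)
        fun ζ hζ a ha => (hc D.r D.R hr f).2 _ (hp1 ζ hζ a ha).2
      refine ⟨G + ProductSpace.const Sp σ (glue 0 f.1.2), fun ζ hζ a ha => ?_⟩
      rw [ProductSpace.eval_add, hG ζ hζ a ha, ProductSpace.eval_eq, ProductSpace.app_const _ ha,
        AnnulusSpace.eval, plus_glue, minus_glue _ _ hR'0 hζ.1]
      simp [AnnulusSpace.plus])
    (fun x y ζ hζ a ha => by rw [minus_add, plus_add]; ring)
    (fun k x ζ hζ a ha => by rw [minus_smul, plus_smul]; ring)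
    (fun ζ hζ a ha => (continuous_minus hr (hp1 ζ (hs2 ζ hζ) a (hbs ha)).2).add
      (continuous_plus hζ.2))
  exact ⟨⟨τm, τp, hτm, hτp⟩⟩

/-! ### The part `(g⁻, g⁺) ↦ (g⁻)⁻ + (g⁺)⁺` -/

theorem exists_collect (D : Overlap) (Sm Sp : SmoothnessClass) :
    ∃ T : AnnulusSpace Sm Sm × AnnulusSpace Sp Sp →L[ℂ] AnnulusSpace Sm Sp,
      ∀ g, ∀ z ∈ annulus D.r D.R, (T g).eval D.r D.R z = g.2.plus D.R z + g.1.minus D.r z := by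
  refine AnnulusSpace.exists_clm_of_eval D.r_pos D.r_lt_R
    (fun (g : AnnulusSpace Sm Sm × AnnulusSpace Sp Sp) z => g.2.plus D.R z + g.1.minus D.r z)
    (fun g => ⟨glue g.1.1.1 g.2.1.2, fun z hz => ?_⟩) ?_ ?_ ?_
  · rw [AnnulusSpace.eval, plus_glue, minus_glue _ _ D.r_pos hz.1]
    rfl
  · intro x y z _
    rw [Prod.fst_add, Prod.snd_add, plus_add, minus_add]
    ring
  · intro c x z _
    rw [Prod.smul_fst, Prod.smul_snd, plus_smul, minus_smul]
    ring
  · intro z hz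
    exact ((continuous_plus hz.2).comp continuous_snd).add
      ((continuous_minus D.r_pos hz.1).comp continuous_fst)

/-- The map `(g⁻, g⁺) ↦ (g⁻)⁻ + (g⁺)⁺`. -/
def collect (D : Overlap) (Sm Sp : SmoothnessClass) :
    AnnulusSpace Sm Sm × AnnulusSpace Sp Sp →L[ℂ] AnnulusSpace Sm Sp :=
  (exists_collect D Sm Sp).choose

variable {D : Overlap} {Sm Sp : SmoothnessClass}

theorem eval_collect (g : AnnulusSpace Sm Sm × AnnulusSpace Sp Sp) {z : ℂ}
    (hz : z ∈ annulus D.r D.R) :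
    (collect D Sm Sp g).eval D.r D.R z = g.2.plus D.R z + g.1.minus D.r z :=
  (exists_collect D Sm Sp).choose_spec g z hz

theorem collect_parts (g : AnnulusSpace Sm Sm × AnnulusSpace Sp Sp) :
    (∀ z ∈ ball (0 : ℂ) D.R, (collect D Sm Sp g).plus D.R z = g.2.plus D.R z) ∧
      ∀ z, D.r < ‖z‖ → (collect D Sm Sp g).minus D.r z = g.1.minus D.r z :=
  ((collect D Sm Sp g).isLaurentDecomposition (R := D.R) D.r_pos).unique D.r_lt_R
    ⟨g.2.differentiableOn_plus, g.1.differentiableOn_minus D.r_pos, g.1.tendsto_minus,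
      fun _ hz => eval_collect g hz⟩

/-- `collect` for tuples. -/
def collectN (D : Overlap) (Sm Sp : SmoothnessClass) (n : ℕ) :
    DistortedCylinder.KappaSpace Sm Sp n →L[ℂ] (Fin n → AnnulusSpace Sm Sp) :=
  ContinuousLinearMap.pi fun i => (collect D Sm Sp).comp
    (((ContinuousLinearMap.proj i).comp (ContinuousLinearMap.fst ℂ _ _)).prod
      ((ContinuousLinearMap.proj i).comp (ContinuousLinearMap.snd ℂ _ _)))

namespace Frame

variable {σ : ℝ} (Φ : Frame D Sm Sp σ) (n : ℕ)

/-- `∑ (fᵢ⁻(z₁) + fᵢ⁺(z₂)) wⁿ⁻ⁱ` on `V⁻`. -/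
def Tm : (Fin n → AnnulusSpace Sm Sp) →L[ℂ] ProductSpace Sm σ :=
  ∑ i : Fin n, ((ProductSpace.mulW Sm σ ^ (n - (i.val + 1))).comp Φ.τm).comp
    (ContinuousLinearMap.proj i)

/-- `∑ (fᵢ⁻(z₁) + fᵢ⁺(z₂)) wⁿ⁻ⁱ` on `V⁺`. -/
def Tp : (Fin n → AnnulusSpace Sm Sp) →L[ℂ] ProductSpace Sp σ :=
  ∑ i : Fin n, ((ProductSpace.mulW Sp σ ^ (n - (i.val + 1))).comp Φ.τp).comp
    (ContinuousLinearMap.proj i)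

variable {n}

theorem Tm_apply (f : Fin n → AnnulusSpace Sm Sp) :
    Φ.Tm n f = ∑ i : Fin n, (ProductSpace.mulW Sm σ ^ (n - (i.val + 1))) (Φ.τm (f i)) := by
  simp [Tm]

theorem Tp_apply (f : Fin n → AnnulusSpace Sm Sp) :
    Φ.Tp n f = ∑ i : Fin n, (ProductSpace.mulW Sp σ ^ (n - (i.val + 1))) (Φ.τp (f i)) := by
  simp [Tp]

theorem eval_Tm (f : Fin n → AnnulusSpace Sm Sp) {ζ a : ℂ} (hζ : ζ ∈ annulus D.r D.r')
    (ha : a ∈ ball (0 : ℂ) σ) : (Φ.Tm n f).eval D.r D.r' ζ a =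
      ∑ i : Fin n, ((f i).minus D.r ζ + (f i).plus D.R (D.trans₁₂ (ζ, a))) *
        a ^ (n - (i.val + 1)) := by
  rw [ProductSpace.eval_eq, Tm_apply, ProductSpace.app_sum, AnnulusSpace.eval_sum]
  refine Finset.sum_congr rfl fun i _ => ?_
  rw [ProductSpace.app_mulW_pow _ _ ha, AnnulusSpace.eval_smul, ← ProductSpace.eval_eq,
    Φ.eval_τm _ ζ hζ a ha, mul_comm]

theorem eval_Tp (f : Fin n → AnnulusSpace Sm Sp) {ζ a : ℂ} (hζ : ζ ∈ annulus D.R' D.R)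
    (ha : a ∈ ball (0 : ℂ) σ) : (Φ.Tp n f).eval D.R' D.R ζ a =
      ∑ i : Fin n, ((f i).minus D.r (D.trans₂₁ (ζ, a)) + (f i).plus D.R ζ) *
        a ^ (n - (i.val + 1)) := by
  rw [ProductSpace.eval_eq, Tp_apply, ProductSpace.app_sum, AnnulusSpace.eval_sum]
  refine Finset.sum_congr rfl fun i _ => ?_
  rw [ProductSpace.app_mulW_pow _ _ ha, AnnulusSpace.eval_smul, ← ProductSpace.eval_eq,
    Φ.eval_τp _ ζ hζ a ha, mul_comm]

/-- On w = 0 both coordinates coincide, so both ends see f itself; f⁻ is read off at the inner and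
f⁺ at the outer end. -/
theorem collect_app_zero (hσ : 0 < σ) (f : AnnulusSpace Sm Sp) :
    collect D Sm Sp ((Φ.τm f).app 0, (Φ.τp f).app 0) = f := by
  have h0 : (0 : ℂ) ∈ ball (0 : ℂ) σ := mem_ball_self hσ
  have hm : ∀ z, D.r < ‖z‖ → ((Φ.τm f).app 0).minus D.r z = f.minus D.r z := by
    refine ((((Φ.τm f).app 0).isLaurentDecomposition (R := D.r') D.r_pos).unique D.r_lt_r'
      ⟨f.differentiableOn_plus.mono (ball_subset_ball
        (D.r'_lt_R'.trans D.R'_lt_R).le), f.differentiableOn_minus D.r_pos, f.tendsto_minus,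
        fun z hz => ?_⟩).2
    rw [← ProductSpace.eval_eq, Φ.eval_τm f z hz 0 h0, D.trans₁₂_zero z hz, add_comm]
  have hp : ∀ z ∈ ball (0 : ℂ) D.R, ((Φ.τp f).app 0).plus D.R z = f.plus D.R z := by
    refine ((((Φ.τp f).app 0).isLaurentDecomposition (R := D.R) D.R'_pos).unique D.R'_lt_R
      ⟨f.differentiableOn_plus, (f.differentiableOn_minus D.r_pos).mono fun z hz =>
        (D.r_lt_r'.trans D.r'_lt_R').trans hz, f.tendsto_minus, fun z hz => ?_⟩).1
    rw [← ProductSpace.eval_eq, Φ.eval_τp f z hz 0 h0, D.trans₂₁_zero z hz, add_comm]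
  refine AnnulusSpace.ext_eval D.r_pos D.r_lt_R fun z hz => ?_
  rw [eval_collect _ hz, hm z hz.1, hp z (annulus_subset_ball _ _ hz)]
  rfl

/-- The operator `f ↦ (ρ⁻)⁻ + (ρ⁺)⁺`, where `ρ^±` are the remainders of
`∑ (fᵢ⁻(z₁) + fᵢ⁺(z₂)) wⁿ⁻ⁱ` on `V^±` modulo `ψ^±`. -/
def op (hσ : 0 < σ) (n : ℕ) (ψ : ProductSpace Sm σ × ProductSpace Sp σ) :
    (Fin n → AnnulusSpace Sm Sp) →L[ℂ] (Fin n → AnnulusSpace Sm Sp) :=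
  (collectN D Sm Sp n).comp
    (((ProductSpace.low Sm hσ n).comp
      ((Ring.inverse (ProductSpace.divOp D.r_pos D.r_lt_r' hσ n ψ.1)).comp (Φ.Tm n))).prod
    ((ProductSpace.low Sp hσ n).comp
      ((Ring.inverse (ProductSpace.divOp D.R'_pos D.R'_lt_R hσ n ψ.2)).comp (Φ.Tp n))))

/-- Index i belongs to the power n - (i + 1). Terms with j < i carry a higher power of w and cannot
contribute to this coefficient; the term j = i contributes its value at w = 0. -/
theorem low_sum_eq {S : SmoothnessClass} (hσ : 0 < σ) (b : Fin n → ProductSpace S σ) (i : Fin n)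
    (hb : ∀ j, i < j → b j = 0) :
    ProductSpace.low S hσ n (∑ j : Fin n, (ProductSpace.mulW S σ ^ (n - (j.val + 1))) (b j)) i =
      (b i).app 0 := by
  have h0 : (0 : ℂ) ∈ ball (0 : ℂ) σ := mem_ball_self hσ
  have hi := i.2
  rw [ProductSpace.low_apply, map_sum, ProductSpace.app_sum, Finset.sum_eq_single i]
  · rw [ProductSpace.shift_pow_mulW_pow]
  · intro j _ hj
    rcases lt_or_gt_of_ne (fun h => hj (Fin.ext h) : j.val ≠ i.val) with h | h
    · rw [ProductSpace.shift_pow_mulW_pow_of_le hσ (by omega), ProductSpace.app_mulW_pow _ _ h0,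
        zero_pow (by omega), zero_smul]
    · rw [hb j h, map_zero, map_zero]
      exact map_zero (ProductSpace.appCLM S σ 0)
  · intro h
    exact absurd (Finset.mem_univ i) h

/-- For ψ^± = wⁿ the operator is triangular with identities on the diagonal: component i depends
only on the components j ≥ i. -/
theorem op_wpow_apply (hσ : 0 < σ) (f : Fin n → AnnulusSpace Sm Sp) (i : Fin n)
    (hf : ∀ j, i < j → f j = 0) :
    Φ.op hσ n (ProductSpace.wpow Sm σ n, ProductSpace.wpow Sp σ n) f i = f i := by
  have h : Φ.op hσ n (ProductSpace.wpow Sm σ n, ProductSpace.wpow Sp σ n) f i =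
      collect D Sm Sp (ProductSpace.low Sm hσ n (Φ.Tm n f) i,
        ProductSpace.low Sp hσ n (Φ.Tp n f) i) := by
    simp only [op, ProductSpace.divOp_wpow, Ring.inverse_one]
    rfl
  rw [h, Tm_apply, Tp_apply, low_sum_eq hσ (fun j => Φ.τm (f j)) i fun j hj => by
    rw [hf j hj, map_zero], low_sum_eq hσ (fun j => Φ.τp (f j)) i fun j hj => by
    rw [hf j hj, map_zero], Φ.collect_app_zero hσ]

theorem isUnit_op_wpow (hσ : 0 < σ) :
    IsUnit (Φ.op hσ n (ProductSpace.wpow Sm σ n, ProductSpace.wpow Sp σ n)) := by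
  set A := Φ.op hσ n (ProductSpace.wpow Sm σ n, ProductSpace.wpow Sp σ n)
  -- Each further power of A - 1 kills one more component, starting from the last; so A - 1 is
  -- nilpotent.
  have key : ∀ (f : Fin n → AnnulusSpace Sm Sp) (m : ℕ) (i : Fin n), n ≤ i.val + m →
      ((A - 1) ^ m) f i = 0 := by
    intro f m
    induction m with
    | zero => intro i hi; exact absurd i.2 (by omega)
    | succ m ih =>
      intro i hi
      rw [pow_succ', ContinuousLinearMap.mul_app, sub_apply, Pi.sub_apply, sub_eq_zero]
      exact Φ.op_wpow_apply hσ _ i fun j hj => ih j (by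
        have : i.val < j.val := hj
        omega)
  have hnil : IsNilpotent (A - 1) := ⟨n, by
    ext1 f
    funext i
    exact key f n i (by omega)⟩
  have := hnil.isUnit_one_add
  rwa [add_sub_cancel] at this

/-- The solution `f` of the equation `wⁿ + ∑ (fᵢ⁻(z₁) + fᵢ⁺(z₂)) wⁿ⁻ⁱ ≡ 0` modulo `ψ^±` on
`V^±`, if there is one. -/
def solution (hσ : 0 < σ) (n : ℕ) (ψ : ProductSpace Sm σ × ProductSpace Sp σ) :
    Fin n → AnnulusSpace Sm Sp :=
  - Ring.inverse (Φ.op hσ n ψ) (collectN D Sm Sp n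
    (ProductSpace.rem D.r_pos D.r_lt_r' hσ n ψ.1 (ProductSpace.wpow Sm σ n),
      ProductSpace.rem D.R'_pos D.R'_lt_R hσ n ψ.2 (ProductSpace.wpow Sp σ n)))

theorem op_apply (hσ : 0 < σ) (ψ : ProductSpace Sm σ × ProductSpace Sp σ)
    (f : Fin n → AnnulusSpace Sm Sp) : Φ.op hσ n ψ f = collectN D Sm Sp n
      (ProductSpace.rem D.r_pos D.r_lt_r' hσ n ψ.1 (Φ.Tm n f),
        ProductSpace.rem D.R'_pos D.R'_lt_R hσ n ψ.2 (Φ.Tp n f)) := rfl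

theorem rem_add {S : SmoothnessClass} {r R : ℝ} (hr : 0 < r) (hrR : r < R) (hσ : 0 < σ)
    (ψ h k : ProductSpace S σ) : ProductSpace.rem hr hrR hσ n ψ (h + k) =
      ProductSpace.rem hr hrR hσ n ψ h + ProductSpace.rem hr hrR hσ n ψ k := by
  simp [ProductSpace.rem]

theorem collect_rem (hσ : 0 < σ) (ψ : ProductSpace Sm σ × ProductSpace Sp σ)
    (f : Fin n → AnnulusSpace Sm Sp) : collectN D Sm Sp n
      (ProductSpace.rem D.r_pos D.r_lt_r' hσ n ψ.1 (ProductSpace.wpow Sm σ n + Φ.Tm n f),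
        ProductSpace.rem D.R'_pos D.R'_lt_R hσ n ψ.2 (ProductSpace.wpow Sp σ n + Φ.Tp n f)) =
      collectN D Sm Sp n
        (ProductSpace.rem D.r_pos D.r_lt_r' hσ n ψ.1 (ProductSpace.wpow Sm σ n),
          ProductSpace.rem D.R'_pos D.R'_lt_R hσ n ψ.2 (ProductSpace.wpow Sp σ n)) +
      Φ.op hσ n ψ f := by
  rw [op_apply, ← map_add, rem_add, rem_add]
  rfl

/-- If both remainders vanish, so do their collected parts, and the collected equation has one
solution because `op` is invertible. -/
theorem eq_solution (hσ : 0 < σ) {ψ : ProductSpace Sm σ × ProductSpace Sp σ}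
    (hψ : IsUnit (Φ.op hσ n ψ)) {f : Fin n → AnnulusSpace Sm Sp}
    (hm : ProductSpace.rem D.r_pos D.r_lt_r' hσ n ψ.1 (ProductSpace.wpow Sm σ n + Φ.Tm n f) = 0)
    (hp : ProductSpace.rem D.R'_pos D.R'_lt_R hσ n ψ.2 (ProductSpace.wpow Sp σ n + Φ.Tp n f) = 0) :
    f = Φ.solution hσ n ψ := by
  have h := Φ.collect_rem hσ ψ f
  rw [hm, hp, show ((0, 0) : DistortedCylinder.KappaSpace Sm Sp n) = 0 from rfl, map_zero] at h
  rw [solution, eq_neg_of_add_eq_zero_left h.symm, map_neg, neg_neg,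
    (ProductSpace.inverse_apply_of_isUnit hψ f).1]

/-- This is weaker than the vanishing of both remainders: the inner one may keep its plus part and
the outer one its minus part. The geometry of the curve is needed to remove these. -/
theorem collect_rem_solution (hσ : 0 < σ) {ψ : ProductSpace Sm σ × ProductSpace Sp σ}
    (hψ : IsUnit (Φ.op hσ n ψ)) : collectN D Sm Sp n
      (ProductSpace.rem D.r_pos D.r_lt_r' hσ n ψ.1
          (ProductSpace.wpow Sm σ n + Φ.Tm n (Φ.solution hσ n ψ)),
        ProductSpace.rem D.R'_pos D.R'_lt_R hσ n ψ.2
          (ProductSpace.wpow Sp σ n + Φ.Tp n (Φ.solution hσ n ψ))) = 0 := by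
  rw [collect_rem, solution, map_neg, (ProductSpace.inverse_apply_of_isUnit hψ _).2,
    add_neg_cancel]

end Frame

/-! ### The overlaps of a distorted cylinder -/

namespace DistortedCylinder

variable (D : DistortedCylinder)

/-- The ends `V⁻` and `V⁺`. -/
def overlap : Overlap where
  r := D.r
  r' := D.r'
  R' := D.R'
  R := D.R
  r_pos := D.r_pos
  r_lt_r' := D.r_lt_r'
  r'_lt_R' := D.r'_lt_R'
  R'_lt_R := D.R'_lt_R
  trans₁₂ := D.trans₁₂
  trans₂₁ := D.trans₂₁
  trans₁₂_zero z hz := by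
    have hz' : z ∈ closedAnnulus D.r D.R :=
      ⟨hz.1.le, (hz.2.trans (D.r'_lt_R'.trans D.R'_lt_R)).le⟩
    rw [trans₁₂, D.psi₁_zero hz', D.z₂_zero hz']
  trans₂₁_zero z hz := by
    have hz' : z ∈ closedAnnulus D.r D.R :=
      ⟨((D.r_lt_r'.trans D.r'_lt_R').trans hz.1).le, hz.2.le⟩
    rw [trans₂₁, D.psi₂_zero hz', D.z₁_zero hz']
  exists_nhds := by
    have h1 := D.r_lt_r'
    have h2 := D.r'_lt_R'
    have h3 := D.R'_lt_R
    -- Half of each gap is spent on thickening the annuli and half on |z₁ - z₂|; so |z₂| < R on the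
    -- inner tube and |z₁| > r on the outer one.
    obtain ⟨η, σ₀, hη, hηr, hσ₀, htube⟩ := D.exists_coord_tube
      (lt_min (by linarith : 0 < (D.R - D.r') / 2) (by linarith : 0 < (D.R' - D.r) / 2))
    refine ⟨min η (min ((D.R - D.r') / 2) ((D.R' - D.r) / 2)), σ₀,
      lt_min hη (lt_min (by linarith) (by linarith)), (min_le_left _ _).trans_lt hηr, hσ₀, ?_, ?_⟩
    all_goals
      generalize hκ : min ((D.R - D.r') / 2) ((D.R' - D.r) / 2) = κ at htube ⊢
      have hκ1 : κ ≤ (D.R - D.r') / 2 := hκ ▸ min_le_left _ _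
      have hκ2 : κ ≤ (D.R' - D.r) / 2 := hκ ▸ min_le_right _ _
      have hm1 := min_le_left η κ
      have hm2 := min_le_right η κ
      intro ζ hζ a ha
      have ha' : ‖a‖ < σ₀ := by simpa using ha
    · obtain ⟨h4, h5, -⟩ := htube ζ ⟨by linarith [hζ.1], by linarith [hζ.2]⟩ a ha'
      refine ⟨(D.analyticAt_trans₁₂ h4.1).differentiableAt, ?_⟩
      have := norm_sub_norm_le (D.trans₁₂ (ζ, a)) ζ
      linarith [hζ.2]
    · obtain ⟨h4, -, h5⟩ := htube ζ ⟨by linarith [hζ.1], by linarith [hζ.2]⟩ a ha'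
      refine ⟨(D.analyticAt_trans₂₁ h4.2).differentiableAt, ?_⟩
      have := norm_sub_norm_le ζ (D.trans₂₁ (ζ, a))
      rw [norm_sub_rev] at this
      linarith [hζ.1]

/-- The radius `R' + t (R - R')`. -/
def rad (t : ℝ) : ℝ := D.R' + t * (D.R - D.R')

theorem rad_lt {s t : ℝ} (h : s < t) : D.rad s < D.rad t := by
  have := D.R'_lt_R
  unfold rad
  nlinarith

theorem rad_one : D.rad 1 = D.R := by simp [rad]

theorem rad_zero : D.rad 0 = D.R' := by simp [rad]

/-- The part of `V⁺` between two circles `|z₂| = a` and `|z₁| = b`, as an overlap with the roles of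
the coordinates exchanged. -/
def swapOverlap : Overlap where
  r := D.rad (1 / 8)
  r' := D.rad (2 / 8)
  R' := D.rad (4 / 8)
  R := D.rad (5 / 8)
  r_pos := D.R'_pos.trans (by rw [← D.rad_zero]; exact D.rad_lt (by norm_num))
  r_lt_r' := D.rad_lt (by norm_num)
  r'_lt_R' := D.rad_lt (by norm_num)
  R'_lt_R := D.rad_lt (by norm_num)
  trans₁₂ := D.trans₂₁
  trans₂₁ := D.trans₁₂
  trans₁₂_zero z hz := by
    have h1 : D.R' < D.rad (1 / 8) := by rw [← D.rad_zero]; exact D.rad_lt (by norm_num)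
    have h2 : D.rad (2 / 8) < D.R := by rw [← D.rad_one]; exact D.rad_lt (by norm_num)
    have hz' : z ∈ closedAnnulus D.r D.R :=
      ⟨((D.r_lt_r'.trans D.r'_lt_R').trans (h1.trans hz.1)).le, (hz.2.trans h2).le⟩
    rw [trans₂₁, D.psi₂_zero hz', D.z₁_zero hz']
  trans₂₁_zero z hz := by
    have h1 : D.R' < D.rad (4 / 8) := by rw [← D.rad_zero]; exact D.rad_lt (by norm_num)
    have h2 : D.rad (5 / 8) < D.R := by rw [← D.rad_one]; exact D.rad_lt (by norm_num)
    have hz' : z ∈ closedAnnulus D.r D.R :=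
      ⟨((D.r_lt_r'.trans D.r'_lt_R').trans (h1.trans hz.1)).le, (hz.2.trans h2).le⟩
    rw [trans₁₂, D.psi₁_zero hz', D.z₂_zero hz']
  exists_nhds := by
    have hL : 0 < D.R - D.R' := sub_pos.2 D.R'_lt_R
    have h0 := D.R'_pos
    have h1 := D.r_lt_r'.trans D.r'_lt_R'
    -- One eighth of R - R' is used both for the thickening and for |z₁ - z₂|. The radii leave room:
    -- 2/8 + 2/8 < 5/8 and 4/8 - 2/8 > 1/8.
    obtain ⟨η, σ₀, hη, hηr, hσ₀, htube⟩ := D.exists_coord_tube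
      (by positivity : 0 < (D.R - D.R') / 8)
    refine ⟨(D.R - D.R') / 8, σ₀, by positivity, by unfold rad; linarith, hσ₀, ?_, ?_⟩
    all_goals
      unfold rad
      intro ζ hζ a ha
      have ha' : ‖a‖ < σ₀ := by simpa using ha
      have hζ1 := hζ.1
      have hζ2 := hζ.2
      obtain ⟨h4, h5, h6⟩ := htube ζ ⟨by linarith, by linarith⟩ a ha'
    · refine ⟨(D.analyticAt_trans₂₁ h4.2).differentiableAt, ?_⟩
      have := norm_sub_norm_le (D.trans₂₁ (ζ, a)) ζ
      linarith
    · refine ⟨(D.analyticAt_trans₁₂ h4.1).differentiableAt, ?_⟩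
      have := norm_sub_norm_le ζ (D.trans₁₂ (ζ, a))
      rw [norm_sub_rev] at this
      linarith

end DistortedCylinder

end

noncomputable section

open Set Metric Filter

/-! ### Polynomials of one variable -/

/-- `∑ cᵢ aⁿ⁻ⁱ`. -/
def lowSum {n : ℕ} (c : Fin n → ℂ) (a : ℂ) : ℂ := ∑ i : Fin n, c i * a ^ (n - (i.val + 1))

theorem lowSum_sub {n : ℕ} (c d : Fin n → ℂ) (a : ℂ) :
    lowSum (c - d) a = lowSum c a - lowSum d a := by
  simp [lowSum, sub_mul, Finset.sum_sub_distrib]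

theorem norm_lowSum_le {n : ℕ} {c : Fin n → ℂ} {M B : ℝ} (hc : ∀ i, ‖c i‖ ≤ M) (hM : 0 ≤ M) {a : ℂ}
    (ha : ‖a‖ ≤ B) (hB : 1 ≤ B) : ‖lowSum c a‖ ≤ n * (M * B ^ n) := by
  refine (norm_sum_le_of_le _ (f := fun i => c i * a ^ (n - (i.val + 1)))
    (n := fun _ => M * B ^ n) fun i _ => ?_).trans (by simp)
  rw [norm_mul, norm_pow]
  refine mul_le_mul (hc i) ?_ (by positivity) hM
  exact (pow_le_pow_left₀ (norm_nonneg _) ha _).trans (pow_le_pow_right₀ hB (Nat.sub_le _ _))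

open Polynomial in
/-- The polynomial `∑ cᵢ Xⁿ⁻ⁱ`. -/
def lowPoly {n : ℕ} (c : Fin n → ℂ) : ℂ[X] := ∑ i : Fin n, C (c i) * X ^ (n - (i.val + 1))

open Polynomial in
theorem eval_lowPoly {n : ℕ} (c : Fin n → ℂ) (a : ℂ) : (lowPoly c).eval a = lowSum c a := by
  simp [lowPoly, lowSum, eval_finsetSum]

open Polynomial in
theorem coeff_lowPoly {n : ℕ} (c : Fin n → ℂ) (i : Fin n) :
    (lowPoly c).coeff (n - (i.val + 1)) = c i := by
  have hi := i.2
  rw [lowPoly, finsetSum_coeff, Finset.sum_eq_single i]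
  · simp
  · intro j _ hj
    have hj' : j.val ≠ i.val := fun h => hj (Fin.ext h)
    have := j.2
    rw [coeff_C_mul, coeff_X_pow, if_neg (by omega), mul_zero]
  · simp

open Polynomial in
theorem degree_lowPoly_lt {n : ℕ} (c : Fin n → ℂ) : (lowPoly c).degree < n := by
  refine (degree_sum_le _ _).trans_lt ((Finset.sup_lt_iff (WithBot.bot_lt_coe n)).2 fun i _ => ?_)
  refine (degree_C_mul_X_pow_le _ _).trans_lt ?_
  have := i.2
  exact WithBot.coe_lt_coe.2 (by omega : n - (i.val + 1) < n)

open Polynomial in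
theorem monic_X_pow_add_lowPoly {n : ℕ} (c : Fin n → ℂ) : (X ^ n + lowPoly c).Monic :=
  monic_X_pow_add (degree_lowPoly_lt c)

open Polynomial in
theorem natDegree_X_pow_add_lowPoly {n : ℕ} (c : Fin n → ℂ) : (X ^ n + lowPoly c).natDegree = n := by
  rw [natDegree_add_eq_left_of_degree_lt, natDegree_X_pow]
  rw [degree_X_pow]
  exact degree_lowPoly_lt c

theorem exists_multiset_pow_add_lowSum {n : ℕ} (c : Fin n → ℂ) : ∃ s : Multiset ℂ,
    Multiset.card s = n ∧ (∀ a, a ^ n + lowSum c a = (s.map (a - ·)).prod) ∧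
    ∀ α ∈ s, α ^ n + lowSum c α = 0 := by
  open Polynomial in
  have hs := IsAlgClosed.splits (X ^ n + lowPoly c)
  have hm := monic_X_pow_add_lowPoly c
  have h := fun a => hs.eval_eq_prod_roots_of_monic hm a
  simp only [Polynomial.eval_add, Polynomial.eval_pow, Polynomial.eval_X, eval_lowPoly] at h
  refine ⟨_, ?_, h, fun α hα => ?_⟩
  · rw [← hs.natDegree_eq_card_roots, natDegree_X_pow_add_lowPoly]
  · have := (Polynomial.mem_roots'.1 hα).2
    simpa [Polynomial.IsRoot, eval_lowPoly] using this

open Polynomial in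
theorem pow_add_lowSum_of_monic {n : ℕ} {p : ℂ[X]} (hp : p.Monic) (hn : p.natDegree = n) (a : ℂ) :
    p.eval a = a ^ n + lowSum (fun i : Fin n => p.coeff (n - (i.val + 1))) a := by
  conv_lhs => rw [hp.as_sum]
  rw [hn, eval_add, eval_pow, eval_X, eval_finsetSum, lowSum, ← Finset.sum_range_reflect]
  rw [Finset.sum_range]
  simp [Nat.sub_sub, add_comm]

open Polynomial in
-- Each root in the disc splits off a linear factor. After cancellation the identity is restored at
-- the root by continuity, so q need only be continuous.
theorem prod_X_sub_C_dvd {σ : ℝ} {q : ℂ → ℂ} (hq : ContinuousOn q (ball 0 σ)) (s : Multiset ℂ)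
    (hs : ∀ α ∈ s, α ∈ ball (0 : ℂ) σ) (p : ℂ[X])
    (h : ∀ a ∈ ball (0 : ℂ) σ, p.eval a = (s.map (a - ·)).prod * q a) :
    (s.map fun α => X - C α).prod ∣ p := by
  induction s using Multiset.induction_on generalizing p with
  | empty => simp
  | cons α s ih =>
    have hα : α ∈ ball (0 : ℂ) σ := hs α (Multiset.mem_cons_self α s)
    have h0 : p.IsRoot α := by simp [IsRoot, h α hα]
    obtain ⟨p', rfl⟩ := dvd_iff_isRoot.2 h0
    rw [Multiset.map_cons, Multiset.prod_cons]
    refine mul_dvd_mul_left _ (ih (fun β hβ => hs β (Multiset.mem_cons_of_mem hβ)) p' ?_)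
    have hne : ∀ a ∈ ball (0 : ℂ) σ, a ≠ α → p'.eval a = (s.map (a - ·)).prod * q a := by
      intro a ha hne
      have := h a ha
      rw [Multiset.map_cons, Multiset.prod_cons, eval_mul, eval_sub, eval_X, eval_C,
        mul_assoc] at this
      exact mul_left_cancel₀ (sub_ne_zero.2 hne) this
    have hcont : ContinuousOn (fun a => (s.map (a - ·)).prod * q a) (ball 0 σ) := by
      refine ContinuousOn.mul (Continuous.continuousOn ?_) hq
      exact continuous_multiset_prod s fun i _ => by fun_prop
    intro a ha
    by_cases hne' : a = α
    · subst hne'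
      have h1 : Tendsto (fun b => p'.eval b) (𝓝[≠] a) (𝓝 (p'.eval a)) :=
        p'.continuous.continuousAt.mono_left nhdsWithin_le_nhds
      have h2 : Tendsto (fun b => (s.map (b - ·)).prod * q b) (𝓝[≠] a)
          (𝓝 ((s.map (a - ·)).prod * q a)) :=
        (hcont.continuousAt (isOpen_ball.mem_nhds ha)).mono_left nhdsWithin_le_nhds
      refine tendsto_nhds_unique h1 (h2.congr' ?_)
      filter_upwards [self_mem_nhdsWithin, mem_nhdsWithin_of_mem_nhds (isOpen_ball.mem_nhds ha)]
        with b hb hb'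
      exact (hne b hb' hb).symm
    · exact hne a ha hne'

/-- A polynomial of degree less than `n` divisible, in a disc, by a monic polynomial of degree `n`
all of whose zeros lie in the disc vanishes. -/
theorem eq_zero_of_lowSum_eq_mul {n : ℕ} {c d : Fin n → ℂ} {σ : ℝ} {q : ℂ → ℂ}
    (hq : ContinuousOn q (ball 0 σ)) (hc : ∀ a, a ^ n + lowSum c a = 0 → a ∈ ball (0 : ℂ) σ)
    (h : ∀ a ∈ ball (0 : ℂ) σ, lowSum d a = (a ^ n + lowSum c a) * q a) : d = 0 := by
  obtain ⟨s, hn, hs, hz⟩ := exists_multiset_pow_add_lowSum c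
  have h1 := prod_X_sub_C_dvd hq s (fun α hα => hc α (hz α hα)) (lowPoly d) fun a ha => by
    rw [eval_lowPoly, h a ha, hs]
  have h2 : lowPoly d = 0 := by
    refine Polynomial.eq_zero_of_dvd_of_degree_lt h1 ?_
    rw [Polynomial.degree_multiset_prod_of_monic _ fun p hp => by
      obtain ⟨α, -, rfl⟩ := Multiset.mem_map.1 hp
      exact Polynomial.monic_X_sub_C α]
    simp only [Multiset.map_map, Function.comp_def, Polynomial.degree_X_sub_C, Multiset.map_const',
      Multiset.sum_replicate, hn, nsmul_one]
    exact degree_lowPoly_lt d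
  funext i
  rw [← coeff_lowPoly d i, h2]
  simp

/-- A holomorphic function in a disc with zeros in a smaller disc only is the product of linear
factors and of a function without zeros. -/
theorem exists_factorization {ρ δ : ℝ} (hδ : 0 < δ) (hδρ : 5 * δ < ρ) {g : ℂ → ℂ}
    (hg : DifferentiableOn ℂ g (ball 0 ρ)) (hne : ∀ a ∈ ball (0 : ℂ) ρ, δ < ‖a‖ → g a ≠ 0) :
    ∃ (s : Multiset ℂ) (e : ℂ → ℂ), (∀ α ∈ s, ‖α‖ ≤ δ) ∧ DifferentiableOn ℂ e (ball 0 ρ) ∧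
      (∀ a ∈ ball (0 : ℂ) ρ, e a ≠ 0) ∧ ∀ a ∈ ball (0 : ℂ) ρ, g a = (s.map (a - ·)).prod * e a := by
  -- Otherwise linear factors can be split off without end. The bound `hbound` then forces g to
  -- vanish at 2δ, where it has no zero.
  by_contra hcon
  push Not at hcon
  have hstep : ∀ N : ℕ, ∃ (s : Multiset ℂ) (e : ℂ → ℂ), Multiset.card s = N ∧ (∀ α ∈ s, ‖α‖ ≤ δ) ∧
      DifferentiableOn ℂ e (ball 0 ρ) ∧
      ∀ a ∈ ball (0 : ℂ) ρ, g a = (s.map (a - ·)).prod * e a := by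
    intro N
    induction N with
    | zero => exact ⟨0, g, by simp, by simp, hg, by simp⟩
    | succ N ih =>
      obtain ⟨s, e, hN, hs, he, hge⟩ := ih
      have : ∃ α ∈ ball (0 : ℂ) ρ, e α = 0 := by
        by_contra! h
        obtain ⟨a, ha, h'⟩ := hcon s e hs he h
        exact h' (hge a ha)
      obtain ⟨α, hα, h0⟩ := this
      have hαδ : ‖α‖ ≤ δ := by
        by_contra! h
        exact hne α hα h (by rw [hge α hα, h0, mul_zero])
      refine ⟨α ::ₘ s, dslope e α, by simp [hN], ?_, ?_, ?_⟩
      · intro β hβ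
        rcases Multiset.mem_cons.1 hβ with rfl | hβ
        · exact hαδ
        · exact hs β hβ
      · exact (Complex.differentiableOn_dslope (isOpen_ball.mem_nhds hα)).2 he
      · intro a ha
        have h1 := sub_smul_dslope e α a
        rw [h0, sub_zero, smul_eq_mul] at h1
        rw [Multiset.map_cons, Multiset.prod_cons, hge a ha, ← h1]
        ring
  have hsub : closedBall (0 : ℂ) (5 * δ) ⊆ ball 0 ρ := closedBall_subset_ball hδρ
  obtain ⟨M, hM⟩ := (isCompact_closedBall (0 : ℂ) (5 * δ)).exists_bound_of_continuousOn
    (hg.continuousOn.mono hsub)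
  have hp : ((2 * δ : ℝ) : ℂ) ∈ closedBall (0 : ℂ) (5 * δ) := by
    rw [mem_closedBall_zero_iff, Complex.norm_real, Real.norm_eq_abs, abs_of_pos (by positivity)]
    linarith
  have hpn : ‖((2 * δ : ℝ) : ℂ)‖ = 2 * δ := by
    rw [Complex.norm_real, Real.norm_eq_abs, abs_of_pos (by positivity)]
  have hprod_le : ∀ (s : Multiset ℂ), (∀ α ∈ s, ‖α‖ ≤ δ) →
      ‖(s.map (((2 * δ : ℝ) : ℂ) - ·)).prod‖ ≤ (3 * δ) ^ Multiset.card s := by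
    intro s
    induction s using Multiset.induction_on with
    | empty => simp
    | cons α s ih =>
      intro hs
      rw [Multiset.map_cons, Multiset.prod_cons, norm_mul, Multiset.card_cons, pow_succ']
      have h1 := hs α (Multiset.mem_cons_self α s)
      have h2 := norm_sub_le ((2 * δ : ℝ) : ℂ) α
      exact mul_le_mul (by linarith) (ih fun β hβ => hs β (Multiset.mem_cons_of_mem hβ))
        (norm_nonneg _) (by positivity)
  have hprod_ge : ∀ (s : Multiset ℂ), (∀ α ∈ s, ‖α‖ ≤ δ) → ∀ t : ℂ, ‖t‖ = 5 * δ →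
      (4 * δ) ^ Multiset.card s ≤ ‖(s.map (t - ·)).prod‖ := by
    intro s
    induction s using Multiset.induction_on with
    | empty => simp
    | cons α s ih =>
      intro hs t ht
      rw [Multiset.map_cons, Multiset.prod_cons, norm_mul, Multiset.card_cons, pow_succ']
      have h1 := hs α (Multiset.mem_cons_self α s)
      have h2 := norm_sub_norm_le t α
      exact mul_le_mul (by linarith) (ih (fun β hβ => hs β (Multiset.mem_cons_of_mem hβ)) t ht)
        (by positivity) (norm_nonneg _)
  have hbound : ∀ N : ℕ, ‖g ((2 * δ : ℝ) : ℂ)‖ ≤ M * (3 / 4) ^ N := by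
    intro N
    obtain ⟨s, e, hN, hs, he, hge⟩ := hstep N
    -- A linear factor has modulus at least 4δ on |t| = 5δ and at most 3δ at the point 2δ. With the
    -- maximum principle for e, each factor gains 3/4.
    have hmax : ‖e ((2 * δ : ℝ) : ℂ)‖ ≤ M / (4 * δ) ^ N := by
      refine Complex.norm_le_of_forall_mem_frontier_norm_le (U := ball 0 (5 * δ)) isBounded_ball
        ((he.mono hsub).diffContOnCl_ball subset_rfl) (fun t ht => ?_)
        (by rwa [closure_ball _ (by positivity)])
      rw [frontier_ball _ (by positivity)] at ht
      have ht' : ‖t‖ = 5 * δ := by simpa using ht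
      rw [le_div_iff₀ (by positivity), mul_comm]
      have htb := sphere_subset_closedBall ht
      calc (4 * δ) ^ N * ‖e t‖ ≤ ‖(s.map (t - ·)).prod‖ * ‖e t‖ := by
            gcongr
            rw [← hN]
            exact hprod_ge s hs t ht'
        _ = ‖g t‖ := by rw [hge t (hsub htb), norm_mul]
        _ ≤ M := hM t htb
    rw [hge _ (hsub hp), norm_mul]
    have h1 := hprod_le s hs
    rw [hN] at h1
    calc _ ≤ (3 * δ) ^ N * (M / (4 * δ) ^ N) := by gcongr
      _ = M * (3 / 4) ^ N := by
        rw [mul_pow, mul_pow, div_pow]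
        field_simp
  have hlim : Tendsto (fun N : ℕ => M * (3 / 4 : ℝ) ^ N) atTop (𝓝 0) := by
    simpa using (tendsto_pow_atTop_nhds_zero_of_lt_one (by norm_num : (0 : ℝ) ≤ 3 / 4)
      (by norm_num)).const_mul M
  have h0 := ge_of_tendsto' hlim hbound
  refine hne _ (hsub hp) (by rw [hpn]; linarith) (norm_le_zero_iff.1 h0)

theorem differentiable_prod_sub (s : Multiset ℂ) :
    Differentiable ℂ fun a => (s.map (a - ·)).prod := by
  induction s using Multiset.induction_on with
  | empty => simp
  | cons α s ih =>
    simp only [Multiset.map_cons, Multiset.prod_cons]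
    exact (differentiable_id.sub_const α).mul ih

theorem prod_sub_ne_zero {δ : ℝ} {s : Multiset ℂ} (hs : ∀ α ∈ s, ‖α‖ ≤ δ) {a : ℂ} (ha : δ < ‖a‖) :
    (s.map (a - ·)).prod ≠ 0 := by
  refine Multiset.prod_ne_zero fun h => ?_
  obtain ⟨α, hα, h0⟩ := Multiset.mem_map.1 h
  have := hs α hα
  rw [sub_eq_zero.1 h0] at ha
  linarith

/-- The logarithmic derivative turns a factor a - α into (t - α)⁻¹, and Cauchy's formula evaluates
tˡ at α. The zero-free factor contributes a holomorphic integrand. -/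
theorem circleIntegral_pow_mul_logDeriv {ρ δ τ : ℝ} (hδ : δ < τ) (hτ : 0 < τ) (hτρ : τ < ρ)
    {e : ℂ → ℂ} (he : DifferentiableOn ℂ e (ball 0 ρ)) (hne : ∀ a ∈ ball (0 : ℂ) ρ, e a ≠ 0)
    (l : ℕ) (s : Multiset ℂ) (hs : ∀ α ∈ s, ‖α‖ ≤ δ) :
    (∮ t in C(0, τ), t ^ l * logDeriv (fun a => (s.map (a - ·)).prod * e a) t) =
      2 * Real.pi * Complex.I * (s.map (· ^ l)).sum := by
  have hsub : closedBall (0 : ℂ) τ ⊆ ball 0 ρ := closedBall_subset_ball hτρ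
  have hderiv : ∀ (f : ℂ → ℂ), DifferentiableOn ℂ f (ball 0 ρ) → ∀ K ⊆ ball (0 : ℂ) ρ,
      (∀ t ∈ K, f t ≠ 0) → ContinuousOn (fun t => t ^ l * logDeriv f t) K := by
    intro f hf K hK h0
    refine (continuousOn_pow l).mul (ContinuousOn.div ?_ (hf.continuousOn.mono hK) h0)
    exact ((hf.deriv isOpen_ball).continuousOn).mono hK
  have hsn : ∀ t ∈ sphere (0 : ℂ) τ, ‖t‖ = τ := fun t ht => by simpa using ht
  induction s using Multiset.induction_on with
  | empty =>
    simp only [Multiset.map_zero, Multiset.prod_zero, one_mul, Multiset.sum_zero, mul_zero]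
    refine Complex.circleIntegral_eq_zero_of_differentiable_on_off_countable hτ.le countable_empty
      (hderiv e he _ hsub fun t ht => hne t (hsub ht)) fun t ht => ?_
    have ht' : t ∈ ball (0 : ℂ) ρ := hsub (ball_subset_closedBall ht.1)
    have h1 := (he.deriv isOpen_ball).differentiableAt (isOpen_ball.mem_nhds ht')
    have h2 := he.differentiableAt (isOpen_ball.mem_nhds ht')
    exact (differentiableAt_id.pow l).mul (h1.div h2 (hne t ht'))
  | cons α s ih =>
    have hα := hs α (Multiset.mem_cons_self α s)
    have hs' : ∀ β ∈ s, ‖β‖ ≤ δ := fun β hβ => hs β (Multiset.mem_cons_of_mem hβ)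
    have hfd : DifferentiableOn ℂ (fun a => (s.map (a - ·)).prod * e a) (ball 0 ρ) :=
      (differentiable_prod_sub s).differentiableOn.mul he
    have hf0 : ∀ t ∈ sphere (0 : ℂ) τ, (s.map (t - ·)).prod * e t ≠ 0 := fun t ht =>
      mul_ne_zero (prod_sub_ne_zero hs' (by rw [hsn t ht]; exact hδ))
        (hne t (hsub (sphere_subset_closedBall ht)))
    have hαt : ∀ t ∈ sphere (0 : ℂ) τ, t - α ≠ 0 := fun t ht h => by
      have := hsn t ht
      rw [sub_eq_zero.1 h] at this
      linarith
    have hcongr : (∮ t in C(0, τ), t ^ l * logDeriv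
        (fun a => ((α ::ₘ s).map (a - ·)).prod * e a) t) =
        ∮ t in C(0, τ), (((t - α)⁻¹ • t ^ l) +
          t ^ l * logDeriv (fun a => (s.map (a - ·)).prod * e a) t) := by
      refine circleIntegral.integral_congr hτ.le fun t ht => ?_
      have h1 : (fun a => ((α ::ₘ s).map (a - ·)).prod * e a) =
          fun a => (a - α) * ((s.map (a - ·)).prod * e a) := by
        funext a
        rw [Multiset.map_cons, Multiset.prod_cons, mul_assoc]
      simp only [h1]
      rw [logDeriv_mul (f := fun a => a - α) t (hαt t ht) (hf0 t ht) (by fun_prop)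
        (hfd.differentiableAt (isOpen_ball.mem_nhds (hsub (sphere_subset_closedBall ht))))]
      simp [logDeriv_apply]
      ring
    have hi1 : CircleIntegrable (fun t => (t - α)⁻¹ • t ^ l) 0 τ :=
      ContinuousOn.circleIntegrable hτ.le
        (ContinuousOn.smul (ContinuousOn.inv₀ (by fun_prop) hαt) (by fun_prop))
    have hi2 : CircleIntegrable
        (fun t => t ^ l * logDeriv (fun a => (s.map (a - ·)).prod * e a) t) 0 τ :=
      ContinuousOn.circleIntegrable hτ.le
        (hderiv _ hfd _ (sphere_subset_closedBall.trans hsub) hf0)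
    rw [hcongr, circleIntegral.integral_add hi1 hi2, ih hs', Multiset.map_cons, Multiset.sum_cons,
      mul_add]
    congr 1
    have := Complex.circleIntegral_sub_inv_smul_of_differentiable_on_off_countable
      (f := fun t => t ^ l) (c := 0) (R := τ) (w := α) countable_empty
      (by simpa using lt_of_le_of_lt hα hδ) (by fun_prop) fun t _ => by fun_prop
    rw [this, smul_eq_mul]

/-- Newton's identities. -/
theorem Multiset.mul_esymm_eq_sum (s : Multiset ℂ) (k : ℕ) :
    (k : ℂ) * s.esymm k = (-1) ^ (k + 1) * ∑ a ∈ Finset.HasAntidiagonal.antidiagonal k with a.1 < k,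
      (-1) ^ a.1 * s.esymm a.1 * (s.map (· ^ a.2)).sum := by
  obtain ⟨l, rfl⟩ := Quot.exists_rep s
  have hl : (Finset.univ.val.map l.get : Multiset ℂ) = Quot.mk _ l := by
    change _ = (l : Multiset ℂ)
    rw [Fin.univ_def, Multiset.map_coe, List.map_get_finRange]
  have h := congrArg (MvPolynomial.aeval l.get) (MvPolynomial.mul_esymm_eq_sum (Fin l.length) ℂ k)
  simp only [map_mul, map_sum, map_pow, map_neg, map_one, map_natCast,
    MvPolynomial.aeval_esymm_eq_multiset_esymm, MvPolynomial.psum, MvPolynomial.aeval_X, hl] at h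
  rw [h]
  congr 1
  refine Finset.sum_congr rfl fun a _ => ?_
  congr 1
  rw [← hl, Multiset.map_map]
  rfl

/-- Newton's identities express each elementary symmetric function by power sums and by lower ones.
This avoids choosing the roots holomorphically. -/
theorem differentiableOn_esymm {Z : Set ℂ} {s : ℂ → Multiset ℂ}
    (h : ∀ l : ℕ, DifferentiableOn ℂ (fun z => ((s z).map (· ^ l)).sum) Z) (k : ℕ) :
    DifferentiableOn ℂ (fun z => (s z).esymm k) Z := by
  induction k using Nat.strong_induction_on with
  | _ k ih =>
    rcases Nat.eq_zero_or_pos k with rfl | hk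
    · simp [Multiset.esymm]
    · have hk' : (k : ℂ) ≠ 0 := by exact_mod_cast hk.ne'
      have : (fun z => (s z).esymm k) = fun z => (k : ℂ)⁻¹ * ((-1) ^ (k + 1) *
          ∑ a ∈ Finset.HasAntidiagonal.antidiagonal k with a.1 < k,
            (-1) ^ a.1 * (s z).esymm a.1 * ((s z).map (· ^ a.2)).sum) := by
        funext z
        rw [← Multiset.mul_esymm_eq_sum, inv_mul_cancel_left₀ hk']
      rw [this]
      refine ((DifferentiableOn.fun_sum fun a ha => ?_).const_mul _).const_mul _
      exact ((ih a.1 (Finset.mem_filter.1 ha).2).const_mul _).mul (h a.2)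

open Polynomial in
theorem prod_sub_eq_pow_add_lowSum {n : ℕ} {s : Multiset ℂ} (hs : Multiset.card s = n) (a : ℂ) :
    (s.map (a - ·)).prod =
      a ^ n + lowSum (fun i : Fin n => (-1) ^ (i.val + 1) * s.esymm (i.val + 1)) a := by
  have hm : (s.map fun α => X - C α).prod.Monic := monic_multiset_prod_of_monic _ _ fun α _ =>
    monic_X_sub_C α
  have hd : (s.map fun α => X - C α).prod.natDegree = n := by
    rw [natDegree_multiset_prod_X_sub_C_eq_card, hs]
  have h1 := pow_add_lowSum_of_monic hm hd a
  have h2 : (s.map fun α => X - C α).prod.eval a = (s.map (a - ·)).prod := by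
    rw [eval_multiset_prod, Multiset.map_map]
    simp
  rw [← h2, h1]
  congr 2
  funext i
  have hi := i.2
  rw [Multiset.prod_X_sub_C_coeff _ (by omega), hs,
    show n - (n - (i.val + 1)) = i.val + 1 by omega]

theorem Multiset.norm_esymm_le {s : Multiset ℂ} {δ : ℝ} (hδ : 0 ≤ δ) (hs : ∀ α ∈ s, ‖α‖ ≤ δ)
    (k : ℕ) : ‖s.esymm k‖ ≤ (Multiset.card s).choose k * δ ^ k := by
  have hprod : ∀ t : Multiset ℂ, (∀ α ∈ t, ‖α‖ ≤ δ) → ‖t.prod‖ ≤ δ ^ Multiset.card t := by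
    intro t
    induction t using Multiset.induction_on with
    | empty => simp
    | cons α t ih =>
      intro ht
      rw [Multiset.prod_cons, norm_mul, Multiset.card_cons, pow_succ']
      exact mul_le_mul (ht α (Multiset.mem_cons_self α t))
        (ih fun β hβ => ht β (Multiset.mem_cons_of_mem hβ)) (norm_nonneg _) hδ
  have hsum : ∀ (m : Multiset (Multiset ℂ)) (B : ℝ), (∀ t ∈ m, ‖t.prod‖ ≤ B) →
      ‖(m.map Multiset.prod).sum‖ ≤ Multiset.card m * B := by
    intro m B
    induction m using Multiset.induction_on with
    | empty => simp
    | cons t m ih =>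
      intro h
      rw [Multiset.map_cons, Multiset.sum_cons, Multiset.card_cons]
      push_cast
      have h1 := h t (Multiset.mem_cons_self t m)
      have h2 := ih fun u hu => h u (Multiset.mem_cons_of_mem hu)
      have h3 := norm_add_le t.prod (m.map Multiset.prod).sum
      linarith
  rw [Multiset.esymm, ← Multiset.card_powersetCard]
  refine hsum _ _ fun t ht => ?_
  obtain ⟨h1, h2⟩ := Multiset.mem_powersetCard.1 ht
  rw [← h2]
  exact hprod t fun α hα => hs α (Multiset.mem_of_le h1 hα)

end

noncomputable section

open Set Metric Filter

/-! ### Holomorphic functions of two variables on a product with a disc -/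

section Product

variable {Z : Set ℂ} {σ : ℝ} {G : ℂ × ℂ → ℂ}

theorem deriv_slice_eq {z a : ℂ} (h : DifferentiableAt ℂ G (z, a)) :
    deriv (fun b => G (z, b)) a = fderiv ℂ G (z, a) (0, 1) := by
  have h1 : HasDerivAt (fun b : ℂ => (z, b)) (0, 1) a :=
    (hasDerivAt_const a z).prodMk (hasDerivAt_id a)
  exact (h.hasFDerivAt.comp_hasDerivAt a h1).deriv

theorem differentiableOn_slice_fst (hG : AnalyticOnNhd ℂ G (Z ×ˢ ball 0 σ)) {a : ℂ}
    (ha : a ∈ ball (0 : ℂ) σ) : DifferentiableOn ℂ (fun z => G (z, a)) Z := fun z hz =>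
  ((hG (z, a) ⟨hz, ha⟩).differentiableAt.comp z (f := fun z => (z, a))
    (by fun_prop)).differentiableWithinAt

theorem differentiableOn_slice_snd (hG : AnalyticOnNhd ℂ G (Z ×ˢ ball 0 σ)) {z : ℂ}
    (hz : z ∈ Z) : DifferentiableOn ℂ (fun a => G (z, a)) (ball 0 σ) := fun a ha =>
  ((hG (z, a) ⟨hz, ha⟩).differentiableAt.comp a (f := fun a => (z, a))
    (by fun_prop)).differentiableWithinAt

/-- The power sums of the zeros of `G (z, ·)` depend holomorphically on `z`. -/
theorem differentiableOn_circleIntegral_logDeriv (hZ : IsOpen Z)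
    (hG : AnalyticOnNhd ℂ G (Z ×ˢ ball 0 σ)) {τ : ℝ} (hτ : 0 < τ) (hτσ : τ < σ)
    (hne : ∀ z ∈ Z, ∀ t ∈ sphere (0 : ℂ) τ, G (z, t) ≠ 0) (l : ℕ) :
    DifferentiableOn ℂ (fun z => ∮ t in C(0, τ), t ^ l * logDeriv (fun a => G (z, a)) t) Z := by
  have hsub : sphere (0 : ℂ) τ ⊆ ball 0 σ :=
    sphere_subset_closedBall.trans (closedBall_subset_ball hτσ)
  have hf : AnalyticOnNhd ℂ (fun p => fderiv ℂ G p (0, 1)) (Z ×ˢ ball 0 σ) := fun p hp =>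
    ((ContinuousLinearMap.apply ℂ ℂ ((0 : ℂ), (1 : ℂ))).analyticAt _).comp (hG p hp).fderiv
  have heq : ∀ z ∈ Z, ∀ t ∈ sphere (0 : ℂ) τ, t ^ l * logDeriv (fun a => G (z, a)) t =
      t ^ l * (fderiv ℂ G (z, t) (0, 1) / G (z, t)) := by
    intro z hz t ht
    rw [logDeriv_apply, deriv_slice_eq (hG (z, t) ⟨hz, hsub ht⟩).differentiableAt]
  refine (differentiableOn_circleIntegral
    (K := fun z t => t ^ l * (fderiv ℂ G (z, t) (0, 1) / G (z, t))) hZ hτ ?_ ?_).congr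
      fun z hz => circleIntegral.integral_congr hτ.le (heq z hz)
  · have hs : Z ×ˢ sphere (0 : ℂ) τ ⊆ Z ×ˢ ball 0 σ := prod_mono subset_rfl hsub
    exact (by fun_prop : ContinuousOn (fun p : ℂ × ℂ => p.2 ^ l) _).mul
      ((hf.continuousOn.mono hs).div (hG.continuousOn.mono hs) fun p hp => hne _ hp.1 _ hp.2)
  · intro t ht
    exact ((differentiableOn_slice_fst hf (hsub ht)).div (differentiableOn_slice_fst hG (hsub ht))
      fun z hz => hne z hz t ht).const_mul _

/-- A Weierstrass preparation theorem: if the zeros of `G` stay near `a = 0` and, for `z` in a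
non-empty open set, `G (z, ·)` has `n` zeros, then `G` is a Weierstrass polynomial of degree `n` up
to functions without zeros. -/
theorem exists_weierstrass (hZ : IsOpen Z) (hZc : IsPreconnected Z)
    (hG : AnalyticOnNhd ℂ G (Z ×ˢ ball 0 σ)) {δ : ℝ} (hδ : 0 < δ) (hδσ : 5 * δ < σ) (hδ1 : δ ≤ 1)
    (hne : ∀ z ∈ Z, ∀ a ∈ ball (0 : ℂ) σ, δ < ‖a‖ → G (z, a) ≠ 0) {n : ℕ} {Z₀ : Set ℂ}
    (hZ₀ : IsOpen Z₀) (hZ₀n : Z₀.Nonempty) (hZ₀Z : Z₀ ⊆ Z)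
    (hn : ∀ z ∈ Z₀, ∃ (c : Fin n → ℂ) (v : ℂ → ℂ), (∀ a, a ^ n + lowSum c a = 0 → ‖a‖ ≤ δ) ∧
      DifferentiableOn ℂ v (ball 0 σ) ∧ (∀ a ∈ ball (0 : ℂ) σ, v a ≠ 0) ∧
      ∀ a ∈ ball (0 : ℂ) σ, G (z, a) = (a ^ n + lowSum c a) * v a) :
    ∃ e : Fin n → ℂ → ℂ, (∀ i, DifferentiableOn ℂ (e i) Z) ∧
      (∀ z ∈ Z, ∀ i, ‖e i z‖ ≤ 2 ^ n * δ) ∧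
      ∀ z ∈ Z, (∀ a, a ^ n + lowSum (e · z) a = 0 → ‖a‖ ≤ δ) ∧
        ∃ v : ℂ → ℂ, DifferentiableOn ℂ v (ball 0 σ) ∧ (∀ a ∈ ball (0 : ℂ) σ, v a ≠ 0) ∧
          ∀ a ∈ ball (0 : ℂ) σ, G (z, a) = (a ^ n + lowSum (e · z) a) * v a := by
  have hτ : 0 < 2 * δ := by positivity
  have hτσ : 2 * δ < σ := by linarith
  have hsub : sphere (0 : ℂ) (2 * δ) ⊆ ball 0 σ :=
    sphere_subset_closedBall.trans (closedBall_subset_ball hτσ)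
  have hpi : (2 * Real.pi * Complex.I : ℂ) ≠ 0 := Complex.two_pi_I_ne_zero
  choose! s v hs hvd hv0 hGv using fun z (hz : z ∈ Z) =>
    exists_factorization hδ hδσ (differentiableOn_slice_snd hG hz) (hne z hz)
  -- The circle |t| = 2δ encloses all zeros, so the power sums do not depend on the chosen
  -- factorization and, by `hpow`, are holomorphic in z.
  have hint : ∀ z ∈ Z, ∀ l : ℕ, ∀ (s : Multiset ℂ) (v : ℂ → ℂ), (∀ α ∈ s, ‖α‖ ≤ δ) →
      DifferentiableOn ℂ v (ball 0 σ) → (∀ a ∈ ball (0 : ℂ) σ, v a ≠ 0) →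
      (∀ a ∈ ball (0 : ℂ) σ, G (z, a) = (s.map (a - ·)).prod * v a) →
      (∮ t in C(0, 2 * δ), t ^ l * logDeriv (fun a => G (z, a)) t) =
        2 * Real.pi * Complex.I * (s.map (· ^ l)).sum := by
    intro z hz l s v hs hvd hv0 hGv
    rw [← circleIntegral_pow_mul_logDeriv (by linarith) hτ hτσ hvd hv0 l s hs]
    refine circleIntegral.integral_congr hτ.le fun t ht => ?_
    have : (fun a => G (z, a)) =ᶠ[𝓝 t] fun a => (s.map (a - ·)).prod * v a := by
      filter_upwards [isOpen_ball.mem_nhds (hsub ht)] with a ha using hGv a ha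
    simp only [logDeriv_apply, this.deriv_eq, this.self_of_nhds]
  have hpow : ∀ l : ℕ, DifferentiableOn ℂ (fun z => ((s z).map (· ^ l)).sum) Z := by
    intro l
    refine ((differentiableOn_circleIntegral_logDeriv hZ hG hτ hτσ (fun z hz t ht => hne z hz t
      (hsub ht) ?_) l).const_mul (2 * Real.pi * Complex.I : ℂ)⁻¹).congr fun z hz => ?_
    · rw [mem_sphere_zero_iff_norm.1 ht]
      linarith
    · rw [hint z hz l (s z) (v z) (hs z hz) (hvd z hz) (hv0 z hz) (hGv z hz),
        inv_mul_cancel_left₀ hpi]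
  have hcard0 : ∀ z ∈ Z, ((s z).map (· ^ 0)).sum = (Multiset.card (s z) : ℂ) := by
    intro z _
    simp
  have hcard : ∀ z ∈ Z, Multiset.card (s z) = n := by
    obtain ⟨z₀, hz₀⟩ := hZ₀n
    -- The power sum with l = 0 counts the zeros. It is holomorphic and equals n on Z₀, hence on the
    -- connected set Z.
    have hev : (fun z => ((s z).map (· ^ 0)).sum) =ᶠ[𝓝 z₀] fun _ => (n : ℂ) := by
      filter_upwards [hZ₀.mem_nhds hz₀] with z hz
      obtain ⟨c, v', hc, hvd', hv0', hGv'⟩ := hn z hz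
      obtain ⟨s', hs'n, hs', hs'z⟩ := exists_multiset_pow_add_lowSum c
      have h1 := hint z (hZ₀Z hz) 0 (s z) (v z) (hs z (hZ₀Z hz)) (hvd z (hZ₀Z hz))
        (hv0 z (hZ₀Z hz)) (hGv z (hZ₀Z hz))
      have h2 := hint z (hZ₀Z hz) 0 s' v' (fun α hα => hc α (hs'z α hα)) hvd' hv0' fun a ha => by
        rw [hGv' a ha, hs']
      rw [h1] at h2
      rw [mul_left_cancel₀ hpi h2]
      simp [hs'n]
    have heq := ((hpow 0).analyticOnNhd hZ).eqOn_of_preconnected_of_eventuallyEq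
      (analyticOnNhd_const (v := (n : ℂ))) hZc (hZ₀Z hz₀) hev
    intro z hz
    have := heq hz
    simp only [hcard0 z hz] at this
    exact_mod_cast this
  have hP : ∀ z ∈ Z, ∀ a, ((s z).map (a - ·)).prod =
      a ^ n + lowSum (fun i : Fin n => (-1) ^ (i.val + 1) * (s z).esymm (i.val + 1)) a :=
    fun z hz => prod_sub_eq_pow_add_lowSum (hcard z hz)
  refine ⟨fun i z => (-1) ^ (i.val + 1) * (s z).esymm (i.val + 1), fun i =>
    (differentiableOn_esymm hpow _).const_mul _, fun z hz i => ?_, fun z hz => ⟨fun a ha => ?_,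
      v z, hvd z hz, hv0 z hz, fun a ha => ?_⟩⟩
  · rw [norm_mul, norm_pow, norm_neg, norm_one, one_pow, one_mul]
    refine (Multiset.norm_esymm_le hδ.le (hs z hz) _).trans ?_
    rw [hcard z hz]
    have h1 : (n.choose (i.val + 1) : ℝ) ≤ 2 ^ n := by exact_mod_cast Nat.choose_le_two_pow n _
    exact mul_le_mul h1 (pow_le_of_le_one hδ.le hδ1 (by omega)) (by positivity) (by positivity)
  · by_contra! h
    rw [← hP z hz] at ha
    exact prod_sub_ne_zero (hs z hz) h ha
  · rw [hGv z hz a ha, hP z hz]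

/-- If the quotient `A / B` is holomorphic and without zeros for fixed `z`, then it is holomorphic. -/
theorem exists_analytic_quotient (hZ : IsOpen Z) {A B : ℂ × ℂ → ℂ}
    (hA : AnalyticOnNhd ℂ A (Z ×ˢ ball 0 σ)) (hB : AnalyticOnNhd ℂ B (Z ×ˢ ball 0 σ)) {τ : ℝ}
    (hτ : 0 < τ) (hτσ : τ < σ) (hne : ∀ z ∈ Z, ∀ t ∈ sphere (0 : ℂ) τ, B (z, t) ≠ 0)
    (hq : ∀ z ∈ Z, ∃ q : ℂ → ℂ, DifferentiableOn ℂ q (ball 0 σ) ∧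
      (∀ a ∈ ball (0 : ℂ) τ, q a ≠ 0) ∧ ∀ a ∈ ball (0 : ℂ) σ, A (z, a) = B (z, a) * q a) :
    ∃ u : ℂ × ℂ → ℂ, ∀ z ∈ Z, ∀ a ∈ ball (0 : ℂ) τ,
      AnalyticAt ℂ u (z, a) ∧ u (z, a) ≠ 0 ∧ A (z, a) = u (z, a) * B (z, a) := by
  have hsub : sphere (0 : ℂ) τ ⊆ ball 0 σ :=
    sphere_subset_closedBall.trans (closedBall_subset_ball hτσ)
  -- The Cauchy integral of A/B over |t| = τ, where B has no zeros, is analytic in both variables;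
  -- on each slice it reproduces the given quotient q.
  refine ⟨fun p => (2 * Real.pi * Complex.I : ℂ)⁻¹ *
    ∮ t in C(0, τ), (t - p.2)⁻¹ * (A (p.1, t) / B (p.1, t)), fun z hz a ha => ⟨?_, ?_⟩⟩
  · refine analyticAt_const.mul (analyticAt_circleIntegral (K := fun z t => A (z, t) / B (z, t))
      hZ hτ ?_ ?_ hz ha)
    · have hs : Z ×ˢ sphere (0 : ℂ) τ ⊆ Z ×ˢ ball 0 σ := prod_mono subset_rfl hsub
      exact (hA.continuousOn.mono hs).div (hB.continuousOn.mono hs) fun p hp => hne _ hp.1 _ hp.2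
    · intro t ht
      exact (differentiableOn_slice_fst hA (hsub ht)).div (differentiableOn_slice_fst hB (hsub ht))
        fun z hz => hne z hz t ht
  · obtain ⟨q, hqd, hq0, hAq⟩ := hq z hz
    have h1 : (∮ t in C(0, τ), (t - a)⁻¹ * (A (z, t) / B (z, t))) =
        ∮ t in C(0, τ), (t - a)⁻¹ • q t := by
      refine circleIntegral.integral_congr hτ.le fun t ht => ?_
      simp only [hAq t (hsub ht), smul_eq_mul]
      rw [mul_div_cancel_left₀ _ (hne z hz t ht)]
    have h2 := ((hqd.mono (closedBall_subset_ball hτσ)).diffContOnCl_ball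
      subset_rfl).two_pi_i_inv_smul_circleIntegral_sub_inv_smul ha
    rw [← h1, smul_eq_mul] at h2
    simp only [h2]
    exact ⟨hq0 a ha, by rw [hAq a (ball_subset_ball hτσ.le ha), mul_comm]⟩

/-- The zeros of `G (·, w)` depend continuously on `w`. -/
theorem eventually_exists_zero {z₀ w₀ : ℂ} (hG : AnalyticAt ℂ G (z₀, w₀)) (h0 : G (z₀, w₀) = 0)
    (hne : ¬ ∀ᶠ z in 𝓝 z₀, G (z, w₀) = 0) {O : Set (ℂ × ℂ)} (hO : O ∈ 𝓝 (z₀, w₀)) :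
    ∀ᶠ w in 𝓝 w₀, ∃ z, (z, w) ∈ O ∧ G (z, w) = 0 := by
  have hO' := inter_mem hO hG.eventually_analyticAt
  rw [nhds_prod_eq] at hO'
  obtain ⟨u, hu, v, hv, huv⟩ := mem_prod_iff.1 hO'
  have h1 : AnalyticAt ℂ (fun z => G (z, w₀)) z₀ :=
    AnalyticAt.comp (f := fun z : ℂ => (z, w₀)) hG (by fun_prop)
  have h2 := (h1.eventually_eq_zero_or_eventually_ne_zero.resolve_left hne)
  rw [eventually_nhdsWithin_iff] at h2
  obtain ⟨s, hs, hsu⟩ := Metric.nhds_basis_closedBall.mem_iff.1 (inter_mem hu h2)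
  have hw₀ : w₀ ∈ v := mem_of_mem_nhds hv
  have hsph : ∀ z ∈ sphere z₀ s, G (z, w₀) ≠ 0 := fun z hz =>
    (hsu (sphere_subset_closedBall hz)).2 (ne_of_mem_sphere hz hs.ne')
  have han : ∀ z ∈ closedBall z₀ s, ∀ w ∈ v, AnalyticAt ℂ G (z, w) := fun z hz w hw =>
    (huv (mk_mem_prod (hsu hz).1 hw)).2
  have hcs : ContinuousOn (fun z => ‖G (z, w₀)‖) (sphere z₀ s) := fun z hz =>
    (((han z (sphere_subset_closedBall hz) w₀ hw₀).continuousAt.comp (f := fun z => (z, w₀))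
      (by fun_prop)).norm).continuousWithinAt
  obtain ⟨z₁, hz₁, hmin⟩ := (isCompact_sphere z₀ s).exists_isMinOn
    (NormedSpace.sphere_nonempty.2 hs.le) hcs
  set m := ‖G (z₁, w₀)‖ with hm
  have hm0 : 0 < m := norm_pos_iff.2 (hsph z₁ hz₁)
  have h3 : ∀ᶠ w in 𝓝 w₀, ∀ z ∈ sphere z₀ s, m / 2 < ‖G (z, w)‖ := by
    refine (isCompact_sphere z₀ s).eventually_forall_of_forall_eventually fun z hz => ?_
    have hc : ContinuousAt (fun p : ℂ × ℂ => ‖G (p.2, p.1)‖) (w₀, z) :=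
      ((han z (sphere_subset_closedBall hz) w₀ hw₀).continuousAt.comp
        (f := fun p : ℂ × ℂ => (p.2, p.1)) (x := (w₀, z)) (by fun_prop)).norm
    refine hc.eventually (lt_mem_nhds ?_)
    have := hmin hz
    simp only [mem_ofPred_eq] at this
    linarith
  have h4 : ∀ᶠ w in 𝓝 w₀, ‖G (z₀, w)‖ < m / 2 := by
    have hc : ContinuousAt (fun w : ℂ => ‖G (z₀, w)‖) w₀ :=
      (hG.continuousAt.comp (f := fun w : ℂ => (z₀, w)) (by fun_prop)).norm
    refine hc.eventually (gt_mem_nhds ?_)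
    change ‖G (z₀, w₀)‖ < m / 2
    rw [h0, norm_zero]
    positivity
  filter_upwards [h3, h4, hv] with w hw3 hw4 hwv
  -- Without zeros, 1/G(·, w) would be holomorphic on the disc and at most 2/m on its boundary, but
  -- larger than 2/m at the centre.
  by_contra! hcon
  have hnz : ∀ z ∈ closedBall z₀ s, G (z, w) ≠ 0 := fun z hz =>
    hcon z (huv (mk_mem_prod (hsu hz).1 hwv)).1
  have hd : DifferentiableOn ℂ (fun z => (G (z, w))⁻¹) (closedBall z₀ s) := fun z hz =>
    (((han z hz w hwv).differentiableAt.comp z (f := fun z => (z, w)) (by fun_prop)).inv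
      (hnz z hz)).differentiableWithinAt
  have hmax : ‖(G (z₀, w))⁻¹‖ ≤ (m / 2)⁻¹ := by
    refine Complex.norm_le_of_forall_mem_frontier_norm_le (U := ball z₀ s) isBounded_ball
      (hd.diffContOnCl_ball subset_rfl) (fun z hz => ?_)
      (subset_closure (mem_ball_self hs))
    rw [frontier_ball _ hs.ne'] at hz
    rw [norm_inv]
    exact inv_anti₀ (by positivity) (hw3 z hz).le
  rw [norm_inv, inv_le_inv₀ (norm_pos_iff.2 (hnz z₀ (mem_closedBall_self hs.le)))
    (by positivity)] at hmax
  linarith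

end Product

/-! ### Curves -/

theorem self_mem_principalStalk (f : ℂ × ℂ → ℂ) (x : ℂ × ℂ) : f ∈ principalStalk f x :=
  ⟨fun _ => 1, analyticAt_const, by simp⟩

theorem principalStalk_subset {f g : ℂ × ℂ → ℂ} {x : ℂ × ℂ} (h : g ∈ principalStalk f x) :
    principalStalk g x ⊆ principalStalk f x := by
  rintro k ⟨a, ha, hk⟩
  obtain ⟨b, hb, hg⟩ := h
  refine ⟨fun y => a y * b y, ha.mul hb, ?_⟩
  filter_upwards [hk, hg] with y h1 h2
  rw [h1, h2, mul_assoc]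

theorem principalStalk_eq_of_unit {f g u : ℂ × ℂ → ℂ} {x : ℂ × ℂ} (hu : AnalyticAt ℂ u x)
    (h0 : u x ≠ 0) (h : g =ᶠ[𝓝 x] fun y => u y * f y) : principalStalk g x = principalStalk f x := by
  refine (principalStalk_subset ⟨u, hu, h⟩).antisymm (principalStalk_subset
    ⟨fun y => (u y)⁻¹, hu.inv h0, ?_⟩)
  filter_upwards [h, hu.continuousAt.eventually_ne h0] with y h1 h2
  rw [h1, inv_mul_cancel_left₀ h2]

namespace Curve

variable {W V : Set (ℂ × ℂ)} {C : Curve W} {F G : ℂ × ℂ → ℂ}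

theorem IsDivOn.mono {V' : Set (ℂ × ℂ)} (h : C.IsDivOn V F) (hV : V' ⊆ V) : C.IsDivOn V' F :=
  fun x hx => h x (hV hx)

theorem mem_support_iff (hF : C.IsDivOn V F) {x : ℂ × ℂ} (hW : x ∈ W) (hV : x ∈ V) :
    x ∈ C.support ↔ F x = 0 := by
  have hs := hF ⟨x, hW⟩ hV
  constructor
  · rintro ⟨hx, h⟩
    exact h F (by rw [hs]; exact self_mem_principalStalk F x)
  · intro h
    refine ⟨hW, fun g hg => ?_⟩
    rw [hs] at hg
    obtain ⟨k, -, hk⟩ := hg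
    refine hk.self_of_nhds.trans ?_
    change k x * F x = 0
    rw [h, mul_zero]

theorem IsDivOn.not_eventuallyEq_zero (hF : C.IsDivOn V F) {x : ℂ × ℂ} (hW : x ∈ W) (hV : x ∈ V) :
    ¬ F =ᶠ[𝓝 x] 0 := by
  intro h0
  obtain ⟨V', -, hxV, -, f, -, hf0, hf⟩ := C.locally_principal ⟨x, hW⟩
  have h1 := self_mem_principalStalk f x
  rw [← hf ⟨x, hW⟩ hxV, hF ⟨x, hW⟩ hV] at h1
  obtain ⟨k, -, hk⟩ := h1
  refine hf0 x hxV ?_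
  filter_upwards [hk, h0] with y h1 h2
  rw [h1, h2]
  simp

/-- If the values differed, h - k would have no zero near x and F would vanish there. Continuity at
x suffices. -/
theorem eq_of_mul_eventuallyEq {h k : ℂ × ℂ → ℂ} {x : ℂ × ℂ} (hF : ¬ F =ᶠ[𝓝 x] 0)
    (hh : ContinuousAt h x) (hk : ContinuousAt k x)
    (he : (fun y => h y * F y) =ᶠ[𝓝 x] fun y => k y * F y) : h x = k x := by
  by_contra hne
  refine hF ?_
  filter_upwards [he, (hh.sub hk).eventually_ne (sub_ne_zero.2 hne)] with y h1 h2
  have : (h y - k y) * F y = 0 := by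
    rw [sub_mul, h1, sub_self]
  exact (mul_eq_zero.1 this).resolve_left h2

/-- Two generators of an ideal sheaf differ by a function without zeros. -/
theorem IsDivOn.exists_unit (hVo : IsOpen V) (hVW : V ⊆ W) (hF : C.IsDivOn V F)
    (hG : C.IsDivOn V G) : ∃ v : ℂ × ℂ → ℂ, AnalyticOnNhd ℂ v V ∧ (∀ x ∈ V, v x ≠ 0) ∧
      ∀ x ∈ V, G x = v x * F x := by
  have h1 : ∀ x ∈ V, ∃ h : ℂ × ℂ → ℂ, AnalyticAt ℂ h x ∧ G =ᶠ[𝓝 x] fun y => h y * F y := by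
    intro x hx
    have := self_mem_principalStalk G x
    rwa [← hG ⟨x, hVW hx⟩ hx, hF ⟨x, hVW hx⟩ hx] at this
  have h2 : ∀ x ∈ V, ∃ k : ℂ × ℂ → ℂ, AnalyticAt ℂ k x ∧ F =ᶠ[𝓝 x] fun y => k y * G y := by
    intro x hx
    have := self_mem_principalStalk F x
    rwa [← hF ⟨x, hVW hx⟩ hx, hG ⟨x, hVW hx⟩ hx] at this
  choose! h hh hGh using h1
  -- The quotient at x is the value of the local quotient chosen at x; cancellation shows that near
  -- x it agrees with the germ chosen at x.
  refine ⟨fun x => h x x, fun x hx => ?_, fun x hx h0 => ?_, fun x hx => (hGh x hx).self_of_nhds⟩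
  · refine (hh x hx).congr ?_
    filter_upwards [(hh x hx).eventually_analyticAt, (hGh x hx).eventually_nhds,
      hVo.mem_nhds hx] with y hy1 hy2 hy3
    exact eq_of_mul_eventuallyEq (hF.not_eventuallyEq_zero (hVW hy3) hy3) hy1.continuousAt
      (hh y hy3).continuousAt ((EventuallyEq.symm hy2).trans (hGh y hy3))
  · obtain ⟨k, hk, hFk⟩ := h2 x hx
    have := eq_of_mul_eventuallyEq (h := fun y => k y * h x y) (k := fun _ => 1)
      (hF.not_eventuallyEq_zero (hVW hx) hx) (hk.continuousAt.mul (hh x hx).continuousAt)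
      continuousAt_const (by
        filter_upwards [hFk, hGh x hx] with y h3 h4
        rw [one_mul, mul_assoc, ← h4, ← h3])
    rw [show h x x = 0 from h0, mul_zero] at this
    exact zero_ne_one this

end Curve

/-! ### The maximum principle for |w| on a curve -/

namespace DistortedCylinder

variable (D : DistortedCylinder)

theorem Vm_subset_W : D.Vm ⊆ D.W := fun x hx =>
  ⟨hx.1, hx.2.1, D.Vm_subset x hx.1 hx.2.1 hx.2.2.1 hx.2.2.2, hx.2.2.2⟩

theorem Vp_subset_W : D.Vp ⊆ D.W := fun x hx =>
  ⟨hx.1, D.Vp_subset x hx.1 hx.2.1 hx.2.2.1 hx.2.2.2, hx.2.2.1, hx.2.2.2⟩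

theorem exists_norm_gt {w : ℂ} {P : ℂ → Prop} (h : ∀ᶠ v in 𝓝 w, P v) : ∃ v, P v ∧ ‖w‖ < ‖v‖ := by
  obtain ⟨u, hu, hwu⟩ : ∃ u : ℂ, ‖u‖ = 1 ∧ ∀ t : ℝ, 0 ≤ t → ‖w + t * u‖ = ‖w‖ + t := by
    by_cases hw : w = 0
    · exact ⟨1, by simp, fun t ht => by simp [hw, abs_of_nonneg ht]⟩
    · have hw' : (‖w‖ : ℂ) ≠ 0 := by exact_mod_cast norm_ne_zero_iff.2 hw
      refine ⟨w / ‖w‖, by simp [hw], fun t ht => ?_⟩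
      have : w + t * (w / ‖w‖) = ((‖w‖ + t : ℝ) : ℂ) * (w / ‖w‖) := by
        push_cast
        field_simp
      rw [this, norm_mul, norm_div, Complex.norm_real, Complex.norm_real, norm_norm,
        div_self (norm_ne_zero_iff.2 hw), mul_one, Real.norm_eq_abs, abs_of_nonneg (by positivity)]
  have hc : Tendsto (fun t : ℝ => w + t * u) (𝓝[>] 0) (𝓝 w) := by
    have : Continuous fun t : ℝ => w + t * u := by fun_prop
    simpa using (this.tendsto 0).mono_left nhdsWithin_le_nhds
  obtain ⟨t, ht, ht0⟩ := ((hc.eventually h).and self_mem_nhdsWithin).exists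
  have ht0' : 0 < t := ht0
  exact ⟨_, ht, by rw [hwu t ht0'.le]; linarith⟩

/-- The maximum of `|w|` on a curve is attained at the ends of the cylinder. -/
theorem exists_mem_support_end {C : Curve D.W} {F : ℂ × ℂ → ℂ} (hF : AnalyticOnNhd ℂ F D.W)
    (hC : C.IsDivOn D.W F) {ρ' : ℝ} (hρ' : ρ' < D.ρ) (hs : ∀ x ∈ C.support, ‖x.2‖ < ρ')
    {x : ℂ × ℂ} (hx : x ∈ C.support) :
    ∃ y ∈ C.support, (y ∈ D.Vm ∨ y ∈ D.Vp) ∧ ‖x.2‖ ≤ ‖y.2‖ := by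
  by_contra! hcon
  let M : Set (ℂ × ℂ) :=
    {x | x ∈ closure D.W ∧ D.r' ≤ ‖D.z₁ x‖ ∧ ‖D.z₂ x‖ ≤ D.R' ∧ ‖x.2‖ ≤ ρ'}
  have hM : IsCompact M := D.isCompact_core ρ'
  have hMW : M ⊆ D.W := fun y hy => D.core_subset_W hρ' hy
  -- If the claim fails, all points of the curve at least as high as x avoid the ends, so they form
  -- a compact set and |w| attains a maximum on it.
  let M' : Set (ℂ × ℂ) := (M ∩ F ⁻¹' {0}) ∩ {y | ‖x.2‖ ≤ ‖y.2‖}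
  have hM' : IsCompact M' := by
    have h1 : IsClosed (M ∩ F ⁻¹' {0}) :=
      (hF.continuousOn.mono hMW).preimage_isClosed_of_isClosed hM.isClosed isClosed_singleton
    exact hM.of_isClosed_subset (h1.inter (isClosed_le continuous_const (by fun_prop)))
      fun y hy => hy.1.1
  have hmem : ∀ y ∈ C.support, ‖x.2‖ ≤ ‖y.2‖ → y ∈ M' := by
    intro y hy hxy
    have hyW : y ∈ D.W := hy.choose
    have hend : ¬ (y ∈ D.Vm ∨ y ∈ D.Vp) := fun h => absurd (hcon y hy h) (not_lt.2 hxy)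
    push Not at hend
    refine ⟨⟨⟨subset_closure hyW, ?_, ?_, (hs y hy).le⟩, (Curve.mem_support_iff hC hyW hyW).1 hy⟩, hxy⟩
    · by_contra! h
      exact hend.1 ⟨hyW.1, hyW.2.1, h, hyW.2.2.2⟩
    · by_contra! h
      exact hend.2 ⟨hyW.1, h, hyW.2.2.1, hyW.2.2.2⟩
  obtain ⟨y, hy, hmax⟩ := hM'.exists_isMaxOn ⟨x, hmem x hx le_rfl⟩
    (by fun_prop : ContinuousOn (fun y : ℂ × ℂ => ‖y.2‖) M')
  -- The slice of the curve at the maximal level is compact. It is also open: if F(·, y.2) did not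
  -- vanish near a zero, the zero would persist for nearby w, including some of larger modulus.
  -- Hence E is empty, a contradiction.
  let E : Set ℂ := {z | (z, y.2) ∈ M'}
  have hEc : IsCompact E := by
    have : Topology.IsClosedEmbedding (fun z : ℂ => (z, y.2)) :=
      ⟨isEmbedding_prodMkLeft y.2, by
        have : range (fun z : ℂ => (z, y.2)) = Prod.snd ⁻¹' {y.2} := by
          ext p
          simp [Prod.ext_iff, eq_comm]
        rw [this]
        exact isClosed_singleton.preimage continuous_snd⟩
    exact this.isCompact_preimage hM'
  have hEo : IsOpen E := by
    rw [isOpen_iff_mem_nhds]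
    intro z hz
    have hzW : (z, y.2) ∈ D.W := hMW hz.1.1
    have hz0 : F (z, y.2) = 0 := hz.1.2
    have hev : ∀ᶠ z' in 𝓝 z, F (z', y.2) = 0 := by
      by_contra hne
      obtain ⟨w, ⟨z', hz'W, hz'0⟩, hw⟩ := exists_norm_gt
        (eventually_exists_zero (hF _ hzW) hz0 hne (D.isOpen_W.mem_nhds hzW))
      have h1 := hmem (z', w) ((Curve.mem_support_iff hC hz'W hz'W).2 hz'0) (hy.2.trans hw.le)
      have h2 : ‖w‖ ≤ ‖y.2‖ := hmax h1
      linarith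
    have hcont : ContinuousAt (fun z : ℂ => (z, y.2)) z := by fun_prop
    filter_upwards [hev, hcont.preimage_mem_nhds (D.isOpen_W.mem_nhds hzW)] with z' h1 h2
    exact hmem (z', y.2) ((Curve.mem_support_iff hC h2 h2).2 h1) hy.2
  have hyE : y.1 ∈ E := hy
  rw [not_isCompact_of_isOpen hEo hEc] at hyE
  exact hyE

end DistortedCylinder

end

noncomputable section

open Set Metric Filter

/-! ### Maps with analytic difference quotients -/

section Slope

variable {E F G H : Type*} [NormedAddCommGroup E] [NormedSpace ℂ E] [NormedAddCommGroup F]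
  [NormedSpace ℂ F] [NormedAddCommGroup G] [NormedSpace ℂ G] [NormedAddCommGroup H]
  [NormedSpace ℂ H]

/-- Near `p` the differences `f a - f b` are given by an analytic family of continuous linear maps
applied to `a - b`. -/
def HasSlopeAt (f : E → F) (p : E) : Prop :=
  ∃ s : E × E → E →L[ℂ] F, AnalyticAt ℂ s (p, p) ∧
    ∀ᶠ x in 𝓝 (p, p), f x.1 - f x.2 = s x (x.1 - x.2)

theorem AnalyticAt.clm_apply_of_bilinear {f : E → F →L[ℂ] G} {g : E → F} {x : E}
    (hf : AnalyticAt ℂ f x) (hg : AnalyticAt ℂ g x) : AnalyticAt ℂ (fun a => f a (g a)) x :=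
  AnalyticAt.comp (f := fun a => (f a, g a))
    ((ContinuousLinearMap.id ℂ (F →L[ℂ] G)).analyticAt_bilinear (f x, g x)) (hf.prod hg)

theorem AnalyticAt.clm_comp_of_bilinear {f : E → G →L[ℂ] H} {g : E → F →L[ℂ] G} {x : E}
    (hf : AnalyticAt ℂ f x) (hg : AnalyticAt ℂ g x) : AnalyticAt ℂ (fun a => (f a).comp (g a)) x :=
  AnalyticAt.comp (f := fun a => (f a, g a))
    ((ContinuousLinearMap.compL ℂ F G H).analyticAt_bilinear (f x, g x)) (hf.prod hg)

namespace HasSlopeAt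

variable {f : E → F} {p : E}

/-- Fix the second argument of the slope at p. -/
theorem analyticAt (h : HasSlopeAt f p) : AnalyticAt ℂ f p := by
  obtain ⟨s, hs, h⟩ := h
  have hc : ContinuousAt (fun a : E => (a, p)) p := by fun_prop
  have h1 : AnalyticAt ℂ (fun a : E => (a, p)) p := analyticAt_id.prod analyticAt_const
  have h2 : AnalyticAt ℂ (fun a => f p + s (a, p) (a - p)) p :=
    analyticAt_const.add (AnalyticAt.clm_apply_of_bilinear
      (AnalyticAt.comp (f := fun a : E => (a, p)) hs h1) (analyticAt_id.sub analyticAt_const))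
  refine h2.congr ?_
  filter_upwards [hc.eventually h] with a ha
  rw [← ha, add_sub_cancel]

theorem continuousAt (h : HasSlopeAt f p) : ContinuousAt f p := h.analyticAt.continuousAt

theorem const (c : F) (p : E) : HasSlopeAt (fun _ => c) p :=
  ⟨fun _ => 0, analyticAt_const, Eventually.of_forall fun x => by simp⟩

theorem clm (L : E →L[ℂ] F) (p : E) : HasSlopeAt L p :=
  ⟨fun _ => L, analyticAt_const, Eventually.of_forall fun x => by simp⟩

theorem comp {g : F → G} (hg : HasSlopeAt g (f p)) (hf : HasSlopeAt f p) :
    HasSlopeAt (fun a => g (f a)) p := by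
  have ha := hf.analyticAt
  obtain ⟨t, ht, htt⟩ := hg
  obtain ⟨s, hs, hss⟩ := hf
  have h1 : AnalyticAt ℂ (fun x : E × E => (f x.1, f x.2)) (p, p) :=
    (AnalyticAt.comp (f := Prod.fst) (x := (p, p)) ha analyticAt_fst).prod
      (AnalyticAt.comp (f := Prod.snd) (x := (p, p)) ha analyticAt_snd)
  have h2 : AnalyticAt ℂ (fun x : E × E => t (f x.1, f x.2)) (p, p) :=
    AnalyticAt.comp (f := fun x : E × E => (f x.1, f x.2)) ht h1
  refine ⟨fun x => (t (f x.1, f x.2)).comp (s x), AnalyticAt.clm_comp_of_bilinear h2 hs, ?_⟩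
  filter_upwards [hss, h1.continuousAt.eventually htt] with x hx hx'
  rw [ContinuousLinearMap.comp_apply, ← hx]
  exact hx'

/-- The difference of products is B(f x₁)(g x₁ - g x₂) + B(f x₁ - f x₂)(g x₂). -/
theorem bilin {f : E → F} {g : E → G} (B : F →L[ℂ] G →L[ℂ] H) (hf : HasSlopeAt f p)
    (hg : HasSlopeAt g p) : HasSlopeAt (fun a => B (f a) (g a)) p := by
  have haf := hf.analyticAt
  have hag := hg.analyticAt
  obtain ⟨s, hs, hss⟩ := hf
  obtain ⟨t, ht, htt⟩ := hg
  have h1 : AnalyticAt ℂ (fun x : E × E => B (f x.1)) (p, p) :=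
    (B.analyticAt _).comp (AnalyticAt.comp (f := Prod.fst) (x := (p, p)) haf analyticAt_fst)
  have h2 : AnalyticAt ℂ (fun x : E × E => B.flip (g x.2)) (p, p) :=
    (B.flip.analyticAt _).comp (AnalyticAt.comp (f := Prod.snd) (x := (p, p)) hag analyticAt_snd)
  refine ⟨fun x => (B (f x.1)).comp (t x) + (B.flip (g x.2)).comp (s x),
    (AnalyticAt.clm_comp_of_bilinear h1 ht).add (AnalyticAt.clm_comp_of_bilinear h2 hs), ?_⟩
  filter_upwards [hss, htt] with x hx hx'
  rw [add_apply, ContinuousLinearMap.comp_apply, ContinuousLinearMap.comp_apply, ← hx, ← hx',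
    ContinuousLinearMap.flip_apply, map_sub, map_sub, sub_apply]
  abel

theorem prodMk {f : E → F} {g : E → G} (hf : HasSlopeAt f p) (hg : HasSlopeAt g p) :
    HasSlopeAt (fun a => (f a, g a)) p := by
  obtain ⟨s, hs, hss⟩ := hf
  obtain ⟨t, ht, htt⟩ := hg
  refine ⟨fun x => (ContinuousLinearMap.inl ℂ F G).comp (s x) +
    (ContinuousLinearMap.inr ℂ F G).comp (t x),
    (AnalyticAt.clm_comp_of_bilinear analyticAt_const hs).add (AnalyticAt.clm_comp_of_bilinear analyticAt_const ht), ?_⟩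
  filter_upwards [hss, htt] with x hx hx'
  simp [← hx, ← hx']

theorem add {f g : E → F} (hf : HasSlopeAt f p) (hg : HasSlopeAt g p) :
    HasSlopeAt (fun a => f a + g a) p :=
  comp (f := fun a => (f a, g a))
    (clm (ContinuousLinearMap.fst ℂ F F + ContinuousLinearMap.snd ℂ F F) (f p, g p))
    (hf.prodMk hg)

theorem clm_comp {f : E → G →L[ℂ] H} {g : E → F →L[ℂ] G} (hf : HasSlopeAt f p)
    (hg : HasSlopeAt g p) : HasSlopeAt (fun a => (f a).comp (g a)) p :=
  bilin (ContinuousLinearMap.compL ℂ F G H) hf hg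

theorem clm_apply {f : E → G →L[ℂ] H} {g : E → G} (hf : HasSlopeAt f p)
    (hg : HasSlopeAt g p) : HasSlopeAt (fun a => f a (g a)) p :=
  bilin (ContinuousLinearMap.id ℂ (G →L[ℂ] H)) hf hg

theorem clm_prod {f : E → F →L[ℂ] G} {g : E → F →L[ℂ] H} (hf : HasSlopeAt f p)
    (hg : HasSlopeAt g p) : HasSlopeAt (fun a => (f a).prod (g a)) p := by
  have h1 := ((const (ContinuousLinearMap.inl ℂ G H) p).clm_comp hf).add
    ((const (ContinuousLinearMap.inr ℂ G H) p).clm_comp hg)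
  convert h1 using 2 with a
  ext x <;> simp

theorem neg (hf : HasSlopeAt f p) : HasSlopeAt (fun a => -f a) p := by
  obtain ⟨s, hs, hss⟩ := hf
  refine ⟨fun x => -s x, hs.neg, ?_⟩
  filter_upwards [hss] with x hx
  rw [neg_apply, ← hx, neg_sub_neg, neg_sub]

/-- The resolvent identity a⁻¹ - b⁻¹ = -a⁻¹ (a - b) b⁻¹ is a slope, and inversion is analytic at
units. -/
theorem inverse [CompleteSpace F] {T : F →L[ℂ] F} (hT : IsUnit T) :
    HasSlopeAt (Ring.inverse : (F →L[ℂ] F) → F →L[ℂ] F) T := by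
  obtain ⟨u, rfl⟩ := hT
  have h1 : AnalyticAt ℂ (Ring.inverse : (F →L[ℂ] F) → F →L[ℂ] F) (u : F →L[ℂ] F) :=
    analyticAt_inverse u
  have h2 : AnalyticAt ℂ (fun x : (F →L[ℂ] F) × (F →L[ℂ] F) =>
      ContinuousLinearMap.compL ℂ F F F (Ring.inverse x.1)) ((u : F →L[ℂ] F), (u : F →L[ℂ] F)) :=
    (ContinuousLinearMap.analyticAt _ _).comp (AnalyticAt.comp (f := Prod.fst)
      (x := ((u : F →L[ℂ] F), (u : F →L[ℂ] F))) h1 analyticAt_fst)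
  have h3 : AnalyticAt ℂ (fun x : (F →L[ℂ] F) × (F →L[ℂ] F) =>
      (ContinuousLinearMap.compL ℂ F F F).flip (Ring.inverse x.2))
      ((u : F →L[ℂ] F), (u : F →L[ℂ] F)) :=
    (ContinuousLinearMap.analyticAt _ _).comp (AnalyticAt.comp (f := Prod.snd)
      (x := ((u : F →L[ℂ] F), (u : F →L[ℂ] F))) h1 analyticAt_snd)
  refine ⟨_, (AnalyticAt.clm_comp_of_bilinear h2 h3).neg, ?_⟩
  have hu : ∀ᶠ x in 𝓝 (u : F →L[ℂ] F), IsUnit x := Units.isOpen.mem_nhds u.isUnit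
  filter_upwards [continuousAt_fst.eventually hu, continuousAt_snd.eventually hu] with x hx hx'
  have h4 : Ring.inverse x.1 - Ring.inverse x.2 =
      -(Ring.inverse x.1 * ((x.1 - x.2) * Ring.inverse x.2)) := by
    rw [sub_mul, mul_sub, ← mul_assoc, Ring.inverse_mul_cancel _ hx, Ring.mul_inverse_cancel _ hx',
      one_mul, mul_one, neg_sub]
  exact h4

end HasSlopeAt

/-! ### Composition with morphisms -/

/-- If g - h = φ · f, then T ∘ g - T ∘ h = (s(g, h) ∘ φ) · f with s the slope of T. So T respects
the ideal generated by f, not only the values on the zero set. -/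
theorem ModelRel.comp {f : E → F} {x : E} {g h : E → G} {T : G → H} (hgh : ModelRel f x g h)
    (hT : HasSlopeAt T (g x)) (hx : g x = h x) (hg : AnalyticAt ℂ g x) (hh : AnalyticAt ℂ h x) :
    ModelRel f x (fun u => T (g u)) (fun u => T (h u)) := by
  obtain ⟨φ, hφ, hφ'⟩ := hgh
  obtain ⟨s, hs, hss⟩ := hT
  have h1 : AnalyticAt ℂ (fun u => (g u, h u)) x := hg.prod hh
  have h2 : (g x, h x) = (g x, g x) := by rw [hx]
  refine ⟨fun u => (s (g u, h u)).comp (φ u),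
    AnalyticAt.clm_comp_of_bilinear
      (AnalyticAt.comp (f := fun u => (g u, h u)) (by rwa [h2]) h1) hφ, ?_⟩
  have h3 : ∀ᶠ u in 𝓝 x, T (g u) - T (h u) = s (g u, h u) (g u - h u) :=
    h1.continuousAt.eventually (p := fun y : G × G => T y.1 - T y.2 = s y (y.1 - y.2))
      (by change ∀ᶠ y in 𝓝 (g x, h x), _; rwa [h2])
  filter_upwards [hφ', h3] with u hu hu'
  rw [hu', hu, ContinuousLinearMap.comp_apply]

theorem ModelRel.eq_of_zero {f : E → F} {x : E} {g h : E → G} (hgh : ModelRel f x g h)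
    (hx : f x = 0) : g x = h x := by
  obtain ⟨φ, -, h⟩ := hgh
  have := h.self_of_nhds
  rwa [hx, map_zero, sub_eq_zero] at this

theorem ModelRel.analyticAt {f : E → F} {x : E} {g h : E → G} (hgh : ModelRel f x g h)
    (hf : AnalyticAt ℂ f x) (hh : AnalyticAt ℂ h x) : AnalyticAt ℂ g x := by
  obtain ⟨φ, hφ, h⟩ := hgh
  refine (hh.add (AnalyticAt.clm_apply_of_bilinear hφ hf)).congr ?_
  filter_upwards [h] with u hu
  simp [← hu]

theorem ModelRel.prodMk {f : E → F} {x : E} {g h : E → G} {g' h' : E → H} (hgh : ModelRel f x g h)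
    (hgh' : ModelRel f x g' h') : ModelRel f x (fun u => (g u, g' u)) (fun u => (h u, h' u)) := by
  obtain ⟨φ, hφ, h1⟩ := hgh
  obtain ⟨φ', hφ', h2⟩ := hgh'
  refine ⟨fun u => (ContinuousLinearMap.inl ℂ G H).comp (φ u) +
    (ContinuousLinearMap.inr ℂ G H).comp (φ' u),
    (AnalyticAt.clm_comp_of_bilinear analyticAt_const hφ).add (AnalyticAt.clm_comp_of_bilinear analyticAt_const hφ'), ?_⟩
  filter_upwards [h1, h2] with u hu hu'
  simp [← hu, ← hu']

end Slope

namespace BanachAnalyticSpace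

universe w'

variable {Y : Type u} [TopologicalSpace Y] {X : BanachAnalyticSpace.{u, v} Y}
  {G : Type w} [NormedAddCommGroup G] [NormedSpace ℂ G]
  {H : Type w'} [NormedAddCommGroup H] [NormedSpace ℂ H]

theorem chart_mem {i : X.ι} {y : Y} (hy : y ∈ X.dom i) :
    X.chart i y ∈ X.U i ∧ X.f i (X.chart i y) = 0 := by
  have : X.chart i y ∈ X.chart i '' X.dom i := ⟨y, hy, rfl⟩
  rwa [X.chart_image i] at this

theorem continuousAt_chart {i : X.ι} {y : Y} (hy : y ∈ X.dom i) : ContinuousAt (X.chart i) y :=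
  (continuousOn_iff_continuous_domRestrict.2 (X.chart_embedding i).continuous).continuousAt
    ((X.isOpen_dom i).mem_nhds hy)

theorem Morphism.analyticAt (s : X.Morphism G) {i : X.ι} {y : Y} (hy : y ∈ X.dom i) :
    AnalyticAt ℂ (s.germ i y) (X.chart i y) := by
  obtain ⟨g, hg, h⟩ := s.isSection i y hy
  exact h.self_of_nhds.analyticAt (X.analytic_f i _ (chart_mem hy).1) hg

theorem analyticAt_trans {i j : X.ι} {y : Y} (hy : y ∈ X.dom i ∩ X.dom j) :
    AnalyticAt ℂ (X.trans i j y) (X.chart i y) := by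
  obtain ⟨g, hg, h⟩ := X.trans_section i j y hy
  exact h.self_of_nhds.analyticAt (X.analytic_f i _ (chart_mem hy.1).1) hg

/-- The conditions on a morphism are relations between germs, which `ModelRel.comp` preserves. The
germs take the values ψ y on the model space, so T needs slopes only at these values. -/
theorem IsHolomorphic.comp [CompleteSpace G] {ψ : Y → G} (hψ : X.IsHolomorphic ψ) {T : G → H}
    (hT : ∀ y, HasSlopeAt T (ψ y)) : X.IsHolomorphic fun y => T (ψ y) := by
  obtain ⟨s, hs⟩ := hψ
  refine ⟨⟨fun i y u => T (s.germ i y u), fun i y hy => ?_, fun i j y hy => ?_⟩,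
    fun i y hy => congrArg T (hs i y hy)⟩
  · obtain ⟨g, hg, h⟩ := s.isSection i y hy
    have hgy : g (X.chart i y) = ψ y := by
      rw [← h.self_of_nhds.eq_of_zero (chart_mem hy).2, hs i y hy]
    refine ⟨fun u => T (g u), AnalyticAt.comp (f := g) (by rw [hgy]; exact (hT y).analyticAt) hg, ?_⟩
    filter_upwards [h, (continuousAt_chart hy).eventually hg.eventually_analyticAt,
      (X.isOpen_dom i).mem_nhds hy] with y' h1 h2 h3
    exact h1.comp (by rw [hs i y' h3]; exact hT y') (h1.eq_of_zero (chart_mem h3).2)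
      (s.analyticAt h3) h2
  · have h1 := X.trans_apply i j y hy
    have h2 := s.compatible i j y hy
    refine h2.comp ?_ (h2.eq_of_zero (chart_mem hy.1).2) (AnalyticAt.comp (f := X.trans i j y)
      (by rw [h1]; exact s.analyticAt hy.2) (analyticAt_trans hy)) (s.analyticAt hy.1)
    rw [h1, hs j y hy.2]
    exact hT y

theorem IsHolomorphic.prodMk {ψ : Y → G} {φ : Y → H} (hψ : X.IsHolomorphic ψ)
    (hφ : X.IsHolomorphic φ) : X.IsHolomorphic fun y => (ψ y, φ y) := by
  obtain ⟨s, hs⟩ := hψ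
  obtain ⟨t, ht⟩ := hφ
  refine ⟨⟨fun i y u => (s.germ i y u, t.germ i y u), fun i y hy => ?_, fun i j y hy =>
    (s.compatible i j y hy).prodMk (t.compatible i j y hy)⟩,
    fun i y hy => Prod.ext (hs i y hy) (ht i y hy)⟩
  obtain ⟨g, hg, h⟩ := s.isSection i y hy
  obtain ⟨g', hg', h'⟩ := t.isSection i y hy
  refine ⟨fun u => (g u, g' u), hg.prod hg', ?_⟩
  filter_upwards [h, h'] with y' h1 h2
  exact h1.prodMk h2

end BanachAnalyticSpace

end

/-! ### Weierstrass polynomials with small coefficients -/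

noncomputable section

open Set Metric Filter

/-- For |a| > δ each lower term, multiplied by δⁿ, is at most μ|a|ⁿ; here δ ≤ 1 is used. All n
together stay below δⁿ|a|ⁿ. -/
theorem pow_add_lowSum_ne_zero {n : ℕ} {c : Fin n → ℂ} {δ μ : ℝ} (hδ : 0 < δ) (hδ1 : δ ≤ 1)
    (hμ : n * μ < δ ^ n) (hc : ∀ i, ‖c i‖ ≤ μ) {a : ℂ} (ha : δ < ‖a‖) : a ^ n + lowSum c a ≠ 0 := by
  rcases Nat.eq_zero_or_pos n with rfl | hn
  · simp [lowSum]
  have ha0 : 0 < ‖a‖ := hδ.trans ha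
  have hμ0 : 0 ≤ μ := (norm_nonneg _).trans (hc ⟨0, hn⟩)
  have hterm : ∀ i : Fin n, ‖c i * a ^ (n - (i.val + 1))‖ * δ ^ n ≤ μ * ‖a‖ ^ n := by
    intro i
    have hi := i.2
    rw [norm_mul, norm_pow, mul_assoc]
    refine mul_le_mul (hc i) ?_ (by positivity) hμ0
    calc ‖a‖ ^ (n - (i.val + 1)) * δ ^ n ≤ ‖a‖ ^ (n - (i.val + 1)) * δ ^ (i.val + 1) := by
          gcongr ?_ * ?_
          exact pow_le_pow_of_le_one hδ.le hδ1 hi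
      _ ≤ ‖a‖ ^ (n - (i.val + 1)) * ‖a‖ ^ (i.val + 1) := by gcongr
      _ = ‖a‖ ^ n := by rw [← pow_add]; congr 1; omega
  have hsum : ‖lowSum c a‖ * δ ^ n ≤ n * (μ * ‖a‖ ^ n) := by
    calc ‖lowSum c a‖ * δ ^ n ≤ (∑ i : Fin n, ‖c i * a ^ (n - (i.val + 1))‖) * δ ^ n := by
          gcongr
          exact norm_sum_le _ _
      _ ≤ ∑ _i : Fin n, μ * ‖a‖ ^ n := by
          rw [Finset.sum_mul]
          exact Finset.sum_le_sum fun i _ => hterm i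
      _ = n * (μ * ‖a‖ ^ n) := by simp
  intro h0
  have h1 : ‖lowSum c a‖ = ‖a‖ ^ n := by
    rw [← norm_pow, eq_neg_of_add_eq_zero_left h0, norm_neg]
  rw [h1] at hsum
  have h2 : 0 < ‖a‖ ^ n := by positivity
  nlinarith

theorem AnnulusSpace.exists_norm_eval_const (Sm Sp : SmoothnessClass) : ∃ c : ℝ, 0 ≤ c ∧
    ∀ (r R : ℝ), 0 < r → ∀ f : AnnulusSpace Sm Sp, ∀ z ∈ annulus r R,
      ‖f.eval r R z‖ ≤ c * ‖f‖ := by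
  obtain ⟨c, hc, h⟩ := AnnulusSpace.exists_bound Sm Sp
  refine ⟨c + c, by positivity, fun r R hr f z hz => ?_⟩
  obtain ⟨h1, h2⟩ := h r R hr f
  exact (norm_add_le _ _).trans (by linarith [h1 z hz.2, h2 z hz.1])

namespace ProductSpace

variable {S : SmoothnessClass} {σ r R : ℝ}

/-- The variation in w is small in norm, hence uniformly in ζ; what remains is continuity in ζ for
fixed w. -/
theorem continuousAt_eval (hr : 0 < r) (G : ProductSpace S σ) {ζ a : ℂ} (hζ : ζ ∈ annulus r R)
    (ha : a ∈ ball (0 : ℂ) σ) :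
    ContinuousAt (fun p : ℂ × ℂ => G.eval r R p.1 p.2) (ζ, a) := by
  obtain ⟨c, hc, h⟩ := AnnulusSpace.exists_norm_eval_const S S
  have h1 : ContinuousAt G.app a :=
    (G.differentiableOn_app.differentiableAt (isOpen_ball.mem_nhds ha)).continuousAt
  have h2 : ContinuousAt ((G.app a).eval r R) ζ :=
    (((G.app a).differentiableOn_eval hr).differentiableAt
      ((isOpen_annulus r R).mem_nhds hζ)).continuousAt
  have h3 : Tendsto (fun p : ℂ × ℂ => c * ‖G.app p.2 - G.app a‖) (𝓝 (ζ, a)) (𝓝 0) := by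
    have : ContinuousAt (fun p : ℂ × ℂ => c * ‖G.app p.2 - G.app a‖) (ζ, a) :=
      continuousAt_const.mul (((h1.comp (f := Prod.snd) (x := (ζ, a)) continuousAt_snd).sub
        continuousAt_const).norm)
    simpa [ContinuousAt] using this
  have h4 : Tendsto (fun p : ℂ × ℂ => (G.app p.2 - G.app a).eval r R p.1) (𝓝 (ζ, a)) (𝓝 0) := by
    refine squeeze_zero_norm' ?_ h3
    filter_upwards [continuousAt_fst.preimage_mem_nhds ((isOpen_annulus r R).mem_nhds hζ)] with p hp
    exact h r R hr _ _ hp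
  have h5 : Tendsto (fun p : ℂ × ℂ => (G.app a).eval r R p.1) (𝓝 (ζ, a))
      (𝓝 ((G.app a).eval r R ζ)) := h2.tendsto.comp continuousAt_fst
  have h6 := h4.add h5
  rw [zero_add] at h6
  change Tendsto _ _ (𝓝 (G.eval r R ζ a))
  rw [eval_eq]
  refine h6.congr fun p => ?_
  rw [eval_eq, AnnulusSpace.eval_sub, sub_add_cancel]

theorem differentiableOn_eval (hr : 0 < r) (G : ProductSpace S σ) {ζ : ℂ} (hζ : ζ ∈ annulus r R) :
    DifferentiableOn ℂ (fun a => G.eval r R ζ a) (ball 0 σ) := by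
  have h := (AnnulusSpace.evalCLM S S hr ⟨ζ, hζ⟩).differentiable.comp_differentiableOn
    G.differentiableOn_app
  refine h.congr fun a _ => ?_
  rw [eval_eq]
  rfl

/-- The Weierstrass polynomial with given coefficients. -/
def weier (S : SmoothnessClass) (σ : ℝ) {n : ℕ} (g : Fin n → AnnulusSpace S S) : ProductSpace S σ :=
  wpow S σ n + poly S σ n g

variable {n : ℕ}

theorem eval_poly' (g : Fin n → AnnulusSpace S S) {ζ a : ℂ} (ha : a ∈ ball (0 : ℂ) σ) :
    (poly S σ n g).eval r R ζ a = lowSum (fun i => (g i).eval r R ζ) a := by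
  rw [eval_poly g ha, lowSum]

theorem eval_weier (hr : 0 < r) (g : Fin n → AnnulusSpace S S) {ζ a : ℂ} (hζ : ζ ∈ annulus r R)
    (ha : a ∈ ball (0 : ℂ) σ) :
    (weier S σ g).eval r R ζ a = a ^ n + lowSum (fun i => (g i).eval r R ζ) a := by
  rw [weier, eval_add, eval_wpow hr n hζ ha, eval_poly' g ha]

theorem continuous_weier : Continuous (weier S σ (n := n)) :=
  continuous_const.add (poly S σ n).continuous

theorem weier_zero : weier S σ (0 : Fin n → AnnulusSpace S S) = wpow S σ n := by
  simp [weier]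

/-- A pointwise multiple of a Weierstrass polynomial has remainder zero. -/
theorem rem_weier_eq_zero (hr : 0 < r) (hrR : r < R) (hσ : 0 < σ) {g : Fin n → AnnulusSpace S S}
    (hg : IsUnit (divOp hr hrR hσ n (weier S σ g)))
    (hz : ∀ ζ ∈ annulus r R, ∀ a, a ^ n + lowSum (fun i => (g i).eval r R ζ) a = 0 →
      a ∈ ball (0 : ℂ) σ) (h : ProductSpace S σ)
    (hh : ∀ ζ ∈ annulus r R, ∃ q : ℂ → ℂ, ContinuousOn q (ball 0 σ) ∧ ∀ a ∈ ball (0 : ℂ) σ,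
      h.eval r R ζ a = (a ^ n + lowSum (fun i => (g i).eval r R ζ) a) * q a) :
    rem hr hrR hσ n (weier S σ g) h = 0 := by
  obtain ⟨Q, hQ⟩ := exists_div hr hrR hσ hg h
  have key : ∀ ζ ∈ annulus r R, (fun i => (rem hr hrR hσ n (weier S σ g) h i).eval r R ζ) = 0 := by
    intro ζ hζ
    obtain ⟨q, hq, hhq⟩ := hh ζ hζ
    -- On the slice the remainder equals the Weierstrass polynomial times q - Q. It has degree less
    -- than n, and all zeros of the divisor lie in the disc, so it is zero.
    refine eq_zero_of_lowSum_eq_mul (c := fun i => (g i).eval r R ζ)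
      (q := fun a => q a - Q.eval r R ζ a)
      (hq.sub (Q.differentiableOn_eval hr hζ).continuousOn) (hz ζ hζ) fun a ha => ?_
    have h1 := congrArg (fun G : ProductSpace S σ => G.eval r R ζ a) hQ
    simp only [eval_add, eval_mul hr hrR _ _ hζ ha, eval_poly' _ ha, eval_weier hr g hζ ha,
      hhq a ha] at h1
    rw [mul_sub, h1]
    ring
  funext i
  exact AnnulusSpace.ext_eval hr hrR fun ζ hζ => by
    rw [Pi.zero_apply, AnnulusSpace.eval_zero]
    exact congrFun (key ζ hζ) i

theorem hasSlopeAt_divOp (hr : 0 < r) (hrR : r < R) (hσ : 0 < σ) (ψ : ProductSpace S σ) :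
    HasSlopeAt (divOp (S := S) hr hrR hσ n) ψ := by
  have h1 : HasSlopeAt (fun ψ : ProductSpace S σ => mul S σ hr hrR ψ) ψ :=
    HasSlopeAt.clm (mul S σ hr hrR) ψ
  have h2 : HasSlopeAt (fun ψ : ProductSpace S σ => mul S σ hr hrR ψ +
      -mul S σ hr hrR (wpow S σ n)) ψ := h1.add (HasSlopeAt.const _ ψ)
  have h3 := (HasSlopeAt.const (1 : ProductSpace S σ →L[ℂ] ProductSpace S σ) ψ).add
    (h2.clm_comp (HasSlopeAt.const (shift S hσ ^ n) ψ))
  have h4 : divOp (S := S) hr hrR hσ n = fun ψ => 1 + (mul S σ hr hrR ψ +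
      -mul S σ hr hrR (wpow S σ n)).comp (shift S hσ ^ n) := by
    funext ψ
    rw [divOp, map_sub, sub_eq_add_neg]
  rwa [h4]

theorem hasSlopeAt_inverse_divOp (hr : 0 < r) (hrR : r < R) (hσ : 0 < σ) {ψ : ProductSpace S σ}
    (hψ : IsUnit (divOp hr hrR hσ n ψ)) :
    HasSlopeAt (fun ψ : ProductSpace S σ => Ring.inverse (divOp hr hrR hσ n ψ)) ψ :=
  (HasSlopeAt.inverse hψ).comp (hasSlopeAt_divOp hr hrR hσ ψ)

theorem rem_wpow_self (hr : 0 < r) (hrR : r < R) (hσ : 0 < σ) :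
    rem hr hrR hσ n (wpow S σ n) (wpow S σ n) = 0 := by
  rw [rem, divOp_wpow, Ring.inverse_one]
  exact low_mulW_pow hσ n _

end ProductSpace

open ProductSpace

/-! ### Regular pairs of determining functions -/

namespace Frame

variable {D : Overlap} {Sm Sp : SmoothnessClass} {σ : ℝ} (Φ : Frame D Sm Sp σ) {n : ℕ}

/-- The Weierstrass polynomials with given coefficients. -/
def pair (Sm Sp : SmoothnessClass) (σ : ℝ) {n : ℕ} (k : DistortedCylinder.KappaSpace Sm Sp n) :
    ProductSpace Sm σ × ProductSpace Sp σ := (weier Sm σ k.1, weier Sp σ k.2)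

theorem continuous_pair : Continuous (pair Sm Sp σ (n := n)) :=
  (continuous_weier.comp continuous_fst).prodMk (continuous_weier.comp continuous_snd)

/-- The linear equation for `f` with given `ψ^±` has a unique solution. -/
structure Regular (hσ : 0 < σ) (n : ℕ) (ψ : ProductSpace Sm σ × ProductSpace Sp σ) : Prop where
  minus : IsUnit (divOp D.r_pos D.r_lt_r' hσ n ψ.1)
  plus : IsUnit (divOp D.R'_pos D.R'_lt_R hσ n ψ.2)
  op : IsUnit (Φ.op hσ n ψ)

theorem hasSlopeAt_inverse_minus (hσ : 0 < σ) {ψ : ProductSpace Sm σ × ProductSpace Sp σ}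
    (h : IsUnit (divOp D.r_pos D.r_lt_r' hσ n ψ.1)) :
    HasSlopeAt (fun ψ : ProductSpace Sm σ × ProductSpace Sp σ =>
      Ring.inverse (divOp D.r_pos D.r_lt_r' hσ n ψ.1)) ψ :=
  HasSlopeAt.comp (f := Prod.fst) (hasSlopeAt_inverse_divOp _ _ hσ h)
    (HasSlopeAt.clm (ContinuousLinearMap.fst ℂ _ _) ψ)

theorem hasSlopeAt_inverse_plus (hσ : 0 < σ) {ψ : ProductSpace Sm σ × ProductSpace Sp σ}
    (h : IsUnit (divOp D.R'_pos D.R'_lt_R hσ n ψ.2)) :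
    HasSlopeAt (fun ψ : ProductSpace Sm σ × ProductSpace Sp σ =>
      Ring.inverse (divOp D.R'_pos D.R'_lt_R hσ n ψ.2)) ψ :=
  HasSlopeAt.comp (f := Prod.snd) (hasSlopeAt_inverse_divOp _ _ hσ h)
    (HasSlopeAt.clm (ContinuousLinearMap.snd ℂ _ _) ψ)

theorem hasSlopeAt_op (hσ : 0 < σ) {ψ : ProductSpace Sm σ × ProductSpace Sp σ}
    (h1 : IsUnit (divOp D.r_pos D.r_lt_r' hσ n ψ.1))
    (h2 : IsUnit (divOp D.R'_pos D.R'_lt_R hσ n ψ.2)) : HasSlopeAt (Φ.op hσ n) ψ := by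
  have hm' := (HasSlopeAt.const (low Sm hσ n) ψ).clm_comp
    ((hasSlopeAt_inverse_minus hσ h1).clm_comp (HasSlopeAt.const (Φ.Tm n) ψ))
  have hp' := (HasSlopeAt.const (low Sp hσ n) ψ).clm_comp
    ((hasSlopeAt_inverse_plus hσ h2).clm_comp (HasSlopeAt.const (Φ.Tp n) ψ))
  have h3 := (HasSlopeAt.const (collectN D Sm Sp n) ψ).clm_comp (hm'.clm_prod hp')
  exact h3

theorem hasSlopeAt_solution (hσ : 0 < σ) {ψ : ProductSpace Sm σ × ProductSpace Sp σ}
    (h : Φ.Regular hσ n ψ) : HasSlopeAt (Φ.solution hσ n) ψ := by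
  have hinv : HasSlopeAt (fun ψ => Ring.inverse (Φ.op hσ n ψ)) ψ :=
    (HasSlopeAt.inverse h.op).comp (Φ.hasSlopeAt_op hσ h.minus h.plus)
  have h2 : HasSlopeAt (fun ψ : ProductSpace Sm σ × ProductSpace Sp σ =>
      rem D.r_pos D.r_lt_r' hσ n ψ.1 (wpow Sm σ n)) ψ :=
    (HasSlopeAt.clm (low Sm hσ n) _).comp
      ((hasSlopeAt_inverse_minus hσ h.minus).clm_apply (HasSlopeAt.const (wpow Sm σ n) ψ))
  have h3 : HasSlopeAt (fun ψ : ProductSpace Sm σ × ProductSpace Sp σ =>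
      rem D.R'_pos D.R'_lt_R hσ n ψ.2 (wpow Sp σ n)) ψ :=
    (HasSlopeAt.clm (low Sp hσ n) _).comp
      ((hasSlopeAt_inverse_plus hσ h.plus).clm_apply (HasSlopeAt.const (wpow Sp σ n) ψ))
  have h4 := (HasSlopeAt.clm (collectN D Sm Sp n) _).comp (h2.prodMk h3)
  exact (hinv.clm_apply h4).neg

/-- For κ = 0 the determining functions are wⁿ, where all three operators are invertible;
invertibility is an open condition and the operators depend continuously on κ. -/
theorem eventually_regular (hσ : 0 < σ) :
    ∀ᶠ k in 𝓝 (0 : DistortedCylinder.KappaSpace Sm Sp n), Φ.Regular hσ n (pair Sm Sp σ k) := by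
  have hm : ∀ᶠ k in 𝓝 (0 : DistortedCylinder.KappaSpace Sm Sp n),
      IsUnit (divOp D.r_pos D.r_lt_r' hσ n (pair Sm Sp σ k).1) :=
    (continuous_fst.tendsto (0 : DistortedCylinder.KappaSpace Sm Sp n)).eventually (eventually_isUnit_divOp D.r_pos D.r_lt_r' hσ)
  have hp : ∀ᶠ k in 𝓝 (0 : DistortedCylinder.KappaSpace Sm Sp n),
      IsUnit (divOp D.R'_pos D.R'_lt_R hσ n (pair Sm Sp σ k).2) :=
    (continuous_snd.tendsto (0 : DistortedCylinder.KappaSpace Sm Sp n)).eventually (eventually_isUnit_divOp D.R'_pos D.R'_lt_R hσ)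
  have hc : ContinuousAt (fun k => Φ.op hσ n (pair Sm Sp σ k)) 0 :=
    (Φ.hasSlopeAt_op hσ hm.self_of_nhds hp.self_of_nhds).continuousAt.comp continuous_pair.continuousAt
  have h0 : IsUnit (Φ.op hσ n (pair Sm Sp σ (0 : DistortedCylinder.KappaSpace Sm Sp n))) := by
    have : pair Sm Sp σ (0 : DistortedCylinder.KappaSpace Sm Sp n) =
        (wpow Sm σ n, wpow Sp σ n) := Prod.ext weier_zero weier_zero
    rw [this]
    exact Φ.isUnit_op_wpow hσ
  filter_upwards [hm, hp, hc.eventually (Units.isOpen.mem_nhds h0)] with k h1 h2 h3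
  exact ⟨h1, h2, h3⟩

theorem solution_pair_zero (hσ : 0 < σ) :
    Φ.solution hσ n (pair Sm Sp σ (0 : DistortedCylinder.KappaSpace Sm Sp n)) = 0 := by
  have : pair Sm Sp σ (0 : DistortedCylinder.KappaSpace Sm Sp n) =
      (wpow Sm σ n, wpow Sp σ n) := Prod.ext weier_zero weier_zero
  rw [this, solution, rem_wpow_self, rem_wpow_self]
  have h0 : ((0, 0) : DistortedCylinder.KappaSpace Sm Sp n) = 0 := rfl
  rw [h0, map_zero, map_zero, neg_zero]

/-- Small κ gives small f, so that the distorted polynomial is close to wⁿ and a quotient by the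
equation of the curve has no zeros. -/
theorem tendsto_solution (hσ : 0 < σ) :
    Tendsto (fun k : DistortedCylinder.KappaSpace Sm Sp n => Φ.solution hσ n (pair Sm Sp σ k))
      (𝓝 0) (𝓝 0) := by
  have h := (Φ.hasSlopeAt_solution hσ (Φ.eventually_regular (n := n) hσ).self_of_nhds).continuousAt.comp
    (f := pair Sm Sp σ (n := n)) (x := 0) continuous_pair.continuousAt
  have h2 : Tendsto (fun k : DistortedCylinder.KappaSpace Sm Sp n =>
      Φ.solution hσ n (pair Sm Sp σ k)) (𝓝 0) (𝓝 (Φ.solution hσ n (pair Sm Sp σ 0))) := h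
  rwa [Φ.solution_pair_zero hσ] at h2

end Frame

/-! ### Curves with small κ -/

namespace DistortedCylinder

variable {D : DistortedCylinder} {Sm Sp : SmoothnessClass} {n : ℕ}

theorem eventually_norm_eval_le (Sm Sp : SmoothnessClass) (n : ℕ) {μ : ℝ} (hμ : 0 < μ) :
    ∀ᶠ k in 𝓝 (0 : KappaSpace Sm Sp n), ∀ (r R : ℝ), 0 < r → ∀ z ∈ annulus r R,
      (∀ i, ‖(k.1 i).eval r R z‖ ≤ μ) ∧ ∀ i, ‖(k.2 i).eval r R z‖ ≤ μ := by
  obtain ⟨c₁, hc₁, h₁⟩ := AnnulusSpace.exists_norm_eval_const Sm Sm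
  obtain ⟨c₂, hc₂, h₂⟩ := AnnulusSpace.exists_norm_eval_const Sp Sp
  have hpos : 0 < μ / (c₁ + c₂ + 1) := by positivity
  filter_upwards [Metric.ball_mem_nhds (0 : KappaSpace Sm Sp n) hpos] with k hk r R hr z hz
  rw [mem_ball_zero_iff, lt_div_iff₀ (by positivity)] at hk
  have hn := norm_nonneg k
  constructor
  · intro i
    have h3 : ‖k.1 i‖ ≤ ‖k‖ := (norm_le_pi_norm k.1 i).trans (norm_fst_le k)
    have := h₁ r R hr (k.1 i) z hz
    nlinarith
  · intro i
    have h3 : ‖k.2 i‖ ≤ ‖k‖ := (norm_le_pi_norm k.2 i).trans (norm_snd_le k)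
    have := h₂ r R hr (k.2 i) z hz
    nlinarith

/-- The zeros of Weierstrass polynomials with small coefficients are small. -/
theorem eventually_zeros (Sm Sp : SmoothnessClass) (n : ℕ) {δ : ℝ} (hδ : 0 < δ) :
    ∀ᶠ k in 𝓝 (0 : KappaSpace Sm Sp n), ∀ (r R : ℝ), 0 < r → ∀ z ∈ annulus r R,
      (∀ a, a ^ n + lowSum (fun i => (k.1 i).eval r R z) a = 0 → ‖a‖ ≤ δ) ∧
        ∀ a, a ^ n + lowSum (fun i => (k.2 i).eval r R z) a = 0 → ‖a‖ ≤ δ := by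
  have hd : 0 < min δ 1 := lt_min hδ one_pos
  have hμ : 0 < (min δ 1) ^ n / (n + 1) := by positivity
  have hlt : n * ((min δ 1) ^ n / (n + 1)) < (min δ 1) ^ n := by
    rw [mul_div_assoc', div_lt_iff₀ (by positivity), mul_comm]
    nlinarith [pow_pos hd n]
  filter_upwards [eventually_norm_eval_le Sm Sp n hμ] with k hk r R hr z hz
  obtain ⟨h1, h2⟩ := hk r R hr z hz
  constructor
  · intro a ha
    by_contra! hcon
    exact pow_add_lowSum_ne_zero hd (min_le_right _ _) hlt h1 ((min_le_left _ _).trans_lt hcon) ha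
  · intro a ha
    by_contra! hcon
    exact pow_add_lowSum_ne_zero hd (min_le_right _ _) hlt h2 ((min_le_left _ _).trans_lt hcon) ha

theorem polyVm_eq (D : DistortedCylinder) (g : Fin n → AnnulusSpace Sm Sm) (x : ℂ × ℂ) :
    D.polyVm g x = x.2 ^ n + lowSum (fun i => (g i).eval D.r D.r' (D.z₁ x)) x.2 := rfl

theorem polyVp_eq (D : DistortedCylinder) (g : Fin n → AnnulusSpace Sp Sp) (x : ℂ × ℂ) :
    D.polyVp g x = x.2 ^ n + lowSum (fun i => (g i).eval D.R' D.R (D.z₂ x)) x.2 := rfl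

theorem distortedPoly_eq (D : DistortedCylinder) (f : Fin n → AnnulusSpace Sm Sp) (x : ℂ × ℂ) :
    D.distortedPoly f x = x.2 ^ n +
      lowSum (fun i => (f i).minus D.r (D.z₁ x) + (f i).plus D.R (D.z₂ x)) x.2 := rfl

/-- A curve with a small `κ` lies near `w = 0`. -/
theorem eventually_support (D : DistortedCylinder) (Sm Sp : SmoothnessClass) (n : ℕ) {δ : ℝ}
    (hδ : 0 < δ) : ∀ᶠ k in 𝓝 (0 : KappaSpace Sm Sp n), ∀ C : Curve D.W,
      D.IsSmoothCurve Sm Sp n C → D.IsKappa C k → ∀ x ∈ C.support, ‖x.2‖ ≤ δ := by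
  filter_upwards [eventually_zeros Sm Sp n hδ] with k hk C hC hCk x hx
  obtain ⟨F, Gm, Gp, ρ', hF, hCF, -, hρ', hs, -⟩ := hC
  obtain ⟨y, hy, hyV, hxy⟩ := D.exists_mem_support_end hF.analytic hCF hρ' hs hx
  refine hxy.trans ?_
  -- It suffices to bound |w| at the ends, where the curve is given by a Weierstrass polynomial with
  -- small coefficients.
  rcases hyV with hyV | hyV
  · have h0 := (Curve.mem_support_iff hCk.1 (D.Vm_subset_W hyV) hyV).1 hy
    exact (hk D.r D.r' D.r_pos _ ⟨hyV.2.1, hyV.2.2.1⟩).1 _ h0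
  · have h0 := (Curve.mem_support_iff hCk.2 (D.Vp_subset_W hyV) hyV).1 hy
    exact (hk D.R' D.R D.R'_pos _ ⟨hyV.2.1, hyV.2.2.1⟩).2 _ h0

theorem analyticOnNhd_distortedPoly (D : DistortedCylinder) (f : Fin n → AnnulusSpace Sm Sp) :
    AnalyticOnNhd ℂ (D.distortedPoly f) D.W := by
  intro x hx
  have h1 : ∀ i, AnalyticAt ℂ (fun x => (f i).minus D.r (D.z₁ x)) x := fun i =>
    (((f i).differentiableOn_minus D.r_pos).analyticAt
      ((isOpen_norm_gt _).mem_nhds hx.2.1)).comp (D.z₁_analytic x hx.1)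
  have h2 : ∀ i, AnalyticAt ℂ (fun x => (f i).plus D.R (D.z₂ x)) x := fun i =>
    ((f i).differentiableOn_plus.analyticAt
      (isOpen_ball.mem_nhds (by simpa using hx.2.2.1))).comp (D.z₂_analytic x hx.1)
  exact (analyticAt_snd.pow n).add (Finset.analyticAt_fun_sum _ fun i _ =>
    ((h1 i).add (h2 i)).mul (analyticAt_snd.pow _))

theorem exists_norm_distortedPoly_sub_le (D : DistortedCylinder) (Sm Sp : SmoothnessClass) (n : ℕ)
    {μ : ℝ} (hμ : 0 < μ) : ∀ᶠ f in 𝓝 (0 : Fin n → AnnulusSpace Sm Sp), ∀ x ∈ D.W,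
      ‖D.distortedPoly f x - x.2 ^ n‖ ≤ μ := by
  obtain ⟨c, hc, h⟩ := AnnulusSpace.exists_bound Sm Sp
  have hB : 0 < (D.ρ + 1) ^ n := pow_pos (by linarith [D.ρ_pos]) n
  have hpos : 0 < μ / ((n + 1) * ((c + c + 1) * (D.ρ + 1) ^ n)) := by positivity
  filter_upwards [Metric.ball_mem_nhds (0 : Fin n → AnnulusSpace Sm Sp) hpos] with f hf x hx
  rw [mem_ball_zero_iff, lt_div_iff₀ (by positivity)] at hf
  have h1 : ∀ i, ‖(f i).minus D.r (D.z₁ x) + (f i).plus D.R (D.z₂ x)‖ ≤ (c + c) * ‖f‖ := by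
    intro i
    obtain ⟨h2, h3⟩ := h D.r D.R D.r_pos (f i)
    have h4 : c * ‖f i‖ ≤ c * ‖f‖ := mul_le_mul_of_nonneg_left (norm_le_pi_norm f i) hc
    refine (norm_add_le _ _).trans ?_
    linarith [h2 _ hx.2.2.1, h3 _ hx.2.1]
  rw [distortedPoly_eq, add_sub_cancel_left]
  refine (norm_lowSum_le h1 (by positivity) (hx.2.2.2.le.trans (by linarith) : _ ≤ D.ρ + 1)
    (by linarith [D.ρ_pos])).trans ?_
  have hf0 := norm_nonneg f
  refine le_trans ?_ hf.le
  have : (n : ℝ) * ((c + c) * ‖f‖ * (D.ρ + 1) ^ n) =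
    ‖f‖ * (n * ((c + c) * (D.ρ + 1) ^ n)) := by ring
  rw [this]
  exact mul_le_mul_of_nonneg_left (mul_le_mul (by linarith)
    (mul_le_mul_of_nonneg_right (by linarith) hB.le) (by positivity) (by positivity)) hf0

end DistortedCylinder

end

noncomputable section

open Set Metric Filter

open ProductSpace

/-! ### Uniqueness for multiples of Weierstrass polynomials -/

namespace Frame

variable {D : Overlap} {Sm Sp : SmoothnessClass} {σ : ℝ} (Φ : Frame D Sm Sp σ) {n : ℕ}

/-- The zeros of the Weierstrass polynomials lie in `Δ(σ)`. -/
structure ZerosIn (D : Overlap) (σ : ℝ) (k : DistortedCylinder.KappaSpace Sm Sp n) : Prop where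
  minus : ∀ ζ ∈ annulus D.r D.r', ∀ a,
    a ^ n + lowSum (fun i => (k.1 i).eval D.r D.r' ζ) a = 0 → a ∈ ball (0 : ℂ) σ
  plus : ∀ ζ ∈ annulus D.R' D.R, ∀ a,
    a ^ n + lowSum (fun i => (k.2 i).eval D.R' D.R ζ) a = 0 → a ∈ ball (0 : ℂ) σ

/-- The homogeneous version: both remainders vanish, so `op` kills f. It serves for the overlap with
exchanged coordinates. -/
theorem eq_zero_of_multiple (hσ : 0 < σ) {k : DistortedCylinder.KappaSpace Sm Sp n}
    (hk : Φ.Regular hσ n (pair Sm Sp σ k)) (hz : ZerosIn D σ k) {f : Fin n → AnnulusSpace Sm Sp}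
    (hm : ∀ ζ ∈ annulus D.r D.r', ∃ q : ℂ → ℂ, ContinuousOn q (ball 0 σ) ∧ ∀ a ∈ ball (0 : ℂ) σ,
      lowSum (fun i => (f i).minus D.r ζ + (f i).plus D.R (D.trans₁₂ (ζ, a))) a =
        (a ^ n + lowSum (fun i => (k.1 i).eval D.r D.r' ζ) a) * q a)
    (hp : ∀ ζ ∈ annulus D.R' D.R, ∃ q : ℂ → ℂ, ContinuousOn q (ball 0 σ) ∧ ∀ a ∈ ball (0 : ℂ) σ,
      lowSum (fun i => (f i).minus D.r (D.trans₂₁ (ζ, a)) + (f i).plus D.R ζ) a =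
        (a ^ n + lowSum (fun i => (k.2 i).eval D.R' D.R ζ) a) * q a) : f = 0 := by
  have h1 : rem D.r_pos D.r_lt_r' hσ n (pair Sm Sp σ k).1 (Φ.Tm n f) = 0 := by
    refine rem_weier_eq_zero _ _ _ hk.minus hz.minus _ fun ζ hζ => ?_
    obtain ⟨q, hq, h⟩ := hm ζ hζ
    exact ⟨q, hq, fun a ha => by rw [Φ.eval_Tm f hζ ha, ← h a ha]; rfl⟩
  have h2 : rem D.R'_pos D.R'_lt_R hσ n (pair Sm Sp σ k).2 (Φ.Tp n f) = 0 := by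
    refine rem_weier_eq_zero _ _ _ hk.plus hz.plus _ fun ζ hζ => ?_
    obtain ⟨q, hq, h⟩ := hp ζ hζ
    exact ⟨q, hq, fun a ha => by rw [Φ.eval_Tp f hζ ha, ← h a ha]; rfl⟩
  have h3 := Φ.op_apply hσ (pair Sm Sp σ k) f
  rw [h1, h2, show ((0, 0) : DistortedCylinder.KappaSpace Sm Sp n) = 0 from rfl, map_zero] at h3
  rw [← (inverse_apply_of_isUnit hk.op f).1, h3, map_zero]

theorem eval_wpow_add_Tm (f : Fin n → AnnulusSpace Sm Sp) {ζ a : ℂ} (hζ : ζ ∈ annulus D.r D.r')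
    (ha : a ∈ ball (0 : ℂ) σ) : (wpow Sm σ n + Φ.Tm n f).eval D.r D.r' ζ a =
      a ^ n + lowSum (fun i => (f i).minus D.r ζ + (f i).plus D.R (D.trans₁₂ (ζ, a))) a := by
  rw [ProductSpace.eval_add, eval_wpow D.r_pos n hζ ha, Φ.eval_Tm f hζ ha]
  rfl

theorem eval_wpow_add_Tp (f : Fin n → AnnulusSpace Sm Sp) {ζ a : ℂ} (hζ : ζ ∈ annulus D.R' D.R)
    (ha : a ∈ ball (0 : ℂ) σ) : (wpow Sp σ n + Φ.Tp n f).eval D.R' D.R ζ a =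
      a ^ n + lowSum (fun i => (f i).minus D.r (D.trans₂₁ (ζ, a)) + (f i).plus D.R ζ) a := by
  rw [ProductSpace.eval_add, eval_wpow D.R'_pos n hζ ha, Φ.eval_Tp f hζ ha]
  rfl

theorem eq_solution_of_multiple (hσ : 0 < σ) {k : DistortedCylinder.KappaSpace Sm Sp n}
    (hk : Φ.Regular hσ n (pair Sm Sp σ k)) (hz : ZerosIn D σ k) {f : Fin n → AnnulusSpace Sm Sp}
    (hm : ∀ ζ ∈ annulus D.r D.r', ∃ q : ℂ → ℂ, ContinuousOn q (ball 0 σ) ∧ ∀ a ∈ ball (0 : ℂ) σ,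
      a ^ n + lowSum (fun i => (f i).minus D.r ζ + (f i).plus D.R (D.trans₁₂ (ζ, a))) a =
        (a ^ n + lowSum (fun i => (k.1 i).eval D.r D.r' ζ) a) * q a)
    (hp : ∀ ζ ∈ annulus D.R' D.R, ∃ q : ℂ → ℂ, ContinuousOn q (ball 0 σ) ∧ ∀ a ∈ ball (0 : ℂ) σ,
      a ^ n + lowSum (fun i => (f i).minus D.r (D.trans₂₁ (ζ, a)) + (f i).plus D.R ζ) a =
        (a ^ n + lowSum (fun i => (k.2 i).eval D.R' D.R ζ) a) * q a) :
    f = Φ.solution hσ n (pair Sm Sp σ k) := by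
  refine Φ.eq_solution hσ hk.op ?_ ?_
  · refine rem_weier_eq_zero _ _ _ hk.minus hz.minus _ fun ζ hζ => ?_
    obtain ⟨q, hq, h⟩ := hm ζ hζ
    exact ⟨q, hq, fun a ha => by rw [Φ.eval_wpow_add_Tm f hζ ha, ← h a ha]⟩
  · refine rem_weier_eq_zero _ _ _ hk.plus hz.plus _ fun ζ hζ => ?_
    obtain ⟨q, hq, h⟩ := hp ζ hζ
    exact ⟨q, hq, fun a ha => by rw [Φ.eval_wpow_add_Tp f hζ ha, ← h a ha]⟩

end Frame

/-- On |t| = τ the quotient differs from 1 by at most (1/4)/(7/8) < 1/2; the maximum principle for q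
- 1 carries the bound 1/2 inside. -/
theorem ne_zero_of_close {σ τ : ℝ} (hτ : 0 < τ) (hτσ : τ < σ) {q : ℂ → ℂ}
    (hq : DifferentiableOn ℂ q (ball 0 σ)) {n : ℕ} {P S : ℂ → ℂ}
    (hS : ∀ t ∈ sphere (0 : ℂ) τ, S t = P t * q t)
    (hP : ∀ t ∈ sphere (0 : ℂ) τ, ‖P t - t ^ n‖ ≤ τ ^ n / 8)
    (hS' : ∀ t ∈ sphere (0 : ℂ) τ, ‖S t - t ^ n‖ ≤ τ ^ n / 8) {a : ℂ} (ha : a ∈ ball (0 : ℂ) τ) :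
    q a ≠ 0 := by
  have hτn : 0 < τ ^ n := pow_pos hτ n
  have hsph : ∀ t ∈ sphere (0 : ℂ) τ, ‖q t - 1‖ ≤ 1 / 2 := by
    intro t ht
    have htn : ‖t ^ n‖ = τ ^ n := by rw [norm_pow, mem_sphere_zero_iff_norm.1 ht]
    have h1 : ‖S t - P t‖ ≤ τ ^ n / 4 := by
      have := norm_sub_le (S t - t ^ n) (P t - t ^ n)
      rw [sub_sub_sub_cancel_right] at this
      linarith [hP t ht, hS' t ht]
    have h2 : τ ^ n * (7 / 8) ≤ ‖P t‖ := by
      have := norm_sub_norm_le (t ^ n) (t ^ n - P t)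
      rw [sub_sub_cancel, norm_sub_rev, htn] at this
      linarith [hP t ht]
    rw [hS t ht, ← mul_sub_one, norm_mul] at h1
    have h3 := norm_nonneg (q t - 1)
    nlinarith
  have hsub : closedBall (0 : ℂ) τ ⊆ ball 0 σ := closedBall_subset_ball hτσ
  have hmax : ‖q a - 1‖ ≤ 1 / 2 := by
    refine Complex.norm_le_of_forall_mem_frontier_norm_le (f := fun a => q a - 1) (U := ball 0 τ)
      isBounded_ball (((hq.mono hsub).sub_const 1).diffContOnCl_ball subset_rfl) (fun t ht => ?_)
      (subset_closure ha)
    rw [frontier_ball _ hτ.ne'] at ht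
    exact hsph t ht
  intro h0
  rw [h0, zero_sub, norm_neg, norm_one] at hmax
  norm_num at hmax

/-! ### Continuation of the Weierstrass polynomial over a thin tube -/

namespace DistortedCylinder

variable {D : DistortedCylinder} {Sm Sp : SmoothnessClass} {n : ℕ}

theorem mem_Vm_of_annulus (D : DistortedCylinder) {ζ a : ℂ} (hζ : ζ ∈ annulus D.r D.r')
    (ha : ‖a‖ < D.ρ) : (ζ, a) ∈ D.phi₁ '' D.U ∧ D.psi₁ (ζ, a) ∈ D.Vm := by
  obtain ⟨x, hx, h1, h2⟩ := D.Vm_product ζ hζ a ha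
  have h3 : D.phi₁ x = (ζ, a) := Prod.ext h1 h2
  have hmem : (ζ, a) ∈ D.phi₁ '' D.U := ⟨x, hx, h3⟩
  refine ⟨hmem, ?_⟩
  rw [← h3, D.psi₁_phi₁ hx]
  exact ⟨hx, by rw [h1]; exact hζ.1, by rw [h1]; exact hζ.2, by rw [h2]; exact ha⟩

theorem mem_Vp_of_annulus (D : DistortedCylinder) {ζ a : ℂ} (hζ : ζ ∈ annulus D.R' D.R)
    (ha : ‖a‖ < D.ρ) : (ζ, a) ∈ D.phi₂ '' D.U ∧ D.psi₂ (ζ, a) ∈ D.Vp := by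
  obtain ⟨x, hx, h1, h2⟩ := D.Vp_product ζ hζ a ha
  have h3 : D.phi₂ x = (ζ, a) := Prod.ext h1 h2
  have hmem : (ζ, a) ∈ D.phi₂ '' D.U := ⟨x, hx, h3⟩
  refine ⟨hmem, ?_⟩
  rw [← h3, D.psi₂_phi₂ hx]
  exact ⟨hx, by rw [h1]; exact hζ.1, by rw [h1]; exact hζ.2, by rw [h2]; exact ha⟩

theorem isOpen_Vm (D : DistortedCylinder) : IsOpen D.Vm := by
  have h1 : IsOpen (D.U ∩ {x | D.r < ‖D.z₁ x‖}) :=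
    D.continuousOn_z₁.norm.isOpen_inter_preimage D.isOpen_U isOpen_Ioi
  have h2 : IsOpen (D.U ∩ {x | ‖D.z₁ x‖ < D.r'}) :=
    D.continuousOn_z₁.norm.isOpen_inter_preimage D.isOpen_U isOpen_Iio
  have h3 : IsOpen {x : ℂ × ℂ | ‖x.2‖ < D.ρ} := isOpen_lt (by fun_prop) continuous_const
  have : D.Vm = (D.U ∩ {x | D.r < ‖D.z₁ x‖}) ∩ ((D.U ∩ {x | ‖D.z₁ x‖ < D.r'}) ∩
      {x : ℂ × ℂ | ‖x.2‖ < D.ρ}) := by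
    ext x
    simp only [Vm, mem_inter_iff, mem_ofPred_eq]
    tauto
  rw [this]
  exact h1.inter (h2.inter h3)

theorem isOpen_Vp (D : DistortedCylinder) : IsOpen D.Vp := by
  have h1 : IsOpen (D.U ∩ {x | D.R' < ‖D.z₂ x‖}) :=
    D.continuousOn_z₂.norm.isOpen_inter_preimage D.isOpen_U isOpen_Ioi
  have h2 : IsOpen (D.U ∩ {x | ‖D.z₂ x‖ < D.R}) :=
    D.continuousOn_z₂.norm.isOpen_inter_preimage D.isOpen_U isOpen_Iio
  have h3 : IsOpen {x : ℂ × ℂ | ‖x.2‖ < D.ρ} := isOpen_lt (by fun_prop) continuous_const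
  have : D.Vp = (D.U ∩ {x | D.R' < ‖D.z₂ x‖}) ∩ ((D.U ∩ {x | ‖D.z₂ x‖ < D.R}) ∩
      {x : ℂ × ℂ | ‖x.2‖ < D.ρ}) := by
    ext x
    simp only [Vp, mem_inter_iff, mem_ofPred_eq]
    tauto
  rw [this]
  exact h1.inter (h2.inter h3)

/-- The part of the cylinder over `Δ(σ)` is so thin that the coordinates are close to each
other. -/
structure IsThin (D : DistortedCylinder) (σ : ℝ) : Prop where
  pos : 0 < σ
  le : σ ≤ D.ρ
  mem_W : ∀ z ∈ annulus D.r (D.rad (7 / 8)), ∀ a ∈ ball (0 : ℂ) σ,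
    (z, a) ∈ D.phi₁ '' D.U ∧ D.psi₁ (z, a) ∈ D.W
  trans₁₂_mem : ∀ z ∈ annulus (D.rad (4 / 8)) (D.rad (5 / 8)), ∀ a ∈ ball (0 : ℂ) σ,
    D.trans₁₂ (z, a) ∈ annulus (D.rad (3 / 8)) D.R
  trans₂₁_mem : ∀ z ∈ annulus (D.rad (1 / 8)) (D.rad (2 / 8)), ∀ a ∈ ball (0 : ℂ) σ,
    D.trans₂₁ (z, a) ∈ annulus D.R' (D.rad (3 / 8))
  cover : ∀ x ∈ D.W, ‖x.2‖ < σ → ‖D.z₁ x‖ < D.rad (5 / 8) ∨ D.rad (1 / 8) < ‖D.z₂ x‖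

theorem exists_isThin (D : DistortedCylinder) : ∃ σ, D.IsThin σ := by
  have hL : 0 < D.R - D.R' := sub_pos.2 D.R'_lt_R
  have h0 := D.R'_pos
  have h1 := D.r_lt_r'.trans D.r'_lt_R'
  -- With |z₁ - z₂| below one eighth of R - R', a change of coordinates moves a radius by less than
  -- one step of the scale `rad`.
  obtain ⟨η, σ₀, hη, hηr, hσ₀, htube⟩ := D.exists_coord_tube (by positivity : 0 < (D.R - D.R') / 8)
  let O : Set (ℂ × ℂ) := (D.U ∩ {x | ‖D.z₁ x‖ < D.rad (5 / 8)}) ∪ (D.U ∩ {x | D.rad (1 / 8) < ‖D.z₂ x‖})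
  have hO : IsOpen O :=
    (D.continuousOn_z₁.norm.isOpen_inter_preimage D.isOpen_U isOpen_Iio).union
      (D.continuousOn_z₂.norm.isOpen_inter_preimage D.isOpen_U isOpen_Ioi)
  obtain ⟨σ₁, hσ₁, hthin⟩ := D.exists_thin hO fun z hz => by
    have hU := D.annulus_subset z hz.1 hz.2
    rcases lt_or_ge ‖z‖ (D.rad (5 / 8)) with h | h
    · exact Or.inl ⟨hU, by simpa [D.z₁_zero hz] using h⟩
    · refine Or.inr ⟨hU, ?_⟩
      simp only [mem_ofPred_eq, D.z₂_zero hz]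
      exact (D.rad_lt (by norm_num)).trans_le h
  have hσ : 0 < min (min σ₀ σ₁) D.ρ := lt_min (lt_min hσ₀ hσ₁) D.ρ_pos
  have hlt : ∀ a ∈ ball (0 : ℂ) (min (min σ₀ σ₁) D.ρ), ‖a‖ < σ₀ ∧ ‖a‖ < D.ρ := by
    intro a ha
    rw [mem_ball_zero_iff] at ha
    exact ⟨ha.trans_le ((min_le_left _ _).trans (min_le_left _ _)), ha.trans_le (min_le_right _ _)⟩
  refine ⟨_, hσ, min_le_right _ _, ?_, ?_, ?_, ?_⟩
  · intro z hz a ha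
    have hz1 := hz.1
    have hz2 := hz.2
    unfold rad at hz2
    obtain ⟨h2, h3, -⟩ := htube z ⟨by linarith, by linarith⟩ a (hlt a ha).1
    refine ⟨h2.1, D.psi₁_mem h2.1, ?_, ?_, ?_⟩
    · rw [D.z₁_psi₁ h2.1]
      exact hz.1
    · have := norm_sub_norm_le (D.trans₁₂ (z, a)) z
      change ‖D.trans₁₂ (z, a)‖ < D.R
      linarith
    · rw [D.psi₁_snd h2.1]
      exact (hlt a ha).2
  · intro z hz a ha
    have hz1 := hz.1
    have hz2 := hz.2
    unfold rad at hz1 hz2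
    obtain ⟨-, h3, -⟩ := htube z ⟨by linarith, by linarith⟩ a (hlt a ha).1
    have h4 := norm_sub_norm_le (D.trans₁₂ (z, a)) z
    have h5 := norm_sub_norm_le z (D.trans₁₂ (z, a))
    rw [norm_sub_rev] at h5
    exact ⟨by unfold rad; linarith, by linarith⟩
  · intro z hz a ha
    have hz1 := hz.1
    have hz2 := hz.2
    unfold rad at hz1 hz2
    obtain ⟨-, -, h3⟩ := htube z ⟨by linarith, by linarith⟩ a (hlt a ha).1
    have h4 := norm_sub_norm_le (D.trans₂₁ (z, a)) z
    have h5 := norm_sub_norm_le z (D.trans₂₁ (z, a))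
    rw [norm_sub_rev] at h5
    refine ⟨by linarith, ?_⟩
    unfold rad
    linarith
  · intro x hx hxσ
    rcases hthin x hx (hxσ.trans_le ((min_le_left _ _).trans (min_le_right _ _))) with h | h
    · exact Or.inl h.2
    · exact Or.inr h.2

theorem r'_lt_rad (D : DistortedCylinder) {t : ℝ} (ht : 0 ≤ t) : D.r' < D.rad t := by
  have := D.r'_lt_R'
  have := D.R'_lt_R
  unfold rad
  nlinarith

theorem rad_lt_R (D : DistortedCylinder) {t : ℝ} (ht : t < 1) : D.rad t < D.R := by
  rw [← D.rad_one]
  exact D.rad_lt ht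

/-- The Weierstrass polynomial of a curve in `V⁻` extends to the part `{|z₁| < rad (7 / 8)}` of the
cylinder. -/
theorem exists_weierstrass_tube {σ₁ σ δ : ℝ} (hthin : D.IsThin σ₁) (hσσ₁ : σ < σ₁)
    (hδ : 0 < δ) (hδσ : 5 * δ < σ) (hδ1 : δ ≤ 1) {C : Curve D.W} {F : ℂ × ℂ → ℂ}
    (hF : AnalyticOnNhd ℂ F D.W) (hCF : C.IsDivOn D.W F) (hs : ∀ x ∈ C.support, ‖x.2‖ ≤ δ)
    {g : Fin n → AnnulusSpace Sm Sm} (hg : C.IsDivOn D.Vm (D.polyVm g))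
    (hgz : ∀ ζ ∈ annulus D.r D.r', ∀ a,
      a ^ n + lowSum (fun i => (g i).eval D.r D.r' ζ) a = 0 → ‖a‖ ≤ δ) :
    ∃ (e : Fin n → ℂ → ℂ) (u : ℂ × ℂ → ℂ),
      (∀ i, DifferentiableOn ℂ (e i) (annulus D.r (D.rad (7 / 8)))) ∧
      (∀ z ∈ annulus D.r (D.rad (7 / 8)), ∀ i, ‖e i z‖ ≤ 2 ^ n * δ) ∧
      (∀ z ∈ annulus D.r (D.rad (7 / 8)), ∀ a, a ^ n + lowSum (e · z) a = 0 → ‖a‖ ≤ δ) ∧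
      (∀ z ∈ annulus D.r (D.rad (7 / 8)), ∀ a ∈ ball (0 : ℂ) σ, AnalyticAt ℂ u (z, a) ∧
        u (z, a) ≠ 0 ∧ F (D.psi₁ (z, a)) = u (z, a) * (a ^ n + lowSum (e · z) a)) ∧
      ∀ z ∈ annulus D.r D.r', ∀ i, e i z = (g i).eval D.r D.r' z := by
  have hσ : 0 < σ := by linarith
  set Z := annulus D.r (D.rad (7 / 8))
  have hZ : IsOpen Z := isOpen_annulus _ _
  have hZ₀Z : annulus D.r D.r' ⊆ Z := fun z hz =>
    annulus_mono le_rfl (D.r'_lt_rad (by norm_num)).le hz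
  have hG : AnalyticOnNhd ℂ (fun p => F (D.psi₁ p)) (Z ×ˢ ball 0 σ₁) := fun p hp =>
    (hF _ (hthin.mem_W _ hp.1 _ hp.2).2).comp (D.analyticAt_psi₁ (hthin.mem_W _ hp.1 _ hp.2).1)
  have hne : ∀ z ∈ Z, ∀ a ∈ ball (0 : ℂ) σ₁, δ < ‖a‖ → F (D.psi₁ (z, a)) ≠ 0 := by
    intro z hz a ha hδa h0
    obtain ⟨h1, h2⟩ := hthin.mem_W z hz a ha
    have := hs _ ((Curve.mem_support_iff hCF h2 h2).2 h0)
    rw [D.psi₁_snd h1] at this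
    exact absurd hδa (not_lt.2 this)
  -- Over V⁻ the given Weierstrass polynomial shows that F has n zeros on each slice; this is the
  -- input for Z₀ in `exists_weierstrass`.
  obtain ⟨v, hv, hv0, hFv⟩ := hg.exists_unit D.isOpen_Vm D.Vm_subset_W (hCF.mono D.Vm_subset_W)
  have hVm : ∀ z ∈ annulus D.r D.r', ∀ a ∈ ball (0 : ℂ) σ₁,
      (z, a) ∈ D.phi₁ '' D.U ∧ D.psi₁ (z, a) ∈ D.Vm := fun z hz a ha =>
    D.mem_Vm_of_annulus hz ((mem_ball_zero_iff.1 ha).trans_le hthin.le)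
  have hslice : ∀ z ∈ annulus D.r D.r', DifferentiableOn ℂ (fun a => v (D.psi₁ (z, a))) (ball 0 σ₁) ∧
      (∀ a ∈ ball (0 : ℂ) σ₁, v (D.psi₁ (z, a)) ≠ 0) ∧ ∀ a ∈ ball (0 : ℂ) σ₁,
        F (D.psi₁ (z, a)) = (a ^ n + lowSum (fun i => (g i).eval D.r D.r' z) a) *
          v (D.psi₁ (z, a)) := by
    intro z hz
    refine ⟨?_, fun a ha => hv0 _ (hVm z hz a ha).2, fun a ha => ?_⟩
    · have : AnalyticOnNhd ℂ (fun p => v (D.psi₁ p)) (annulus D.r D.r' ×ˢ ball 0 σ₁) := fun p hp =>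
        (hv _ (hVm _ hp.1 _ hp.2).2).comp (D.analyticAt_psi₁ (hVm _ hp.1 _ hp.2).1)
      exact differentiableOn_slice_snd this hz
    · rw [hFv _ (hVm z hz a ha).2, D.polyVm_eq, D.z₁_psi₁ (hVm z hz a ha).1,
        D.psi₁_snd (hVm z hz a ha).1, mul_comm]
  obtain ⟨e, he, heb, hez⟩ := exists_weierstrass hZ (isPreconnected_annulus D.r_pos.le) hG hδ
    (hδσ.trans hσσ₁) hδ1 hne (isOpen_annulus D.r D.r') (annulus_nonempty D.r_pos.le D.r_lt_r') hZ₀Z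
    fun z hz => ⟨_, _, hgz z hz, hslice z hz⟩
  have hB : AnalyticOnNhd ℂ (fun p : ℂ × ℂ => p.2 ^ n + lowSum (e · p.1) p.2) (Z ×ˢ ball 0 σ₁) := by
    intro p hp
    refine (analyticAt_snd.pow n).add (Finset.analyticAt_fun_sum _ fun i _ => ?_)
    exact (AnalyticAt.comp (f := Prod.fst) ((he i).analyticAt (hZ.mem_nhds hp.1))
      analyticAt_fst).mul (analyticAt_snd.pow _)
  obtain ⟨u, hu⟩ := exists_analytic_quotient hZ hG hB hσ hσσ₁ (fun z hz t ht h0 => by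
      have h1 := (hez z hz).1 t h0
      rw [mem_sphere_zero_iff_norm.1 ht] at h1
      linarith) fun z hz => by
      obtain ⟨-, v, h1, h2, h3⟩ := hez z hz
      exact ⟨v, h1, fun a ha => h2 a (ball_subset_ball hσσ₁.le ha), h3⟩
  refine ⟨e, u, he, heb, fun z hz => (hez z hz).1, hu, fun z hz => ?_⟩
  obtain ⟨h1, v', h2, h3, h4⟩ := hez z (hZ₀Z hz)
  obtain ⟨h5, h6, h7⟩ := hslice z hz
  have h8 : (fun i => (g i).eval D.r D.r' z) - (e · z) = 0 := by
    -- Over A_{r,r'} both monic polynomials divide F with zero-free quotient, so the difference, of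
    -- degree less than n, is a multiple of one of them.
    refine eq_zero_of_lowSum_eq_mul (c := (e · z)) (σ := σ₁)
      (q := fun a => v' a / v (D.psi₁ (z, a)) - 1)
      ((h2.continuousOn.div h5.continuousOn h6).sub continuousOn_const)
      (fun a ha => mem_ball_zero_iff.2 (lt_of_le_of_lt (h1 a ha) (by linarith))) fun a ha => ?_
    have h9 := (h4 a ha).symm.trans (h7 a ha)
    rw [lowSum_sub, mul_sub, mul_one, mul_div_assoc', h9, mul_div_cancel_right₀ _ (h6 a ha)]
    ring
  intro i
  exact (sub_eq_zero.1 (congrFun h8 i)).symm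

end DistortedCylinder

end

noncomputable section

open Set Metric Filter

open ProductSpace

theorem AnnulusSpace.plus_zero {Sm Sp : SmoothnessClass} {R : ℝ} (z : ℂ) :
    (0 : AnnulusSpace Sm Sp).plus R z = 0 := by
  change Sp.toFun 0 _ = 0
  simp

theorem AnnulusSpace.minus_zero {Sm Sp : SmoothnessClass} {r : ℝ} (z : ℂ) :
    (0 : AnnulusSpace Sm Sp).minus r z = 0 := by
  change Sm.toFun 0 _ - Sm.toFun 0 0 = 0
  simp

/-! ### Vanishing of the two remainders -/

namespace DistortedCylinder

variable {D : DistortedCylinder} {Sm Sp : SmoothnessClass} {n : ℕ}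

theorem phi₁_psi₂ (D : DistortedCylinder) {y : ℂ × ℂ} (hy : y ∈ D.phi₂ '' D.U) :
    D.phi₁ (D.psi₂ y) = (D.trans₂₁ y, y.2) := Prod.ext rfl (D.psi₂_snd hy)

/-- If the remainders `νm`, `νp` of `S` on `V⁻`, `V⁺` have no principal part at the inner, resp.
outer side, then they vanish. -/
theorem remainders_eq_zero {σ₁ σ r₁ : ℝ} (hthin : D.IsThin σ₁) (hσ : 0 < σ) (hσσ₁ : σ < σ₁)
    (hr₁ : D.r < r₁) (hr₁' : r₁ < D.r') {C : Curve D.W} {F : ℂ × ℂ → ℂ}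
    (hCF : C.IsDivOn D.W F) {e : Fin n → ℂ → ℂ} {u : ℂ × ℂ → ℂ}
    (hez : ∀ z ∈ annulus D.r (D.rad (7 / 8)), ∀ a, a ^ n + lowSum (e · z) a = 0 →
      a ∈ ball (0 : ℂ) σ)
    (hu : ∀ z ∈ annulus D.r (D.rad (7 / 8)), ∀ a ∈ ball (0 : ℂ) σ, AnalyticAt ℂ u (z, a) ∧
      u (z, a) ≠ 0 ∧ F (D.psi₁ (z, a)) = u (z, a) * (a ^ n + lowSum (e · z) a))
    {k : KappaSpace Sm Sp n} (hk : C.IsDivOn D.Vp (D.polyVp k.2))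
    (hkz : ∀ ζ ∈ annulus D.R' D.R, ∀ a,
      a ^ n + lowSum (fun i => (k.2 i).eval D.R' D.R ζ) a = 0 → a ∈ ball (0 : ℂ) σ)
    (hke : ∀ z ∈ annulus D.r D.r', ∀ i, e i z = (k.1 i).eval D.r D.r' z)
    (Φ : Frame D.swapOverlap Sp Sm σ) {l : KappaSpace Sp Sm n}
    (hl : Φ.Regular hσ n (Frame.pair Sp Sm σ l))
    (hl₁ : ∀ z ∈ annulus (D.rad (1 / 8)) (D.rad (2 / 8)), ∀ i,
      (l.1 i).eval (D.rad (1 / 8)) (D.rad (2 / 8)) z = (k.2 i).eval D.R' D.R z)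
    (hl₂ : ∀ z ∈ annulus (D.rad (4 / 8)) (D.rad (5 / 8)), ∀ i,
      (l.2 i).eval (D.rad (4 / 8)) (D.rad (5 / 8)) z = e i z)
    {S : ℂ × ℂ → ℂ} {νm s : Fin n → AnnulusSpace Sm Sm} {νp : Fin n → AnnulusSpace Sp Sp}
    {Qm Q : ProductSpace Sm σ} {Qp : ProductSpace Sp σ}
    (hm : ∀ z ∈ annulus D.r D.r', ∀ a ∈ ball (0 : ℂ) σ, S (D.psi₁ (z, a)) =
      (a ^ n + lowSum (fun i => (k.1 i).eval D.r D.r' z) a) * Qm.eval D.r D.r' z a +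
        lowSum (fun i => (νm i).eval D.r D.r' z) a)
    (hp : ∀ z ∈ annulus D.R' D.R, ∀ a ∈ ball (0 : ℂ) σ, S (D.psi₂ (z, a)) =
      (a ^ n + lowSum (fun i => (k.2 i).eval D.R' D.R z) a) * Qp.eval D.R' D.R z a +
        lowSum (fun i => (νp i).eval D.R' D.R z) a)
    (hs : ∀ z ∈ annulus r₁ (D.rad (6 / 8)), ∀ a ∈ ball (0 : ℂ) σ, S (D.psi₁ (z, a)) =
      (a ^ n + lowSum (e · z) a) * Q.eval r₁ (D.rad (6 / 8)) z a +
        lowSum (fun i => (s i).eval r₁ (D.rad (6 / 8)) z) a)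
    (hνm : ∀ i z, D.r < ‖z‖ → (νm i).minus D.r z = 0)
    (hνp : ∀ i, ∀ z ∈ ball (0 : ℂ) D.R, (νp i).plus D.R z = 0) :
    (∀ z ∈ annulus D.r D.r', ∀ i, (νm i).eval D.r D.r' z = 0) ∧
      (∀ z ∈ annulus r₁ (D.rad (5 / 8)), ∀ i, (s i).eval r₁ (D.rad (6 / 8)) z = 0) ∧
      ∀ z ∈ annulus (D.rad (1 / 8)) D.R, ∀ i, (νp i).eval D.R' D.R z = 0 := by
  have hr₁0 : 0 < r₁ := D.r_pos.trans hr₁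
  have hrR' := D.r_lt_r'.trans D.r'_lt_R'
  have hr'6 := D.r'_lt_rad (by norm_num : (0 : ℝ) ≤ 6 / 8)
  have hr'5 := D.r'_lt_rad (by norm_num : (0 : ℝ) ≤ 5 / 8)
  have hR1 : D.R' < D.rad (1 / 8) := by rw [← D.rad_zero]; exact D.rad_lt (by norm_num)
  have hR3 : D.R' < D.rad (3 / 8) := by rw [← D.rad_zero]; exact D.rad_lt (by norm_num)
  have hR4 : D.R' < D.rad (4 / 8) := by rw [← D.rad_zero]; exact D.rad_lt (by norm_num)
  have h15 : D.rad (1 / 8) < D.rad (5 / 8) := D.rad_lt (by norm_num)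
  have h25 : D.rad (2 / 8) < D.rad (5 / 8) := D.rad_lt (by norm_num)
  have h56 : D.rad (5 / 8) < D.rad (6 / 8) := D.rad_lt (by norm_num)
  have h36 : D.rad (3 / 8) < D.rad (6 / 8) := D.rad_lt (by norm_num)
  have h67 : D.rad (6 / 8) < D.rad (7 / 8) := D.rad_lt (by norm_num)
  have h2R := D.rad_lt_R (by norm_num : (2 / 8 : ℝ) < 1)
  have h5R := D.rad_lt_R (by norm_num : (5 / 8 : ℝ) < 1)
  have hσb : ball (0 : ℂ) σ ⊆ ball 0 σ₁ := ball_subset_ball hσσ₁.le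
  -- `s` is the continuation of `νm`.
  have hsm : ∀ z ∈ annulus r₁ D.r', ∀ i, (s i).eval r₁ (D.rad (6 / 8)) z = (νm i).plus D.r' z := by
    intro z hz
    have hzm : z ∈ annulus D.r D.r' := annulus_mono hr₁.le le_rfl hz
    have hz6 : z ∈ annulus r₁ (D.rad (6 / 8)) := annulus_mono le_rfl hr'6.le hz
    have hz7 : z ∈ annulus D.r (D.rad (7 / 8)) := annulus_mono hr₁.le h67.le hz6
    have h1 : (fun i => (s i).eval r₁ (D.rad (6 / 8)) z) - (fun i => (νm i).eval D.r D.r' z) = 0 := by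
      refine eq_zero_of_lowSum_eq_mul (c := (e · z))
        (q := fun a => Qm.eval D.r D.r' z a - Q.eval r₁ (D.rad (6 / 8)) z a)
        ((Qm.differentiableOn_eval D.r_pos hzm).sub
          (Q.differentiableOn_eval hr₁0 hz6)).continuousOn (hez z hz7) fun a ha => ?_
      have h2 := (hs z hz6 a ha).symm.trans (hm z hzm a ha)
      simp only [← hke z hzm] at h2
      rw [lowSum_sub, mul_sub]
      linear_combination h2
    intro i
    have h3 := sub_eq_zero.1 (congrFun h1 i)
    simp only at h3
    rw [h3, AnnulusSpace.eval, hνm i z hzm.1, add_zero]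
  -- On r₁ < |z| < r' the function s has two Laurent decompositions. By uniqueness s has no minus
  -- part, and its plus part continues that of νm.
  have hsu : ∀ i, (∀ z ∈ ball (0 : ℂ) D.r', (s i).plus (D.rad (6 / 8)) z = (νm i).plus D.r' z) ∧
      ∀ z, r₁ < ‖z‖ → (s i).minus r₁ z = 0 := by
    intro i
    refine IsLaurentDecomposition.unique (f := fun z => (s i).eval r₁ (D.rad (6 / 8)) z) hr₁'
      ⟨(s i).differentiableOn_plus.mono (ball_subset_ball hr'6.le),
        (s i).differentiableOn_minus hr₁0, (s i).tendsto_minus, fun _ _ => rfl⟩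
      ⟨(νm i).differentiableOn_plus, differentiableOn_const 0, tendsto_const_nhds,
        fun z hz => by rw [hsm z hz i, add_zero]⟩
  have hse : ∀ z ∈ annulus r₁ (D.rad (6 / 8)), ∀ i,
      (s i).eval r₁ (D.rad (6 / 8)) z = (s i).plus (D.rad (6 / 8)) z := fun z hz i => by
    rw [AnnulusSpace.eval, (hsu i).2 z hz.1, add_zero]
  have hνe : ∀ z ∈ annulus D.R' D.R, ∀ i,
      (νp i).eval D.R' D.R z = (νp i).minus D.R' z := fun z hz i => by
    rw [AnnulusSpace.eval, hνp i z (annulus_subset_ball _ _ hz), zero_add]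
  -- the difference of the remainders, as a distorted Laurent sum
  obtain ⟨K, -, hK⟩ := AnnulusSpace.exists_of_holomorphic Sp Sm (D.R'_pos.trans hR1) h15
    D.R'_pos hR1 h56
  have hf : ∀ i, ∃ f : AnnulusSpace Sp Sm,
      (∀ z ∈ ball (0 : ℂ) (D.rad (5 / 8)),
        f.plus (D.rad (5 / 8)) z = -(s i).plus (D.rad (6 / 8)) z) ∧
      ∀ z, D.rad (1 / 8) < ‖z‖ → f.minus (D.rad (1 / 8)) z = (νp i).minus D.R' z := by
    intro i
    obtain ⟨c₁, -, h1⟩ := AnnulusSpace.exists_bound Sm Sm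
    obtain ⟨c₂, -, h2⟩ := AnnulusSpace.exists_bound Sp Sp
    obtain ⟨f, hf, -⟩ := hK (fun z => -(s i).plus (D.rad (6 / 8)) z + (νp i).minus D.R' z)
      (c₁ * ‖s i‖ + c₂ * ‖νp i‖)
      (((s i).differentiableOn_plus.mono (annulus_subset_ball _ _)).neg.add
        (((νp i).differentiableOn_minus D.R'_pos).mono fun z hz => hz.1)) fun z hz => by
        refine (norm_add_le _ _).trans (add_le_add ?_ ((h2 D.R' D.R D.R'_pos (νp i)).2 z hz.1))
        rw [norm_neg]
        exact (h1 r₁ (D.rad (6 / 8)) hr₁0 (s i)).1 z hz.2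
    exact ⟨f, (f.isLaurentDecomposition (D.R'_pos.trans hR1)).unique h15
      ⟨((s i).differentiableOn_plus.mono (ball_subset_ball h56.le)).neg,
        ((νp i).differentiableOn_minus D.R'_pos).mono fun z hz => hR1.trans hz,
        (νp i).tendsto_minus, hf⟩⟩
  choose f hfp hfm using hf
  obtain ⟨v, hv, hv0, hvF⟩ := (hCF.mono D.Vp_subset_W).exists_unit D.isOpen_Vp D.Vp_subset_W hk
  -- Subtracting the two divisions of S at a point of the overlap: the difference of the remainders
  -- is a combination of the two Weierstrass polynomials, which differ by the zero-free factor v u.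
  have hdiff : ∀ x ∈ D.Vp, x.2 ∈ ball (0 : ℂ) σ → D.z₁ x ∈ annulus r₁ (D.rad (6 / 8)) →
      D.polyVp k.2 x = v x * u (D.phi₁ x) * (x.2 ^ n + lowSum (e · (D.z₁ x)) x.2) ∧
      u (D.phi₁ x) ≠ 0 ∧ v x ≠ 0 ∧
      lowSum (fun i => (νp i).minus D.R' (D.z₂ x) + -(s i).plus (D.rad (6 / 8)) (D.z₁ x)) x.2 =
        (x.2 ^ n + lowSum (e · (D.z₁ x)) x.2) * Q.eval r₁ (D.rad (6 / 8)) (D.z₁ x) x.2 -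
          D.polyVp k.2 x * Qp.eval D.R' D.R (D.z₂ x) x.2 := by
    intro x hx hxσ hx₁
    have hx₂ : D.z₂ x ∈ annulus D.R' D.R := ⟨hx.2.1, hx.2.2.1⟩
    have h1 := hs _ hx₁ _ hxσ
    have h2 := hp _ hx₂ _ hxσ
    have h3 := hu _ (annulus_mono hr₁.le h67.le hx₁) _ hxσ
    rw [show (D.z₁ x, x.2) = D.phi₁ x from rfl, D.psi₁_phi₁ hx.1] at h1 h3
    rw [show (D.z₂ x, x.2) = D.phi₂ x from rfl, D.psi₂_phi₂ hx.1] at h2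
    refine ⟨?_, h3.2.1, hv0 x hx, ?_⟩
    · rw [hvF x hx, h3.2.2, mul_assoc]
    · simp only [hse _ hx₁] at h1
      simp only [hνe _ hx₂] at h2
      have h4 := lowSum_sub (fun i => (νp i).minus D.R' (D.z₂ x))
        (fun i => (s i).plus (D.rad (6 / 8)) (D.z₁ x)) x.2
      have h5 : (fun i => (νp i).minus D.R' (D.z₂ x) + -(s i).plus (D.rad (6 / 8)) (D.z₁ x)) =
          (fun i => (νp i).minus D.R' (D.z₂ x)) -
            fun i => (s i).plus (D.rad (6 / 8)) (D.z₁ x) := by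
        funext i
        simp [sub_eq_add_neg]
      rw [h5, h4, D.polyVp_eq]
      linear_combination h1 - h2
  -- Uniqueness with exchanged coordinates: the minus part of f, from νp, is a function of z₂ and
  -- the plus part, from s, a function of z₁. The moduli are k.2 at the inner end, in (z₂, w), and
  -- the continued polynomial e at the outer end, in (z₁, w).
  have hf0 : f = 0 := by
    refine Φ.eq_zero_of_multiple hσ hl ⟨fun z hz a ha => ?_, fun z hz a ha => ?_⟩
      (fun z hz => ?_) fun z hz => ?_
    · simp only [swapOverlap] at hz ha
      simp only [hl₁ z hz] at ha
      exact hkz z (annulus_mono hR1.le h2R.le hz) a ha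
    · simp only [swapOverlap] at hz ha
      simp only [hl₂ z hz] at ha
      exact hez z (annulus_mono (hrR'.trans hR4).le (h56.trans h67).le hz) a ha
    · simp only [swapOverlap] at hz ⊢
      have hz' : z ∈ annulus D.R' D.R := annulus_mono hR1.le h2R.le hz
      have hV : ∀ a ∈ ball (0 : ℂ) σ, (z, a) ∈ D.phi₂ '' D.U ∧ D.psi₂ (z, a) ∈ D.Vp :=
        fun a ha => D.mem_Vp_of_annulus hz'
          ((mem_ball_zero_iff.1 ha).trans (hσσ₁.trans_le hthin.le))
      have hz₁ : ∀ a ∈ ball (0 : ℂ) σ, D.z₁ (D.psi₂ (z, a)) ∈ annulus r₁ (D.rad (6 / 8)) := by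
        intro a ha
        have := hthin.trans₂₁_mem z hz a (hσb ha)
        exact annulus_mono (hr₁'.trans D.r'_lt_R').le h36.le this
      -- Here the divisor is the polynomial of k.2, so the term with Q is rewritten through (v u)⁻¹.
      refine ⟨fun a => (v (D.psi₂ (z, a)) * u (D.trans₂₁ (z, a), a))⁻¹ *
        Q.eval r₁ (D.rad (6 / 8)) (D.trans₂₁ (z, a)) a - Qp.eval D.R' D.R z a, ?_, fun a ha => ?_⟩
      · refine ContinuousOn.sub (ContinuousOn.mul (ContinuousOn.inv₀ ?_ ?_) ?_)
          (Qp.differentiableOn_eval D.R'_pos hz').continuousOn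
        · intro a ha
          have h1 : ContinuousAt (fun a => v (D.psi₂ (z, a))) a :=
            ((hv _ (hV a ha).2).continuousAt.comp
              (D.analyticAt_psi₂ (hV a ha).1).continuousAt).comp (f := fun a => (z, a))
              (by fun_prop)
          have h2 : ContinuousAt (fun a => (D.trans₂₁ (z, a), a)) a :=
            ((D.analyticAt_trans₂₁ (hV a ha).1).continuousAt.comp (f := fun a => (z, a))
              (by fun_prop)).prodMk continuousAt_id
          have h3 : ContinuousAt u (D.trans₂₁ (z, a), a) :=
            (hu _ (annulus_mono hr₁.le h67.le (hz₁ a ha)) a ha).1.continuousAt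
          exact (h1.mul (ContinuousAt.comp (f := fun a => (D.trans₂₁ (z, a), a)) h3
            h2)).continuousWithinAt
        · intro a ha
          exact mul_ne_zero (hv0 _ (hV a ha).2)
            (hu _ (annulus_mono hr₁.le h67.le (hz₁ a ha)) a ha).2.1
        · intro a ha
          have h2 : ContinuousAt (fun a => (D.trans₂₁ (z, a), a)) a :=
            ((D.analyticAt_trans₂₁ (hV a ha).1).continuousAt.comp (f := fun a => (z, a))
              (by fun_prop)).prodMk continuousAt_id
          have h3 : ContinuousAt (fun p : ℂ × ℂ => Q.eval r₁ (D.rad (6 / 8)) p.1 p.2)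
            (D.trans₂₁ (z, a), a) := Q.continuousAt_eval hr₁0 (hz₁ a ha) ha
          exact (ContinuousAt.comp (f := fun a => (D.trans₂₁ (z, a), a)) h3 h2).continuousWithinAt
      · obtain ⟨h1, h2, h3, h4⟩ := hdiff _ (hV a ha).2
          (by rw [D.psi₂_snd (hV a ha).1]; exact ha) (hz₁ a ha)
        rw [D.polyVp_eq, D.phi₁_psi₂ (hV a ha).1] at h1
        rw [D.polyVp_eq] at h4
        rw [D.phi₁_psi₂ (hV a ha).1] at h2
        rw [D.psi₂_snd (hV a ha).1, D.z₂_psi₂ (hV a ha).1] at h1 h4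
        simp only [hl₁ z hz]
        have h5 : ∀ i, (f i).minus (D.rad (1 / 8)) z +
            (f i).plus (D.rad (5 / 8)) (D.trans₂₁ (z, a)) =
            (νp i).minus D.R' z + -(s i).plus (D.rad (6 / 8)) (D.trans₂₁ (z, a)) := fun i => by
          rw [hfm i z hz.1, hfp i]
          exact mem_ball_zero_iff.2 ((hthin.trans₂₁_mem z hz a (hσb ha)).2.trans
            (D.rad_lt (by norm_num)))
        simp only [h5]
        rw [show D.z₁ (D.psi₂ (z, a)) = D.trans₂₁ (z, a) from rfl] at h1 h4
        simp only at h1 h2 h3 h4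
        rw [h4, mul_sub, h1]
        field_simp
    · simp only [swapOverlap] at hz ⊢
      have hz7 : z ∈ annulus D.r (D.rad (7 / 8)) :=
        annulus_mono (hrR'.trans hR4).le (h56.trans h67).le hz
      have hz6 : z ∈ annulus r₁ (D.rad (6 / 8)) :=
        annulus_mono ((hr₁'.trans D.r'_lt_R').trans hR4).le h56.le hz
      have hV : ∀ a ∈ ball (0 : ℂ) σ, (z, a) ∈ D.phi₁ '' D.U ∧ D.psi₁ (z, a) ∈ D.Vp := by
        intro a ha
        obtain ⟨h1, h2⟩ := hthin.mem_W z hz7 a (hσb ha)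
        have h3 := hthin.trans₁₂_mem z hz a (hσb ha)
        exact ⟨h1, h2.1, hR3.trans h3.1, h3.2, h2.2.2.2⟩
      have hz₂ : ∀ a ∈ ball (0 : ℂ) σ, D.trans₁₂ (z, a) ∈ annulus D.R' D.R := fun a ha =>
        annulus_mono hR3.le le_rfl (hthin.trans₁₂_mem z hz a (hσb ha))
      -- Here the divisor is the continued polynomial e, so the term with Qp acquires the factor v
      -- u.
      refine ⟨fun a => Q.eval r₁ (D.rad (6 / 8)) z a - v (D.psi₁ (z, a)) * u (z, a) *
        Qp.eval D.R' D.R (D.trans₁₂ (z, a)) a, ?_, fun a ha => ?_⟩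
      · refine ContinuousOn.sub (Q.differentiableOn_eval hr₁0 hz6).continuousOn
          fun a ha => ContinuousAt.continuousWithinAt ?_
        have h1 : ContinuousAt (fun a => v (D.psi₁ (z, a))) a :=
          ((hv _ (hV a ha).2).continuousAt.comp
            (D.analyticAt_psi₁ (hV a ha).1).continuousAt).comp (f := fun a => (z, a))
            (by fun_prop)
        have h2 : ContinuousAt (fun a => (D.trans₁₂ (z, a), a)) a :=
          ((D.analyticAt_trans₁₂ (hV a ha).1).continuousAt.comp (f := fun a => (z, a))
            (by fun_prop)).prodMk continuousAt_id
        have h3 : ContinuousAt (fun a => u (z, a)) a :=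
          (hu z hz7 a ha).1.continuousAt.comp (f := fun a => (z, a)) (by fun_prop)
        have h4 : ContinuousAt (fun p : ℂ × ℂ => Qp.eval D.R' D.R p.1 p.2)
          (D.trans₁₂ (z, a), a) := Qp.continuousAt_eval D.R'_pos (hz₂ a ha) ha
        exact (h1.mul h3).mul (ContinuousAt.comp (f := fun a => (D.trans₁₂ (z, a), a)) h4 h2)
      · obtain ⟨h1, h2, h3, h4⟩ := hdiff _ (hV a ha).2
          (by rw [D.psi₁_snd (hV a ha).1]; exact ha)
          (by rw [D.z₁_psi₁ (hV a ha).1]; exact hz6)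
        rw [h1] at h4
        rw [D.phi₁_psi₁ (hV a ha).1, D.psi₁_snd (hV a ha).1, D.z₁_psi₁ (hV a ha).1] at h4
        simp only [hl₂ z hz]
        have h5 : ∀ i, (f i).minus (D.rad (1 / 8)) (D.trans₁₂ (z, a)) +
            (f i).plus (D.rad (5 / 8)) z =
            (νp i).minus D.R' (D.trans₁₂ (z, a)) + -(s i).plus (D.rad (6 / 8)) z := fun i => by
          rw [hfp i z (annulus_subset_ball _ _ hz), hfm i]
          exact (D.rad_lt (by norm_num)).trans (hthin.trans₁₂_mem z hz a (hσb ha)).1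
        simp only [h5]
        rw [show D.z₂ (D.psi₁ (z, a)) = D.trans₁₂ (z, a) from rfl] at h4
        simp only at h4
        rw [h4]
        ring
  have hs0 : ∀ i, ∀ z ∈ ball (0 : ℂ) (D.rad (5 / 8)), (s i).plus (D.rad (6 / 8)) z = 0 := by
    intro i z hz
    have := hfp i z hz
    rw [hf0, Pi.zero_apply, AnnulusSpace.plus_zero] at this
    exact neg_eq_zero.1 this.symm
  refine ⟨fun z hz i => ?_, fun z hz i => ?_, fun z hz i => ?_⟩
  · have hzb := annulus_subset_ball _ _ hz
    rw [AnnulusSpace.eval, hνm i z hz.1, add_zero, ← (hsu i).1 z hzb]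
    exact hs0 i z (ball_subset_ball hr'5.le hzb)
  · rw [hse z (annulus_mono le_rfl h56.le hz)]
    exact hs0 i z (annulus_subset_ball _ _ hz)
  · rw [hνe z (annulus_mono hR1.le le_rfl hz), ← hfm i z hz.1, hf0, Pi.zero_apply,
      AnnulusSpace.minus_zero]

end DistortedCylinder

end

noncomputable section

open Set Metric Filter

open ProductSpace

/-! ### Existence of the distorted Weierstrass polynomial -/

namespace DistortedCylinder

variable {D : DistortedCylinder} {Sm Sp : SmoothnessClass} {n : ℕ}

/-- For |w| ≥ τ neither F nor S has zeros. For |w| < τ one of the two coordinate systems is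
available by `cover`, and there the zero-free quotients on slices assemble to an analytic unit by
`exists_analytic_quotient`. -/
theorem isDivOn_of_slices {σ₁ σ τ δ : ℝ} (hthin : D.IsThin σ₁) (hσσ₁ : σ < σ₁) (hτ : 0 < τ)
    (hτσ : τ < σ) (hδτ : δ < τ) {C : Curve D.W} {F S : ℂ × ℂ → ℂ} (hF : AnalyticOnNhd ℂ F D.W)
    (hCF : C.IsDivOn D.W F) (hs : ∀ x ∈ C.support, ‖x.2‖ ≤ δ) (hS : AnalyticOnNhd ℂ S D.W)
    (hSn : ∀ x ∈ D.W, ‖S x - x.2 ^ n‖ ≤ τ ^ n / 8)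
    (h₁ : ∀ z ∈ annulus D.r (D.rad (5 / 8)), ∃ q : ℂ → ℂ, DifferentiableOn ℂ q (ball 0 σ) ∧
      (∀ a ∈ ball (0 : ℂ) τ, q a ≠ 0) ∧
      ∀ a ∈ ball (0 : ℂ) σ, S (D.psi₁ (z, a)) = F (D.psi₁ (z, a)) * q a)
    (h₂ : ∀ z ∈ annulus (D.rad (1 / 8)) D.R, ∃ q : ℂ → ℂ, DifferentiableOn ℂ q (ball 0 σ) ∧
      (∀ a ∈ ball (0 : ℂ) τ, q a ≠ 0) ∧
      ∀ a ∈ ball (0 : ℂ) σ, S (D.psi₂ (z, a)) = F (D.psi₂ (z, a)) * q a) :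
    C.IsDivOn D.W S := by
  have hF0 : ∀ x ∈ D.W, δ < ‖x.2‖ → F x ≠ 0 := fun x hx hδ h0 =>
    absurd (hs x ((Curve.mem_support_iff hCF hx hx).2 h0)) (not_le.2 hδ)
  have hσb : ball (0 : ℂ) σ ⊆ ball 0 σ₁ := ball_subset_ball hσσ₁.le
  have hm₁ : ∀ z ∈ annulus D.r (D.rad (5 / 8)), ∀ a ∈ ball (0 : ℂ) σ,
      (z, a) ∈ D.phi₁ '' D.U ∧ D.psi₁ (z, a) ∈ D.W := fun z hz a ha =>
    hthin.mem_W z (annulus_mono le_rfl (D.rad_lt (by norm_num)).le hz) a (hσb ha)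
  have hR1 : D.R' < D.rad (1 / 8) := by rw [← D.rad_zero]; exact D.rad_lt (by norm_num)
  have hm₂ : ∀ z ∈ annulus (D.rad (1 / 8)) D.R, ∀ a ∈ ball (0 : ℂ) σ,
      (z, a) ∈ D.phi₂ '' D.U ∧ D.psi₂ (z, a) ∈ D.W := fun z hz a ha => by
    obtain ⟨h1, h2⟩ := D.mem_Vp_of_annulus (annulus_mono hR1.le le_rfl hz)
      ((mem_ball_zero_iff.1 ha).trans (hσσ₁.trans_le hthin.le))
    exact ⟨h1, D.Vp_subset_W h2⟩
  have hcomp₁ : ∀ G : ℂ × ℂ → ℂ, AnalyticOnNhd ℂ G D.W →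
      AnalyticOnNhd ℂ (fun p => G (D.psi₁ p)) (annulus D.r (D.rad (5 / 8)) ×ˢ ball 0 σ) :=
    fun G hG p hp => (hG _ (hm₁ _ hp.1 _ hp.2).2).comp (D.analyticAt_psi₁ (hm₁ _ hp.1 _ hp.2).1)
  have hcomp₂ : ∀ G : ℂ × ℂ → ℂ, AnalyticOnNhd ℂ G D.W →
      AnalyticOnNhd ℂ (fun p => G (D.psi₂ p)) (annulus (D.rad (1 / 8)) D.R ×ˢ ball 0 σ) :=
    fun G hG p hp => (hG _ (hm₂ _ hp.1 _ hp.2).2).comp (D.analyticAt_psi₂ (hm₂ _ hp.1 _ hp.2).1)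
  have hsph : ∀ t ∈ sphere (0 : ℂ) τ, t ∈ ball (0 : ℂ) σ ∧ δ < ‖t‖ := fun t ht => by
    have := mem_sphere_zero_iff_norm.1 ht
    exact ⟨mem_ball_zero_iff.2 (this ▸ hτσ), this ▸ hδτ⟩
  obtain ⟨u₁, hu₁⟩ := exists_analytic_quotient (isOpen_annulus _ _) (hcomp₁ S hS) (hcomp₁ F hF)
    hτ hτσ (fun z hz t ht => hF0 _ (hm₁ z hz t (hsph t ht).1).2
      (by rw [D.psi₁_snd (hm₁ z hz t (hsph t ht).1).1]; exact (hsph t ht).2)) h₁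
  obtain ⟨u₂, hu₂⟩ := exists_analytic_quotient (isOpen_annulus _ _) (hcomp₂ S hS) (hcomp₂ F hF)
    hτ hτσ (fun z hz t ht => hF0 _ (hm₂ z hz t (hsph t ht).1).2
      (by rw [D.psi₂_snd (hm₂ z hz t (hsph t ht).1).1]; exact (hsph t ht).2)) h₂
  intro x hxW
  rw [hCF x hxW]
  obtain ⟨x, hx⟩ := x
  simp only at hxW ⊢
  symm
  rcases le_or_gt τ ‖x.2‖ with hxτ | hxτ
  · have hFx := hF0 x hx (hδτ.trans_le hxτ)
    have hSx : S x ≠ 0 := by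
      intro h0
      have h1 := hSn x hx
      rw [h0, zero_sub, norm_neg, norm_pow] at h1
      have h2 : τ ^ n ≤ ‖x.2‖ ^ n := pow_le_pow_left₀ hτ.le hxτ n
      have h3 : 0 < τ ^ n := pow_pos hτ n
      linarith
    refine principalStalk_eq_of_unit (u := fun y => S y / F y) ((hS x hx).div (hF x hx) hFx)
      (div_ne_zero hSx hFx) ?_
    filter_upwards [(hF x hx).continuousAt.eventually_ne hFx] with y hy
    rw [div_mul_cancel₀ _ hy]
  · have hxτ' : ∀ᶠ y : ℂ × ℂ in 𝓝 x, ‖y.2‖ < τ :=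
      (continuous_snd.norm.continuousAt).eventually (gt_mem_nhds hxτ)
    rcases hthin.cover x hx (hxτ.trans (hτσ.trans hσσ₁)) with h | h
    · have hx₁ : D.z₁ x ∈ annulus D.r (D.rad (5 / 8)) := ⟨hx.2.1, h⟩
      obtain ⟨h1, h2, -⟩ := hu₁ _ hx₁ x.2 (mem_ball_zero_iff.2 hxτ)
      refine principalStalk_eq_of_unit (u := fun y => u₁ (D.phi₁ y))
        (AnalyticAt.comp (f := D.phi₁) h1 (D.analyticAt_phi₁ hx.1)) h2 ?_
      filter_upwards [hxτ', D.isOpen_W.mem_nhds hx,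
        (D.z₁_analytic x hx.1).continuousAt.preimage_mem_nhds ((isOpen_annulus _ _).mem_nhds hx₁)]
        with y hy hyW hy₁
      have := (hu₁ _ hy₁ y.2 (mem_ball_zero_iff.2 hy)).2.2
      rwa [show (D.z₁ y, y.2) = D.phi₁ y from rfl, D.psi₁_phi₁ hyW.1] at this
    · have hx₁ : D.z₂ x ∈ annulus (D.rad (1 / 8)) D.R := ⟨h, hx.2.2.1⟩
      obtain ⟨h1, h2, -⟩ := hu₂ _ hx₁ x.2 (mem_ball_zero_iff.2 hxτ)
      refine principalStalk_eq_of_unit (u := fun y => u₂ (D.phi₂ y))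
        (AnalyticAt.comp (f := D.phi₂) h1 (D.analyticAt_phi₂ hx.1)) h2 ?_
      filter_upwards [hxτ', D.isOpen_W.mem_nhds hx,
        (D.z₂_analytic x hx.1).continuousAt.preimage_mem_nhds ((isOpen_annulus _ _).mem_nhds hx₁)]
        with y hy hyW hy₁
      have := (hu₂ _ hy₁ y.2 (mem_ball_zero_iff.2 hy)).2.2
      rwa [show (D.z₂ y, y.2) = D.phi₂ y from rfl, D.psi₂_phi₂ hyW.1] at this

theorem distortedPoly_psi₁ (D : DistortedCylinder) (f : Fin n → AnnulusSpace Sm Sp) {z a : ℂ}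
    (h : (z, a) ∈ D.phi₁ '' D.U) : D.distortedPoly f (D.psi₁ (z, a)) =
      a ^ n + lowSum (fun i => (f i).minus D.r z + (f i).plus D.R (D.trans₁₂ (z, a))) a := by
  rw [D.distortedPoly_eq, D.psi₁_snd h, D.z₁_psi₁ h]
  rfl

theorem distortedPoly_psi₂ (D : DistortedCylinder) (f : Fin n → AnnulusSpace Sm Sp) {z a : ℂ}
    (h : (z, a) ∈ D.phi₂ '' D.U) : D.distortedPoly f (D.psi₂ (z, a)) =
      a ^ n + lowSum (fun i => (f i).minus D.r (D.trans₂₁ (z, a)) + (f i).plus D.R z) a := by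
  rw [D.distortedPoly_eq, D.psi₂_snd h, D.z₂_psi₂ h]
  rfl

/-- Existence: the distorted Weierstrass polynomial with the coefficients computed from a small
`κ` defines the curve. -/
theorem eventually_isDivOn (D : DistortedCylinder) (Sm Sp : SmoothnessClass) (n : ℕ) :
    ∃ σ₁, 0 < σ₁ ∧ σ₁ ≤ D.ρ ∧ ∀ σ (hσ : 0 < σ), σ < σ₁ → ∀ Φ : Frame D.overlap Sm Sp σ,
      ∀ᶠ k in 𝓝 (0 : KappaSpace Sm Sp n), ∀ C : Curve D.W, D.IsSmoothCurve Sm Sp n C →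
        D.IsKappa C k →
          C.IsDivOn D.W (D.distortedPoly (Φ.solution hσ n (Frame.pair Sm Sp σ k))) := by
  obtain ⟨σ₁', hthin'⟩ := D.exists_isThin
  obtain ⟨σ₂, hσ₂, hframe⟩ := exists_frame D.swapOverlap Sp Sm
  refine ⟨min σ₁' σ₂, lt_min hthin'.pos hσ₂, (min_le_left _ _).trans hthin'.le,
    fun σ hσ hσσ₁ Φ => ?_⟩
  obtain ⟨Φ'⟩ := hframe σ hσ (hσσ₁.trans_le (min_le_right _ _))
  replace hσσ₁ : σ < σ₁' := hσσ₁.trans_le (min_le_left _ _)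
  have hσb : ball (0 : ℂ) σ ⊆ ball 0 σ₁' := ball_subset_ball hσσ₁.le
  set τ := σ / 2 with hτdef
  have hτ : 0 < τ := by positivity
  have hτσ : τ < σ := by linarith
  have hτn : 0 < τ ^ n := pow_pos hτ n
  -- radii
  set r₁ := (D.r + D.r') / 2 with hr₁def
  have hrr' := D.r_lt_r'
  have hr₁ : D.r < r₁ := by linarith
  have hr₁' : r₁ < D.r' := by linarith
  have hr₁0 : 0 < r₁ := D.r_pos.trans hr₁
  have hR1 : D.R' < D.rad (1 / 8) := by rw [← D.rad_zero]; exact D.rad_lt (by norm_num)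
  have hrR4 : D.r < D.rad (4 / 8) := hrr'.trans (D.r'_lt_rad (by norm_num))
  have hr₁6 : r₁ < D.rad (6 / 8) := hr₁'.trans (D.r'_lt_rad (by norm_num))
  have h12 : D.rad (1 / 8) < D.rad (2 / 8) := D.rad_lt (by norm_num)
  have h45 : D.rad (4 / 8) < D.rad (5 / 8) := D.rad_lt (by norm_num)
  have h57 : D.rad (5 / 8) < D.rad (7 / 8) := D.rad_lt (by norm_num)
  have h56 : D.rad (5 / 8) < D.rad (6 / 8) := D.rad_lt (by norm_num)
  have h67 : D.rad (6 / 8) < D.rad (7 / 8) := D.rad_lt (by norm_num)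
  have h2R := D.rad_lt_R (by norm_num : (2 / 8 : ℝ) < 1)
  -- thresholds
  obtain ⟨C₁, hC₁, HC₁⟩ := AnnulusSpace.exists_of_holomorphic Sm Sm hr₁0 hr₁6 D.r_pos hr₁ h67
  obtain ⟨C₂, hC₂, HC₂⟩ := AnnulusSpace.exists_of_holomorphic Sm Sm (D.r_pos.trans hrR4) h45
    D.r_pos hrR4 h57
  obtain ⟨C₃, hC₃, HC₃⟩ := AnnulusSpace.exists_of_holomorphic Sp Sp (D.R'_pos.trans hR1) h12
    D.R'_pos hR1 h2R
  obtain ⟨ε₁, hε₁, H₁⟩ := Metric.eventually_nhds_iff_ball.1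
    (eventually_isUnit_divOp (S := Sm) (n := n) hr₁0 hr₁6 hσ)
  obtain ⟨ε₂, hε₂, H₂⟩ := Metric.eventually_nhds_iff_ball.1 (Φ'.eventually_regular (n := n) hσ)
  set B := 1 + τ with hBdef
  have hBn : 0 < B ^ n := by positivity
  -- Coefficients bounded by M keep a Weierstrass polynomial within τⁿ/8 of wⁿ on |w| = τ, as
  -- `ne_zero_of_close` requires.
  set M := τ ^ n / 8 / ((n + 1) * B ^ n) with hMdef
  have hM : 0 < M := by positivity
  have hMle : ∀ c : Fin n → ℂ, (∀ i, ‖c i‖ ≤ M) → ∀ t ∈ sphere (0 : ℂ) τ,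
      ‖t ^ n + lowSum c t - t ^ n‖ ≤ τ ^ n / 8 := by
    intro c hc t ht
    rw [add_sub_cancel_left]
    refine (norm_lowSum_le hc hM.le (B := B) ((mem_sphere_zero_iff_norm.1 ht).le.trans
      (by linarith)) (by linarith)).trans ?_
    have h1 : (n + 1) * (M * B ^ n) = τ ^ n / 8 := by
      rw [hMdef]
      field_simp
    have h2 : 0 < M * B ^ n := by positivity
    linarith
  -- If the curve lies in |w| ≤ δ, the coefficients of the continued polynomial are at most 2ⁿδ. The
  -- bounds make them small enough for M, for division by it over the tube (ε₁), and for regularity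
  -- in the exchanged frame (ε₂).
  obtain ⟨δ, hδ, hδ1, hδσ, hδM, hδ₁, hδ₂⟩ : ∃ δ : ℝ, 0 < δ ∧ δ ≤ 1 ∧ 5 * δ < σ ∧ 2 ^ n * δ ≤ M ∧
      C₁ * (2 ^ n * δ) < ε₁ ∧ C₂ * (2 ^ n * δ) < ε₂ := by
    have hc : ∀ c : ℝ, Tendsto (fun δ : ℝ => c * δ) (𝓝[>] 0) (𝓝 0) := fun c => by
      have : Continuous fun δ : ℝ => c * δ := by fun_prop
      simpa using (this.tendsto 0).mono_left nhdsWithin_le_nhds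
    have := (((((hc 1).eventually (gt_mem_nhds one_pos)).and ((hc 5).eventually
      (gt_mem_nhds hσ))).and ((hc (2 ^ n)).eventually (gt_mem_nhds hM))).and
      (((hc (C₁ * 2 ^ n)).eventually (gt_mem_nhds hε₁)).and ((hc (C₂ * 2 ^ n)).eventually
      (gt_mem_nhds hε₂)))).and self_mem_nhdsWithin
    obtain ⟨δ, ⟨⟨⟨h1, h2⟩, h3⟩, h4, h5⟩, h6⟩ := this.exists
    exact ⟨δ, h6, by linarith, h2, h3.le, by rwa [← mul_assoc], by rwa [← mul_assoc]⟩
  have hδτ : δ < τ := by linarith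
  obtain ⟨μ, hμ, hμM, hμ₃⟩ : ∃ μ : ℝ, 0 < μ ∧ μ ≤ M ∧ C₃ * μ < ε₂ := by
    refine ⟨min M (ε₂ / (C₃ + 1)), lt_min hM (by positivity), min_le_left _ _, ?_⟩
    have h1 : min M (ε₂ / (C₃ + 1)) ≤ ε₂ / (C₃ + 1) := min_le_right _ _
    have h2 : C₃ * (ε₂ / (C₃ + 1)) < ε₂ := by
      rw [mul_div_assoc', div_lt_iff₀ (by positivity)]
      nlinarith
    exact (mul_le_mul_of_nonneg_left h1 hC₃).trans_lt h2
  filter_upwards [Φ.eventually_regular (n := n) hσ, eventually_zeros Sm Sp n hδ,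
    eventually_norm_eval_le Sm Sp n hμ, D.eventually_support Sm Sp n hδ,
    (Φ.tendsto_solution (n := n) hσ).eventually
      (D.exists_norm_distortedPoly_sub_le Sm Sp n (by positivity : 0 < τ ^ n / 8))]
    with k hreg hzeros heval hsupp hSn C hC hkC
  have hs := hsupp C hC hkC
  obtain ⟨F, Gm, Gp, ρ', hF, hCF, -⟩ := hC
  set f := Φ.solution hσ n (Frame.pair Sm Sp σ k) with hfdef
  have hmemσ : ∀ a : ℂ, ‖a‖ ≤ δ → a ∈ ball (0 : ℂ) σ := fun a ha =>
    mem_ball_zero_iff.2 (by linarith)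
  obtain ⟨e, u, he, heb, hez, hu, heg⟩ := exists_weierstrass_tube hthin' hσσ₁ hδ hδσ hδ1 hF.analytic
    hCF hs hkC.1 fun ζ hζ => (hzeros D.r D.r' D.r_pos ζ hζ).1
  have heM : ∀ z ∈ annulus D.r (D.rad (7 / 8)), ∀ i, ‖e i z‖ ≤ M := fun z hz i =>
    (heb z hz i).trans hδM
  have hkM : ∀ z ∈ annulus D.R' D.R, ∀ i, ‖(k.2 i).eval D.R' D.R z‖ ≤ M := fun z hz i =>
    ((heval D.R' D.R D.R'_pos z hz).2 i).trans hμM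
  -- coefficients on smaller annuli
  have hE₁ : ∀ i, ∃ g : AnnulusSpace Sm Sm, (∀ z ∈ annulus r₁ (D.rad (6 / 8)),
      g.eval r₁ (D.rad (6 / 8)) z = e i z) ∧ ‖g‖ ≤ C₁ * (2 ^ n * δ) := fun i =>
    HC₁ (e i) _ (he i) fun z hz => heb z hz i
  have hE₂ : ∀ i, ∃ g : AnnulusSpace Sm Sm, (∀ z ∈ annulus (D.rad (4 / 8)) (D.rad (5 / 8)),
      g.eval (D.rad (4 / 8)) (D.rad (5 / 8)) z = e i z) ∧ ‖g‖ ≤ C₂ * (2 ^ n * δ) := fun i =>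
    HC₂ (e i) _ (he i) fun z hz => heb z hz i
  have hE₃ : ∀ i, ∃ g : AnnulusSpace Sp Sp, (∀ z ∈ annulus (D.rad (1 / 8)) (D.rad (2 / 8)),
      g.eval (D.rad (1 / 8)) (D.rad (2 / 8)) z = (k.2 i).eval D.R' D.R z) ∧ ‖g‖ ≤ C₃ * μ := fun i =>
    HC₃ _ _ ((k.2 i).differentiableOn_eval D.R'_pos) fun z hz => (heval D.R' D.R D.R'_pos z hz).2 i
  choose E₁ hE₁ hE₁n using hE₁
  choose E₂ hE₂ hE₂n using hE₂
  choose E₃ hE₃ hE₃n using hE₃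
  have hU₁ : IsUnit (divOp hr₁0 hr₁6 hσ n (weier Sm σ E₁)) := by
    refine H₁ E₁ (mem_ball_zero_iff.2 (lt_of_le_of_lt ?_ hδ₁))
    exact (pi_norm_le_iff_of_nonneg (by positivity)).2 hE₁n
  have hU₂ : Φ'.Regular hσ n (Frame.pair Sp Sm σ (E₃, E₂)) := by
    refine H₂ (E₃, E₂) (mem_ball_zero_iff.2 ?_)
    exact max_lt
      (((pi_norm_le_iff_of_nonneg (by positivity)).2 hE₃n).trans_lt hμ₃)
      (((pi_norm_le_iff_of_nonneg (by positivity)).2 hE₂n).trans_lt hδ₂)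
  -- divisions
  have hSa : AnalyticOnNhd ℂ (D.distortedPoly f) D.W := D.analyticOnNhd_distortedPoly f
  obtain ⟨Qm, hQm⟩ := exists_div _ _ hσ hreg.minus (wpow Sm σ n + Φ.Tm n f)
  obtain ⟨Qp, hQp⟩ := exists_div _ _ hσ hreg.plus (wpow Sp σ n + Φ.Tp n f)
  have hcol := Φ.collect_rem_solution hσ hreg.op
  rw [← hfdef] at hcol
  set νm := rem D.overlap.r_pos D.overlap.r_lt_r' hσ n (Frame.pair Sm Sp σ k).1
    (wpow Sm σ n + Φ.Tm n f)
  set νp := rem D.overlap.R'_pos D.overlap.R'_lt_R hσ n (Frame.pair Sm Sp σ k).2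
    (wpow Sp σ n + Φ.Tp n f)
  have hcoli : ∀ i, collect D.overlap Sm Sp (νm i, νp i) = 0 := fun i => congrFun hcol i
  -- The equation for f says exactly that the inner remainder has no minus part and the outer one no
  -- plus part.
  have hνm : ∀ i z, D.r < ‖z‖ → (νm i).minus D.r z = 0 := fun i z hz => by
    have h := (collect_parts (D := D.overlap) (νm i, νp i)).2 z hz
    rw [hcoli i, AnnulusSpace.minus_zero] at h
    exact h.symm
  have hνp : ∀ i, ∀ z ∈ ball (0 : ℂ) D.R, (νp i).plus D.R z = 0 := fun i z hz => by
    have h := (collect_parts (D := D.overlap) (νm i, νp i)).1 z hz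
    rw [hcoli i, AnnulusSpace.plus_zero] at h
    exact h.symm
  have hm₁ : ∀ z ∈ annulus D.r D.r', ∀ a ∈ ball (0 : ℂ) σ, (z, a) ∈ D.phi₁ '' D.U :=
    fun z hz a ha => (D.mem_Vm_of_annulus hz
      ((mem_ball_zero_iff.1 ha).trans (hσσ₁.trans_le hthin'.le))).1
  have hm₂ : ∀ z ∈ annulus D.R' D.R, ∀ a ∈ ball (0 : ℂ) σ,
      (z, a) ∈ D.phi₂ '' D.U ∧ D.psi₂ (z, a) ∈ D.Vp :=
    fun z hz a ha => D.mem_Vp_of_annulus hz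
      ((mem_ball_zero_iff.1 ha).trans (hσσ₁.trans_le hthin'.le))
  have hm : ∀ z ∈ annulus D.r D.r', ∀ a ∈ ball (0 : ℂ) σ, D.distortedPoly f (D.psi₁ (z, a)) =
      (a ^ n + lowSum (fun i => (k.1 i).eval D.r D.r' z) a) * Qm.eval D.r D.r' z a +
        lowSum (fun i => (νm i).eval D.r D.r' z) a := by
    intro z hz a ha
    rw [D.distortedPoly_psi₁ f (hm₁ z hz a ha), ← eval_poly' νm ha, ← eval_weier D.r_pos k.1 hz ha,
      ← eval_mul D.r_pos D.r_lt_r' _ _ hz ha, ← ProductSpace.eval_add]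
    exact (Φ.eval_wpow_add_Tm f hz ha).symm.trans
      (congrArg (fun G : ProductSpace Sm σ => G.eval D.r D.r' z a) hQm)
  have hp : ∀ z ∈ annulus D.R' D.R, ∀ a ∈ ball (0 : ℂ) σ, D.distortedPoly f (D.psi₂ (z, a)) =
      (a ^ n + lowSum (fun i => (k.2 i).eval D.R' D.R z) a) * Qp.eval D.R' D.R z a +
        lowSum (fun i => (νp i).eval D.R' D.R z) a := by
    intro z hz a ha
    rw [D.distortedPoly_psi₂ f (hm₂ z hz a ha).1, ← eval_poly' νp ha,
      ← eval_weier D.R'_pos k.2 hz ha, ← eval_mul D.R'_pos D.R'_lt_R _ _ hz ha,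
      ← ProductSpace.eval_add]
    exact (Φ.eval_wpow_add_Tp f hz ha).symm.trans
      (congrArg (fun G : ProductSpace Sp σ => G.eval D.R' D.R z a) hQp)
  -- Division by the continued polynomial. It takes place over r₁ < |z₁| < rad (6/8), a
  -- neighbourhood of whose closure lies in the tube, so that the distorted polynomial is smooth
  -- there merely by being holomorphic and bounded.
  obtain ⟨s, Q, hsQ⟩ : ∃ (s : Fin n → AnnulusSpace Sm Sm) (Q : ProductSpace Sm σ),
      ∀ z ∈ annulus r₁ (D.rad (6 / 8)), ∀ a ∈ ball (0 : ℂ) σ, D.distortedPoly f (D.psi₁ (z, a)) =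
        (a ^ n + lowSum (e · z) a) * Q.eval r₁ (D.rad (6 / 8)) z a +
          lowSum (fun i => (s i).eval r₁ (D.rad (6 / 8)) z) a := by
    have hSd : AnalyticOnNhd ℂ (fun p => D.distortedPoly f (D.psi₁ p))
        (annulus D.r (D.rad (7 / 8)) ×ˢ ball 0 σ₁') := fun p hp =>
      (hSa _ (hthin'.mem_W _ hp.1 _ hp.2).2).comp (D.analyticAt_psi₁ (hthin'.mem_W _ hp.1 _ hp.2).1)
    obtain ⟨G, hG⟩ := ProductSpace.exists_of_holomorphic Sm D.r_pos hr₁ hr₁6 h67 hσ hσσ₁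
      (h := fun z a => D.distortedPoly f (D.psi₁ (z, a))) (M := D.ρ ^ n + τ ^ n / 8)
      hSd.continuousOn (fun a ha => differentiableOn_slice_fst hSd ha)
      (fun z hz => differentiableOn_slice_snd hSd hz) fun z hz a ha => by
        obtain ⟨h1, h2⟩ := hthin'.mem_W z hz a ha
        have h3 := hSn _ h2
        have h4 := norm_le_norm_sub_add (D.distortedPoly f (D.psi₁ (z, a)))
          ((D.psi₁ (z, a)).2 ^ n)
        have h5 : ‖(D.psi₁ (z, a)).2 ^ n‖ ≤ D.ρ ^ n := by
          rw [norm_pow]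
          exact pow_le_pow_left₀ (norm_nonneg _) h2.2.2.2.le n
        linarith
    obtain ⟨Q, hQ⟩ := exists_div hr₁0 hr₁6 hσ hU₁ G
    refine ⟨rem hr₁0 hr₁6 hσ n (weier Sm σ E₁) G, Q, fun z hz a ha => ?_⟩
    rw [← hG z hz a ha, ← eval_poly' _ ha]
    have h1 := eval_weier (σ := σ) hr₁0 E₁ hz ha
    simp only [fun i => hE₁ i z hz] at h1
    rw [← h1, ← eval_mul hr₁0 hr₁6 _ _ hz ha, ← ProductSpace.eval_add]
    exact congrArg (fun G : ProductSpace Sm σ => G.eval r₁ (D.rad (6 / 8)) z a) hQ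
  obtain ⟨hν₁, hν₂, hν₃⟩ := remainders_eq_zero hthin' hσ hσσ₁ hr₁ hr₁' hCF
    (fun z hz a ha => hmemσ a (hez z hz a ha)) hu hkC.2
    (fun ζ hζ a ha => hmemσ a ((hzeros D.R' D.R D.R'_pos ζ hζ).2 a ha)) heg Φ' hU₂
    (fun z hz i => hE₃ i z hz) (fun z hz i => hE₂ i z hz) hm hp hsQ hνm hνp
  have hlow0 : ∀ a, lowSum (fun _ : Fin n => (0 : ℂ)) a = 0 := fun a => by simp [lowSum]
  have hSsph₁ : ∀ z ∈ annulus D.r (D.rad (7 / 8)), ∀ t ∈ sphere (0 : ℂ) τ,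
      ‖D.distortedPoly f (D.psi₁ (z, t)) - t ^ n‖ ≤ τ ^ n / 8 := by
    intro z hz t ht
    have htσ : t ∈ ball (0 : ℂ) σ₁' := mem_ball_zero_iff.2
      ((mem_sphere_zero_iff_norm.1 ht).trans_lt (hτσ.trans hσσ₁))
    obtain ⟨h1, h2⟩ := hthin'.mem_W z hz t htσ
    have := hSn _ h2
    rwa [D.psi₁_snd h1] at this
  refine isDivOn_of_slices hthin' hσσ₁ hτ hτσ hδτ hF.analytic hCF hs hSa hSn (fun z hz => ?_)
    fun z hz => ?_
  · have hz7 : z ∈ annulus D.r (D.rad (7 / 8)) := annulus_mono le_rfl h57.le hz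
    obtain ⟨q, hq, hSq⟩ : ∃ q : ℂ → ℂ, DifferentiableOn ℂ q (ball 0 σ) ∧ ∀ a ∈ ball (0 : ℂ) σ,
        D.distortedPoly f (D.psi₁ (z, a)) = (a ^ n + lowSum (e · z) a) * q a := by
      -- Near the inner side the quotient Qm on V⁻ is used, further out the quotient Q over the
      -- tube.
      rcases lt_or_ge ‖z‖ D.r' with h | h
      · have hz' : z ∈ annulus D.r D.r' := ⟨hz.1, h⟩
        refine ⟨_, Qm.differentiableOn_eval D.r_pos hz', fun a ha => ?_⟩
        rw [hm z hz' a ha]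
        simp only [hν₁ z hz', hlow0, add_zero, heg z hz']
      · have hz' : z ∈ annulus r₁ (D.rad (5 / 8)) := ⟨hr₁'.trans_le h, hz.2⟩
        have hz6 : z ∈ annulus r₁ (D.rad (6 / 8)) := annulus_mono le_rfl h56.le hz'
        refine ⟨_, Q.differentiableOn_eval hr₁0 hz6, fun a ha => ?_⟩
        rw [hsQ z hz6 a ha]
        simp only [hν₂ z hz', hlow0, add_zero]
    have hud : DifferentiableOn ℂ (fun a => u (z, a)) (ball 0 σ) := fun a ha =>
      ((hu z hz7 a ha).1.differentiableAt.comp a (f := fun a => (z, a))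
        (by fun_prop)).differentiableWithinAt
    have hsub : sphere (0 : ℂ) τ ⊆ ball 0 σ :=
      sphere_subset_closedBall.trans (closedBall_subset_ball hτσ)
    refine ⟨fun a => q a / u (z, a), hq.div hud fun a ha => (hu z hz7 a ha).2.1, fun a ha => ?_,
      fun a ha => ?_⟩
    · refine div_ne_zero ?_ (hu z hz7 a (ball_subset_ball hτσ.le ha)).2.1
      exact ne_zero_of_close hτ hτσ hq (fun t ht => hSq t (hsub ht)) (hMle _ (heM z hz7))
        (hSsph₁ z hz7) ha
    · rw [hSq a ha, (hu z hz7 a ha).2.2, mul_comm (u (z, a)), mul_assoc,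
        mul_div_cancel₀ _ (hu z hz7 a ha).2.1]
  · have hz' : z ∈ annulus D.R' D.R := annulus_mono hR1.le le_rfl hz
    obtain ⟨v, hv, hv0, hvF⟩ := (hCF.mono D.Vp_subset_W).exists_unit D.isOpen_Vp D.Vp_subset_W hkC.2
    have hSq : ∀ a ∈ ball (0 : ℂ) σ, D.distortedPoly f (D.psi₂ (z, a)) =
        (a ^ n + lowSum (fun i => (k.2 i).eval D.R' D.R z) a) * Qp.eval D.R' D.R z a := by
      intro a ha
      rw [hp z hz' a ha]
      simp only [hν₃ z hz, hlow0, add_zero]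
    have hq := Qp.differentiableOn_eval D.R'_pos hz'
    have hsub : sphere (0 : ℂ) τ ⊆ ball 0 σ :=
      sphere_subset_closedBall.trans (closedBall_subset_ball hτσ)
    refine ⟨fun a => Qp.eval D.R' D.R z a * v (D.psi₂ (z, a)), hq.mul fun a ha => ?_,
      fun a ha => ?_, fun a ha => ?_⟩
    · exact (((hv _ (hm₂ z hz' a ha).2).comp (D.analyticAt_psi₂
        (hm₂ z hz' a ha).1)).differentiableAt.comp a (f := fun a => (z, a))
        (by fun_prop)).differentiableWithinAt
    · refine mul_ne_zero ?_ (hv0 _ (hm₂ z hz' a (ball_subset_ball hτσ.le ha)).2)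
      refine ne_zero_of_close hτ hτσ hq (fun t ht => hSq t (hsub ht)) (hMle _ (hkM z hz'))
        (fun t ht => ?_) ha
      have h1 := hm₂ z hz' t (hsub ht)
      have := hSn _ (D.Vp_subset_W h1.2)
      rwa [D.psi₂_snd h1.1] at this
    · have h1 := hvF _ (hm₂ z hz' a ha).2
      rw [D.polyVp_eq, D.psi₂_snd (hm₂ z hz' a ha).1, D.z₂_psi₂ (hm₂ z hz' a ha).1] at h1
      simp only at h1
      rw [hSq a ha, h1]
      ring

end DistortedCylinder

end

noncomputable section

open Set Metric Filter

open ProductSpace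

/-! ### Uniqueness of the coefficients and of κ -/

namespace DistortedCylinder

variable {D : DistortedCylinder} {Sm Sp : SmoothnessClass} {n : ℕ}

theorem exists_slice_minus {C : Curve D.W} {F G : ℂ × ℂ → ℂ} (hF : C.IsDivOn D.Vm F)
    (hG : C.IsDivOn D.Vm G) {ζ : ℂ} (hζ : ζ ∈ annulus D.r D.r') :
    ∃ q : ℂ → ℂ, DifferentiableOn ℂ q (ball 0 D.ρ) ∧ (∀ a ∈ ball (0 : ℂ) D.ρ, q a ≠ 0) ∧
      ∀ a ∈ ball (0 : ℂ) D.ρ, G (D.psi₁ (ζ, a)) = F (D.psi₁ (ζ, a)) * q a := by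
  obtain ⟨v, hv, hv0, hFv⟩ := hF.exists_unit D.isOpen_Vm D.Vm_subset_W hG
  have hVm : ∀ z ∈ annulus D.r D.r', ∀ a ∈ ball (0 : ℂ) D.ρ,
      (z, a) ∈ D.phi₁ '' D.U ∧ D.psi₁ (z, a) ∈ D.Vm := fun z hz a ha =>
    D.mem_Vm_of_annulus hz (mem_ball_zero_iff.1 ha)
  have hd : AnalyticOnNhd ℂ (fun p => v (D.psi₁ p)) (annulus D.r D.r' ×ˢ ball 0 D.ρ) := fun p hp =>
    (hv _ (hVm _ hp.1 _ hp.2).2).comp (D.analyticAt_psi₁ (hVm _ hp.1 _ hp.2).1)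
  exact ⟨fun a => v (D.psi₁ (ζ, a)), differentiableOn_slice_snd hd hζ,
    fun a ha => hv0 _ (hVm ζ hζ a ha).2, fun a ha => by
      rw [hFv _ (hVm ζ hζ a ha).2, mul_comm]⟩

theorem exists_slice_plus {C : Curve D.W} {F G : ℂ × ℂ → ℂ} (hF : C.IsDivOn D.Vp F)
    (hG : C.IsDivOn D.Vp G) {ζ : ℂ} (hζ : ζ ∈ annulus D.R' D.R) :
    ∃ q : ℂ → ℂ, DifferentiableOn ℂ q (ball 0 D.ρ) ∧ (∀ a ∈ ball (0 : ℂ) D.ρ, q a ≠ 0) ∧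
      ∀ a ∈ ball (0 : ℂ) D.ρ, G (D.psi₂ (ζ, a)) = F (D.psi₂ (ζ, a)) * q a := by
  obtain ⟨v, hv, hv0, hFv⟩ := hF.exists_unit D.isOpen_Vp D.Vp_subset_W hG
  have hVp : ∀ z ∈ annulus D.R' D.R, ∀ a ∈ ball (0 : ℂ) D.ρ,
      (z, a) ∈ D.phi₂ '' D.U ∧ D.psi₂ (z, a) ∈ D.Vp := fun z hz a ha =>
    D.mem_Vp_of_annulus hz (mem_ball_zero_iff.1 ha)
  have hd : AnalyticOnNhd ℂ (fun p => v (D.psi₂ p)) (annulus D.R' D.R ×ˢ ball 0 D.ρ) := fun p hp =>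
    (hv _ (hVp _ hp.1 _ hp.2).2).comp (D.analyticAt_psi₂ (hVp _ hp.1 _ hp.2).1)
  exact ⟨fun a => v (D.psi₂ (ζ, a)), differentiableOn_slice_snd hd hζ,
    fun a ha => hv0 _ (hVp ζ hζ a ha).2, fun a ha => by
      rw [hFv _ (hVp ζ hζ a ha).2, mul_comm]⟩

theorem polyVm_psi₁ (D : DistortedCylinder) (g : Fin n → AnnulusSpace Sm Sm) {ζ a : ℂ}
    (hζ : ζ ∈ annulus D.r D.r') (ha : a ∈ ball (0 : ℂ) D.ρ) :
    D.polyVm g (D.psi₁ (ζ, a)) = a ^ n + lowSum (fun i => (g i).eval D.r D.r' ζ) a := by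
  have h := (D.mem_Vm_of_annulus hζ (mem_ball_zero_iff.1 ha)).1
  rw [D.polyVm_eq, D.z₁_psi₁ h, D.psi₁_snd h]

theorem polyVp_psi₂ (D : DistortedCylinder) (g : Fin n → AnnulusSpace Sp Sp) {ζ a : ℂ}
    (hζ : ζ ∈ annulus D.R' D.R) (ha : a ∈ ball (0 : ℂ) D.ρ) :
    D.polyVp g (D.psi₂ (ζ, a)) = a ^ n + lowSum (fun i => (g i).eval D.R' D.R ζ) a := by
  have h := (D.mem_Vp_of_annulus hζ (mem_ball_zero_iff.1 ha)).1
  rw [D.polyVp_eq, D.z₂_psi₂ h, D.psi₂_snd h]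

/-- Two equations of C over V^± differ by a unit, so the distorted polynomial is a multiple of both
Weierstrass polynomials on slices and both remainders vanish. -/
theorem eq_solution_of_isDivOn {σ : ℝ} (hσ : 0 < σ) (hσρ : σ ≤ D.ρ) (Φ : Frame D.overlap Sm Sp σ)
    {k : KappaSpace Sm Sp n} (hk : Φ.Regular hσ n (Frame.pair Sm Sp σ k))
    (hz : Frame.ZerosIn D.overlap σ k) {C : Curve D.W} (hCk : D.IsKappa C k)
    {f : Fin n → AnnulusSpace Sm Sp} (hf : C.IsDivOn D.W (D.distortedPoly f)) :
    f = Φ.solution hσ n (Frame.pair Sm Sp σ k) := by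
  have hb : ball (0 : ℂ) σ ⊆ ball 0 D.ρ := ball_subset_ball hσρ
  refine Φ.eq_solution_of_multiple hσ hk hz (fun ζ hζ => ?_) fun ζ hζ => ?_
  · obtain ⟨q, hq, -, h⟩ := exists_slice_minus hCk.1 (hf.mono D.Vm_subset_W) hζ
    refine ⟨q, hq.continuousOn.mono hb, fun a ha => ?_⟩
    have h1 := h a (hb ha)
    rwa [distortedPoly_psi₁ D f (D.mem_Vm_of_annulus hζ (mem_ball_zero_iff.1 (hb ha))).1,
      D.polyVm_psi₁ _ hζ (hb ha)] at h1
  · obtain ⟨q, hq, -, h⟩ := exists_slice_plus hCk.2 (hf.mono D.Vp_subset_W) hζ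
    refine ⟨q, hq.continuousOn.mono hb, fun a ha => ?_⟩
    have h1 := h a (hb ha)
    rwa [distortedPoly_psi₂ D f (D.mem_Vp_of_annulus hζ (mem_ball_zero_iff.1 (hb ha))).1,
      D.polyVp_psi₂ _ hζ (hb ha)] at h1

/-- The Weierstrass polynomials of a curve are unique. -/
theorem IsKappa.unique {C : Curve D.W} {k K : KappaSpace Sm Sp n} (hk : D.IsKappa C k)
    (hz : Frame.ZerosIn D.overlap D.ρ k) (hK : D.IsKappa C K) : K = k := by
  refine Prod.ext (funext fun i => AnnulusSpace.ext_eval D.r_pos D.r_lt_r' fun ζ hζ => ?_)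
    (funext fun i => AnnulusSpace.ext_eval D.R'_pos D.R'_lt_R fun ζ hζ => ?_)
  · obtain ⟨q, hq, -, h⟩ := exists_slice_minus hk.1 hK.1 hζ
    have h8 : (fun i => (K.1 i).eval D.r D.r' ζ) - (fun i => (k.1 i).eval D.r D.r' ζ) = 0 := by
      refine eq_zero_of_lowSum_eq_mul (c := fun i => (k.1 i).eval D.r D.r' ζ) (σ := D.ρ)
        (q := fun a => q a - 1) (hq.continuousOn.sub continuousOn_const) (hz.minus ζ hζ)
        fun a ha => ?_
      have h9 := h a ha
      rw [D.polyVm_psi₁ _ hζ ha, D.polyVm_psi₁ _ hζ ha] at h9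
      rw [lowSum_sub, mul_sub, mul_one, ← h9]
      ring
    exact sub_eq_zero.1 (congrFun h8 i)
  · obtain ⟨q, hq, -, h⟩ := exists_slice_plus hk.2 hK.2 hζ
    have h8 : (fun i => (K.2 i).eval D.R' D.R ζ) - (fun i => (k.2 i).eval D.R' D.R ζ) = 0 := by
      refine eq_zero_of_lowSum_eq_mul (c := fun i => (k.2 i).eval D.R' D.R ζ) (σ := D.ρ)
        (q := fun a => q a - 1) (hq.continuousOn.sub continuousOn_const) (hz.plus ζ hζ)
        fun a ha => ?_
      have h9 := h a ha
      rw [D.polyVp_psi₂ _ hζ ha, D.polyVp_psi₂ _ hζ ha] at h9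
      rw [lowSum_sub, mul_sub, mul_one, ← h9]
      ring
    exact sub_eq_zero.1 (congrFun h8 i)

theorem eventually_zerosIn (D : DistortedCylinder) (Sm Sp : SmoothnessClass) (n : ℕ) {σ : ℝ}
    (hσ : 0 < σ) : ∀ᶠ k in 𝓝 (0 : KappaSpace Sm Sp n), Frame.ZerosIn D.overlap σ k := by
  filter_upwards [eventually_zeros Sm Sp n (half_pos hσ)] with k hk
  exact ⟨fun ζ hζ a ha => mem_ball_zero_iff.2
      (((hk _ _ D.r_pos ζ hζ).1 a ha).trans_lt (half_lt_self hσ)),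
    fun ζ hζ a ha => mem_ball_zero_iff.2
      (((hk _ _ D.R'_pos ζ hζ).2 a ha).trans_lt (half_lt_self hσ))⟩

end DistortedCylinder

end

noncomputable section

open Set Metric Filter

/-! ### Arbitrary determining functions as units times Weierstrass polynomials -/

namespace ProductSpace

variable {S : SmoothnessClass} {σ ρ r R : ℝ} {n : ℕ}

theorem exists_restrict (S : SmoothnessClass) (h : σ ≤ ρ) :
    ∃ T : ProductSpace S ρ →L[ℂ] ProductSpace S σ, ∀ G, ∀ a ∈ ball (0 : ℂ) σ,
      (T G).app a = G.app a :=
  exists_clm_of_app (fun G a => G.app a)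
    (fun G => exists_of_differentiableOn (H := G.app) (G.differentiableOn_app.mono (ball_subset_ball h))
      fun a _ => G.norm_app_le a)
    (fun G G' a _ => app_add G G' a) (fun c G a _ => map_smul (appCLM S ρ a) c G)
    fun a _ => (appCLM S ρ a).continuous

/-- The restriction to a smaller disc. -/
def restrict (S : SmoothnessClass) (h : σ ≤ ρ) : ProductSpace S ρ →L[ℂ] ProductSpace S σ :=
  (exists_restrict S h).choose

theorem eval_restrict (h : σ ≤ ρ) (G : ProductSpace S ρ) (ζ : ℂ) {a : ℂ} (ha : a ∈ ball (0 : ℂ) σ) :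
    (restrict S h G).eval r R ζ a = G.eval r R ζ a := by
  rw [eval_eq, eval_eq, restrict, (exists_restrict S h).choose_spec G a ha]

theorem exists_norm_eval_le' (hr : 0 < r) (G : ProductSpace S σ) : ∃ M : ℝ, 0 < M ∧
    ∀ ζ ∈ annulus r R, ∀ a, ‖G.eval r R ζ a‖ ≤ M := by
  obtain ⟨c, hc, h⟩ := AnnulusSpace.exists_norm_eval_const S S
  refine ⟨c * ‖G‖ + 1, by positivity, fun ζ hζ a => ?_⟩
  rw [eval_eq]
  have := h r R hr (G.app a) ζ hζ
  have := mul_le_mul_of_nonneg_left (G.norm_app_le a) hc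
  linarith

/-- A function bounded away from zero is invertible over a smaller disc. -/
theorem exists_inv (hr : 0 < r) (hrR : r < R) (hσρ : σ < ρ) {G : ProductSpace S ρ} {c : ℝ}
    (hc : 0 < c) (hG : ∀ ζ ∈ annulus r R, ∀ a ∈ ball (0 : ℂ) ρ, c ≤ ‖G.eval r R ζ a‖) :
    ∃ G' : ProductSpace S σ, mul S σ hr hrR (restrict S hσρ.le G) G' = one S σ := by
  let m := AnnulusSpace.mulCLM S S hr hrR
  -- For each w the inverse exists by the inversion axiom of the class, without a norm bound.
  -- Passing to multiplication operators makes the inverse holomorphic in w.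
  have hu : ∀ a ∈ ball (0 : ℂ) ρ, IsUnit (m (G.app a)) := by
    intro a ha
    obtain ⟨k, hk⟩ := AnnulusSpace.exists_inv hr hrR (G.app a)
      ⟨c, hc, fun z hz => by rw [← eval_eq]; exact hG z hz a ha⟩
    have hne : ∀ z ∈ annulus r R, (G.app a).eval r R z ≠ 0 := fun z hz h0 => by
      have := hG z hz a ha
      rw [eval_eq, h0, norm_zero] at this
      linarith
    have h1 : m (G.app a) * m k = 1 := by
      ext1 x
      refine AnnulusSpace.ext_eval hr hrR fun z hz => ?_
      rw [ContinuousLinearMap.mul_app, AnnulusSpace.eval_mulCLM hr hrR _ _ hz,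
        AnnulusSpace.eval_mulCLM hr hrR _ _ hz, hk z hz, mul_inv_cancel_left₀ (hne z hz)]
      rfl
    have h2 : m k * m (G.app a) = 1 := by
      ext1 x
      refine AnnulusSpace.ext_eval hr hrR fun z hz => ?_
      rw [ContinuousLinearMap.mul_app, AnnulusSpace.eval_mulCLM hr hrR _ _ hz,
        AnnulusSpace.eval_mulCLM hr hrR _ _ hz, hk z hz, inv_mul_cancel_left₀ (hne z hz)]
      rfl
    exact ⟨⟨_, _, h1, h2⟩, rfl⟩
  have hd : DifferentiableOn ℂ (fun a => Ring.inverse (m (G.app a)) (AnnulusSpace.one S S))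
      (ball 0 ρ) := by
    intro a ha
    have h1 : DifferentiableAt ℂ (fun a => m (G.app a)) a :=
      m.differentiableAt.comp a (G.differentiableOn_app.differentiableAt (isOpen_ball.mem_nhds ha))
    have h2 : DifferentiableAt ℂ Ring.inverse (m (G.app a)) :=
      (HasSlopeAt.inverse (hu a ha)).analyticAt.differentiableAt
    exact ((DifferentiableAt.comp (g := Ring.inverse) a h2 h1).clm_apply
      (differentiableAt_const _)).differentiableWithinAt
  -- Boundedness of the inverse in norm comes from compactness; this is why the disc is shrunk.
  obtain ⟨M, hM⟩ := (isCompact_closedBall (0 : ℂ) σ).exists_bound_of_continuousOn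
    (hd.continuousOn.mono (closedBall_subset_ball hσρ))
  obtain ⟨G', hG'⟩ := exists_of_differentiableOn (hd.mono (ball_subset_ball hσρ.le))
    fun a ha => hM a (ball_subset_closedBall ha)
  refine ⟨G', ext_app fun a ha => ?_⟩
  rw [app_mul hr hrR _ _ ha, hG' a ha, one, app_const _ ha, restrict,
    (exists_restrict S hσρ.le).choose_spec G a ha]
  exact (inverse_apply_of_isUnit (hu a (ball_subset_ball hσρ.le ha)) _).2

/-- A determining function bounded away from zero near `|w| = ρ` is a unit times the Weierstrass
polynomial. -/
theorem exists_unit_factor (hr : 0 < r) (hrR : r < R) {σ₁ : ℝ} (hσ₁ : 0 < σ₁) (hσσ₁ : σ < σ₁)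
    (hσ₁ρ : σ₁ < ρ) {g : Fin n → AnnulusSpace S S}
    (hg : IsUnit (divOp hr hrR hσ₁ n (weier S σ₁ g)))
    (hz : ∀ ζ ∈ annulus r R, ∀ a, a ^ n + lowSum (fun i => (g i).eval r R ζ) a = 0 →
      a ∈ ball (0 : ℂ) σ₁) {G : ProductSpace S ρ}
    (hG : ∀ ζ ∈ annulus r R, ∃ q : ℂ → ℂ, DifferentiableOn ℂ q (ball 0 ρ) ∧
      (∀ a ∈ ball (0 : ℂ) ρ, q a ≠ 0) ∧ ∀ a ∈ ball (0 : ℂ) ρ,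
        G.eval r R ζ a = (a ^ n + lowSum (fun i => (g i).eval r R ζ) a) * q a)
    {ρ' c : ℝ} (hρ' : ρ' < ρ) (hc : 0 < c)
    (hGc : ∀ ζ ∈ annulus r R, ∀ a ∈ ball (0 : ℂ) ρ, ρ' < ‖a‖ → c ≤ ‖G.eval r R ζ a‖) :
    ∃ e e' : ProductSpace S σ, mul S σ hr hrR e e' = one S σ ∧
      restrict S (hσσ₁.trans hσ₁ρ).le G = mul S σ hr hrR (weier S σ g) e := by
  have hb : ball (0 : ℂ) σ₁ ⊆ ball 0 ρ := ball_subset_ball hσ₁ρ.le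
  have hrem : rem hr hrR hσ₁ n (weier S σ₁ g) (restrict S hσ₁ρ.le G) = 0 := by
    refine rem_weier_eq_zero hr hrR hσ₁ hg hz _ fun ζ hζ => ?_
    obtain ⟨q, hq, -, h⟩ := hG ζ hζ
    exact ⟨q, hq.continuousOn.mono hb, fun a ha => by
      rw [eval_restrict _ _ _ ha, h a (hb ha)]⟩
  obtain ⟨Q, hQ⟩ := exists_div hr hrR hσ₁ hg (restrict S hσ₁ρ.le G)
  rw [hrem, map_zero, add_zero] at hQ
  have hQe : ∀ ζ ∈ annulus r R, ∀ a ∈ ball (0 : ℂ) σ₁, G.eval r R ζ a =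
      (a ^ n + lowSum (fun i => (g i).eval r R ζ) a) * Q.eval r R ζ a := by
    intro ζ hζ a ha
    have h1 := congrArg (fun G : ProductSpace S σ₁ => G.eval r R ζ a) hQ
    simp only [eval_mul hr hrR _ _ hζ ha, eval_weier hr g hζ ha, eval_restrict _ _ _ ha] at h1
    exact h1
  obtain ⟨M, hM, hPM⟩ := exists_norm_eval_le' (R := R) hr (weier S ρ g)
  obtain ⟨τ, hτ, hτρ⟩ := exists_between (max_lt hσ₁ρ hρ')
  have hσ₁τ : σ₁ < τ := (le_max_left _ _).trans_lt hτ
  have hτ0 : 0 < τ := hσ₁.trans hσ₁τ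
  have hcl : closedBall (0 : ℂ) τ ⊆ ball 0 ρ := closedBall_subset_ball hτρ
  -- On |a| = τ, beyond ρ', the function G is at least c and the Weierstrass polynomial at most M,
  -- so |q| ≥ c/M there. The maximum principle for 1/q carries this inside, uniformly in ζ.
  have hlow : ∀ ζ ∈ annulus r R, ∀ a ∈ ball (0 : ℂ) σ₁, c / M ≤ ‖Q.eval r R ζ a‖ := by
    intro ζ hζ a ha
    obtain ⟨q, hq, hq0, h⟩ := hG ζ hζ
    -- Q and the slice quotient q agree after multiplication by a nonzero monic polynomial, hence
    -- agree by the identity theorem.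
    have hqQ : q a = Q.eval r R ζ a := by
      have hA : AnalyticOnNhd ℂ (fun a => a ^ n + lowSum (fun i => (g i).eval r R ζ) a)
          (ball 0 σ₁) := fun a _ => (analyticAt_id.pow n).add
        (Finset.analyticAt_fun_sum _ fun i _ => analyticAt_const.mul (analyticAt_id.pow _))
      have hB : AnalyticOnNhd ℂ (fun a => q a - Q.eval r R ζ a) (ball 0 σ₁) :=
        ((hq.mono hb).sub (Q.differentiableOn_eval hr hζ)).analyticOnNhd isOpen_ball
      rcases hA.eq_zero_or_eq_zero_of_smul_eq_zero hB (fun a ha => by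
        rw [smul_eq_mul, mul_sub, ← h a (hb ha), ← hQe ζ hζ a ha, sub_self])
        (convex_ball 0 σ₁).isPreconnected with h1 | h1
      · obtain ⟨b, hb1, hb2⟩ := exists_between ((le_max_right σ₁ ρ').trans_lt hτ)
        exfalso
        have h2 := Polynomial.eq_of_infinite_eval_eq
          (Polynomial.X ^ n + lowPoly fun i => (g i).eval r R ζ) 0
          ((infinite_of_mem_nhds 0 (ball_mem_nhds (0 : ℂ) hσ₁)).mono fun a ha => by
            simpa [eval_lowPoly] using h1 a ha)
        exact (monic_X_pow_add_lowPoly _).ne_zero h2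
      · exact sub_eq_zero.1 (h1 a ha)
    have hmax : ‖(q a)⁻¹‖ ≤ M / c := by
      refine Complex.norm_le_of_forall_mem_frontier_norm_le (f := fun a => (q a)⁻¹)
        (U := ball 0 τ) isBounded_ball (((hq.mono hcl).inv fun a ha =>
          hq0 a (hcl ha)).diffContOnCl_ball subset_rfl) (fun t ht => ?_)
        (subset_closure (ball_subset_ball hσ₁τ.le ha))
      rw [frontier_ball _ hτ0.ne', mem_sphere_zero_iff_norm] at ht
      have htρ : t ∈ ball (0 : ℂ) ρ := mem_ball_zero_iff.2 (by rwa [ht])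
      have h1 := hGc ζ hζ t htρ (by rw [ht]; exact (le_max_right _ _).trans_lt hτ)
      have h2 := hPM ζ hζ t
      rw [eval_weier hr g hζ htρ] at h2
      rw [h t htρ, norm_mul] at h1
      have h3 : 0 < ‖q t‖ := norm_pos_iff.2 (hq0 t htρ)
      rw [norm_inv, inv_le_comm₀ h3 (by positivity), inv_div, div_le_iff₀ hM]
      nlinarith
    rw [← hqQ]
    rw [norm_inv, inv_le_comm₀ (norm_pos_iff.2 (hq0 a (hb ha))) (by positivity), inv_div] at hmax
    exact hmax
  obtain ⟨e', he'⟩ := exists_inv hr hrR hσσ₁ (div_pos hc hM) hlow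
  refine ⟨_, e', he', ext_eval hr hrR fun ζ hζ a ha => ?_⟩
  have ha₁ := ball_subset_ball hσσ₁.le ha
  rw [eval_restrict _ _ _ ha, eval_mul hr hrR _ _ hζ ha, eval_weier hr g hζ ha,
    eval_restrict _ _ _ ha, hQe ζ hζ a ha₁]

end ProductSpace

open ProductSpace

namespace Frame

variable {D : Overlap} {Sm Sp : SmoothnessClass} {σ : ℝ} (Φ : Frame D Sm Sp σ) {n : ℕ}

/-- The solution does not change if the determining functions are multiplied by units. -/
theorem solution_mul_unit (hσ : 0 < σ) {ψ : ProductSpace Sm σ × ProductSpace Sp σ}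
    (h : Φ.Regular hσ n ψ) {e e' : ProductSpace Sm σ} {d d' : ProductSpace Sp σ}
    (he : mul Sm σ D.r_pos D.r_lt_r' e e' = one Sm σ)
    (hd : mul Sp σ D.R'_pos D.R'_lt_R d d' = one Sp σ) :
    Φ.Regular hσ n (mul Sm σ D.r_pos D.r_lt_r' ψ.1 e, mul Sp σ D.R'_pos D.R'_lt_R ψ.2 d) ∧
      Φ.solution hσ n (mul Sm σ D.r_pos D.r_lt_r' ψ.1 e, mul Sp σ D.R'_pos D.R'_lt_R ψ.2 d) =
        Φ.solution hσ n ψ := by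
  obtain ⟨h1, h2⟩ := mul_unit D.r_pos D.r_lt_r' hσ h.minus he
  obtain ⟨h3, h4⟩ := mul_unit D.R'_pos D.R'_lt_R hσ h.plus hd
  have hop : Φ.op hσ n (mul Sm σ D.r_pos D.r_lt_r' ψ.1 e, mul Sp σ D.R'_pos D.R'_lt_R ψ.2 d) =
      Φ.op hσ n ψ := by
    ext1 f
    rw [op_apply, op_apply, h2, h4]
  refine ⟨⟨h1, h3, by rw [hop]; exact h.op⟩, ?_⟩
  rw [solution, solution, hop, h2, h4]

end Frame

end

noncomputable section

open Set Metric Filter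

open ProductSpace

namespace Frame

theorem ZerosIn.mono {D : Overlap} {Sm Sp : SmoothnessClass} {n : ℕ} {σ σ' : ℝ}
    {k : DistortedCylinder.KappaSpace Sm Sp n} (h : ZerosIn D σ k) (hσ : σ ≤ σ') :
    ZerosIn D σ' k :=
  ⟨fun ζ hζ a ha => ball_subset_ball hσ (h.minus ζ hζ a ha),
    fun ζ hζ a ha => ball_subset_ball hσ (h.plus ζ hζ a ha)⟩

end Frame

/-! ### The theorem -/

namespace DistortedCylinder

variable {D : DistortedCylinder} {Sm Sp : SmoothnessClass} {n : ℕ}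

/-- The solution of the linear equation may be computed from any determining functions bounded away
from zero near `|w| = ρ`. -/
theorem solution_restrict {σ σ₁ : ℝ} (hσ : 0 < σ) (hσσ₁ : σ < σ₁) (hσ₁ρ : σ₁ < D.ρ)
    (Φ : Frame D.overlap Sm Sp σ) {k : KappaSpace Sm Sp n}
    (hk : Φ.Regular hσ n (Frame.pair Sm Sp σ k)) (hz : Frame.ZerosIn D.overlap σ₁ k)
    (hm : IsUnit (divOp D.r_pos D.r_lt_r' (hσ.trans hσσ₁) n (weier Sm σ₁ k.1)))
    (hp : IsUnit (divOp D.R'_pos D.R'_lt_R (hσ.trans hσσ₁) n (weier Sp σ₁ k.2)))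
    {C : Curve D.W} (hCk : D.IsKappa C k) {Gm : ProductSpace Sm D.ρ} {Gp : ProductSpace Sp D.ρ}
    (hGm : C.IsDivOn D.Vm (D.funVm Gm)) (hGp : C.IsDivOn D.Vp (D.funVp Gp)) {ρ' c : ℝ}
    (hρ' : ρ' < D.ρ) (hc : 0 < c) (hcm : ∀ x ∈ D.Vm, ρ' < ‖x.2‖ → c ≤ ‖D.funVm Gm x‖)
    (hcp : ∀ x ∈ D.Vp, ρ' < ‖x.2‖ → c ≤ ‖D.funVp Gp x‖) :
    Φ.Regular hσ n (restrict Sm (hσσ₁.trans hσ₁ρ).le Gm, restrict Sp (hσσ₁.trans hσ₁ρ).le Gp) ∧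
      Φ.solution hσ n (restrict Sm (hσσ₁.trans hσ₁ρ).le Gm,
        restrict Sp (hσσ₁.trans hσ₁ρ).le Gp) = Φ.solution hσ n (Frame.pair Sm Sp σ k) := by
  have hem : ∀ ζ ∈ annulus D.r D.r', ∀ a ∈ ball (0 : ℂ) D.ρ,
      D.funVm Gm (D.psi₁ (ζ, a)) = Gm.eval D.r D.r' ζ a := fun ζ hζ a ha => by
    have h := (D.mem_Vm_of_annulus hζ (mem_ball_zero_iff.1 ha)).1
    rw [funVm, D.z₁_psi₁ h, D.psi₁_snd h]
  have hep : ∀ ζ ∈ annulus D.R' D.R, ∀ a ∈ ball (0 : ℂ) D.ρ,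
      D.funVp Gp (D.psi₂ (ζ, a)) = Gp.eval D.R' D.R ζ a := fun ζ hζ a ha => by
    have h := (D.mem_Vp_of_annulus hζ (mem_ball_zero_iff.1 ha)).1
    rw [funVp, D.z₂_psi₂ h, D.psi₂_snd h]
  obtain ⟨e, e', he, heG⟩ := exists_unit_factor D.r_pos D.r_lt_r' (hσ.trans hσσ₁) hσσ₁ hσ₁ρ hm
    hz.minus (G := Gm) (fun ζ hζ => by
      obtain ⟨q, hq, hq0, h⟩ := exists_slice_minus hCk.1 hGm hζ
      exact ⟨q, hq, hq0, fun a ha => by rw [← hem ζ hζ a ha, h a ha, D.polyVm_psi₁ _ hζ ha]⟩)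
    hρ' hc fun ζ hζ a ha hρa => by
      obtain ⟨h1, h2⟩ := D.mem_Vm_of_annulus hζ (mem_ball_zero_iff.1 ha)
      rw [← hem ζ hζ a ha]
      exact hcm _ h2 (by rwa [D.psi₁_snd h1])
  obtain ⟨d, d', hd, hdG⟩ := exists_unit_factor D.R'_pos D.R'_lt_R (hσ.trans hσσ₁) hσσ₁ hσ₁ρ hp
    hz.plus (G := Gp) (fun ζ hζ => by
      obtain ⟨q, hq, hq0, h⟩ := exists_slice_plus hCk.2 hGp hζ
      exact ⟨q, hq, hq0, fun a ha => by rw [← hep ζ hζ a ha, h a ha, D.polyVp_psi₂ _ hζ ha]⟩)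
    hρ' hc fun ζ hζ a ha hρa => by
      obtain ⟨h1, h2⟩ := D.mem_Vp_of_annulus hζ (mem_ball_zero_iff.1 ha)
      rw [← hep ζ hζ a ha]
      exact hcp _ h2 (by rwa [D.psi₂_snd h1])
  rw [heG, hdG]
  exact Φ.solution_mul_unit hσ hk he hd

end DistortedCylinder

open DistortedCylinder

theorem lemma2p1 (D : DistortedCylinder) (Sm Sp : SmoothnessClass) (n : ℕ) :
    ∃ ε : ℝ, 0 < ε ∧
      (∀ C : Curve D.W, D.IsSmoothCurve Sm Sp n C → D.KappaNormLE Sm Sp n C ε →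
        ∃! f : Fin n → AnnulusSpace Sm Sp, C.IsDivOn D.W (D.distortedPoly f)) ∧
      (∀ (Y : Type u) [TopologicalSpace Y] (C : Y → Curve D.W),
        D.IsContinuousFamily Sm Sp n C → (∀ y, D.KappaNormLE Sm Sp n (C y) ε) →
        ∀ ψ : Y → Fin n → AnnulusSpace Sm Sp,
          (∀ y, (C y).IsDivOn D.W (D.distortedPoly (ψ y))) → Continuous ψ) ∧
      (∀ (Y : Type u) [TopologicalSpace Y] (X : BanachAnalyticSpace.{u, v} Y)
        (C : Y → Curve D.W),
        D.IsHolomorphicFamily Sm Sp n X C → (∀ y, D.KappaNormLE Sm Sp n (C y) ε) →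
        ∀ ψ : Y → Fin n → AnnulusSpace Sm Sp,
          (∀ y, (C y).IsDivOn D.W (D.distortedPoly (ψ y))) → X.IsHolomorphic ψ) := by
  obtain ⟨σ₂, hσ₂, hσ₂ρ, hdiv⟩ := D.eventually_isDivOn Sm Sp n
  obtain ⟨σ₀, hσ₀, hframe⟩ := exists_frame D.overlap Sm Sp
  -- Two radii: over Δ(σ₁) the determining functions of a family are divided by the Weierstrass
  -- polynomials, and over the smaller Δ(σ) the quotients are invertible and the equation for f is
  -- solved.
  obtain ⟨σ₁, hσ₁, hσ₁'⟩ := exists_between (lt_min hσ₂ hσ₀)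
  obtain ⟨σ, hσ, hσσ₁⟩ := exists_between hσ₁
  have hσ₁ρ : σ₁ < D.ρ := hσ₁'.trans_le ((min_le_left _ _).trans hσ₂ρ)
  obtain ⟨Φ⟩ := hframe σ hσ (hσσ₁.trans (hσ₁'.trans_le (min_le_right _ _)))
  have hm : ∀ᶠ k in 𝓝 (0 : KappaSpace Sm Sp n),
      IsUnit (divOp D.r_pos D.r_lt_r' (hσ.trans hσσ₁) n (weier Sm σ₁ k.1)) :=
    (continuous_fst.tendsto (0 : KappaSpace Sm Sp n)).eventually
      (eventually_isUnit_divOp D.r_pos D.r_lt_r' (hσ.trans hσσ₁))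
  have hp : ∀ᶠ k in 𝓝 (0 : KappaSpace Sm Sp n),
      IsUnit (divOp D.R'_pos D.R'_lt_R (hσ.trans hσσ₁) n (weier Sp σ₁ k.2)) :=
    (continuous_snd.tendsto (0 : KappaSpace Sm Sp n)).eventually
      (eventually_isUnit_divOp D.R'_pos D.R'_lt_R (hσ.trans hσσ₁))
  obtain ⟨ε, hε, hgood⟩ := Metric.nhds_basis_closedBall.eventually_iff.1
    ((hdiv σ hσ (hσσ₁.trans (hσ₁'.trans_le (min_le_left _ _))) Φ).and
      ((Φ.eventually_regular (n := n) hσ).and ((D.eventually_zerosIn Sm Sp n hσ).and (hm.and hp))))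
  replace hgood := fun (k : KappaSpace Sm Sp n) (hk : ‖k‖ ≤ ε) =>
    hgood (mem_closedBall_zero_iff.2 hk)
  have hunique : ∀ (C : Curve D.W) (k : KappaSpace Sm Sp n), D.IsKappa C k → ‖k‖ ≤ ε →
      ∀ f, C.IsDivOn D.W (D.distortedPoly f) → f = Φ.solution hσ n (Frame.pair Sm Sp σ k) :=
    fun C k hCk hk f hf => eq_solution_of_isDivOn hσ (hσσ₁.trans hσ₁ρ).le Φ (hgood k hk).2.1
      (hgood k hk).2.2.1 hCk hf
  -- The bound is stated for some κ of the curve and the family supplies possibly another one;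
  -- uniqueness of κ identifies them.
  have hkappa : ∀ (C : Curve D.W) (K : KappaSpace Sm Sp n), D.IsKappa C K →
      D.KappaNormLE Sm Sp n C ε → ‖K‖ ≤ ε := by
    rintro C K hK ⟨k, hk, hkε⟩
    rwa [hk.unique ((hgood k hkε).2.2.1.mono (hσσ₁.trans hσ₁ρ).le) hK]
  refine ⟨ε, hε, ?_, ?_, ?_⟩
  · rintro C hC ⟨k, hk, hkε⟩
    exact ⟨_, (hgood k hkε).1 C hC hk, fun f hf => hunique C k hk hkε f hf⟩
  · rintro Y _ C ⟨-, K, hK, hKc⟩ hCε ψ hψ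
    have h : ψ = fun y => Φ.solution hσ n (Frame.pair Sm Sp σ (K y)) := funext fun y =>
      hunique _ _ (hK y) (hkappa _ _ (hK y) (hCε y)) _ (hψ y)
    rw [h, continuous_iff_continuousAt]
    intro y
    exact ContinuousAt.comp (f := fun y => Frame.pair Sm Sp σ (K y))
      (Φ.hasSlopeAt_solution hσ (hgood _ (hkappa _ _ (hK y) (hCε y))).2.1).continuousAt
      (Frame.continuous_pair.comp hKc).continuousAt
  · rintro Y _ X C ⟨-, ψm, ψp, hψm, hψp, hdet⟩ hCε ψ hψ
    -- The given determining functions, restricted to the thin disc, yield the same solution as the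
    -- Weierstrass polynomials, so holomorphy of ψm and ψp passes to ψ by composition.
    have hsol : ∀ y, Φ.Regular hσ n (restrict Sm (hσσ₁.trans hσ₁ρ).le (ψm y),
          restrict Sp (hσσ₁.trans hσ₁ρ).le (ψp y)) ∧
        Φ.solution hσ n (restrict Sm (hσσ₁.trans hσ₁ρ).le (ψm y),
          restrict Sp (hσσ₁.trans hσ₁ρ).le (ψp y)) = ψ y := by
      intro y
      obtain ⟨k, hk, hkε⟩ := hCε y
      obtain ⟨hGm, hGp, ρ', c, hρ', hc, hcm, hcp⟩ := hdet y
      obtain ⟨-, h1, h2, h3, h4⟩ := hgood k hkε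
      rw [hunique _ k hk hkε _ (hψ y)]
      exact solution_restrict hσ hσσ₁ hσ₁ρ Φ h1 (h2.mono hσσ₁.le) h3 h4 hk hGm hGp hρ' hc hcm hcp
    have hhol := ((hψm.comp (T := restrict Sm (hσσ₁.trans hσ₁ρ).le)
      fun y => HasSlopeAt.clm _ _).prodMk (hψp.comp (T := restrict Sp (hσσ₁.trans hσ₁ρ).le)
      fun y => HasSlopeAt.clm _ _)).comp fun y => Φ.hasSlopeAt_solution hσ (hsol y).1
    simp only [fun y => (hsol y).2] at hhol
    exact hhol

end
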